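/- Let $m\ge 3$ and $\mathbb F=\mathbb Z/2$. **The algebra.** Let $\mathcal C=\mathcal C(m,1)$ be the path algebra over $\mathbb F$ (paths are composed from left to right) of the quiver with vertices $[1],\dots,[m-1]$ and arrows $L_i\colon[i]\to[i-1]$, $R_i\colon[i-1]\to[i]$ for $2\le i\le m-1$, $U_1\colon[1]\to[1]$, $U_m\colon[m-1]\to[m-1]$, modulo the relations $L_iL_{i-1}=0$, $R_{i-1}R_i=0$ $(3\le i\le m-1)$ and $L_2U_1=U_1R_2=R_{m-1}U_m=U_mL_{m-1}=0$. Let $I_x$ be the idempotent of the constant path at $[x]$, $\mathbb I=\bigoplus_x\mathbb F I_x$, $1=\sum_xI_x$, and $U_i=R_iL_i+L_iR_i$ for $2\le i\le m-1$. A *pure element* is the class in $\mathcal C$ of a non-constant path, if it is non-zero; the pure elements span $\mathcal C_+$, and $\mathcal C=\mathbb I\oplus\mathcal C_+$. Grade $\mathcal C[t]$ by giving $\mathcal C$ degree $0$ and $t$ degree $2m-4$. **Tiling graphs.** Consider graphs $\Gamma$ embedded in the disk $D$, up to isotopy, which meet $\partial D$ exactly in their leaves, one of which is the root, and which have at least one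 internal vertex. Each internal vertex has degree $2m-2$. The edges are oriented and labeled by $1,\dots,m-1$ so that around each internal vertex one meets, counterclockwise, the incoming edges $1,2,\dots,m-1$ and then the outgoing edges $m-1,\dots,2,1$. The sector between outgoing edges $i-1$ and $i$ carries the letter $L_i$, that between incoming edges $i-1$ and $i$ the letter $R_i$, that between the incoming and the outgoing edge $1$ the letter $U_1$, and that between the incoming and the outgoing edge $m-1$ the letter $U_m$. Such a $\Gamma$ is a *centered tiling graph* if it is connected, every oriented simple cycle of $\Gamma$ has length one, and each component of $D\setminus\Gamma$ that does not meet $\partial D$ is a monogon with the single sector $U_1$ (type $1$), a monogon with the single sector $U_m$ (type $m$), or a bigon whose two sectors are $R_i$ and $L_i$ for some $2\le i\le m-1$ (type $i$). Its *weight* $w(\Gamma)\in\mathbb Z_{\ge0}^m$ has as $i$-th component the number of components of type $i$. Its *algebra sequence* $\vec a(\Gamma)=(a_1,\dots,a_n)$ lists, counterclockwise along $\partial D$ starting at the root, for each of the $n$ boundary intervals the product of the letters of the sectors of the component of $D\setminus\Gamma$ adjacent to it (in the order in which they are met when walking along $\Gamma$ from the initial to the final leaf of the interval). Let $d(\Gamma)$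 be the number of internal vertices and $\iota(\Gamma)=I_k$, where $k$ is the label of the root edge. **The operations.** For pure $a_1,\dots,a_n$ put $c^w_n(a_1,\dots,a_n)=\sum_\Gamma \iota(\Gamma)\,t^{d(\Gamma)}$, the sum over the centered tiling graphs with $w(\Gamma)=w$ and $\vec a(\Gamma)=(a_1,\dots,a_n)$. For weights $w\in\mathbb Z_{\ge0}^m$ and $n\ge 1$ with $(w,n)\ne(0,2)$ define on pure elements $$\mu^w_n(a_1,\dots,a_n)=c^w_n(a_1,\dots,a_n)+\sum_{a_1=a\,a_1'}a\,c^w_n(a_1',a_2,\dots,a_n)+\sum_{a_n=a_n'\,a}c^w_n(a_1,\dots,a_{n-1},a_n')\,a,$$ the sums being over the factorizations into two pure elements (centered, left-extended and right-extended terms); put $\mu^w_n=0$ if some input is a constant path; and extend $\mathbb F[t]$-multilinearly to $\mathcal C[t]$. Moreover, $\mu^0_2$ is the multiplication of $\mathcal C[t]$, $\mu_0^{e_i}=U_i$ for $1\le i\le m$, and $\mu^w_0=0$ for all other $w$. **Theorem.** The operations $\{\mu^w_n\}$ make $\mathcal C[t]$ a unital weighted $A_\infty$ algebra over the ground ring $\mathbb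 I$, which has characteristic $2$. That is: $\mathcal C[t]$ is a graded $\mathbb I$-bimodule; each $\mu^w_n$ is a map of $\mathbb I$-bimodules $\mathcal C[t]^{\otimes_{\mathbb I} n}\to\mathcal C[t]$ of degree $n-2+2\sum_iw_i$; $\mu^0_0=0$; for all $n\ge 0$, all $a_1,\dots,a_n\in\mathcal C[t]$ and all $w\in\mathbb Z_{\ge0}^m$, $$\sum_{\substack{1\le i\le j\le n+1\\ u+v=w}}\mu^u_{n-j+i+1}\bigl(a_1,\dots,a_{i-1},\mu^v_{j-i}(a_i,\dots,a_{j-1}),a_j,\dots,a_n\bigr)=0;$$ and $\mu^0_2(a,1)=\mu^0_2(1,a)=a$ for all $a\in\mathcal C[t]$, while $\mu^w_n(a_1,\dots,a_n)=0$ whenever some $a_i=1$ and $(n,w)\neq(2,0)$. -/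

import Mathlib

open scoped Polynomial

noncomputable section

/-! ## Weighted A-infinity algebras in characteristic two

Sequences `(a₁, …, aₙ)` are lists, so an operation `μ^w_n` is the restriction of `μ w` to lists of
length `n`.  Weights are vectors of natural numbers, indexed by the basis `ι` of the weight space.
`K` is the ground ring and the bimodule `A` has commuting actions of `K` and `Kᵐᵒᵖ`; `K`-linearity
of a map out of `A ⊗_K ⋯ ⊗_K A` is additivity in each entry, left linearity in the first,
right linearity in the last, and balancedness in between.  For `n = 0` the tensor product is `K`,
so that a bimodule map out of it is an element on which both actions agree. -/

structure IsWeightedAInfinityAlgebra (K : Type*) {ι A : Type*} [Ring K] [Fintype ι]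
    [DecidableEq ι] [AddCommGroup A] [Module K A] [Module Kᵐᵒᵖ A] [SMulCommClass K Kᵐᵒᵖ A]
    (gr : ℤ → AddSubgroup A) (μ : (ι →₀ ℕ) → List A → A) : Prop where
  char_two : CharP K 2
  graded : DirectSum.IsInternal gr
  smul_mem : ∀ (g : ℤ) (κ : K) (x : A), x ∈ gr g → κ • x ∈ gr g
  op_smul_mem : ∀ (g : ℤ) (κ : K) (x : A), x ∈ gr g → MulOpposite.op κ • x ∈ gr g
  map_add : ∀ (w : ι →₀ ℕ) (l₁ l₂ : List A) (x y : A),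
    μ w (l₁ ++ (x + y) :: l₂) = μ w (l₁ ++ x :: l₂) + μ w (l₁ ++ y :: l₂)
  map_smul_left : ∀ (w : ι →₀ ℕ) (l : List A) (κ : K) (x : A),
    μ w ((κ • x) :: l) = κ • μ w (x :: l)
  map_smul_right : ∀ (w : ι →₀ ℕ) (l : List A) (κ : K) (x : A),
    μ w (l ++ [MulOpposite.op κ • x]) = MulOpposite.op κ • μ w (l ++ [x])
  balanced : ∀ (w : ι →₀ ℕ) (l₁ l₂ : List A) (κ : K) (x y : A),
    μ w (l₁ ++ (MulOpposite.op κ • x) :: y :: l₂) = μ w (l₁ ++ x :: (κ • y) :: l₂)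
  smul_nil : ∀ (w : ι →₀ ℕ) (κ : K), κ • μ w [] = MulOpposite.op κ • μ w []
  degree : ∀ (w : ι →₀ ℕ) (l : List A) (g : List ℤ),
    List.Forall₂ (fun x k => x ∈ gr k) l g →
      μ w l ∈ gr (g.sum + (l.length : ℤ) - 2 + 2 * ∑ i, (w i : ℤ))
  zero_nil : μ 0 [] = 0
  /-- The structure relation: the inner operation is applied to the entries with
  (zero-based) positions `i, …, j - 1`. -/
  relation : ∀ (w : ι →₀ ℕ) (l : List A),
    ∑ i ∈ Finset.range (l.length + 1), ∑ j ∈ Finset.Icc i l.length,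
      ∑ uv ∈ Finset.HasAntidiagonal.antidiagonal w,
        μ uv.1 (l.take i ++ μ uv.2 ((l.take j).drop i) :: l.drop j) = 0

/-- `e` is a (strict) unit for the operations `μ`. -/
structure IsAInfinityUnit {ι A : Type*} [AddCommGroup A]
    (μ : (ι →₀ ℕ) → List A → A) (e : A) : Prop where
  mul_unit : ∀ a : A, μ 0 [a, e] = a
  unit_mul : ∀ a : A, μ 0 [e, a] = a
  eq_zero : ∀ (w : ι →₀ ℕ) (l : List A), e ∈ l → (l.length, w) ≠ (2, 0) → μ w l = 0

namespace PlanarTiling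

/-! ## The quiver and its paths -/

/-- The vertices `[1], …, [m-1]` of the quiver. -/
abbrev Vertex (m : ℕ) : Type := ↥(Finset.Ico 1 m)

/-- The basis `e_1, …, e_m` of the weight space. -/
abbrev WeightIndex (m : ℕ) : Type := ↥(Finset.Icc 1 m)

/-- The first vertex `[1]`. -/
def Vertex.first (m : ℕ) [hm : Fact (3 ≤ m)] : Vertex m :=
  ⟨1, Finset.mem_Ico.2 ⟨le_refl 1, by have := hm.out; omega⟩⟩

/-- The last vertex `[m-1]`. -/
def Vertex.last (m : ℕ) [hm : Fact (3 ≤ m)] : Vertex m :=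
  ⟨m - 1, Finset.mem_Ico.2 (by have := hm.out; omega)⟩

/-- The arrows `L_i : [i] → [i-1]`, `R_i : [i-1] → [i]` (for `2 ≤ i ≤ m - 1`),
`U_1 : [1] → [1]` and `U_m : [m-1] → [m-1]`. -/
inductive Arrow (m : ℕ) : Type
  | L (i : ℕ) (h : 2 ≤ i ∧ i < m) : Arrow m
  | R (i : ℕ) (h : 2 ≤ i ∧ i < m) : Arrow m
  | U₁ : Arrow m
  | Uₘ : Arrow m

def Arrow.src {m : ℕ} [Fact (3 ≤ m)] : Arrow m → Vertex m
  | .L i h => ⟨i, Finset.mem_Ico.2 (by omega)⟩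
  | .R i h => ⟨i - 1, Finset.mem_Ico.2 (by omega)⟩
  | .U₁ => Vertex.first m
  | .Uₘ => Vertex.last m

def Arrow.tgt {m : ℕ} [Fact (3 ≤ m)] : Arrow m → Vertex m
  | .L i h => ⟨i - 1, Finset.mem_Ico.2 (by omega)⟩
  | .R i h => ⟨i, Finset.mem_Ico.2 (by omega)⟩
  | .U₁ => Vertex.first m
  | .Uₘ => Vertex.last m

/-- The relations: the products of two arrows that are set to zero. -/
inductive Arrow.Relation {m : ℕ} : Arrow m → Arrow m → Prop
  | LL (i : ℕ) (h : 2 ≤ i ∧ i < m) (h' : 2 ≤ i - 1 ∧ i - 1 < m) :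
      Arrow.Relation (.L i h) (.L (i - 1) h')
  | RR (i : ℕ) (h : 2 ≤ i ∧ i < m) (h' : 2 ≤ i - 1 ∧ i - 1 < m) :
      Arrow.Relation (.R (i - 1) h') (.R i h)
  | LU (h : 2 ≤ 2 ∧ 2 < m) : Arrow.Relation (.L 2 h) .U₁
  | UR (h : 2 ≤ 2 ∧ 2 < m) : Arrow.Relation .U₁ (.R 2 h)
  | RU (h : 2 ≤ m - 1 ∧ m - 1 < m) : Arrow.Relation (.R (m - 1) h) .Uₘ
  | UL (h : 2 ≤ m - 1 ∧ m - 1 < m) : Arrow.Relation .Uₘ (.L (m - 1) h)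

/-- The arrow `b` can follow the arrow `a` in a path, and the product `a b` is not set to zero. -/
def Arrow.Follows {m : ℕ} [Fact (3 ≤ m)] (a b : Arrow m) : Prop :=
  a.tgt = b.src ∧ ¬ Arrow.Relation a b

/-- The paths in the quiver (possibly constant) that contain none of the relations.  As the
relations are monomials, these paths form a basis of the path algebra modulo the relations. -/
@[ext]
structure QPath (m : ℕ) [Fact (3 ≤ m)] : Type where
  start : Vertex m
  word : List (Arrow m)
  chain : List.IsChain Arrow.Follows word
  src_head : ∀ a ∈ word.head?, a.src = start

namespace QPath

variable {m : ℕ} [Fact (3 ≤ m)]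

/-- The constant path at `x`. -/
def const (x : Vertex m) : QPath m := ⟨x, [], List.isChain_nil, by simp⟩

/-- The path of length one. -/
def ofArrow (a : Arrow m) : QPath m := ⟨a.src, [a], List.isChain_singleton a, by simp⟩

/-- A path is pure if it is not constant. -/
def IsPure (p : QPath m) : Prop := p.word ≠ []

/-- The length of a path. -/
def length (p : QPath m) : ℕ := p.word.length

/-- The end point of a path. -/
def finish (p : QPath m) : Vertex m := (p.word.getLast?.map Arrow.tgt).getD p.start

open Classical in
/-- The product of two paths: their concatenation if it is a path that contains no relation, and
`none` (which stands for zero) otherwise. -/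
def comp (p q : QPath m) : Option (QPath m) :=
  if h : p.finish = q.start ∧ List.IsChain Arrow.Follows (p.word ++ q.word) then
    some ⟨p.start, p.word ++ q.word, h.2, by
      intro a ha
      rcases hp : p.word with _ | ⟨b, l⟩
      · have h1 := h.1
        simp only [finish, hp, List.getLast?_nil, Option.map_none, Option.getD_none] at h1
        rw [hp, List.nil_append] at ha
        rw [h1]
        exact q.src_head a ha
      · rw [hp] at ha
        exact p.src_head a (by rw [hp]; simpa using ha)⟩
  else none

/-- The initial subpath of length `k`. -/
def take (p : QPath m) (k : ℕ) : QPath m :=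
  ⟨p.start, p.word.take k, p.chain.take k, by
    intro a ha
    apply p.src_head
    rcases hp : p.word with _ | ⟨b, l⟩
    · simp [hp] at ha
    · rcases k with _ | k
      · simp at ha
      · simpa [hp] using ha⟩

/-- The subpath that remains when the first `k` arrows are removed. -/
def drop (p : QPath m) (k : ℕ) : QPath m :=
  ⟨(p.take k).finish, p.word.drop k, p.chain.drop k, by
    intro a ha
    have hc := p.chain
    rw [← List.take_append_drop k p.word, List.isChain_append] at hc
    rcases hl : (p.word.take k).getLast? with _ | b
    · have h0 : p.word.take k = [] := by simpa using hl
      have h1 : p.word.drop k = p.word := by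
        conv_rhs => rw [← List.take_append_drop k p.word, h0, List.nil_append]
      rw [h1] at ha
      simp only [finish, take, h0, List.getLast?_nil, Option.map_none, Option.getD_none]
      exact p.src_head a ha
    · have h2 := (hc.2.2 b (by simp [hl]) a ha).1
      simp only [finish, take, hl, Option.map_some, Option.getD_some]
      exact h2.symm⟩

theorem comp_eq_some_iff {p q s : QPath m} :
    p.comp q = some s ↔ p.finish = q.start ∧ s.start = p.start ∧ s.word = p.word ++ q.word := by
  classical
  unfold comp
  constructor
  · intro h
    split_ifs at h with h1
    obtain rfl := Option.some.inj h
    exact ⟨h1.1, rfl, rfl⟩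
  · rintro ⟨h1, h2, h3⟩
    rw [dif_pos ⟨h1, h3 ▸ s.chain⟩]
    congr 1
    ext1
    · exact h2.symm
    · exact h3.symm

theorem finish_of_comp {p q s : QPath m} (h : p.comp q = some s) : s.finish = q.finish := by
  rw [comp_eq_some_iff] at h
  obtain ⟨h1, h2, h3⟩ := h
  rcases hq : q.word with _ | ⟨b, l⟩
  · rw [hq, List.append_nil] at h3
    have : s.finish = p.finish := by simp only [finish, h3, h2]
    rw [this, h1]
    simp [finish, hq]
  · rw [hq] at h3
    simp [finish, h3, hq, List.getLast?_eq_some_getLast]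

theorem comp_assoc (p q r : QPath m) :
    (p.comp q).bind (fun s => s.comp r) = (q.comp r).bind (fun s => p.comp s) := by
  ext u
  simp only [Option.bind_eq_some_iff]
  constructor
  · rintro ⟨s, hs, hu⟩
    have hf := finish_of_comp hs
    have hu' := comp_eq_some_iff.1 hu
    have hs' := comp_eq_some_iff.1 hs
    have hw : u.word = p.word ++ (q.word ++ r.word) := by
      rw [hu'.2.2, hs'.2.2, List.append_assoc]
    have hqr : q.finish = r.start := hf ▸ hu'.1
    have hc : List.IsChain Arrow.Follows (q.word ++ r.word) := by
      have := u.chain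
      rw [hw, List.isChain_append] at this
      exact this.2.1
    classical
    obtain ⟨v, hv⟩ : ∃ v, q.comp r = some v := by
      unfold comp
      rw [dif_pos ⟨hqr, hc⟩]
      exact ⟨_, rfl⟩
    have hv' := comp_eq_some_iff.1 hv
    refine ⟨v, hv, comp_eq_some_iff.2 ⟨?_, ?_, ?_⟩⟩
    · rw [hs'.1, hv'.2.1]
    · rw [hu'.2.1, hs'.2.1]
    · rw [hw, hv'.2.2]
  · rintro ⟨s, hs, hu⟩
    have hu' := comp_eq_some_iff.1 hu
    have hs' := comp_eq_some_iff.1 hs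
    have hw : u.word = (p.word ++ q.word) ++ r.word := by
      rw [hu'.2.2, hs'.2.2, List.append_assoc]
    have hpq : p.finish = q.start := by rw [hu'.1, hs'.2.1]
    have hc : List.IsChain Arrow.Follows (p.word ++ q.word) := by
      have := u.chain
      rw [hw, List.isChain_append] at this
      exact this.1
    classical
    obtain ⟨v, hv⟩ : ∃ v, p.comp q = some v := by
      unfold comp
      rw [dif_pos ⟨hpq, hc⟩]
      exact ⟨_, rfl⟩
    have hv' := comp_eq_some_iff.1 hv
    refine ⟨v, hv, comp_eq_some_iff.2 ⟨?_, ?_, ?_⟩⟩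
    · rw [finish_of_comp hv, hs'.1]
    · rw [hu'.2.1, hv'.2.1]
    · rw [hw, hv'.2.2]

open Classical in
theorem const_comp (x : Vertex m) (p : QPath m) :
    (const x).comp p = if x = p.start then some p else none := by
  split_ifs with h
  · exact comp_eq_some_iff.2 ⟨by simp [finish, const, h], by simp [const, h], by simp [const]⟩
  · unfold comp
    rw [dif_neg]
    rintro ⟨h1, _⟩
    exact h (by simpa [finish, const] using h1)

open Classical in
theorem comp_const (x : Vertex m) (p : QPath m) :
    p.comp (const x) = if x = p.finish then some p else none := by
  split_ifs with h
  · exact comp_eq_some_iff.2 ⟨by simp [const, h], rfl, by simp [const]⟩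
  · unfold comp
    rw [dif_neg]
    rintro ⟨h1, _⟩
    exact h (by simpa [const] using h1.symm)

end QPath

/-! ## The bordered algebra -/

/-- The bordered algebra `𝒞(m,1)` with coefficients in `R`: the path algebra of the quiver modulo
the relations, with its basis of paths. -/
def BorderedAlgebra (R : Type*) [CommRing R] (m : ℕ) [Fact (3 ≤ m)] : Type _ := QPath m →₀ R

namespace BorderedAlgebra

variable {R : Type*} [CommRing R] {m : ℕ} [Fact (3 ≤ m)]

instance : AddCommGroup (BorderedAlgebra R m) := inferInstanceAs (AddCommGroup (QPath m →₀ R))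

instance : Module R (BorderedAlgebra R m) := inferInstanceAs (Module R (QPath m →₀ R))

/-- The coefficients of an element with respect to the basis of paths. -/
def coeffs (a : BorderedAlgebra R m) : QPath m →₀ R := a

/-- `r` times the basis element `p`. -/
def single (p : QPath m) (r : R) : BorderedAlgebra R m := Finsupp.single p r

/-- The basis element given by a path. -/
def basis (p : QPath m) : BorderedAlgebra R m := single p 1

/-- A product of two paths as an element of the algebra. -/
def ofOption (R : Type*) [CommRing R] : Option (QPath m) → (QPath m →₀ R)
  | none => 0
  | some p => Finsupp.single p 1

/-- The multiplication as a bilinear map on the free module on the paths. -/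
def mulLin (R : Type*) [CommRing R] (m : ℕ) [Fact (3 ≤ m)] :
    (QPath m →₀ R) →ₗ[R] (QPath m →₀ R) →ₗ[R] (QPath m →₀ R) :=
  Finsupp.lift ((QPath m →₀ R) →ₗ[R] (QPath m →₀ R)) R (QPath m) fun p =>
    Finsupp.lift (QPath m →₀ R) R (QPath m) fun q => ofOption R (p.comp q)

/-- The multiplication: the bilinear extension of the product of paths. -/
instance : Mul (BorderedAlgebra R m) := ⟨fun a b => mulLin R m a b⟩

/-- The unit is the sum of the constant paths. -/
instance : One (BorderedAlgebra R m) := ⟨∑ x : Vertex m, basis (QPath.const x)⟩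

theorem mulLin_single_single (p q : QPath m) :
    mulLin R m (Finsupp.single p 1) (Finsupp.single q 1) = ofOption R (p.comp q) := by
  simp [mulLin]

theorem mulLin_ofOption_left (o : Option (QPath m)) (r : QPath m) :
    mulLin R m (ofOption R o) (Finsupp.single r 1) = ofOption R (o.bind fun s => s.comp r) := by
  cases o with
  | none => simp [ofOption]
  | some s => exact mulLin_single_single s r

theorem mulLin_ofOption_right (o : Option (QPath m)) (r : QPath m) :
    mulLin R m (Finsupp.single r 1) (ofOption R o) = ofOption R (o.bind fun s => r.comp s) := by
  cases o with
  | none => simp [ofOption]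
  | some s => exact mulLin_single_single r s

theorem mulLin_assoc (a b c : QPath m →₀ R) :
    mulLin R m (mulLin R m a b) c = mulLin R m a (mulLin R m b c) := by
  induction a using Finsupp.induction_linear with
  | zero => simp
  | add a a' ha ha' => simp only [map_add, LinearMap.add_apply, ha, ha']
  | single p x =>
    induction b using Finsupp.induction_linear with
    | zero => simp
    | add b b' hb hb' => simp only [map_add, LinearMap.add_apply, hb, hb']
    | single q y =>
      induction c using Finsupp.induction_linear with
      | zero => simp
      | add c c' hc hc' => simp only [map_add, hc, hc']
      | single r z =>
        have h : ∀ (p : QPath m) (x : R), Finsupp.single p x = x • Finsupp.single p (1 : R) := by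
          intro p x
          simp
        rw [h p x, h q y, h r z]
        simp only [map_smul, LinearMap.smul_apply, mulLin_single_single, mulLin_ofOption_left,
          mulLin_ofOption_right, QPath.comp_assoc]

theorem mulLin_one_left (a : QPath m →₀ R) :
    mulLin R m (∑ x : Vertex m, Finsupp.single (QPath.const x) 1) a = a := by
  classical
  induction a using Finsupp.induction_linear with
  | zero => simp
  | add a a' ha ha' => rw [map_add, ha, ha']
  | single p x =>
    have h : Finsupp.single p x = x • Finsupp.single p (1 : R) := by simp
    rw [h, map_smul, map_sum, LinearMap.sum_apply]
    congr 1
    simp only [mulLin_single_single, QPath.const_comp]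
    rw [Finset.sum_eq_single p.start]
    · simp [ofOption]
    · intro y _ hy
      simp [hy, ofOption]
    · simp

theorem mulLin_one_right (a : QPath m →₀ R) :
    mulLin R m a (∑ x : Vertex m, Finsupp.single (QPath.const x) 1) = a := by
  classical
  induction a using Finsupp.induction_linear with
  | zero => simp
  | add a a' ha ha' => rw [map_add, LinearMap.add_apply, ha, ha']
  | single p x =>
    have h : Finsupp.single p x = x • Finsupp.single p (1 : R) := by simp
    rw [h, map_smul, LinearMap.smul_apply, map_sum]
    congr 1
    simp only [mulLin_single_single, QPath.comp_const]
    rw [Finset.sum_eq_single p.finish]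
    · simp [ofOption]
    · intro y _ hy
      simp [hy, ofOption]
    · simp

instance : Ring (BorderedAlgebra R m) :=
  { (inferInstance : AddCommGroup (BorderedAlgebra R m)),
    (inferInstance : Mul (BorderedAlgebra R m)),
    (inferInstance : One (BorderedAlgebra R m)) with
    left_distrib := fun a b c => (mulLin R m a).map_add b c
    right_distrib := fun a b c => (mulLin R m).map_add₂ a b c
    zero_mul := fun a => (mulLin R m).map_zero₂ a
    mul_zero := fun a => (mulLin R m a).map_zero
    mul_assoc := mulLin_assoc
    one_mul := mulLin_one_left
    mul_one := mulLin_one_right }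

theorem basis_mul_basis (p q : QPath m) :
    (basis p * basis q : BorderedAlgebra R m) = ofOption R (p.comp q) :=
  mulLin_single_single p q

theorem smul_mul (r : R) (a b : BorderedAlgebra R m) : (r • a) * b = r • (a * b) :=
  (mulLin R m).map_smul₂ r a b

theorem mul_smul' (r : R) (a b : BorderedAlgebra R m) : a * (r • b) = r • (a * b) :=
  (mulLin R m a).map_smul r b

theorem one_def : (1 : BorderedAlgebra R m) = ∑ x : Vertex m, basis (QPath.const x) := rfl

/-- The element `U_i`: the loop `U_1` or `U_m`, or `R_i L_i + L_i R_i` if `2 ≤ i ≤ m - 1`. -/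
def U (i : WeightIndex m) : BorderedAlgebra R m :=
  if h : 2 ≤ (i : ℕ) ∧ (i : ℕ) < m then
    basis (.ofArrow (.R i h)) * basis (.ofArrow (.L i h)) +
      basis (.ofArrow (.L i h)) * basis (.ofArrow (.R i h))
  else if (i : ℕ) = 1 then basis (.ofArrow .U₁)
  else basis (.ofArrow .Uₘ)

/-- The inclusion of the ring of idempotents `⊕ R I_x`, which is the product ring `R^{m-1}`. -/
def idempotents (R : Type*) [CommRing R] (m : ℕ) [Fact (3 ≤ m)] :
    (Vertex m → R) →+* BorderedAlgebra R m where
  toFun κ := ∑ x, κ x • basis (QPath.const x)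
  map_one' := by simp [one_def]
  map_zero' := by simp
  map_add' κ κ' := by simp [add_smul, Finset.sum_add_distrib]
  map_mul' κ κ' := by
    classical
    have h : ∀ x y : Vertex m, (basis (QPath.const x) * basis (QPath.const y) :
        BorderedAlgebra R m) = if x = y then basis (QPath.const x) else 0 := by
      intro x y
      rw [basis_mul_basis, QPath.const_comp]
      by_cases hxy : x = y
      · subst hxy
        simp only [QPath.const, if_true]
        rfl
      · simp only [QPath.const, hxy, if_false]
        rfl
    rw [Finset.sum_mul]
    refine Finset.sum_congr rfl fun x _ => ?_
    simp [Finset.mul_sum, smul_mul, mul_smul', h, smul_smul, mul_comm]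

end BorderedAlgebra

/-- The algebra `𝒞(m,1)[t]` over `ℤ/2`, that is `𝒞(m,1)` with coefficients in `(ℤ/2)[t]`.
The variable `t` is `Polynomial.X`. -/
abbrev TAlgebra (m : ℕ) [Fact (3 ≤ m)] : Type := BorderedAlgebra (ZMod 2)[X] m

/-- The ground ring: the ring of idempotents of `𝒞(m,1)` over `ℤ/2`. -/
abbrev IdempotentRing (m : ℕ) : Type := Vertex m → ZMod 2

section Bimodule

variable (m : ℕ) [Fact (3 ≤ m)]

/-- The ground ring as a subring of `𝒞(m,1)[t]`. -/
def groundHom : IdempotentRing m →+* TAlgebra m :=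
  (BorderedAlgebra.idempotents (ZMod 2)[X] m).comp
    ((Polynomial.C : ZMod 2 →+* (ZMod 2)[X]).compLeft (Vertex m))

/-- Left multiplication by idempotents. -/
instance leftModule : Module (IdempotentRing m) (TAlgebra m) :=
  Module.compHom (TAlgebra m) (groundHom m)

/-- Right multiplication by idempotents. -/
instance rightModule : Module (IdempotentRing m)ᵐᵒᵖ (TAlgebra m) :=
  Module.compHom (TAlgebra m) (RingHom.op (groundHom m))

instance bimodule : SMulCommClass (IdempotentRing m) (IdempotentRing m)ᵐᵒᵖ (TAlgebra m) where
  smul_comm κ κ' a := (mul_assoc (groundHom m κ) a (groundHom m κ'.unop)).symm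

/-- The grading `gr`, in which `𝒞(m,1)` has degree zero and `t` has degree `2m - 4`. -/
def grading (g : ℤ) : AddSubgroup (TAlgebra m) where
  carrier := {a | ∀ (p : QPath m) (k : ℕ), (a.coeffs p).coeff k ≠ 0 → (k : ℤ) * (2 * m - 4) = g}
  zero_mem' := by
    intro p k h
    exact absurd (Polynomial.coeff_zero k) h
  add_mem' := by
    intro a b ha hb p k h
    by_cases h1 : (a.coeffs p).coeff k = 0
    · refine hb p k fun h2 => h ?_
      change (a.coeffs p + b.coeffs p).coeff k = 0
      rw [Polynomial.coeff_add, h1, h2, add_zero]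
    · exact ha p k h1
  neg_mem' := by
    intro a ha p k h
    refine ha p k fun h1 => h ?_
    change (-(a.coeffs p)).coeff k = 0
    rw [Polynomial.coeff_neg, h1, neg_zero]

end Bimodule

/-! ## Compatibly decorated planar graphs -/

/-- The half-edges at an internal vertex: outgoing ones and incoming ones, labeled by
`1, …, m - 1`. -/
inductive Slot (m : ℕ) : Type
  | out (k : Vertex m) : Slot m
  | inc (k : Vertex m) : Slot m

namespace Slot

/-- The label of a half-edge. -/
def label {m : ℕ} : Slot m → Vertex m
  | out k => k
  | inc k => k

/-- The type of the other half of an edge: same label, and outgoing at one end means incoming at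
the other. -/
def flip {m : ℕ} : Slot m → Slot m
  | out k => inc k
  | inc k => out k

variable {m : ℕ} [hm : Fact (3 ≤ m)]

/-- The counterclockwise successor of a half-edge at an internal vertex.  The counterclockwise
order is: incoming `1, …, m - 1`, then outgoing `m - 1, …, 1`. -/
def next : Slot m → Slot m
  | out k => if h : (k : ℕ) = 1 then inc k else
      out ⟨k - 1, Finset.mem_Ico.2 (by have := Finset.mem_Ico.1 k.2; omega)⟩
  | inc k => if h : (k : ℕ) = m - 1 then out k else
      inc ⟨k + 1, Finset.mem_Ico.2 (by have := Finset.mem_Ico.1 k.2; omega)⟩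

/-- The clockwise successor of a half-edge at an internal vertex. -/
def prev : Slot m → Slot m
  | out k => if h : (k : ℕ) = m - 1 then inc k else
      out ⟨k + 1, Finset.mem_Ico.2 (by have := Finset.mem_Ico.1 k.2; omega)⟩
  | inc k => if h : (k : ℕ) = 1 then out k else
      inc ⟨k - 1, Finset.mem_Ico.2 (by have := Finset.mem_Ico.1 k.2; omega)⟩

theorem prev_next (s : Slot m) : s.next.prev = s := by
  have h3 := hm.out
  rcases s with ⟨k, hk⟩ | ⟨k, hk⟩ <;> have hk' := Finset.mem_Ico.1 hk <;>
    unfold next <;> dsimp only <;> split_ifs with h1 <;> unfold prev <;> dsimp only <;>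
    split_ifs <;> first | rfl | (exfalso; omega) | (congr 2; omega)

theorem next_prev (s : Slot m) : s.prev.next = s := by
  have h3 := hm.out
  rcases s with ⟨k, hk⟩ | ⟨k, hk⟩ <;> have hk' := Finset.mem_Ico.1 hk <;>
    unfold prev <;> dsimp only <;> split_ifs with h1 <;> unfold next <;> dsimp only <;>
    split_ifs <;> first | rfl | (exfalso; omega) | (congr 2; omega)

/-- The counterclockwise rotation of the half-edges at an internal vertex. -/
def rot : Equiv.Perm (Slot m) := ⟨next, prev, prev_next, next_prev⟩

/-- The letter of the sector between the half-edge `s` and its counterclockwise successor. -/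
def sector : Slot m → Arrow m
  | out k => if h : (k : ℕ) = 1 then .U₁ else
      .L k (by have := Finset.mem_Ico.1 k.2; omega)
  | inc k => if h : (k : ℕ) = m - 1 then .Uₘ else
      .R (k + 1) (by have := Finset.mem_Ico.1 k.2; omega)

end Slot

/-- The half-edges of a graph with `d` internal vertices and `n` leaves: `Sum.inl (v, s)` is the
half-edge of type `s` at the internal vertex `v`, and `Sum.inr j` is the half-edge at the leaf `j`.
Each half-edge is identified with the sector that follows it in the counterclockwise order. -/
abbrev HalfEdge (m n d : ℕ) : Type := (Fin d × Slot m) ⊕ Fin n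

/-- A compatibly decorated rooted graph, given by its half-edges and the involution that exchanges
the two halves of each edge.  The leaves are numbered `0, …, n - 1` counterclockwise around the
boundary of the disk, and leaf `0` is the root.  Each leaf is joined to an internal vertex. -/
structure DecoratedGraph (m n d : ℕ) : Type where
  edge : Equiv.Perm (HalfEdge m n d)
  edge_edge : ∀ x, edge (edge x) = x
  edge_inl : ∀ v s v' s', edge (.inl (v, s)) = .inl (v', s') → s' = s.flip
  edge_inr : ∀ j, ∃ x, edge (.inr j) = .inl x

namespace DecoratedGraph

section Isomorphism

variable {m n d : ℕ}

/-- The renumbering of half-edges induced by a renumbering of the internal vertices. -/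
def renumber (e : Equiv.Perm (Fin d)) : Equiv.Perm (HalfEdge m n d) :=
  Equiv.sumCongr (Equiv.prodCongr e (Equiv.refl (Slot m))) (Equiv.refl (Fin n))

/-- Two graphs are the same up to isotopy: they differ by a renumbering of the internal
vertices. -/
def Isomorphic (Γ Γ' : DecoratedGraph m n d) : Prop :=
  ∃ e : Equiv.Perm (Fin d), ∀ x, Γ'.edge (renumber e x) = renumber e (Γ.edge x)

theorem renumber_symm_apply (e : Equiv.Perm (Fin d)) (x : HalfEdge m n d) :
    renumber e (renumber e.symm x) = x := by
  rcases x with ⟨v, s⟩ | j <;> simp [renumber]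

theorem renumber_apply_symm (e : Equiv.Perm (Fin d)) (x : HalfEdge m n d) :
    renumber e.symm (renumber e x) = x := by
  rcases x with ⟨v, s⟩ | j <;> simp [renumber]

/-- Isomorphism of graphs is an equivalence relation. -/
instance setoid (m n d : ℕ) : Setoid (DecoratedGraph m n d) where
  r := Isomorphic
  iseqv :=
    { refl := fun Γ => ⟨Equiv.refl _, fun x => by
        have h : ∀ y : HalfEdge m n d, renumber (Equiv.refl (Fin d)) y = y := by
          rintro (⟨v, s⟩ | j) <;> simp [renumber]
        rw [h, h]⟩
      symm := by
        rintro Γ Γ' ⟨e, he⟩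
        refine ⟨e.symm, fun x => ?_⟩
        have h := he (renumber e.symm x)
        rw [renumber_symm_apply] at h
        rw [h, renumber_apply_symm]
      trans := by
        rintro Γ Γ' Γ'' ⟨e, he⟩ ⟨e', he'⟩
        refine ⟨e.trans e', fun x => ?_⟩
        have h : ∀ y : HalfEdge m n d, renumber (e.trans e') y = renumber e' (renumber e y) := by
          rintro (⟨v, s⟩ | j) <;> simp [renumber]
        rw [h, h, he', he] }

end Isomorphism

variable {m n d : ℕ} [Fact (3 ≤ m)] (Γ : DecoratedGraph m n d)

/-- The counterclockwise rotation around the vertices of the graph on the sphere that is obtained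
by collapsing the complement of the open disk, with all the leaves, to one further vertex.  Around
the latter the order of the leaves is reversed. -/
def rotation : Equiv.Perm (HalfEdge m n d) :=
  Equiv.sumCongr (Equiv.prodCongr (Equiv.refl (Fin d)) Slot.rot) (finRotate n).symm

/-- The permutation that takes each sector to the next one in the same region: cross the edge which
bounds the sector on its far side. -/
def nextSector : Equiv.Perm (HalfEdge m n d) := rotation.trans Γ.edge

/-- The edges, as sets of half-edges. -/
def edges : Set (Set (HalfEdge m n d)) := Set.range fun x => {x, Γ.edge x}

/-- The components of the complement of the graph, as sets of sectors. -/
def regions : Set (Set (HalfEdge m n d)) :=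
  Set.range fun x => {y | Γ.nextSector.SameCycle x y}

/-- The region contains exactly the sector `U_1` (if `i = 1`), exactly the sector `U_m` (if
`i = m`), or exactly two sectors, `R_i` and `L_i` (if `2 ≤ i ≤ m - 1`).  In particular it does not
meet the boundary of the disk. -/
def IsOfType (F : Set (HalfEdge m n d)) (i : ℕ) : Prop :=
  (i = 1 ∧ ∃ v s, Slot.sector s = .U₁ ∧ F = {.inl (v, s)}) ∨
  (i = m ∧ ∃ v s, Slot.sector s = .Uₘ ∧ F = {.inl (v, s)}) ∨
  (∃ h : 2 ≤ i ∧ i < m, ∃ v s v' s', Slot.sector s = .R i h ∧ Slot.sector s' = .L i h ∧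
    F = {.inl (v, s), .inl (v', s')})

/-- Two internal vertices are joined by an edge. -/
def Adj (v v' : Fin d) : Prop := ∃ s s', Γ.edge (.inl (v, s)) = .inl (v', s')

/-- There is an edge from `v` to the different vertex `v'`. -/
def Step (v v' : Fin d) : Prop :=
  v ≠ v' ∧ ∃ k, Γ.edge (.inl (v, .out k)) = .inl (v', .inc k)

/-- The conditions for a centered tiling graph.  Planarity is expressed by Euler's formula on the
sphere, where the collapsed boundary counts as a vertex. -/
structure IsCentered : Prop where
  root : 0 < n
  connected : ∀ v v' : Fin d, Relation.ReflTransGen Γ.Adj v v'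
  planar : ((d : ℤ) + 1) - Γ.edges.ncard + Γ.regions.ncard = 2
  /-- Every oriented cycle is a loop. -/
  cycles : ∀ v : Fin d, ¬ Relation.TransGen Γ.Step v v
  /-- Every region that does not meet the boundary is a monogon `U_1`, a monogon `U_m` or a
  bigon `R_i, L_i`. -/
  inner_regions : ∀ F ∈ Γ.regions, (∀ j : Fin n, Sum.inr j ∉ F) →
    ∃ i : WeightIndex m, IsOfType F i

/-- The `i`-th component of the weight: the number of regions of type `i`. -/
def weight (i : WeightIndex m) : ℕ := {F | F ∈ Γ.regions ∧ IsOfType F i}.ncard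

/-- `Γ.Reads x w`: the letters of the sectors met from `x` on, up to the next leaf, form the
word `w`. -/
inductive Reads : HalfEdge m n d → List (Arrow m) → Prop
  | leaf (j : Fin n) : Reads (.inr j) []
  | sector (v : Fin d) (s : Slot m) (w : List (Arrow m)) :
      Reads (Γ.nextSector (.inl (v, s))) w → Reads (.inl (v, s)) (s.sector :: w)

/-- The algebra sequence of the graph is `ps`: for each `j`, the product of the letters of the
sectors in the region at the boundary interval which runs counterclockwise from leaf `j` to the
next leaf is the `j`-th path. -/
def HasSequence (ps : List (QPath m)) : Prop :=
  ∃ h : ps.length = n, ∀ j : Fin n, Γ.Reads (Γ.edge (.inr j)) (ps.get (j.cast h.symm)).word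

/-- `k` is the label of the root edge. -/
def RootLabel (k : Vertex m) : Prop :=
  ∃ (h : 0 < n) (v : Fin d) (s : Slot m), Γ.edge (.inr ⟨0, h⟩) = .inl (v, s) ∧ s.label = k

/-- The isomorphism classes of centered tiling graphs with `d` internal vertices, with weight `w`,
algebra sequence `ps` and label `k` of the root edge. -/
def classes (w : WeightIndex m →₀ ℕ) (ps : List (QPath m)) (d : ℕ) (k : Vertex m) :
    Set (Quotient (setoid m ps.length d)) :=
  {C | ∃ Γ : DecoratedGraph m ps.length d, Quotient.mk _ Γ = C ∧ Γ.IsCentered ∧ Γ.RootLabel k ∧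
    (∀ i, Γ.weight i = w i) ∧ Γ.HasSequence ps}

end DecoratedGraph

/-! ## The operations -/

section Operations

variable {m : ℕ} [Fact (3 ≤ m)]

open BorderedAlgebra

/-- The count `c^w_n` of centered tiling graphs: each contributes `t^d` times the idempotent of its
root edge.  (Only finitely many `d` contribute, as `w` and the inputs determine the number of
sectors.) -/
def centered (w : WeightIndex m →₀ ℕ) (ps : List (QPath m)) : TAlgebra m :=
  ∑ᶠ d : ℕ, ∑ k : Vertex m,
    (DecoratedGraph.classes w ps d k).ncard • single (QPath.const k) (Polynomial.X ^ d)

/-- The left-extended terms: the sum of `a · c(a₁', a₂, …, aₙ)` over the factorizations of the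
first input `a₁ = a · a₁'` into two pure elements. -/
def leftExtended (w : WeightIndex m →₀ ℕ) : List (QPath m) → TAlgebra m
  | [] => 0
  | p :: ps => ∑ k ∈ Finset.Ioo 0 p.length, basis (p.take k) * centered w (p.drop k :: ps)

/-- The right-extended terms: the sum of `c(a₁, …, aₙ₋₁, aₙ') · a` over the factorizations of the
last input `aₙ = aₙ' · a` into two pure elements. -/
def rightExtended (w : WeightIndex m →₀ ℕ) (ps : List (QPath m)) : TAlgebra m :=
  match ps.getLast? with
  | none => 0
  | some p => ∑ k ∈ Finset.Ioo 0 p.length,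
      centered w (ps.dropLast ++ [p.take k]) * basis (p.drop k)

open Classical in
/-- The operation defined by tiling graphs, on paths; it vanishes if an input is constant. -/
def graphOperation (w : WeightIndex m →₀ ℕ) (ps : List (QPath m)) : TAlgebra m :=
  if ∀ p ∈ ps, p.IsPure then centered w ps + leftExtended w ps + rightExtended w ps else 0

open Classical in
/-- The operations `μ^w_n` on paths: `μ_0^{e_i} = U_i`, `μ_2^0` is the product, and all the others
are given by tiling graphs. -/
def pathOperation (w : WeightIndex m →₀ ℕ) : List (QPath m) → TAlgebra m
  | [] => ∑ i : WeightIndex m, if w = Finsupp.single i 1 then U i else 0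
  | [p, q] => if w = 0 then basis p * basis q else graphOperation w [p, q]
  | ps => graphOperation w ps

/-- The extension to `𝒞(m,1)[t]`, linear over `(ℤ/2)[t]` in each entry, of a function on sequences
of paths. -/
def multilinearExtension : (List (QPath m) → TAlgebra m) → List (TAlgebra m) → TAlgebra m
  | f, [] => f []
  | f, a :: l => a.coeffs.sum fun p r => r • multilinearExtension (fun ps => f (p :: ps)) l

/-- The operations `μ^w_n` on `𝒞(m,1)[t]`. -/
def operation (w : WeightIndex m →₀ ℕ) (l : List (TAlgebra m)) : TAlgebra m :=
  multilinearExtension (pathOperation w) l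

end Operations

end PlanarTiling

end

/-!
# The weighted A-infinity algebra of centered tiling graphs

**Tilings as permutations.** A half-edge at an internal vertex, which is also the sector that
follows it, is a pair of a number and a slot (`Corner`), and a tiling is an involution of these
half-edges whose fixed points are the leaves (`IsGluing`). Following the sectors of a region is the
permutation `face`. A connected tiling all of whose regions but one are monogons or bigons is
`Realizes S ε y ω`: `S` is the set of vertices, and `ω` is the word read along the remaining region,
the boundary, from the sector `y` on. Such a tiling has no symmetries that fix `y`, so that centered
tiling graphs up to isotopy with `d` vertices correspond to orbits of the free action of the
permutations of `d` numbers on these tilings (`IsTiling.presents`, `Presents.isTiling`,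
`factorial_mul_ncard_classes`). In this dictionary planarity is Euler's formula, which makes the
number of vertices a function of the weight and the number of inputs (`Num`,
`mul_add_two_of_tilingNumber_ne`); this gives the degree of the operations, and finiteness. The
condition on oriented cycles need not be imposed: Euler's formula and the shape of the inner regions
imply it (`Realizes.acyclic`).

**Cutting an edge.** Let the boundary have a product `p q` of two non-constant paths between two
consecutive leaves, and cut the edge at which the factors meet. If the region on the other side of
this edge is an inner region, then cutting merges this region with the boundary, and the result is
an arbitrary tiling with a monogon or bigon as one input and with one fewer inner region
(`ncard_cut_inner`). Otherwise the boundary meets both sides of the edge, and Euler's inequality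
shows that cutting separates the tiling into two (`Realizes.cut_separating`,
`ncard_cut_separating`). Both processes can be reversed by gluing two leaves. Hence the number `C`
of tilings with a given boundary satisfies the quadratic equation `IsTilingCount.cut`
(`ncard_labeled_cut`, `tilingNumber_cut`). Euler's inequality itself is linear algebra: coboundaries
of functions on vertices are orthogonal to functions on edges and functions on faces
(`Euler.euler_le`).

**The structure relation.** Numbers of tilings are collected in a power series in the weights over
`(ℤ/2)[t]`, so that the curvature and all operations become those of an unweighted structure
(`isTilingCount_tilingSeries`). For pure inputs, the terms with an outer operation given by graphs
are sorted by a gap between inputs: insertion of a monogon or bigon at the gap, multiplication of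
its neighbours, and those inner extended terms whose inputs begin or end there. Their sum is
`defect`. If the outer term is centered, then by the cut equation the sum is zero at each gap
between two inputs (`IsTilingCount.defect_eq_zero`), and the sums at the two ends cancel by
rotational symmetry. If the outer term is extended, then the same equation leaves only terms at the
ends; for at least two inputs these cancel against the products of the first or the last input with
the operation on the other ones (`IsTilingCount.gaps_defect_graphTerm_add`). An inner centered term
is a multiple of an idempotent, so that it contributes to such products only. The terms without
graphs cancel by associativity and because the curvature `∑ U_i` is central (`totalOp_cancel`). If
an input is a constant path, then only products with it survive, and they cancel in pairs
(`IsTilingCount.relation_of_const`). This proves `IsTilingCount.relation`; taking coefficients of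
the power series (`weightPart_totalOp`, `pathOperation_relation`) and extending multilinearly
(`operation_relation`) yields the theorem.
-/

set_option linter.unusedSectionVars false
set_option linter.unnecessarySeqFocus false

noncomputable section

namespace PlanarTiling

open Finset (Ioo card_le_card card_range disjoint_left mem_Icc mem_Ico mem_Ioo mem_filter mem_image
  mem_map mem_powerset mem_product mem_range mem_sdiff mem_sigma mem_singleton mem_univ mul_sum
  range sum_add_distrib sum_congr sum_eq_zero sum_smul univ)
open List (append_assoc concat_eq_append cons_append cons_eq_cons countP_append eq_nil_or_concat
  getElem_mem length_append length_cons length_pos_iff_ne_nil map_append map_cons mem_append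
  mem_append_left mem_append_right mem_cons mem_cons_of_mem nil_append)
open Function (Injective iterate_add_apply iterate_one iterate_succ_apply iterate_succ_apply')
open Equiv (Perm)
open Relation (ReflTransGen)
open Finset.HasAntidiagonal (antidiagonal mem_antidiagonal)

/-! ### Slots, sectors and paths -/

/-- The half-edge of a given type at the internal vertex with a given number.  As for decorated
graphs, it also stands for the sector that follows it counterclockwise. -/
abbrev Corner (m : ℕ) : Type := ℕ × Slot m

/-- A run of consecutive sectors of a region: the first sector and the number of sectors. -/
abbrev Arc (m : ℕ) : Type := Slot m × ℕ

/-- A letter of a boundary word: the slot of a sector, and whether the half-edge at the beginning of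
the sector is a leaf. -/
abbrev Mark (m : ℕ) : Type := Slot m × Bool

/-- Weights of tilings and of operations. -/
abbrev Weight (m : ℕ) : Type := WeightIndex m →₀ ℕ

namespace Slot

variable {m : ℕ}

theorem flip_flip (s : Slot m) : s.flip.flip = s := by cases s <;> rfl

theorem flip_ne (s : Slot m) : s.flip ≠ s := by cases s <;> simp [flip]

theorem label_flip (s : Slot m) : s.flip.label = s.label := by cases s <;> rfl

theorem eq_or_eq_flip_of_label_eq {s s' : Slot m} (h : s.label = s'.label) :
    s = s' ∨ s = s'.flip := by
  cases s <;> cases s' <;> simp_all [label, flip]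

/-- Slots are vertices of the quiver together with a direction. -/
def equivSum (m : ℕ) : Slot m ≃ Vertex m ⊕ Vertex m where
  toFun s := match s with
    | out k => .inl k
    | inc k => .inr k
  invFun x := match x with
    | .inl k => out k
    | .inr k => inc k
  left_inv s := by cases s <;> rfl
  right_inv x := by cases x <;> rfl

instance : DecidableEq (Slot m) := (equivSum m).decidableEq

instance : Fintype (Slot m) := Fintype.ofEquiv _ (equivSum m).symm

theorem card_eq (m : ℕ) : Fintype.card (Slot m) = 2 * (m - 1) := by
  rw [Fintype.card_congr (equivSum m), Fintype.card_sum]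
  simp
  omega

variable [hm : Fact (3 ≤ m)]

/-- The sector that follows the sector `s` in a region: the edge on the far side of the sector is
crossed. -/
def across (s : Slot m) : Slot m := s.next.flip

theorem next_eq (s : Slot m) : s.next = s.across.flip := by rw [across, flip_flip]

/-- A region without leaves has one or two sectors. -/
theorem across_across (s : Slot m) : s.across.across = s := by
  have h3 := hm.out
  rcases s with ⟨k, hk⟩ | ⟨k, hk⟩ <;> have hk' := mem_Ico.1 hk <;>
    unfold across next <;> dsimp only <;> split_ifs with h1 <;> dsimp only [flip] <;>
    split_ifs <;> first | rfl | (exfalso; omega) | (dsimp only [flip]; congr 2; omega)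

theorem next_ne (s : Slot m) : s.next ≠ s := by
  have h3 := hm.out
  rcases s with ⟨k, hk⟩ | ⟨k, hk⟩ <;> have hk' := mem_Ico.1 hk <;>
    unfold next <;> dsimp only <;> split_ifs with h1 <;> simp <;> omega

theorem next_next_ne (s : Slot m) : s.next.next ≠ s := by
  have h3 := hm.out
  rcases s with ⟨k, hk⟩ | ⟨k, hk⟩ <;> have hk' := mem_Ico.1 hk <;>
    unfold next <;> dsimp only <;> split_ifs with h1 <;> dsimp only <;>
    split_ifs <;> simp <;> omega

/-- The number of sectors of a region without leaves that contains the sector `s`. -/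
def period (s : Slot m) : ℕ := if s.across = s then 1 else 2

theorem period_cases (s : Slot m) :
    (s.period = 1 ∧ s.across = s) ∨ (s.period = 2 ∧ s.across ≠ s) := by
  unfold period; split_ifs with h <;> simp [h]

theorem period_pos (s : Slot m) : 0 < s.period := by rcases period_cases s with h | h <;> omega

theorem period_across (s : Slot m) : s.across.period = s.period := by
  unfold period
  rw [across_across]
  congr 1
  exact propext eq_comm

theorem across_iterate_period (s : Slot m) : across^[s.period] s = s := by
  rcases period_cases s with ⟨h, h'⟩ | ⟨h, -⟩ <;> rw [h]
  · exact h'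
  · exact across_across s

theorem across_iterate_cases (s : Slot m) (n : ℕ) : across^[n] s = s ∨ across^[n] s = s.across := by
  induction n with
  | zero => simp
  | succ n ih =>
    rw [iterate_succ_apply']
    rcases ih with h | h <;> rw [h]
    · exact .inr rfl
    · exact .inl (across_across s)

theorem across_iterate_self (s : Slot m) (n : ℕ) : across^[n] (across^[n] s) = s := by
  induction n generalizing s with
  | zero => rfl
  | succ n ih => rw [iterate_succ_apply' across n s, iterate_succ_apply, across_across, ih]

theorem across_iterate_inj {s t : Slot m} {n : ℕ} : across^[n] s = across^[n] t ↔ s = t :=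
  ⟨fun h => by rw [← across_iterate_self s n, h, across_iterate_self], fun h => by rw [h]⟩

/-- The type of an inner region with the sector `s`. -/
def typeIdx : Slot m → WeightIndex m
  | out k => ⟨k, mem_Icc.2 (by have := mem_Ico.1 k.2; omega)⟩
  | inc k => ⟨k + 1, mem_Icc.2 (by have := mem_Ico.1 k.2; omega)⟩

/-- A slot of each type: the sector `U_1`, or `R_i`, or `U_m`. -/
def rep (i : WeightIndex m) : Slot m := if h : (i : ℕ) = 1 then out (Vertex.first m)
  else inc ⟨i - 1, mem_Ico.2 (by have := mem_Icc.1 i.2; omega)⟩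

theorem typeIdx_rep (i : WeightIndex m) : (rep i).typeIdx = i := by
  have h3 := hm.out
  obtain ⟨i, hi⟩ := i
  have hi' := mem_Icc.1 hi
  unfold rep
  dsimp only
  split_ifs with h
  · simp [typeIdx, Vertex.first, h]
  · simp only [typeIdx, Subtype.mk.injEq]; omega

theorem typeIdx_across (s : Slot m) : s.across.typeIdx = s.typeIdx := by
  have h3 := hm.out
  rcases s with ⟨k, hk⟩ | ⟨k, hk⟩ <;> have hk' := mem_Ico.1 hk <;>
    unfold across next <;> dsimp only <;> split_ifs with h1 <;>
    simp only [flip, typeIdx, Subtype.mk.injEq] <;> omega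

theorem typeIdx_eq_iff (s : Slot m) (i : WeightIndex m) :
    s.typeIdx = i ↔ s = rep i ∨ s = (rep i).across := by
  constructor
  · rintro rfl
    have h3 := hm.out
    rcases s with ⟨k, hk⟩ | ⟨k, hk⟩
    · have hk' := mem_Ico.1 hk
      by_cases h : k = 1
      · subst h
        left
        simp [rep, typeIdx, Vertex.first]
      · right
        have e : rep (typeIdx (out ⟨k, hk⟩)) = inc ⟨k - 1, mem_Ico.2 (by omega)⟩ := by
          simp [rep, typeIdx, h]
        rw [e]
        unfold across next
        dsimp only
        rw [dif_neg (by omega)]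
        dsimp only [flip]
        congr 2; omega
    · have hk' := mem_Ico.1 hk
      left
      have : k ≠ 0 := by omega
      simp [rep, typeIdx, this]
  · rintro (h | h)
    · rw [h, typeIdx_rep]
    · rw [h, typeIdx_across, typeIdx_rep]

theorem rep_typeIdx_cases (s : Slot m) : s = rep s.typeIdx ∨ s.across = rep s.typeIdx := by
  rcases (typeIdx_eq_iff s _).1 rfl with h | h
  · exact .inl h
  · right
    conv_lhs => rw [h]
    exact across_across _

/-- The slot of the sector with a given letter. -/
def ofArrow : Arrow m → Slot m
  | .L i h => out ⟨i, mem_Ico.2 (by omega)⟩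
  | .R i h => inc ⟨i - 1, mem_Ico.2 (by omega)⟩
  | .U₁ => out (Vertex.first m)
  | .Uₘ => inc (Vertex.last m)

theorem sector_ofArrow (a : Arrow m) : (ofArrow a).sector = a := by
  have h3 := hm.out
  rcases a with ⟨i, h⟩ | ⟨i, h⟩ | _ | _
  · have : i ≠ 1 := by omega
    simp [ofArrow, sector, this]
  · have : i - 1 ≠ m - 1 := by omega
    simp only [ofArrow, sector, this, dite_false]
    congr 1; omega
  · simp [ofArrow, sector, Vertex.first]
  · simp [ofArrow, sector, Vertex.last]

theorem ofArrow_sector (s : Slot m) : ofArrow s.sector = s := by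
  have h3 := hm.out
  rcases s with ⟨k, hk⟩ | ⟨k, hk⟩ <;> unfold sector <;> dsimp only <;> split_ifs with h
  · subst h; rfl
  · rfl
  · subst h; rfl
  · simp [ofArrow]

theorem sector_injective : Injective (sector (m := m)) :=
  Function.LeftInverse.injective ofArrow_sector

theorem src_sector (s : Slot m) : s.sector.src = s.label := by
  have h3 := hm.out
  rcases s with ⟨k, hk⟩ | ⟨k, hk⟩ <;> unfold sector <;> dsimp only <;> split_ifs with h
  · subst h; rfl
  · rfl
  · subst h; rfl
  · simp [Arrow.src, label]

theorem tgt_sector (s : Slot m) : s.sector.tgt = s.across.label := by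
  have h3 := hm.out
  rcases s with ⟨k, hk⟩ | ⟨k, hk⟩ <;> unfold sector across next <;> dsimp only <;>
    split_ifs with h
  · subst h; rfl
  · rfl
  · subst h; rfl
  · simp [Arrow.tgt, label, flip]

/-- Two sectors can follow each other in a region exactly if the product of their letters is
not set to zero: the relations forbid the other sector with the right starting point. -/
theorem follows_sector_iff (s t : Slot m) : Arrow.Follows s.sector t.sector ↔ t = s.across := by
  have h3 := hm.out
  unfold Arrow.Follows
  rw [tgt_sector, src_sector]
  constructor
  · rintro ⟨h, hr⟩
    rcases eq_or_eq_flip_of_label_eq h with h | h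
    · exact h.symm
    · exfalso
      apply hr
      have ht : t = s.next := by rw [next_eq, h, flip_flip]
      rw [ht]
      clear h ht hr
      rcases s with ⟨k, hk⟩ | ⟨k, hk⟩ <;> have hk' := mem_Ico.1 hk
      · by_cases h1 : k = 1
        · subst h1
          have e1 : (out ⟨1, hk⟩ : Slot m).sector = .U₁ := by simp [sector]
          have e2 : (out ⟨1, hk⟩ : Slot m).next.sector = .R 2 ⟨le_refl _, by omega⟩ := by
            have : 1 ≠ m - 1 := by omega
            simp [next, sector, this]
          rw [e1, e2]; exact Arrow.Relation.UR _
        · have e1 : (out ⟨k, hk⟩ : Slot m).sector = .L k (by omega) := by simp [sector, h1]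
          rw [e1]
          by_cases h2 : k = 2
          · subst h2
            have e2 : (out ⟨2, hk⟩ : Slot m).next.sector = .U₁ := by simp [next, sector]
            rw [e2]; exact Arrow.Relation.LU _
          · have e2 : (out ⟨k, hk⟩ : Slot m).next.sector = .L (k - 1) (by omega) := by
              have : k - 1 ≠ 1 := by omega
              simp [next, sector, h1, this]
            rw [e2]; exact Arrow.Relation.LL _ _ _
      · by_cases h1 : k = m - 1
        · subst h1
          have e1 : (inc ⟨m - 1, hk⟩ : Slot m).sector = .Uₘ := by simp [sector]
          have e2 : (inc ⟨m - 1, hk⟩ : Slot m).next.sector = .L (m - 1) (by omega) := by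
            have : m - 1 ≠ 1 := by omega
            simp [next, sector, this]
          rw [e1, e2]; exact Arrow.Relation.UL _
        · have e1 : (inc ⟨k, hk⟩ : Slot m).sector = .R (k + 1) (by omega) := by simp [sector, h1]
          rw [e1]
          by_cases h2 : k + 1 = m - 1
          · have e2 : (inc ⟨k, hk⟩ : Slot m).next.sector = .Uₘ := by simp [next, sector, h1, h2]
            rw [e2]
            have := Arrow.Relation.RU (m := m) (by omega)
            convert this using 2
          · have e2 : (inc ⟨k, hk⟩ : Slot m).next.sector = .R (k + 1 + 1) (by omega) := by
              simp [next, sector, h1, h2]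
            rw [e2]; exact Arrow.Relation.RR (k + 1 + 1) (by omega) (by simp; omega)
  · rintro rfl
    refine ⟨rfl, ?_⟩
    intro hr
    have key : ∀ a b : Arrow m, Arrow.Relation a b → ofArrow b ≠ (ofArrow a).across := by
      intro a b hab
      cases hab with
      | LL i h h' => simp [ofArrow, across, next, flip, show i ≠ 1 by omega]
      | RR i h h' => simp [ofArrow, across, next, flip, show i - 1 - 1 ≠ m - 1 by omega]
      | LU h => simp [ofArrow, across, next, flip, Vertex.first]
      | UR h => simp [ofArrow, across, next, flip, Vertex.first]
      | RU h => simp [ofArrow, across, next, flip, Vertex.last, show m - 1 - 1 ≠ m - 1 by omega]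
      | UL h => simp [ofArrow, across, next, flip, Vertex.last]
    apply key _ _ hr
    rw [ofArrow_sector, ofArrow_sector]

/-- The word of `n` letters read along a region from the sector `s` on. -/
def letters : Slot m → ℕ → List (Arrow m)
  | _, 0 => []
  | s, n + 1 => s.sector :: letters s.across n

@[simp] theorem length_letters (s : Slot m) (n : ℕ) : (letters s n).length = n := by
  induction n generalizing s with
  | zero => rfl
  | succ n ih => simp [letters, ih]

theorem isChain_letters (s : Slot m) (n : ℕ) : (letters s n).IsChain Arrow.Follows := by
  induction n generalizing s with
  | zero => exact List.isChain_nil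
  | succ n ih =>
    cases n with
    | zero => exact List.isChain_singleton _
    | succ n =>
      have := ih s.across
      simp only [letters] at this ⊢
      rw [List.isChain_cons_cons]; exact ⟨(follows_sector_iff _ _).2 rfl, this⟩

theorem letters_add (s : Slot m) (a b : ℕ) :
    letters s (a + b) = letters s a ++ letters (across^[a] s) b := by
  induction a generalizing s with
  | zero => simp [letters]
  | succ a ih =>
    rw [Nat.succ_add_eq_add_succ, Nat.add_succ]
    simp [letters, ih]

theorem eq_letters_of_isChain (w : List (Arrow m)) (a : Arrow m)
    (h : (a :: w).IsChain Arrow.Follows) : a :: w = letters (ofArrow a) (w.length + 1) := by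
  induction w generalizing a with
  | nil => simp [letters, sector_ofArrow]
  | cons b w ih =>
    rw [List.isChain_cons_cons] at h
    have hb : ofArrow b = (ofArrow a).across := by
      rw [← follows_sector_iff, sector_ofArrow, sector_ofArrow]; exact h.1
    rw [ih b h.2, hb]
    simp [letters, sector_ofArrow]

end Slot

open Slot (across across_across across_iterate_period flip_ne label_flip letters_add period_across
  period_cases rep typeIdx_rep)

open BorderedAlgebra

variable {m : ℕ} [hm : Fact (3 ≤ m)]

namespace QPath

/-- The path of length `n` that starts with the letter of the sector `s`. -/
def arc (s : Slot m) (n : ℕ) : QPath m where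
  start := s.label
  word := s.letters n
  chain := s.isChain_letters n
  src_head := by
    intro a ha
    cases n with
    | zero => simp [Slot.letters] at ha
    | succ n =>
      simp only [Slot.letters, List.head?_cons, Option.mem_def, Option.some.injEq] at ha
      rw [← ha, Slot.src_sector]

@[simp] theorem length_arc (s : Slot m) (n : ℕ) : (arc s n).length = n := Slot.length_letters s n

theorem isPure_arc {s : Slot m} {n : ℕ} (h : 0 < n) : (arc s n).IsPure := by
  unfold IsPure
  rw [← length_pos_iff_ne_nil]
  change 0 < (Slot.letters s n).length
  rw [Slot.length_letters]
  exact h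

/-- The slot of the first letter of a path. -/
def slot (p : QPath m) : Slot m := (p.word.head?.map Slot.ofArrow).getD (.out p.start)

theorem eq_arc (p : QPath m) (h : p.IsPure) : p = arc p.slot p.length := by
  obtain ⟨st, w, hc, hs⟩ := p
  cases w with
  | nil => exact absurd rfl h
  | cons a w =>
    ext1
    · have : a.src = st := hs a (by simp)
      simp only [arc, slot, List.head?_cons, Option.map_some, Option.getD_some]
      rw [← Slot.src_sector, Slot.sector_ofArrow]; exact this.symm
    · simp only [arc, slot, List.head?_cons, Option.map_some, Option.getD_some, length, length_cons]
      exact Slot.eq_letters_of_isChain w a hc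

theorem length_pos {p : QPath m} (h : p.IsPure) : 0 < p.length := length_pos_iff_ne_nil.2 h

theorem not_isPure_iff (p : QPath m) : ¬ p.IsPure ↔ ∃ x, p = const x := by
  constructor
  · intro h
    refine ⟨p.start, ?_⟩
    ext1
    · rfl
    · simpa [IsPure, const] using h
  · rintro ⟨x, rfl⟩
    simp [IsPure, const]

theorem slot_arc (s : Slot m) {n : ℕ} (h : 0 < n) : (arc s n).slot = s := by
  obtain ⟨n, rfl⟩ := Nat.exists_eq_succ_of_ne_zero h.ne'
  simp [slot, arc, Slot.letters, Slot.ofArrow_sector]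

theorem arc_inj {s t : Slot m} {a b : ℕ} (ha : 0 < a) : arc s a = arc t b ↔ s = t ∧ a = b := by
  constructor
  · intro h
    have hl : a = b := by rw [← length_arc s a, h, length_arc]
    subst hl; exact ⟨by rw [← slot_arc s ha, h, slot_arc t ha], rfl⟩
  · rintro ⟨rfl, rfl⟩; rfl

theorem finish_arc (s : Slot m) (n : ℕ) : (arc s n).finish = (across^[n] s).label := by
  cases n with
  | zero => simp [finish, arc, Slot.letters]
  | succ n =>
    have : (arc s (n + 1)).word = Slot.letters s n ++ [(across^[n] s).sector] := by
      change Slot.letters s (n + 1) = _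
      rw [letters_add]; rfl
    simp only [finish, this, List.getLast?_append, List.getLast?_singleton, Option.some_or,
      Option.map_some, Option.getD_some, Slot.tgt_sector, iterate_succ_apply']

@[simp] theorem start_arc (s : Slot m) (n : ℕ) : (arc s n).start = s.label := rfl

theorem take_arc (s : Slot m) {n k : ℕ} (h : k ≤ n) : (arc s n).take k = arc s k := by
  obtain ⟨j, rfl⟩ := Nat.exists_eq_add_of_le h
  ext1
  · rfl
  · change (Slot.letters s (k + j)).take k = Slot.letters s k
    rw [letters_add, List.take_left' (by simp)]

theorem drop_arc (s : Slot m) {n k : ℕ} (h : k ≤ n) :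
    (arc s n).drop k = arc (across^[k] s) (n - k) := by
  have ht := take_arc s h
  obtain ⟨j, rfl⟩ := Nat.exists_eq_add_of_le h
  ext1
  · change ((arc s (k + j)).take k).finish = (across^[k] s).label
    rw [ht, finish_arc]
  · change (Slot.letters s (k + j)).drop k = Slot.letters _ (k + j - k)
    rw [letters_add, List.drop_left' (by simp), Nat.add_sub_cancel_left]

open Classical in
theorem comp_arc (s t : Slot m) {a b : ℕ} (ha : 0 < a) (hb : 0 < b) :
    (arc s a).comp (arc t b) = if t = across^[a] s then some (arc s (a + b)) else none := by
  split_ifs with h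
  · subst h
    rw [comp_eq_some_iff]
    refine ⟨finish_arc s a, rfl, ?_⟩
    exact letters_add s a b
  · rw [← Option.not_isSome_iff_eq_none, Option.isSome_iff_exists]
    rintro ⟨r, hr⟩
    apply h
    rw [comp_eq_some_iff] at hr
    obtain ⟨-, hst, hw⟩ := hr
    have hp : r.IsPure := by
      unfold IsPure
      rw [hw]
      intro h0; exact isPure_arc (s := s) ha (List.append_eq_nil_iff.1 h0).1
    have hlen : r.length = a + b := by
      unfold length
      rw [hw, length_append]
      change (Slot.letters _ _).length + (Slot.letters _ _).length = _; simp
    have hr := eq_arc r hp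
    have e : Slot.letters r.slot (a + b) = Slot.letters s a ++ Slot.letters t b := by
      have := congrArg QPath.word hr
      rw [hlen, hw] at this; exact this.symm
    rw [letters_add] at e
    obtain ⟨e1, e2⟩ := List.append_inj e (by simp)
    have h1 : r.slot = s := by
      have := (arc_inj (s := r.slot) (t := s) (b := a) ha).1
        (by
          obtain ⟨a, rfl⟩ := Nat.exists_eq_succ_of_ne_zero ha.ne'
          simp only [Slot.letters, List.cons.injEq] at e1
          rw [Slot.sector_injective e1.1])
      exact this.1
    obtain ⟨b, rfl⟩ := Nat.exists_eq_succ_of_ne_zero hb.ne'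
    simp only [Slot.letters, List.cons.injEq] at e2
    rw [← h1]; exact (Slot.sector_injective e2.1).symm

end QPath

/-! ### Euler's inequality for a pair of permutations -/

namespace Euler

open Module

variable {H : Type*} [Fintype H]

/-- The functions that are constant on the cycles of `π`. -/
def inv (π : Perm H) : Submodule ℚ (H → ℚ) where
  carrier := {f | ∀ x, f (π x) = f x}
  add_mem' := fun ha hb x => by simp [ha x, hb x]
  zero_mem' := fun _ => rfl
  smul_mem' := fun c f hf x => by simp [hf x]

theorem card_le_finrank_inv {ι : Type*} [Fintype ι] (π : Perm H) (c : H → ι)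
    (hc : ∀ x, c (π x) = c x) (hs : Function.Surjective c) :
    Fintype.card ι ≤ finrank ℚ (inv π) := by
  have hmem : ∀ g : ι → ℚ, g ∘ c ∈ inv π := fun g x => by simp [hc x]
  let T : (ι → ℚ) →ₗ[ℚ] inv π :=
    { toFun := fun g => ⟨g ∘ c, hmem g⟩
      map_add' := fun _ _ => rfl
      map_smul' := fun _ _ => rfl }
  have hT : Injective T := by
    intro g g' h
    have h' : g ∘ c = g' ∘ c := congrArg Subtype.val h
    exact hs.injective_comp_right h'
  have := LinearMap.finrank_le_finrank_of_injective hT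
  rwa [Module.finrank_fintype_fun_eq_card] at this

/-- An involution has at least half as many cycles as there are points, and fixed points. -/
theorem card_add_le_two_mul_finrank_inv [DecidableEq H] (α : Perm H) (hα : ∀ x, α (α x) = x) :
    Fintype.card H + (univ.filter fun x => α x = x).card ≤ 2 * finrank ℚ (inv α) := by
  classical
  let r : Setoid H :=
    { r := fun x y => y = x ∨ y = α x
      iseqv :=
        { refl := fun x => .inl rfl
          symm := by
            rintro x y (h | h)
            · exact .inl h.symm
            · right; rw [h, hα]
          trans := by
            rintro x y z (rfl | rfl) (rfl | rfl)
            · exact .inl rfl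
            · exact .inr rfl
            · exact .inr rfl
            · exact .inl (hα x) } }
  have h1 : Fintype.card (Quotient r) ≤ finrank ℚ (inv α) := by
    refine card_le_finrank_inv α (Quotient.mk r) (fun x => ?_) Quotient.mk_surjective
    exact Quotient.sound (.inr (hα x).symm)
  have h2 : Fintype.card H + (univ.filter fun x => α x = x).card ≤
      2 * Fintype.card (Quotient r) := by
    rw [← Finset.card_univ, Finset.card_eq_sum_card_fiberwise
      (f := Quotient.mk r) (t := univ) (fun _ _ => Finset.mem_coe.2 (mem_univ _)),
      Finset.card_eq_sum_card_fiberwise (s := univ.filter fun x => α x = x)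
      (f := Quotient.mk r) (t := univ) (fun _ _ => Finset.mem_coe.2 (mem_univ _)),
      ← sum_add_distrib]
    calc _ ≤ ∑ _q : Quotient r, 2 := ?_
      _ = _ := by rw [Finset.sum_const, Finset.card_univ, smul_eq_mul, mul_comm]
    refine Finset.sum_le_sum fun q _ => ?_
    induction q using Quotient.inductionOn with
    | h x =>
      have hq : ∀ y : H, Quotient.mk r y = Quotient.mk r x ↔ y = x ∨ y = α x := by
        intro y
        rw [eq_comm, Quotient.eq]; rfl
      by_cases hx : α x = x
      · have e1 : (univ.filter fun y => Quotient.mk r y = Quotient.mk r x) = {x} := by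
          ext y; simp [hq, hx]
        have e2 : ((univ.filter fun y => α y = y).filter
            fun y => Quotient.mk r y = Quotient.mk r x).card ≤ 1 := by
          rw [← Finset.card_singleton x, ← e1]
          apply card_le_card
          intro y hy
          simp only [mem_filter, mem_univ, true_and] at hy ⊢; exact hy.2
        rw [e1, Finset.card_singleton]; omega
      · have e1 : (univ.filter fun y => Quotient.mk r y = Quotient.mk r x).card ≤ 2 := by
          refine (card_le_card (t := {x, α x}) ?_).trans Finset.card_le_two
          intro y hy
          simp only [mem_filter, mem_univ, true_and] at hy; simpa [hq] using hy
        have e2 : ((univ.filter fun y => α y = y).filter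
            fun y => Quotient.mk r y = Quotient.mk r x) = ∅ := by
          ext y
          simp only [mem_filter, mem_univ, true_and, hq, Finset.notMem_empty,
            iff_false, not_and, not_or]
          intro hy
          refine ⟨fun h => hx (h ▸ hy), fun h => hx ?_⟩
          rw [h, hα] at hy; exact hy.symm
        rw [e2, Finset.card_empty]; omega
  omega

variable (σ α : Perm H)

/-- The coboundary of a function on half-edges. -/
def coboundary : (H → ℚ) →ₗ[ℚ] (H → ℚ) where
  toFun f := fun x => f x - f (α x)
  map_add' f g := by ext x; simp; ring
  map_smul' c f := by ext x; simp; ring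

/-- The functions on half-edges that satisfy `f x = g x - g (α x)` for a function `g` on the
vertices. -/
def cobs : Submodule ℚ (H → ℚ) := (inv σ).map (coboundary α)

/-- The functions that are sums of a function on edges and a function on faces. -/
def cycs : Submodule ℚ (H → ℚ) := inv α ⊔ inv (σ.trans α)

/-- Transitivity of the group generated by `σ` and `α`. -/
def Transitive : Prop := ∀ f : H → ℚ, f ∈ inv σ → f ∈ inv α → ∀ x y, f x = f y

variable {σ α}

theorem finrank_le_one_of_const (P : Submodule ℚ (H → ℚ)) (h : ∀ f ∈ P, ∀ x y, f x = f y) :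
    finrank ℚ P ≤ 1 := by
  rcases isEmpty_or_nonempty H with hH | ⟨⟨x⟩⟩
  · have : finrank ℚ P ≤ finrank ℚ (H → ℚ) := Submodule.finrank_le P
    rw [Module.finrank_fintype_fun_eq_card, Fintype.card_eq_zero] at this; omega
  · let T : P →ₗ[ℚ] ℚ :=
      { toFun := fun f => f.1 x
        map_add' := fun _ _ => rfl
        map_smul' := fun _ _ => rfl }
    have hT : Injective T := by
      rintro ⟨f, hf⟩ ⟨g, hg⟩ hfg
      ext y
      change f y = g y
      rw [h f hf y x, h g hg y x]; exact hfg
    have := LinearMap.finrank_le_finrank_of_injective hT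
    rwa [Module.finrank_self] at this

theorem sum_mul_eq_zero (hα : ∀ x, α (α x) = x) {u w : H → ℚ} (hu : u ∈ cobs σ α)
    (hw : w ∈ cycs σ α) : ∑ x, u x * w x = 0 := by
  obtain ⟨f, hf, rfl⟩ := hu
  obtain ⟨a, ha, b, hb, rfl⟩ := Submodule.mem_sup.1 hw
  have e1 : ∑ x, f (α x) * a x = ∑ x, f x * a x := by
    rw [← Equiv.sum_comp α (fun x => f x * a x)]
    exact sum_congr rfl fun x _ => by rw [ha x]
  have e2 : ∑ x, f (α x) * b x = ∑ x, f x * b x := by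
    rw [← Equiv.sum_comp α (fun x => f (α x) * b x), ← Equiv.sum_comp σ]
    refine sum_congr rfl fun x _ => ?_
    rw [hα, hf x]
    congr 1; exact hb x
  change ∑ x, (f x - f (α x)) * (a x + b x) = 0
  simp only [sub_mul, mul_add, Finset.sum_sub_distrib, sum_add_distrib, e1, e2, sub_self, add_zero]

theorem disjoint_cobs_cycs (hα : ∀ x, α (α x) = x) : Disjoint (cobs σ α) (cycs σ α) := by
  rw [Submodule.disjoint_def]
  intro f h1 h2
  have := sum_mul_eq_zero hα h1 h2
  ext x
  rw [Finset.sum_eq_zero_iff_of_nonneg (fun x _ => mul_self_nonneg _)] at this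
  exact mul_self_eq_zero.1 (this x (mem_univ x))

theorem finrank_inv_le_cobs (ht : Transitive σ α) :
    finrank ℚ (inv σ) ≤ finrank ℚ (cobs σ α) + 1 := by
  have h := LinearMap.finrank_range_add_finrank_ker ((coboundary α).domRestrict (inv σ))
  have hr : LinearMap.range ((coboundary α).domRestrict (inv σ)) = cobs σ α := by
    rw [LinearMap.range_domRestrict]; rfl
  rw [hr] at h
  have hk : finrank ℚ (LinearMap.ker ((coboundary α).domRestrict (inv σ))) ≤ 1 := by
    have hinj := LinearMap.finrank_le_finrank_of_injective (R := ℚ)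
      (f := ((inv σ).subtype.comp
        (LinearMap.ker ((coboundary α).domRestrict (inv σ))).subtype).rangeRestrict)
      (by
        intro x y hxy
        have h' := congrArg Subtype.val hxy
        exact Subtype.ext (Subtype.ext h'))
    refine hinj.trans (finrank_le_one_of_const _ ?_)
    rintro _ ⟨⟨⟨f, hf⟩, hk⟩, rfl⟩
    refine ht f hf fun x => ?_
    have : coboundary α f = 0 := by simpa using hk
    have := congrFun this x
    change f x - f (α x) = 0 at this; linarith
  omega

theorem finrank_add_le_cycs (ht : Transitive σ α) :
    finrank ℚ (inv α) + finrank ℚ (inv (σ.trans α)) ≤ finrank ℚ (cycs σ α) + 1 := by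
  have h := Submodule.finrank_sup_add_finrank_inf_eq (inv α) (inv (σ.trans α))
  have hk : finrank ℚ (inv α ⊓ inv (σ.trans α) : Submodule ℚ (H → ℚ)) ≤ 1 := by
    apply finrank_le_one_of_const
    rintro f ⟨h1, h2⟩
    refine ht f (fun x => ?_) h1
    rw [← h1 (σ x)]; exact h2 x
  unfold cycs
  omega

/-- Euler's inequality: the genus of a connected surface is not negative. -/
theorem euler_le (hα : ∀ x, α (α x) = x) (ht : Transitive σ α) :
    finrank ℚ (inv σ) + finrank ℚ (inv α) + finrank ℚ (inv (σ.trans α)) ≤ Fintype.card H + 2 := by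
  have h1 := finrank_inv_le_cobs ht
  have h2 := finrank_add_le_cycs ht
  have h3 := Submodule.finrank_sup_add_finrank_inf_eq (cobs σ α) (cycs σ α)
  rw [(disjoint_cobs_cycs hα).eq_bot, finrank_bot] at h3
  have h4 : finrank ℚ (cobs σ α ⊔ cycs σ α : Submodule ℚ (H → ℚ)) ≤ finrank ℚ (H → ℚ) :=
    Submodule.finrank_le _
  rw [Module.finrank_fintype_fun_eq_card] at h4
  omega

/-- On a sphere every cocycle is a coboundary. -/
theorem exists_potential (hα : ∀ x, α (α x) = x) (ht : Transitive σ α) (he : Fintype.card H + 2 ≤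
      finrank ℚ (inv σ) + finrank ℚ (inv α) + finrank ℚ (inv (σ.trans α)))
    (g : H → ℚ) (hg : ∀ w ∈ cycs σ α, ∑ x, g x * w x = 0) :
    ∃ f ∈ inv σ, ∀ x, g x = f x - f (α x) := by
  have h1 := finrank_inv_le_cobs ht
  have h2 := finrank_add_le_cycs ht
  have h3 := Submodule.finrank_sup_add_finrank_inf_eq (cobs σ α) (cycs σ α)
  rw [(disjoint_cobs_cycs hα).eq_bot, finrank_bot] at h3
  have h5 : cobs σ α ⊔ cycs σ α = ⊤ := by
    apply Submodule.eq_top_of_finrank_eq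
    apply le_antisymm (Submodule.finrank_le _)
    rw [Module.finrank_fintype_fun_eq_card]; omega
  obtain ⟨u, hu, w, hw, huw⟩ := Submodule.mem_sup.1 (h5 ▸ Submodule.mem_top : g ∈ _)
  have h6 : ∑ x, w x * w x = 0 := by
    have e1 := hg w hw
    have e2 := sum_mul_eq_zero hα hu hw
    rw [← huw] at e1
    simp only [Pi.add_apply, add_mul, sum_add_distrib, e2, zero_add] at e1; exact e1
  rw [Finset.sum_eq_zero_iff_of_nonneg (fun x _ => mul_self_nonneg _)] at h6
  obtain ⟨f, hf, rfl⟩ := hu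
  refine ⟨f, hf, fun x => ?_⟩
  have : w x = 0 := mul_self_eq_zero.1 (h6 x (mem_univ x))
  rw [← huw]
  simp [this, coboundary]

end Euler

/-! ### Tilings as involutions on half-edges -/

/-- The counterclockwise rotation around internal vertices, which are natural numbers here. -/
def spin : Perm (Corner m) := Equiv.prodCongr (Equiv.refl ℕ) Slot.rot

/-- For an involution `ε` of the half-edges whose fixed points are the leaves and which exchanges
the two halves of all other edges, this takes each sector to the next one of its region, where a
leaf is passed by without further notice. -/
def face (ε : Perm (Corner m)) : Perm (Corner m) := spin.trans ε

theorem face_apply (ε : Perm (Corner m)) (x : Corner m) : face ε x = ε (x.1, x.2.next) := rfl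

/-- The word read along a region from the sector `x` on: the slots of the sectors that are met,
and whether the half-edge at the beginning of the sector is a leaf. -/
def Marks (ε : Perm (Corner m)) : Corner m → List (Mark m) → Prop
  | _, [] => True
  | x, a :: ω => x.2 = a.1 ∧ (ε x = x ↔ a.2 = true) ∧ Marks ε (face ε x) ω

/-- The sector `x` lies in a region without leaves, which has as few sectors as possible. -/
def Inner (ε : Perm (Corner m)) (x : Corner m) : Prop := (face ε)^[x.2.period] x = x

/-- `x` is one of the first `n` sectors of the region that are met from `y` on. -/
def OnOrbit (ε : Perm (Corner m)) (y : Corner m) (n : ℕ) (x : Corner m) : Prop :=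
  ∃ i < n, (face ε)^[i] y = x

/-- Two vertices are joined by an edge. -/
def Joined (ε : Perm (Corner m)) (a b : ℕ) : Prop := ∃ s s', ε (a, s) = (b, s')

/-- `ε` is an involution that glues half-edges at the vertices in `S`. -/
structure IsGluing (S : Finset ℕ) (ε : Perm (Corner m)) : Prop where
  invol : ∀ x, ε (ε x) = x
  flip : ∀ x, ε x ≠ x → (ε x).2 = x.2.flip
  supp : ∀ x, ε x ≠ x → x.1 ∈ S

/-- At the vertices in `S`, the permutation `ε` describes a connected tiling.  One of its regions
has the word `ω`, read from the sector `y` on, and all others are inner regions. -/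
structure Traces (S : Finset ℕ) (ε : Perm (Corner m)) (y : Corner m)
    (ω : List (Mark m)) : Prop where
  base : y.1 ∈ S
  conn : ∀ v ∈ S, ReflTransGen (Joined ε) y.1 v
  period : (face ε)^[ω.length] y = y
  minimal : ∀ i, 0 < i → i < ω.length → (face ε)^[i] y ≠ y
  marks : Marks ε y ω
  inner : ∀ x : Corner m, x.1 ∈ S → OnOrbit ε y ω.length x ∨ Inner ε x

/-- `ε` describes a connected tiling with the vertices `S`, one of whose regions has the word `ω`,
read from the sector `y` on, while all others are inner regions. -/
structure Realizes (S : Finset ℕ) (ε : Perm (Corner m)) (y : Corner m)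
    (ω : List (Mark m)) : Prop extends IsGluing S ε, Traces S ε y ω

/-- The numerical conditions on a tiling with `d` vertices, weight `w` and boundary word `ω`: each
sector of a vertex lies in an inner region or on the boundary, and Euler's formula. -/
def Num (d : ℕ) (w : Weight m) (ω : List (Mark m)) : Prop :=
  (∀ i, w i + (ω.map Prod.fst).count (rep i) = d) ∧
    (2 * m - 4) * d + 2 = ω.countP (fun a => a.2) + 2 * ∑ i, w i

theorem Num.sum_sub {d : ℕ} {w : Weight m} {ω : List (Mark m)} (h : Num d w ω) :
    ∑ i, (d - (ω.map Prod.fst).count (rep i)) = ∑ i, w i :=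
  sum_congr rfl fun i _ => by have := h.1 i; omega

/-- The tilings with vertices `S`, weight `w` and boundary word `ω`. -/
def labeled (S : Finset ℕ) (w : Weight m) (ω : List (Mark m)) :
    Set (Perm (Corner m) × (Corner m)) :=
  {p | Num S.card w ω ∧ Realizes S p.1 p.2 ω}

section Basic

variable {ε : Perm (Corner m)} {S : Finset ℕ}

theorem marks_append (x : Corner m) (ω ω' : List (Mark m)) :
    Marks ε x (ω ++ ω') ↔ Marks ε x ω ∧ Marks ε ((face ε)^[ω.length] x) ω' := by
  induction ω generalizing x with
  | nil => simp [Marks]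
  | cons a ω ih => simp [Marks, ih, and_assoc]

theorem marks_iff (x : Corner m) (ω : List (Mark m)) :
    Marks ε x ω ↔ ∀ (i : ℕ) (h : i < ω.length), ((face ε)^[i] x).2 = ω[i].1 ∧
      (ε ((face ε)^[i] x) = (face ε)^[i] x ↔ ω[i].2 = true) := by
  induction ω generalizing x with
  | nil => simp [Marks]
  | cons a ω ih =>
    simp only [Marks, ih]
    constructor
    · rintro ⟨h1, h2, h3⟩ i hi
      cases i with
      | zero => exact ⟨h1, h2⟩
      | succ i => exact h3 i (by simpa using hi)
    · intro h
      refine ⟨(h 0 (by simp)).1, (h 0 (by simp)).2, fun i hi => ?_⟩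
      exact h (i + 1) (by simpa using hi)

namespace IsGluing

variable (hg : IsGluing S ε)
include hg

theorem face_of_leaf {x : Corner m} (h : ε (face ε x) = face ε x) : face ε x = (x.1, x.2.next) := by
  rw [face_apply] at h ⊢
  rw [hg.invol] at h
  exact h.symm

theorem face_slot {x : Corner m} (h : ε (face ε x) ≠ face ε x) : (face ε x).2 = x.2.across := by
  rw [face_apply] at h ⊢
  rw [hg.invol] at h
  exact hg.flip _ (Ne.symm h)

theorem face_slot_leaf {x : Corner m} (h : ε (face ε x) = face ε x) :
    (face ε x).2 = x.2.across.flip := by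
  rw [hg.face_of_leaf h, ← Slot.next_eq]

theorem supp' {x : Corner m} (h : ε x ≠ x) : (ε x).1 ∈ S := by
  apply hg.supp
  intro h'
  exact h (ε.injective h')

theorem face_mem {x : Corner m} (h : x.1 ∈ S) : (face ε x).1 ∈ S := by
  by_cases h' : ε (face ε x) = face ε x
  · rw [hg.face_of_leaf h']; exact h
  · exact hg.supp _ h'

theorem iterate_face_mem {x : Corner m} (h : x.1 ∈ S) (n : ℕ) : ((face ε)^[n] x).1 ∈ S := by
  induction n with
  | zero => exact h
  | succ n ih => rw [iterate_succ_apply']; exact hg.face_mem ih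

omit hg in
theorem joined_face (x : Corner m) : Joined ε x.1 (face ε x).1 := ⟨x.2.next, _, rfl⟩

theorem joined_symm {a b : ℕ} (h : Joined ε a b) : Joined ε b a := by
  obtain ⟨s, s', h⟩ := h
  exact ⟨s', s, by rw [← h, hg.invol]⟩

theorem joined_trans_symm {a b : ℕ} (h : ReflTransGen (Joined ε) a b) :
    ReflTransGen (Joined ε) b a := by
  have : Std.Symm (Joined ε) := ⟨fun _ _ h => hg.joined_symm h⟩
  exact symm_of (ReflTransGen (Joined ε)) h

omit hg in
theorem conn_iterate (x : Corner m) (n : ℕ) : ReflTransGen (Joined ε) x.1 ((face ε)^[n] x).1 := by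
  induction n with
  | zero => exact .refl
  | succ n ih => rw [iterate_succ_apply']; exact ih.tail (joined_face _)

theorem inner_aux {x : Corner m} (h : Inner ε x) : ε (face ε x) ≠ face ε x := by
  intro hl
  have h1 := hg.face_slot_leaf hl
  unfold Inner at h
  rcases period_cases x.2 with ⟨hp, hx⟩ | ⟨hp, hx⟩
  · rw [hp, iterate_one] at h
    rw [h, hx] at h1; exact flip_ne _ h1.symm
  · rw [hp] at h
    change face ε (face ε x) = x at h
    by_cases h2 : ε (face ε (face ε x)) = face ε (face ε x)
    · have h3 := hg.face_of_leaf h2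
      rw [h, hg.face_of_leaf hl] at h3
      exact Slot.next_next_ne x.2 (congrArg Prod.snd h3).symm
    · have h3 := hg.face_slot h2
      rw [h, h1] at h3
      have h4 : x.2.across = x.2.across.flip := by
        conv_lhs => rw [h3]
        rw [across_across]
      exact flip_ne _ h4.symm

theorem inner_slot {x : Corner m} (h : Inner ε x) : (face ε x).2 = x.2.across :=
  hg.face_slot (hg.inner_aux h)

theorem inner_face {x : Corner m} (h : Inner ε x) : Inner ε (face ε x) := by
  unfold Inner
  rw [hg.inner_slot h, period_across, ← iterate_succ_apply, iterate_succ_apply', h]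

theorem inner_not_leaf {x : Corner m} (h : Inner ε x) : ε x ≠ x := by
  have h' := h
  unfold Inner at h'
  rcases period_cases x.2 with ⟨hp, hx⟩ | ⟨hp, hx⟩
  · rw [hp, iterate_one] at h'
    have := hg.inner_aux h
    rwa [h'] at this
  · rw [hp] at h'
    change face ε (face ε x) = x at h'
    have := hg.inner_aux (hg.inner_face h)
    rwa [h'] at this

theorem inner_face_face {x : Corner m} (h : Inner ε x) : face ε (face ε x) = x := by
  unfold Inner at h
  rcases period_cases x.2 with ⟨hp, hx⟩ | ⟨hp, hx⟩ <;> rw [hp] at h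
  · change face ε x = x at h
    rw [h, h]
  · exact h

theorem inner_symm {x : Corner m} (h : Inner ε (face ε x)) : Inner ε x := by
  have := hg.inner_face h
  rwa [(face ε).injective (hg.inner_face_face h)] at this

end IsGluing

theorem onOrbit_face {y x : Corner m} {n : ℕ} (hn : (face ε)^[n] y = y)
    (h : OnOrbit ε y n x) : OnOrbit ε y n (face ε x) := by
  obtain ⟨i, hi, rfl⟩ := h
  rw [← iterate_succ_apply' (face ε)]
  rcases Nat.lt_or_ge (i + 1) n with h | h
  · exact ⟨i + 1, h, rfl⟩
  · have : i + 1 = n := by omega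
    rw [Nat.succ_eq_add_one, this, hn]; exact ⟨0, by omega, rfl⟩

theorem onOrbit_of_face {y x : Corner m} {n : ℕ} (hn : (face ε)^[n] y = y)
    (h : OnOrbit ε y n (face ε x)) : OnOrbit ε y n x := by
  obtain ⟨i, hi, h⟩ := h
  cases i with
  | zero =>
    refine ⟨n - 1, by omega, (face ε).injective ?_⟩
    rw [← iterate_succ_apply' (face ε), Nat.succ_eq_add_one, Nat.sub_add_cancel (by omega), hn]
    exact h
  | succ i =>
    rw [iterate_succ_apply'] at h; exact ⟨i, by omega, (face ε).injective h⟩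

theorem not_onOrbit_iterate {y x : Corner m} {n : ℕ} (hn : (face ε)^[n] y = y)
    (hx : ¬ OnOrbit ε y n x) (i : ℕ) : ¬ OnOrbit ε y n ((face ε)^[i] x) := by
  induction i with
  | zero => exact hx
  | succ i ih => rw [iterate_succ_apply']; exact fun h => ih (onOrbit_of_face hn h)

theorem onOrbit_iterate {y x : Corner m} {n : ℕ} (hn : (face ε)^[n] y = y)
    (h : OnOrbit ε y n x) (k : ℕ) : OnOrbit ε y n ((face ε)^[k] x) := by
  induction k with
  | zero => exact h
  | succ k ih => rw [iterate_succ_apply']; exact onOrbit_face hn ih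

theorem iterate_injOn {y : Corner m} {n : ℕ}
    (hm : ∀ i, 0 < i → i < n → (face ε)^[i] y ≠ y) {i j : ℕ} (hi : i < n) (hj : j < n)
    (h : (face ε)^[i] y = (face ε)^[j] y) : i = j := by
  wlog hij : i ≤ j generalizing i j
  · exact (this hj hi h.symm (by omega)).symm
  by_contra hne
  obtain ⟨k, rfl⟩ := Nat.exists_eq_add_of_le hij
  rw [iterate_add_apply] at h
  exact hm k (by omega) (by omega) (((face ε).injective.iterate i h).symm)

end Basic

theorem card_filter_getElem? {α : Type*} (l : List α) (P : α → Bool) :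
    ((range l.length).filter fun i => l[i]?.any P = true).card = l.countP P := by
  induction l using List.reverseRecOn with
  | nil => simp
  | append_singleton l a ih =>
    rw [length_append, List.length_singleton, Finset.range_add_one, Finset.filter_insert,
      countP_append, ← ih, List.countP_singleton]
    have e : ((range l.length).filter fun i => (l ++ [a])[i]?.any P = true) =
        (range l.length).filter fun i => l[i]?.any P = true := by
      refine Finset.filter_congr fun i hi => ?_
      rw [List.getElem?_append_left (mem_range.1 hi)]
    rw [e]
    by_cases h : P a = true
    · simp [h]
    · simp [h]

namespace Realizes

variable {ε : Perm (Corner m)} {S : Finset ℕ} {y : Corner m}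
  {ω : List (Mark m)}

theorem rotate {a : Mark m} (h : Realizes S ε y (a :: ω)) :
    Realizes S ε (face ε y) (ω ++ [a]) where
  toIsGluing := h.toIsGluing
  base := h.face_mem h.base
  conn := fun v hv =>
    (ReflTransGen.single (h.joined_symm (IsGluing.joined_face y))).trans (h.conn v hv)
  period := by
    have := h.period
    simp only [length_append, length_cons, List.length_nil] at this ⊢
    rw [← iterate_succ_apply, iterate_succ_apply', this]
  minimal := fun i h0 hi h' => by
    rw [← iterate_succ_apply, iterate_succ_apply'] at h'
    exact h.minimal i h0 (by simpa using hi) ((face ε).injective h')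
  marks := by
    have h1 := h.marks
    have h2 := h.period
    rw [marks_append]
    rw [length_cons, iterate_succ_apply] at h2
    exact ⟨h1.2.2, by rw [h2]; exact ⟨h1.1, h1.2.1, trivial⟩⟩
  inner := fun x hx => by
    refine (h.inner x hx).imp_left fun h' => ?_
    have h2 := h.period
    obtain ⟨i, hi, h'⟩ := h'
    cases i with
    | zero =>
      refine ⟨ω.length, by simp, ?_⟩
      rw [length_cons, iterate_succ_apply] at h2
      rw [h2]; exact h'
    | succ i => exact ⟨i, by simp at hi ⊢; omega, h'⟩

theorem card_orbit (h : Realizes S ε y ω) (P : Mark m → Bool) (Q : Corner m → Prop)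
    [DecidablePred Q]
    (hPQ : ∀ (i : ℕ) (hi : i < ω.length), Q ((face ε)^[i] y) ↔ P ω[i] = true) :
    (((range ω.length).image fun i => (face ε)^[i] y).filter Q).card = ω.countP P := by
  rw [Finset.filter_image, Finset.card_image_of_injOn, ← card_filter_getElem?]
  · congr 1
    ext i
    simp only [mem_filter, mem_range, and_congr_right_iff]
    intro hi
    rw [hPQ i hi, List.getElem?_eq_getElem hi]; rfl
  · intro i hi j hj hij
    simp only [Finset.coe_filter, mem_range] at hi hj
    exact iterate_injOn h.minimal hi.1 hj.1 hij

open Classical in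
/-- The slots of the boundary word account for those vertices whose sector of that slot lies on
the boundary. -/
theorem count_add (h : Realizes S ε y ω) (t : Slot m) :
    (ω.map Prod.fst).count t + (S.filter fun v => ¬ OnOrbit ε y ω.length (v, t)).card
      = S.card := by
  rw [← Finset.card_filter_add_card_filter_not (s := S) fun v => OnOrbit ε y ω.length (v, t)]
  congr 1
  rw [List.count_eq_countP, List.countP_map, ← h.card_orbit _ (fun x => x.2 = t)]
  · symm
    refine Finset.card_bij (fun v _ => (v, t)) ?_ ?_ ?_
    · intro v hv
      obtain ⟨i, hi, hv⟩ := (mem_filter.1 hv).2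
      exact mem_filter.2 ⟨mem_image.2 ⟨i, mem_range.2 hi, hv⟩, rfl⟩
    · intro v _ v' _ hv; exact congrArg Prod.fst hv
    · rintro ⟨v, t'⟩ hv
      obtain ⟨hv1, ht⟩ := mem_filter.1 hv
      obtain rfl : t' = t := ht
      obtain ⟨i, hi, hvi⟩ := mem_image.1 hv1
      refine ⟨v, mem_filter.2 ⟨?_, i, mem_range.1 hi, hvi⟩, rfl⟩
      have := h.iterate_face_mem h.base i
      rwa [hvi] at this
  · intro i hi
    rw [((marks_iff _ _).1 h.marks i hi).1]; simp

theorem count_le (h : Realizes S ε y ω) (t : Slot m) : (ω.map Prod.fst).count t ≤ S.card :=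
  (Nat.le_add_right _ _).trans (h.count_add t).le

theorem leaf_iff (h : Realizes S ε y ω) {i : ℕ} (hi : i < ω.length) :
    ε ((face ε)^[i] y) = (face ε)^[i] y ↔ ω[i].2 = true :=
  ((marks_iff _ _).1 h.marks i hi).2

/-- All leaves are met along the boundary word. -/
theorem onOrbit_of_leaf (h : Realizes S ε y ω) {x : Corner m} (hx : x.1 ∈ S) (hl : ε x = x) :
    OnOrbit ε y ω.length x :=
  (h.inner x hx).resolve_right fun hi => h.inner_not_leaf hi hl

open Classical in
theorem card_leaves (h : Realizes S ε y ω) :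
    ((S ×ˢ (univ : Finset (Slot m))).filter fun x => ε x = x).card
      = ω.countP fun a => a.2 := by
  rw [← h.card_orbit (fun a => a.2) (fun x => ε x = x) (fun i hi => h.leaf_iff hi)]
  congr 1
  ext x
  simp only [mem_filter, mem_product, mem_univ, and_true, mem_image, mem_range]
  refine and_congr_left fun hl => ⟨fun hx => h.onOrbit_of_leaf hx hl, ?_⟩
  rintro ⟨i, -, rfl⟩
  exact h.iterate_face_mem h.base i

end Realizes

theorem finite_labeled (S : Finset ℕ) (w : Weight m) (ω : List (Mark m)) :
    (labeled S w ω).Finite := by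
  classical
  let K : Finset (Corner m) := S ×ˢ univ
  have hK : ∀ x : Corner m, x ∈ K ↔ x.1 ∈ S := fun x => by simp [K]
  refine Set.Finite.of_injOn
    (f := fun p : Perm (Corner m) × (Corner m) => (K.image fun x => (x, p.1 x), p.2))
    (t := ↑((K ×ˢ K).powerset ×ˢ K)) ?_ ?_ (Finset.finite_toSet _)
  · rintro ⟨ε, y⟩ ⟨-, h⟩
    simp only [Finset.coe_product, Set.mem_prod, Finset.mem_coe, mem_powerset]
    refine ⟨?_, (hK y).2 h.base⟩
    intro z hz
    obtain ⟨x, hx, rfl⟩ := mem_image.1 hz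
    refine mem_product.2 ⟨hx, (hK _).2 ?_⟩
    by_cases h' : ε x = x
    · simpa [h'] using (hK x).1 hx
    · exact h.supp' h'
  · rintro ⟨ε, y⟩ ⟨-, h⟩ ⟨ε', y'⟩ ⟨-, h'⟩ heq
    simp only [Prod.mk.injEq] at heq
    obtain ⟨h1, rfl⟩ := heq
    congr 1
    ext1 x
    by_cases hx : x.1 ∈ S
    · have : (x, ε x) ∈ K.image fun x => (x, ε x) := Finset.mem_image_of_mem _ ((hK x).2 hx)
      rw [h1] at this
      obtain ⟨z, -, hz⟩ := mem_image.1 this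
      simp only [Prod.mk.injEq] at hz
      rw [← hz.2, hz.1]
    · have e1 : ε x = x := by_contra fun hne => hx (h.supp x hne)
      have e2 : ε' x = x := by_contra fun hne => hx (h'.supp x hne)
      rw [e1, e2]

theorem num_perm {d : ℕ} {w : Weight m} {ω ω' : List (Mark m)}
    (h : ω.Perm ω') : Num d w ω ↔ Num d w ω' := by
  unfold Num
  rw [h.countP_eq]
  simp only [(h.map Prod.fst).count_eq]

theorem ncard_labeled_rotate (S : Finset ℕ) (w : Weight m) (ω ω' : List (Mark m)) :
    (labeled S w (ω ++ ω')).ncard = (labeled S w (ω' ++ ω)).ncard := by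
  have one : ∀ (a : Mark m) (ω : List (Mark m)),
      (labeled S w (a :: ω)).ncard ≤ (labeled S w (ω ++ [a])).ncard := by
    intro a ω
    refine Set.ncard_le_ncard_of_injOn (fun p => (p.1, face p.1 p.2)) ?_ ?_ (finite_labeled _ _ _)
    · rintro ⟨ε, y⟩ ⟨h1, h2⟩
      exact ⟨(num_perm (List.perm_append_singleton a ω).symm).1 h1, h2.rotate⟩
    · rintro ⟨ε, y⟩ - ⟨ε', y'⟩ - h
      simp only [Prod.mk.injEq] at h
      obtain ⟨rfl, h⟩ := h
      rw [(face ε).injective h]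
  have le : ∀ ω ω' : List (Mark m),
      (labeled S w (ω ++ ω')).ncard ≤ (labeled S w (ω' ++ ω)).ncard := by
    intro ω
    induction ω with
    | nil => intro ω'; simp
    | cons a ω ih =>
      intro ω'
      refine (one a (ω ++ ω')).trans ?_
      rw [append_assoc]
      refine (ih (ω' ++ [a])).trans ?_
      simp
  exact le_antisymm (le _ _) (le _ _)

/-- Renumbering of the vertices. -/
def relabel (π : Perm ℕ) : Perm (Corner m) := Equiv.prodCongr π (Equiv.refl _)

theorem relabel_apply (π : Perm ℕ) (x : Corner m) : relabel π x = (π x.1, x.2) := rfl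

theorem Realizes.relabel {S : Finset ℕ} {ε : Perm (Corner m)} {y : Corner m}
    {ω : List (Mark m)} (h : Realizes S ε y ω) (π : Perm ℕ) :
    Realizes (S.map π.toEmbedding) ((relabel π).symm.trans (ε.trans (relabel π)))
      (PlanarTiling.relabel π y) ω := by
  set τ : Perm (Corner m) := PlanarTiling.relabel π with hτ
  set ε' := τ.symm.trans (ε.trans τ) with hε'
  have e1 : ∀ x, ε' (τ x) = τ (ε x) := fun x => by simp [hε']
  have e2 : ∀ x, face ε' (τ x) = τ (face ε x) := fun x => by rw [face_apply, face_apply, ← e1]; rfl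
  have e3 : ∀ n x, (face ε')^[n] (τ x) = τ ((face ε)^[n] x) := by
    intro n
    induction n with
    | zero => intro x; rfl
    | succ n ih => intro x; rw [iterate_succ_apply, e2, ih, iterate_succ_apply]
  have e4 : ∀ x, ε' (τ x) = τ x ↔ ε x = x := fun x => by rw [e1, τ.injective.eq_iff]
  have hS : ∀ v, π v ∈ S.map π.toEmbedding ↔ v ∈ S := fun v => by simp
  have hs : ∀ P : Corner m → Prop, (∀ x, P (τ x)) → ∀ x, P x := fun P hP x => by
    have := hP (τ.symm x)
    rwa [τ.apply_symm_apply] at this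
  refine ⟨⟨?_, ?_, ?_⟩, ⟨?_, ?_, ?_, ?_, ?_, ?_⟩⟩
  · apply hs
    intro x
    rw [e1, e1, h.invol]
  · apply hs
    intro x hx
    rw [Ne, e4] at hx
    rw [e1]; exact h.flip x hx
  · apply hs
    intro x hx
    rw [Ne, e4] at hx; exact (hS _).2 (h.supp x hx)
  · exact (hS _).2 h.base
  · intro v hv
    obtain ⟨u, hu, rfl⟩ := mem_map.1 hv
    have := h.conn u hu
    refine ReflTransGen.lift π ?_ _ _ this
    rintro a b ⟨s, s', hab⟩
    refine ⟨s, s', ?_⟩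
    have := e1 (a, s)
    rwa [hab] at this
  · rw [e3, h.period]
  · intro i h0 hi
    rw [e3, Ne, τ.injective.eq_iff]; exact h.minimal i h0 hi
  · rw [marks_iff]
    intro i hi
    rw [e3, e4]; exact (marks_iff _ _).1 h.marks i hi
  · apply hs
    intro x hx
    refine (h.inner x ((hS _).1 hx)).imp ?_ ?_
    · rintro ⟨i, hi, rfl⟩
      exact ⟨i, hi, e3 _ _⟩
    · intro h'
      unfold Inner at h' ⊢
      rw [e3]; exact congrArg τ h'

theorem exists_perm_map_eq (S T : Finset ℕ) (h : S.card = T.card) :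
    ∃ π : Perm ℕ, S.map π.toEmbedding = T := by
  have ht := Perm.isMultiplyPretransitive ℕ S.card
  let f : Fin S.card ↪ ℕ := (S.equivFin.symm.toEmbedding).trans (Function.Embedding.subtype _)
  let g : Fin S.card ↪ ℕ := ((finCongr h).trans T.equivFin.symm).toEmbedding.trans
    (Function.Embedding.subtype _)
  obtain ⟨π, hπ⟩ := ht.exists_smul_eq f g
  refine ⟨π, Finset.eq_of_subset_of_card_le ?_ (by rw [Finset.card_map, h])⟩
  intro v hv
  obtain ⟨u, hu, rfl⟩ := mem_map.1 hv
  have := congrArg (fun k : Fin S.card ↪ ℕ => k (S.equivFin ⟨u, hu⟩)) hπ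
  have e : π u = g (S.equivFin ⟨u, hu⟩) := by
    rw [← this]
    simp [f]
  change π u ∈ T
  rw [e]
  exact (T.equivFin.symm _).2

/-- The number of tilings depends only on the number of vertices. -/
theorem ncard_labeled_eq_of_card_eq {S T : Finset ℕ} (h : S.card = T.card)
    (w : Weight m) (ω : List (Mark m)) :
    (labeled S w ω).ncard = (labeled T w ω).ncard := by
  have le : ∀ S T : Finset ℕ, S.card = T.card → (labeled S w ω).ncard ≤ (labeled T w ω).ncard := by
    intro S T h
    obtain ⟨π, rfl⟩ := exists_perm_map_eq S T h
    refine Set.ncard_le_ncard_of_injOn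
      (fun p => ((relabel π).symm.trans (p.1.trans (relabel π)), relabel π p.2)) ?_ ?_
      (finite_labeled _ _ _)
    · rintro ⟨ε, y⟩ ⟨h1, h2⟩
      exact ⟨h ▸ h1, h2.relabel π⟩
    · rintro ⟨ε, y⟩ - ⟨ε', y'⟩ - h
      simp only [Prod.mk.injEq] at h
      obtain ⟨h1, h2⟩ := h
      congr 1
      · ext1 x
        have := congrArg (fun e : Perm (Corner m) => e (relabel π x)) h1
        simpa using this
      · exact (relabel π).injective h2
  exact le_antisymm (le S T h) (le T S h.symm)

/-! ### Euler's inequality for tilings -/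

namespace Slot

theorem iterate_next_inc (k : ℕ) (hk : k ∈ Finset.Ico 1 m) :
    next^[k] (out (Vertex.first m)) = inc ⟨k, hk⟩ := by
  have hk' := mem_Ico.1 hk
  induction k with
  | zero => omega
  | succ k ih =>
    rw [iterate_succ_apply']
    rcases Nat.eq_zero_or_pos k with rfl | h0
    · simp [next, Vertex.first]
    · rw [ih (mem_Ico.2 ⟨h0, by omega⟩) ⟨h0, by omega⟩]
      simp [next, show k ≠ m - 1 by omega]

theorem iterate_next_out (j : ℕ) (hk : m - 1 - j ∈ Finset.Ico 1 m) :
    next^[m + j] (out (Vertex.first m)) = out ⟨m - 1 - j, hk⟩ := by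
  have h3 := hm.out
  have hk' := mem_Ico.1 hk
  induction j with
  | zero =>
    have e : m + 0 = (m - 1) + 1 := by omega
    rw [e, iterate_succ_apply', iterate_next_inc (m - 1) (mem_Ico.2 ⟨by omega, by omega⟩)]
    simp [next]
  | succ j ih =>
    rw [← Nat.add_assoc, iterate_succ_apply',
      ih (mem_Ico.2 ⟨by omega, by omega⟩) ⟨by omega, by omega⟩]
    simp only [next]
    rw [dif_neg (by omega)]; congr 2

/-- The rotation around a vertex is transitive. -/
theorem eq_of_next_eq {α : Type*} (f : Slot m → α) (h : ∀ s, f s.next = f s) (s t : Slot m) :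
    f s = f t := by
  have key : ∀ n, f (next^[n] (out (Vertex.first m))) = f (out (Vertex.first m)) := by
    intro n
    induction n with
    | zero => rfl
    | succ n ih => rw [iterate_succ_apply', h, ih]
  have key2 : ∀ s, f s = f (out (Vertex.first m)) := by
    intro s
    rcases s with ⟨k, hk⟩ | ⟨k, hk⟩ <;> have hk' := mem_Ico.1 hk
    · have e : m - 1 - (m - 1 - k) = k := by omega
      have := iterate_next_out (m - 1 - k) (by rw [e]; exact hk)
      simp only [e] at this
      rw [← this, key]
    · rw [← iterate_next_inc k hk, key]
  rw [key2 s, key2 t]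

theorem rep_injective : Injective (rep (m := m)) := Function.LeftInverse.injective typeIdx_rep

/-- The sign of a half-edge: `1` for the outgoing and `-1` for the incoming ones. -/
def sign : Slot m → ℚ
  | out _ => 1
  | inc _ => -1

theorem sign_flip (s : Slot m) : s.flip.sign = -s.sign := by cases s <;> simp [flip, sign]

theorem sign_across (s : Slot m) (h : s.across ≠ s) : s.across.sign = -s.sign := by
  rcases s with ⟨k, hk⟩ | ⟨k, hk⟩ <;> unfold across next at h ⊢ <;> dsimp only at h ⊢ <;>
    split_ifs with h1
  · simp [h1, flip] at h
  · simp [flip, sign]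
  · simp [h1, flip] at h
  · simp [flip, sign]

end Slot

theorem card_halfEdges (d : ℕ) : d * (2 * (m - 1)) = (2 * m - 4) * d + 2 * d := by
  have h3 := hm.out
  rw [← add_mul, mul_comm]
  congr 1; omega

namespace IsGluing

variable {S : Finset ℕ} {ε : Perm (Corner m)}

theorem mem (hg : IsGluing S ε) {x : Corner m} (h : x.1 ∈ S) : (ε x).1 ∈ S := by
  by_cases h' : ε x = x
  · rwa [h']
  · exact hg.supp' h'

/-- The inclusion of the half-edges at the vertices of a tiling. -/
def incl (x : S × Slot m) : Corner m := (x.1, x.2)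

theorem incl_injective : Injective (incl (S := S) (m := m)) := by
  rintro ⟨a, s⟩ ⟨b, t⟩ h
  simp only [incl, Prod.mk.injEq] at h
  exact Prod.ext (Subtype.ext h.1) h.2

/-- The involution on the half-edges at the vertices of a tiling. -/
def edgeOn (hg : IsGluing S ε) : Perm (S × Slot m) := Function.Involutive.toPerm
    (fun x => (⟨(ε (incl x)).1, hg.mem x.1.2⟩, (ε (incl x)).2))
    (fun x => by
      have : incl (S := S) (⟨(ε (incl x)).1, hg.mem x.1.2⟩, (ε (incl x)).2) = ε (incl x) := rfl
      apply incl_injective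
      simp only [this]
      change ε (ε (incl x)) = incl x
      exact hg.invol _)

variable (m S) in
/-- The rotation on the half-edges at the vertices of a tiling. -/
def spinOn : Perm (S × Slot m) := Equiv.prodCongr (Equiv.refl S) Slot.rot

theorem incl_edgeOn (hg : IsGluing S ε) (x : S × Slot m) : incl (hg.edgeOn x) = ε (incl x) := rfl

theorem edgeOn_edgeOn (hg : IsGluing S ε) (x : S × Slot m) : hg.edgeOn (hg.edgeOn x) = x := by
  apply incl_injective
  rw [incl_edgeOn, incl_edgeOn, hg.invol]

theorem incl_faceOn (hg : IsGluing S ε) (x : S × Slot m) :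
    incl (((spinOn m S).trans hg.edgeOn) x) = face ε (incl x) := rfl

theorem incl_faceOn_iterate (hg : IsGluing S ε) (n : ℕ) (x : S × Slot m) :
    incl (((spinOn m S).trans hg.edgeOn)^[n] x) = (face ε)^[n] (incl x) := by
  induction n with
  | zero => rfl
  | succ n ih => rw [iterate_succ_apply', iterate_succ_apply', incl_faceOn, ih]

theorem exists_incl {x : Corner m} (h : x.1 ∈ S) : ∃ z : S × Slot m, incl z = x :=
  ⟨(⟨x.1, h⟩, x.2), rfl⟩

theorem transitive (hg : IsGluing S ε) {v₀ : ℕ}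
    (hc : ∀ v ∈ S, ReflTransGen (Joined ε) v₀ v) (h0 : v₀ ∈ S) :
    Euler.Transitive (spinOn m S) hg.edgeOn := by
  intro f h1 h2
  have hv : ∀ (v : S) (s t : Slot m), f (v, s) = f (v, t) := fun v =>
    Slot.eq_of_next_eq (fun s => f (v, s)) (fun s => h1 (v, s))
  let s₀ : Slot m := .out (Vertex.first m)
  have key : ∀ v, ReflTransGen (Joined ε) v₀ v →
      ∃ hv : v ∈ S, f (⟨v, hv⟩, s₀) = f (⟨v₀, h0⟩, s₀) := by
    intro v h
    induction h with
    | refl => exact ⟨h0, rfl⟩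
    | @tail a b _ hab ih =>
      obtain ⟨ha, ih⟩ := ih
      obtain ⟨s, s', hab⟩ := hab
      have hb : b ∈ S := by
        have := hg.mem (x := (a, s)) ha
        rwa [hab] at this
      refine ⟨hb, ?_⟩
      have e : hg.edgeOn (⟨a, ha⟩, s) = (⟨b, hb⟩, s') := incl_injective hab
      rw [hv _ s₀ s', ← e, h2, hv _ s s₀, ih]
  rintro ⟨⟨v, hvS⟩, s⟩ ⟨⟨v', hvS'⟩, s'⟩
  rw [hv _ s s₀, hv _ s' s₀, (key v (hc v hvS)).2, (key v' (hc v' hvS')).2]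

theorem card_half (S : Finset ℕ) (m : ℕ) : Fintype.card (S × Slot m) = S.card * (2 * (m - 1)) := by
  rw [Fintype.card_prod, Slot.card_eq, Fintype.card_coe]

open Module

theorem card_le_finrank_spinOn : S.card ≤ finrank ℚ (Euler.inv (spinOn m S)) := by
  have := Euler.card_le_finrank_inv (spinOn m S) (fun x => x.1) (fun _ => rfl)
    (fun v => ⟨(v, .out (Vertex.first m)), rfl⟩)
  rwa [Fintype.card_coe] at this

open Classical in
theorem card_le_finrank_edgeOn (hg : IsGluing S ε) : S.card * (2 * (m - 1)) +
      ((S ×ˢ (univ : Finset (Slot m))).filter fun x => ε x = x).card ≤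
      2 * finrank ℚ (Euler.inv hg.edgeOn) := by
  have h := Euler.card_add_le_two_mul_finrank_inv hg.edgeOn hg.edgeOn_edgeOn
  rw [card_half] at h
  convert h using 2
  symm
  refine Finset.card_bij (fun x _ => incl x) ?_ (fun _ _ _ _ h => incl_injective h) ?_
  · intro x hx
    have hx' := (mem_filter.1 hx).2
    refine mem_filter.2 ⟨mem_product.2 ⟨x.1.2, mem_univ _⟩, ?_⟩
    rw [← hg.incl_edgeOn, hx']
  · intro x hx
    obtain ⟨hx1, hx2⟩ := mem_filter.1 hx
    obtain ⟨z, rfl⟩ := exists_incl (mem_product.1 hx1).1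
    exact ⟨z, mem_filter.2 ⟨mem_univ _, incl_injective hx2⟩, rfl⟩

/-- A lower bound for the number of regions: pairwise different regions through the leaves `b i`,
and the inner regions with a sector in `T`. -/
theorem card_le_finrank_faceOn (hg : IsGluing S ε) {ι : Type} [Fintype ι] [Nonempty ι]
    (b : ι → Corner m) (hbS : ∀ i, (b i).1 ∈ S) (hbl : ∀ i, ε (b i) = b i)
    (hb : ∀ i j n, (face ε)^[n] (b i) = b j → i = j)
    (T : Finset (Corner m)) (hT : ∀ x ∈ T, x.1 ∈ S ∧ Inner ε x ∧ ∃ i, x.2 = rep i) :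
    Fintype.card ι + T.card ≤ finrank ℚ (Euler.inv ((spinOn m S).trans hg.edgeOn)) := by
  classical
  set φ : Perm (S × Slot m) := (spinOn m S).trans hg.edgeOn with hφ
  let B : ι ⊕ T → Corner m := Sum.elim b (fun x => x.1)
  have hBS : ∀ i, (B i).1 ∈ S := by
    rintro (i | i)
    · exact hbS i
    · exact (hT i.1 i.2).1
  have inner_it : ∀ (x : Corner m) (n : ℕ), Inner ε x → Inner ε ((face ε)^[n] x) := by
    intro x n hx
    induction n with
    | zero => exact hx
    | succ n ih => rw [iterate_succ_apply']; exact hg.inner_face ih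
  have inner_it' : ∀ (x : Corner m) (n : ℕ), Inner ε ((face ε)^[n] x) → Inner ε x := by
    intro x n hx
    induction n with
    | zero => exact hx
    | succ n ih => rw [iterate_succ_apply'] at hx; exact ih (hg.inner_symm hx)
  have hB : ∀ i j n, (face ε)^[n] (B i) = B j → i = j := by
    rintro (i | ⟨x, hx⟩) (j | ⟨x', hx'⟩) n h
    · exact congrArg Sum.inl (hb i j n h)
    · exfalso
      have h1 := (hT x' hx').2.1
      change (face ε)^[n] (b i) = x' at h
      rw [← h] at h1; exact hg.inner_not_leaf (inner_it' _ _ h1) (hbl i)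
    · exfalso
      have h1 := inner_it x n (hT x hx).2.1
      change (face ε)^[n] x = b j at h
      rw [h] at h1; exact hg.inner_not_leaf h1 (hbl j)
    · obtain ⟨-, h1, k, hk⟩ := hT x hx
      obtain ⟨-, h1', k', hk'⟩ := hT x' hx'
      change (face ε)^[n] x = x' at h
      have h2 : (face ε)^[n] x = x ∨ (face ε)^[n] x = face ε x := by
        clear h
        induction n with
        | zero => exact .inl rfl
        | succ n ih =>
          rw [iterate_succ_apply']
          rcases ih with ih | ih <;> rw [ih]
          · exact .inr rfl
          · exact .inl (hg.inner_face_face h1)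
      have h3 : x = x' := by
        rcases h2 with h2 | h2
        · rw [← h, h2]
        · rw [h2] at h
          have h4 := hg.inner_slot h1
          rw [h, hk', hk] at h4
          have h5 := congrArg Slot.typeIdx h4
          rw [Slot.typeIdx_across, typeIdx_rep, typeIdx_rep] at h5
          rw [h5, ← hk] at h4
          have h6 : x.2.period = 1 := by simp [Slot.period, ← h4]
          unfold Inner at h1
          rw [h6, iterate_one, h] at h1; exact h1.symm
      subst h3; rfl
  have hsame : ∀ i j z, incl z = B i → φ.SameCycle z j → ∀ i' z', incl z' = B i' →
      φ.SameCycle z' j → i = i' := by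
    intro i j z hz h1 i' z' hz' h2
    have h3 : φ.SameCycle z z' := h1.trans h2.symm
    obtain ⟨n, -, -, hn⟩ := h3.exists_pow_eq''
    apply hB i i' n
    rw [← hz, ← hz', ← hn, Perm.coe_pow, incl_faceOn_iterate]
  let c : S × Slot m → ι ⊕ T := fun j =>
    if h : ∃ i z, incl z = B i ∧ φ.SameCycle z j then h.choose else .inl (Classical.arbitrary ι)
  have hc : ∀ i z j, incl z = B i → φ.SameCycle z j → c j = i := by
    intro i z j hz hj
    have h : ∃ i z, incl z = B i ∧ φ.SameCycle z j := ⟨i, z, hz, hj⟩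
    simp only [c, dif_pos h]
    obtain ⟨z', hz', hj'⟩ := h.choose_spec; exact hsame _ j z' hz' hj' i z hz hj
  have := Euler.card_le_finrank_inv φ c ?_ ?_
  · rwa [Fintype.card_sum, Fintype.card_coe] at this
  · intro x
    by_cases h : ∃ i z, incl z = B i ∧ φ.SameCycle z x
    · obtain ⟨i, z, hz, hx⟩ := h
      rw [hc i z x hz hx, hc i z (φ x) hz (by simpa using hx)]
    · simp only [c, Perm.sameCycle_apply_right]
  · intro i
    obtain ⟨z, hz⟩ := exists_incl (hBS i); exact ⟨z, hc i z z hz (Perm.SameCycle.refl _ _)⟩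

open Classical in
/-- Euler's inequality for a connected tiling. -/
theorem euler (hg : IsGluing S ε) {v₀ : ℕ}
    (hc : ∀ v ∈ S, ReflTransGen (Joined ε) v₀ v) (h0 : v₀ ∈ S)
    {ι : Type} [Fintype ι] [Nonempty ι]
    (b : ι → Corner m) (hbS : ∀ i, (b i).1 ∈ S) (hbl : ∀ i, ε (b i) = b i)
    (hb : ∀ i j n, (face ε)^[n] (b i) = b j → i = j)
    (T : Finset (Corner m)) (hT : ∀ x ∈ T, x.1 ∈ S ∧ Inner ε x ∧ ∃ i, x.2 = rep i) :
    2 * (Fintype.card ι + T.card) + ((S ×ˢ (univ : Finset (Slot m))).filter fun x => ε x = x).card ≤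
      (2 * m - 4) * S.card + 4 := by
  have h1 := card_le_finrank_spinOn (m := m) (S := S)
  have h2 := hg.card_le_finrank_edgeOn
  have h3 := hg.card_le_finrank_faceOn b hbS hbl hb T hT
  have h4 := Euler.euler_le hg.edgeOn_edgeOn (hg.transitive hc h0)
  rw [card_half] at h4
  have h5 := card_halfEdges (m := m) S.card
  omega

end IsGluing

namespace Realizes

open IsGluing (incl spinOn incl_injective)

variable {ε : Perm (Corner m)} {S : Finset ℕ} {y : Corner m}
  {ω : List (Mark m)}

open Classical in
/-- The distinguished sectors with a given property at the vertices in `S`. -/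
def reps (S : Finset ℕ) (p : Corner m → Prop) : Finset (Corner m) :=
  univ.biUnion fun i : WeightIndex m => (S.filter fun v => p (v, rep i)).image fun v => (v, rep i)

theorem mem_reps {p : Corner m → Prop} {x : Corner m} :
    x ∈ reps S p ↔ x.1 ∈ S ∧ p x ∧ ∃ i, x.2 = rep i := by
  classical
  simp only [reps, Finset.mem_biUnion, mem_univ, true_and, mem_image, mem_filter]
  constructor
  · rintro ⟨i, v, ⟨h1, h2⟩, rfl⟩
    exact ⟨h1, h2, i, rfl⟩
  · rintro ⟨h1, h2, i, h3⟩
    exact ⟨i, x.1, ⟨h1, by rw [← h3]; exact h2⟩, by rw [← h3]⟩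

open Classical in
theorem card_reps (S : Finset ℕ) (p : Corner m → Prop) :
    (reps S p).card = ∑ i, (S.filter fun v => p (v, rep i)).card := by
  unfold reps
  rw [Finset.card_biUnion]
  · exact sum_congr rfl fun i _ =>
      Finset.card_image_of_injective _ fun a b hab => congrArg Prod.fst hab
  · intro i _ j _ hij
    rw [Function.onFun, disjoint_left]
    rintro x hx hx'
    obtain ⟨v, -, rfl⟩ := mem_image.1 hx
    obtain ⟨v', -, hv⟩ := mem_image.1 hx'
    exact hij (Slot.rep_injective (congrArg Prod.snd hv).symm)

/-- One sector from each inner region. -/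
def innerReps (ε : Perm (Corner m)) (S : Finset ℕ) (y : Corner m) (n : ℕ) : Finset (Corner m) :=
  reps S fun x => ¬ OnOrbit ε y n x

theorem card_innerReps (h : Realizes S ε y ω) :
    (innerReps ε S y ω.length).card = ∑ i, (S.card - (ω.map Prod.fst).count (rep i)) := by
  classical
  refine (card_reps _ _).trans (sum_congr rfl fun i _ => ?_)
  rw [← h.count_add (rep i), Nat.add_sub_cancel_left]
  congr!

theorem innerReps_spec (h : Realizes S ε y ω) :
    ∀ x ∈ innerReps ε S y ω.length, x.1 ∈ S ∧ Inner ε x ∧ ∃ i, x.2 = rep i := by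
  intro x hx
  obtain ⟨h1, h2, h3⟩ := mem_reps.1 hx
  exact ⟨h1, (h.inner x h1).resolve_left h2, h3⟩

theorem euler_le (h : Realizes S ε y ω) (hy : ε y = y) :
    ω.countP (fun a => a.2) + 2 * ∑ i, (S.card - (ω.map Prod.fst).count (rep i)) ≤
      (2 * m - 4) * S.card + 2 := by
  classical
  have := h.toIsGluing.euler h.conn h.base (ι := Unit) (fun _ => y) (fun _ => h.base)
    (fun _ => hy) (fun _ _ _ _ => rfl) _ h.innerReps_spec
  rw [h.card_innerReps, h.card_leaves, Fintype.card_unit] at this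
  omega

/-- The tilings that satisfy Euler's formula have no oriented cycles except loops: there is a
function on the vertices that decreases by one along each oriented edge that is not a loop. -/
theorem acyclic {w : Weight m} (h : Realizes S ε y ω) (hy : ε y = y) (hn : Num S.card w ω) (v : ℕ) :
    ¬ Relation.TransGen (fun a b => a ≠ b ∧ ∃ k, ε (a, Slot.out k) = (b, Slot.inc k)) v v := by
  classical
  have hg := h.toIsGluing
  have h1 := IsGluing.card_le_finrank_spinOn (m := m) (S := S)
  have h2 := hg.card_le_finrank_edgeOn
  have h3 := hg.card_le_finrank_faceOn (ι := Unit) (fun _ => y) (fun _ => h.base)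
    (fun _ => hy) (fun _ _ _ _ => rfl) _ h.innerReps_spec
  rw [h.card_innerReps, hn.sum_sub, Fintype.card_unit] at h3
  rw [h.card_leaves] at h2
  have h4 := card_halfEdges (m := m) S.card
  have h5 := hn.2
  let g : S × Slot m → ℚ := fun x => if (ε (incl x)).1 = x.1 then 0 else x.2.sign
  have hgα : ∀ x, g (hg.edgeOn x) = -g x := by
    intro x
    have e : ((hg.edgeOn x).1 : ℕ) = (ε (incl x)).1 := rfl
    have e' : (hg.edgeOn x).2 = (ε (incl x)).2 := rfl
    simp only [g, hg.incl_edgeOn, hg.invol, e, e']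
    by_cases hx : (ε (incl x)).1 = x.1
    · rw [if_pos hx, if_pos (show (incl x).1 = _ from hx.symm), neg_zero]
    · rw [if_neg hx, if_neg (show ¬ (incl x).1 = _ from fun h => hx h.symm),
        hg.flip _ (fun h => hx (by rw [h]; rfl)), Slot.sign_flip]
      rfl
  have hgφ : ∀ x, Inner ε (incl x) →
      g (((spinOn m S).trans hg.edgeOn) x) = -g x := by
    intro x hx
    set z := ((spinOn m S).trans hg.edgeOn) x with hz
    have hzi : incl z = face ε (incl x) := hg.incl_faceOn x
    have hz1 : (z.1 : ℕ) = (face ε (incl x)).1 := by rw [← hzi]; rfl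
    have hz2 : z.2 = (incl x).2.across := by rw [← hg.inner_slot hx, ← hzi]; rfl
    have e1 : (ε (incl z)).1 = x.1 := by rw [hzi, face_apply, hg.invol]; rfl
    have e2 : (ε (incl x)).1 = (face ε (incl x)).1 := by
      conv_lhs => rw [← hg.inner_face_face hx]
      rw [face_apply ε (face ε _), hg.invol]
    simp only [g]
    rw [e1, e2, hz1]
    by_cases hx1 : (face ε (incl x)).1 = x.1
    · rw [if_pos hx1, if_pos hx1.symm, neg_zero]
    · rw [if_neg hx1, if_neg (Ne.symm hx1), hz2, Slot.sign_across]
      · rfl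
      · intro hs
        apply hx1
        have hp : (incl x).2.period = 1 := by simp [Slot.period, hs]
        unfold Inner at hx
        rw [hp, iterate_one] at hx
        rw [hx]; rfl
  obtain ⟨f, hf, hfg⟩ := Euler.exists_potential hg.edgeOn_edgeOn (hg.transitive h.conn h.base)
    (by rw [IsGluing.card_half]; omega) g (by
      intro c hc
      obtain ⟨a, ha, b, hb, rfl⟩ := Submodule.mem_sup.1 hc
      have e0 : ∀ a ∈ Euler.inv hg.edgeOn, ∑ x, g x * a x = 0 := by
        intro a ha
        have : ∑ x, g x * a x = - ∑ x, g x * a x := by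
          conv_lhs => rw [← Equiv.sum_comp hg.edgeOn]
          rw [← Finset.sum_neg_distrib]
          exact sum_congr rfl fun x _ => by rw [hgα, ha x]; ring
        linarith
      obtain ⟨z₀, hz₀⟩ := IsGluing.exists_incl h.base
      have hby : ∀ x, OnOrbit ε y ω.length (incl x) → b x = b z₀ := by
        rintro x ⟨i, -, hi⟩
        rw [← hz₀, ← hg.incl_faceOn_iterate] at hi
        rw [← incl_injective hi]
        clear hi
        induction i with
        | zero => rfl
        | succ i ih => rw [iterate_succ_apply', hb, ih]
      have e1 : ∑ x, g x * (b x - b z₀) = 0 := by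
        have : ∑ x, g x * (b x - b z₀) = - ∑ x, g x * (b x - b z₀) := by
          conv_lhs => rw [← Equiv.sum_comp ((spinOn m S).trans hg.edgeOn)]
          rw [← Finset.sum_neg_distrib]
          refine sum_congr rfl fun x _ => ?_
          rw [hb x]
          rcases h.inner (incl x) x.1.2 with h' | h'
          · rw [hby x h']; ring
          · rw [hgφ x h']; ring
        linarith
      have e2 : ∑ x, g x * b z₀ = 0 := e0 (fun _ => b z₀) (fun _ => rfl)
      simp only [mul_sub, Finset.sum_sub_distrib, e2] at e1
      simp only [Pi.add_apply, mul_add, sum_add_distrib, e0 a ha]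
      linarith)
  -- the potential, extended to all vertices
  let F : ℕ → ℚ := fun v => if hv : v ∈ S then f (⟨v, hv⟩, .out (Vertex.first m)) else 0
  have hF : ∀ (v : ℕ) (hv : v ∈ S) (s : Slot m), f (⟨v, hv⟩, s) = F v := by
    intro v hv s
    simp only [F, dif_pos hv]
    exact Slot.eq_of_next_eq (fun s => f (⟨v, hv⟩, s)) (fun s => hf (⟨v, hv⟩, s)) _ _
  have step : ∀ a b, (a ≠ b ∧ ∃ k, ε (a, Slot.out k) = (b, Slot.inc k)) → F b < F a := by
    rintro a b ⟨hab, k, hk⟩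
    have hne : ε (a, Slot.out k) ≠ (a, Slot.out k) := by rw [hk]; simp
    have ha : a ∈ S := hg.supp _ hne
    have hb : b ∈ S := by have := hg.supp' hne; rwa [hk] at this
    have h6 := hfg (⟨a, ha⟩, .out k)
    have e1 : hg.edgeOn (⟨a, ha⟩, .out k) = (⟨b, hb⟩, .inc k) := incl_injective hk
    have e2 : g (⟨a, ha⟩, .out k) = 1 := by
      simp only [g]
      have : ε (incl (S := S) (⟨a, ha⟩, Slot.out k)) = (b, Slot.inc k) := hk
      rw [this]
      simp [Ne.symm hab, Slot.sign]
    rw [e1, e2, hF, hF] at h6; linarith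
  intro hcyc
  have : ∀ a b, Relation.TransGen
      (fun a b => a ≠ b ∧ ∃ k, ε (a, Slot.out k) = (b, Slot.inc k)) a b → F b < F a := by
    intro a b hab
    induction hab with
    | single h => exact step _ _ h
    | tail _ h ih => exact (step _ _ h).trans ih
  exact lt_irrefl _ (this v v hcyc)

end Realizes

/-! ### Cutting an edge -/

/-- If `y` and `h` are the halves of an edge, this cuts the edge; if `y` and `h` are leaves, this
glues them. -/
def regraft (ε : Perm (Corner m)) (y h : Corner m) : Perm (Corner m) := ε * Equiv.swap y h

theorem regraft_regraft (ε : Perm (Corner m)) (y h : Corner m) :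
    regraft (regraft ε y h) y h = ε := by
  unfold regraft
  rw [mul_assoc, Equiv.swap_mul_self, mul_one]

/-- `y` and `h` are the two halves of an edge, or they are two leaves. -/
abbrev Twins (ε : Perm (Corner m)) (y h : Corner m) : Prop :=
  (ε y = h ∧ ε h = y) ∨ (ε y = y ∧ ε h = h)

section Regraft

variable {ε : Perm (Corner m)} {y h : Corner m}

theorem regraft_left : regraft ε y h y = ε h := by simp [regraft]

theorem regraft_right : regraft ε y h h = ε y := by simp [regraft]

theorem regraft_of_ne {x : Corner m} (h1 : x ≠ y) (h2 : x ≠ h) : regraft ε y h x = ε x := by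
  simp [regraft, Equiv.swap_apply_of_ne_of_ne h1 h2]

theorem face_regraft (hyh : Twins ε y h) (x : Corner m) :
    face (regraft ε y h) x = Equiv.swap y h (face ε x) := by
  rw [face_apply, face_apply]
  generalize (x.1, x.2.next) = z
  by_cases h1 : z = y
  · subst h1
    rw [regraft_left]
    rcases hyh with ⟨e1, e2⟩ | ⟨e1, e2⟩ <;> rw [e1, e2] <;> simp
  · by_cases h2 : z = h
    · subst h2
      rw [regraft_right]
      rcases hyh with ⟨e1, e2⟩ | ⟨e1, e2⟩ <;> rw [e1, e2] <;> simp
    · rw [regraft_of_ne h1 h2, Equiv.swap_apply_of_ne_of_ne]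
      · rcases hyh with ⟨e1, e2⟩ | ⟨e1, e2⟩
        · exact fun h' => h2 (ε.injective (h'.trans e2.symm))
        · exact fun h' => h1 (ε.injective (h'.trans e1.symm))
      · rcases hyh with ⟨e1, e2⟩ | ⟨e1, e2⟩
        · exact fun h' => h1 (ε.injective (h'.trans e1.symm))
        · exact fun h' => h2 (ε.injective (h'.trans e2.symm))

theorem iterate_face_regraft (hyh : Twins ε y h) (x : Corner m) (n : ℕ)
    (hn : ∀ i, 0 < i → i ≤ n → (face ε)^[i] x ≠ y ∧ (face ε)^[i] x ≠ h) :
    (face (regraft ε y h))^[n] x = (face ε)^[n] x := by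
  induction n with
  | zero => rfl
  | succ n ih =>
    rw [iterate_succ_apply', ih fun i h0 hi => hn i h0 (by omega), face_regraft hyh,
      ← iterate_succ_apply' (face ε)]
    have := hn (n + 1) (by omega) le_rfl
    exact Equiv.swap_apply_of_ne_of_ne this.1 this.2

/-- The first time that a region meets one of the two half-edges, the regrafted region turns to
the other one. -/
theorem iterate_face_regraft_last (hyh : Twins ε y h)
    (x : Corner m) (n : ℕ) (h0 : 0 < n)
    (hn : ∀ i, 0 < i → i < n → (face ε)^[i] x ≠ y ∧ (face ε)^[i] x ≠ h) :
    (face (regraft ε y h))^[n] x = Equiv.swap y h ((face ε)^[n] x) := by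
  obtain ⟨n, rfl⟩ := Nat.exists_eq_succ_of_ne_zero h0.ne'
  rw [iterate_succ_apply',
    iterate_face_regraft hyh x n (fun i h0 hi => hn i h0 (by omega)), face_regraft hyh,
    ← iterate_succ_apply' (face ε)]

theorem inner_regraft (hyh : Twins ε y h) {x : Corner m}
    (hx : Inner ε x) (hn : ∀ i, (face ε)^[i] x ≠ y ∧ (face ε)^[i] x ≠ h) :
    Inner (regraft ε y h) x := by
  unfold Inner
  rw [iterate_face_regraft hyh x _ fun i _ _ => hn i]
  exact hx

theorem IsGluing.cut {S : Finset ℕ} (hg : IsGluing S ε) (hy : ε y = h) :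
    IsGluing S (regraft ε y h) :=
  have hh : ε h = y := by rw [← hy, hg.invol]
  have key : ∀ x, regraft ε y h x ≠ x → regraft ε y h x = ε x := fun x hx => regraft_of_ne
    (by rintro rfl; exact hx (by rw [regraft_left, hh]))
    (by rintro rfl; exact hx (by rw [regraft_right, hy]))
  { invol := fun x => by
      by_cases h1 : x = y
      · rw [h1, regraft_left, hh, regraft_left, hh]
      · by_cases h2 : x = h
        · rw [h2, regraft_right, hy, regraft_right, hy]
        · rw [regraft_of_ne h1 h2, regraft_of_ne, hg.invol]
          · exact fun h' => h2 (ε.injective (h'.trans hh.symm))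
          · exact fun h' => h1 (ε.injective (h'.trans hy.symm))
    flip := fun x hx => by have e := key x hx; rw [e] at hx ⊢; exact hg.flip x hx
    supp := fun x hx => by rw [key x hx] at hx; exact hg.supp x hx }

theorem IsGluing.glue {S : Finset ℕ} (hg : IsGluing S ε) (hy : ε y = y) (hh : ε h = h)
    (hyS : y.1 ∈ S) (hhS : h.1 ∈ S) (hs : h.2 = y.2.flip) : IsGluing S (regraft ε y h) where
  invol x := by
    by_cases h1 : x = y
    · rw [h1, regraft_left, hh, regraft_right, hy]
    · by_cases h2 : x = h
      · rw [h2, regraft_right, hy, regraft_left, hh]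
      · rw [regraft_of_ne h1 h2, regraft_of_ne, hg.invol]
        · exact fun h' => h1 (ε.injective (h'.trans hy.symm))
        · exact fun h' => h2 (ε.injective (h'.trans hh.symm))
  flip x hx := by
    by_cases h1 : x = y
    · rw [h1, regraft_left, hh, hs]
    · by_cases h2 : x = h
      · rw [h2, regraft_right, hy, hs, Slot.flip_flip]
      · rw [regraft_of_ne h1 h2] at hx ⊢; exact hg.flip x hx
  supp x hx := by
    by_cases h1 : x = y
    · rw [h1]; exact hyS
    · by_cases h2 : x = h
      · rw [h2]; exact hhS
      · rw [regraft_of_ne h1 h2] at hx; exact hg.supp x hx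

/-- Connectivity is not affected by changing an edge between connected vertices. -/
theorem conn_regraft {a b : ℕ} (hy : ReflTransGen (Joined (regraft ε y h)) y.1 (ε y).1)
    (hh : ReflTransGen (Joined (regraft ε y h)) h.1 (ε h).1)
    (hab : ReflTransGen (Joined ε) a b) :
    ReflTransGen (Joined (regraft ε y h)) a b := by
  induction hab with
  | refl => exact .refl
  | @tail a b _ hab ih =>
    refine ih.trans ?_
    obtain ⟨s, s', hab⟩ := hab
    by_cases h1 : (a, s) = y
    · subst h1
      rwa [hab] at hy
    · by_cases h2 : (a, s) = h
      · subst h2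
        rwa [hab] at hh
      · exact .single ⟨s, s', by rw [regraft_of_ne h1 h2, hab]⟩

end Regraft

/-- The word of a stretch of `n` sectors without leaves that starts with the sector `s`. -/
def run : Slot m → ℕ → List (Mark m)
  | _, 0 => []
  | s, n + 1 => (s, false) :: run s.across n

/-- The word of `n` sectors of which only the first one, `s`, is preceded by a leaf. -/
def stretch : Slot m → ℕ → List (Mark m)
  | _, 0 => []
  | s, n + 1 => (s, true) :: run s.across n

theorem length_run (s : Slot m) (n : ℕ) : (run s n).length = n := by
  induction n generalizing s with
  | zero => rfl
  | succ n ih => simp [run, ih]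

theorem length_stretch (s : Slot m) (n : ℕ) : (stretch s n).length = n := by
  cases n with
  | zero => rfl
  | succ n => simp [stretch, length_run]

theorem stretch_period (s : Slot m) : (s.period = 1 ∧ stretch s s.period = [(s, true)]) ∨
    (s.period = 2 ∧ stretch s s.period = [(s, true), (s.across, false)]) := by
  rcases period_cases s with ⟨h, -⟩ | ⟨h, -⟩ <;> rw [h] <;> simp [stretch, run]

theorem count_stretch_period (s : Slot m) (i : WeightIndex m) :
    ((stretch s s.period).map Prod.fst).count (rep i) = if s.typeIdx = i then 1 else 0 := by
  have h := Slot.typeIdx_eq_iff s i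
  rcases stretch_period s with ⟨hp, hs⟩ | ⟨hp, hs⟩
  · have ha : s.across = s := by
      rcases period_cases s with h' | h'
      · exact h'.2
      · omega
    rw [hs]
    by_cases hi : s.typeIdx = i
    · rw [if_pos hi]
      rcases h.1 hi with h' | h'
      · simp [h']
      · have : s = rep i := by rw [← ha, h', across_across]
        simp [this]
    · rw [if_neg hi]
      have : s ≠ rep i := fun h' => hi (h.2 (.inl h'))
      simp [this]
  · have ha : s.across ≠ s := by
      rcases period_cases s with h' | h'
      · omega
      · exact h'.2
    rw [hs]
    by_cases hi : s.typeIdx = i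
    · rw [if_pos hi]
      rcases h.1 hi with h' | h'
      · rw [h'] at ha
        simp [h', ha]
      · have e : s.across = rep i := by rw [h', across_across]
        rw [e] at ha
        simp [e, Ne.symm ha]
    · rw [if_neg hi]
      have h1 : s ≠ rep i := fun h' => hi (h.2 (.inl h'))
      have h2 : s.across ≠ rep i := fun h' => by
        apply hi
        rw [← Slot.typeIdx_across, h', typeIdx_rep]
      simp [h1, h2]

theorem countP_stretch_period (s : Slot m) : (stretch s s.period).countP (fun a => a.2) = 1 := by
  rcases stretch_period s with ⟨-, hs⟩ | ⟨-, hs⟩ <;> rw [hs] <;> simp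

theorem Realizes.ne {ε : Perm (Corner m)} {S : Finset ℕ} {y : Corner m} {s : Slot m}
    {r : List (Mark m)} (hr : Realizes S ε y ((s, false) :: r)) : ε y ≠ y := fun h => by
  simpa using hr.marks.2.1.1 h

/-- Cutting an edge between the boundary and an inner region of type `i` lowers the weight by
`e_i`. -/
theorem num_cut_inner {d : ℕ} {w : Weight m} {s : Slot m} {r : List (Mark m)} :
    Num d (w + Finsupp.single s.flip.typeIdx 1) ((s, false) :: r) ↔
      Num d w ((s, true) :: r ++ stretch s.flip s.flip.period) := by
  unfold Num
  refine and_congr (forall_congr' fun i => ?_) ?_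
  · have := count_stretch_period s.flip i
    simp only [cons_append, map_cons, map_append, List.count_cons,
      List.count_append, Finsupp.add_apply, Finsupp.single_apply] at this ⊢
    rw [this]; omega
  · have := countP_stretch_period s.flip
    have e : ∑ i, (w + Finsupp.single s.flip.typeIdx 1 : Weight m) i = ∑ i, w i + 1 := by
      simp [sum_add_distrib, Finsupp.single_apply]
    rw [e]
    simp only [cons_append, List.countP_cons, countP_append, this]
    simp; omega

section CutInner

variable {ε : Perm (Corner m)} {S : Finset ℕ} {y : Corner m} {s : Slot m}
  {r : List (Mark m)}

theorem Realizes.cut_inner (hr : Realizes S ε y ((s, false) :: r))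
    (ho : ¬ OnOrbit ε y (r.length + 1) (ε y)) :
    Realizes S (regraft ε y (ε y)) y ((s, true) :: r ++ stretch s.flip s.flip.period) := by
  have hg := hr.toIsGluing
  obtain ⟨h, hh⟩ : ∃ h, h = ε y := ⟨_, rfl⟩
  rw [← hh] at ho ⊢
  have hys : y.2 = s := hr.marks.1
  have hne := hr.ne
  have hhs : h.2 = s.flip := by rw [hh, hg.flip y hne, hys]
  have hhy : ε h = y := by rw [hh, hg.invol]
  have hhne : h ≠ y := by rw [hh]; exact hne
  have hyh : Twins ε y h := .inl ⟨hh.symm, hhy⟩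
  have hhS : h.1 ∈ S := by rw [hh]; exact hg.mem hr.base
  have hn := hr.period
  have hmin := hr.minimal
  have hin := hr.inner
  rw [length_cons] at hn hmin hin
  set n := r.length + 1 with hn'
  have hhI : Inner ε h := (hin h hhS).resolve_left ho
  have hyO : OnOrbit ε y n y := ⟨0, by omega, rfl⟩
  set ε' := regraft ε y h with hε'
  have a1 : ∀ i, 0 < i → i < n → (face ε)^[i] y ≠ y ∧ (face ε)^[i] y ≠ h := fun i h0 hi =>
    ⟨hmin i h0 hi, fun h' => ho ⟨i, hi, h'⟩⟩
  have a2 : ∀ i < n, (face ε')^[i] y = (face ε)^[i] y := fun i hi =>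
    iterate_face_regraft hyh y i fun j h0 hj => a1 j h0 (by omega)
  have a3 : (face ε')^[n] y = h := by
    rw [iterate_face_regraft_last hyh y n (by omega) a1, hn, Equiv.swap_apply_left]
  set q := s.flip.period with hq
  have hq1 : 1 ≤ q ∧ q ≤ 2 := by rcases period_cases s.flip with h' | h' <;> omega
  have b1 : ∀ i, 0 < i → i < q → (face ε)^[i] h ≠ y ∧ (face ε)^[i] h ≠ h := by
    intro i h0 hi
    refine ⟨fun h' => not_onOrbit_iterate hn ho i (h' ▸ hyO), ?_⟩
    have : i = 1 := by omega
    subst this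
    rw [iterate_one]
    intro h'
    have h1 := hg.inner_slot hhI
    rw [h', hhs] at h1
    have : q = 1 := by simp [hq, Slot.period, ← h1]
    omega
  have b2 : ∀ i < q, (face ε')^[i] h = (face ε)^[i] h := fun i hi =>
    iterate_face_regraft hyh h i fun j h0 hj => b1 j h0 (by omega)
  have hqh : (face ε)^[q] h = h := by
    have := hhI
    unfold Inner at this; rwa [hhs] at this
  have b3 : (face ε')^[q] h = y := by
    rw [iterate_face_regraft_last hyh h q (by omega) b1, hqh, Equiv.swap_apply_right]
  have c1 : ∀ i, (face ε')^[n + i] y = (face ε')^[i] h := fun i => by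
    rw [Nat.add_comm, iterate_add_apply, a3]
  have hg' : IsGluing S ε' := hg.cut hh.symm
  have hlen : ((s, true) :: r ++ stretch s.flip q).length = n + q := by
    simp only [length_append, length_cons, length_stretch, hn']
  refine ⟨hg', ⟨hr.base, ?_, ?_, ?_, ?_, ?_⟩⟩
  · intro v hv
    have hc : ReflTransGen (Joined ε') y.1 h.1 := by rw [← a3]; exact IsGluing.conn_iterate y n
    exact conn_regraft (by rwa [← hh]) (by rw [hhy]; exact hg'.joined_trans_symm hc) (hr.conn v hv)
  · rw [hlen, c1, b3]
  · intro i h0 hi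
    rw [hlen] at hi
    rcases Nat.lt_or_ge i n with h' | h'
    · rw [a2 i h']; exact (a1 i h0 h').1
    · obtain ⟨j, rfl⟩ := Nat.exists_eq_add_of_le h'
      rw [c1]
      rcases Nat.eq_zero_or_pos j with rfl | hj
      · exact hhne
      · rw [b2 j (by omega)]; exact (b1 j hj (by omega)).1
  · rw [marks_append]
    constructor
    · rw [marks_iff]
      intro i hi
      have hi' : i < n := by rwa [length_cons] at hi
      rw [a2 i hi']
      have hmk := (marks_iff _ _).1 hr.marks i (by simpa using hi)
      cases i with
      | zero =>
        refine ⟨hys, ?_⟩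
        have : ε' y = y := by rw [hε', regraft_left, hhy]
        simp [this]
      | succ i =>
        have h1 := a1 (i + 1) (by omega) hi'
        rw [hε', regraft_of_ne h1.1 h1.2]; exact hmk
    · have e : (face ε')^[((s, true) :: r).length] y = h := by rw [length_cons]; exact a3
      rw [e]
      have hl : ε' h = h := by rw [hε', regraft_right, ← hh]
      rcases stretch_period s.flip with ⟨hp, hs⟩ | ⟨hp, hs⟩ <;> rw [← hq] at hs hp <;> rw [hs]
      · exact ⟨hhs, by simp [hl], trivial⟩
      · have h1 : face ε' h = face ε h := b2 1 (by omega)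
        refine ⟨hhs, by simp [hl], ?_, ?_, trivial⟩
        · rw [h1, hg.inner_slot hhI, hhs]
        · have h2 := b1 1 (by omega) (by omega)
          rw [iterate_one] at h2
          rw [h1, hε', regraft_of_ne h2.1 h2.2]
          simp [hg.inner_not_leaf (hg.inner_face hhI)]
  · intro x hx
    rw [hlen]
    by_cases hxO : OnOrbit ε y n x
    · obtain ⟨i, hi, rfl⟩ := hxO; exact .inl ⟨i, by omega, a2 i hi⟩
    · have hxI := (hin x hx).resolve_left hxO
      by_cases hxh : ∃ i < q, (face ε)^[i] h = x
      · obtain ⟨i, hi, rfl⟩ := hxh; exact .inl ⟨n + i, by omega, by rw [c1, b2 i hi]⟩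
      · right
        refine inner_regraft hyh hxI fun i =>
          ⟨fun h' => not_onOrbit_iterate hn hxO i (h' ▸ hyO), fun h' => hxh ?_⟩
        have hff := hg.inner_face_face hxI
        have h2 : (face ε)^[i] x = x ∨ (face ε)^[i] x = face ε x := by
          clear h'
          induction i with
          | zero => exact .inl rfl
          | succ i ih =>
            rw [iterate_succ_apply']
            rcases ih with ih | ih <;> rw [ih]
            · exact .inr rfl
            · exact .inl hff
        rcases h2 with h2 | h2
        · exact ⟨0, by omega, by rw [← h', h2]; rfl⟩
        · have h3 : face ε h = x := by rw [← h', h2, hff]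
          rcases Nat.lt_or_ge 1 q with h4 | h4
          · exact ⟨1, h4, h3⟩
          · have : q = 1 := by omega
            rw [this, iterate_one] at hqh; exact ⟨0, by omega, by rw [← h3, hqh]; rfl⟩

theorem Realizes.glue_inner (hr : Realizes S ε y ((s, true) :: r ++ stretch s.flip s.flip.period)) :
    Realizes S (regraft ε y ((face ε)^[r.length + 1] y)) y ((s, false) :: r) ∧
      ¬ OnOrbit (regraft ε y ((face ε)^[r.length + 1] y)) y (r.length + 1)
        ((face ε)^[r.length + 1] y) := by
  have hg := hr.toIsGluing
  set n := r.length + 1 with hn'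
  obtain ⟨h, hh⟩ : ∃ h, h = (face ε)^[n] y := ⟨_, rfl⟩
  rw [← hh]
  set q := s.flip.period with hq
  have hq1 : 1 ≤ q ∧ q ≤ 2 := by rcases period_cases s.flip with h' | h' <;> omega
  have hlen : ((s, true) :: r ++ stretch s.flip q).length = n + q := by
    simp only [length_append, length_cons, length_stretch, hn']
  have hper := hr.period
  have hmin := hr.minimal
  have hin := hr.inner
  rw [hlen] at hper hmin hin
  have hmk := (marks_append _ _ _).1 hr.marks
  have hm1 := hmk.1
  have hm2 := hmk.2
  rw [length_cons, ← hn', ← hh] at hm2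
  have hys : y.2 = s := hm1.1
  have hyl : ε y = y := hm1.2.1.2 rfl
  have hh2 : h.2 = s.flip ∧ ε h = h := by
    rcases stretch_period s.flip with ⟨hp, hs⟩ | ⟨hp, hs⟩ <;> rw [← hq] at hs <;> rw [hs] at hm2 <;>
      exact ⟨hm2.1, hm2.2.1.2 rfl⟩
  obtain ⟨hhs, hhl⟩ := hh2
  have hhS : h.1 ∈ S := by rw [hh]; exact hg.iterate_face_mem hr.base n
  have hhne : h ≠ y := by rw [hh]; exact hmin n (by omega) (by omega)
  have hyh : Twins ε y h := .inr ⟨hyl, hhl⟩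
  have hav : ∀ i, 0 < i → i < n + q → i ≠ n → (face ε)^[i] y ≠ y ∧ (face ε)^[i] y ≠ h := by
    intro i h0 hi hin'
    refine ⟨hmin i h0 hi, fun h' => hin' ?_⟩
    rw [hh] at h'; exact iterate_injOn hmin hi (by omega) h'
  have hst : ∀ i, (face ε)^[n + i] y = (face ε)^[i] h := fun i => by
    rw [Nat.add_comm, iterate_add_apply, hh]
  set ε' := regraft ε y h with hε'
  have hg' : IsGluing S ε' := hg.glue hyl hhl hr.base hhS (by rw [hhs, hys])
  have a2 : ∀ i < n, (face ε')^[i] y = (face ε)^[i] y := fun i hi =>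
    iterate_face_regraft hyh y i fun j h0 hj => hav j h0 (by omega) (by omega)
  have a3 : (face ε')^[n] y = y := by
    rw [iterate_face_regraft_last hyh y n (by omega) fun j h0 hj => hav j h0 (by omega) (by omega),
      ← hh, Equiv.swap_apply_right]
  have b1 : ∀ i, 0 < i → i < q → (face ε)^[i] h ≠ y ∧ (face ε)^[i] h ≠ h := by
    intro i h0 hi
    rw [← hst]; exact hav _ (by omega) (by omega) (by omega)
  have b2 : ∀ i < q, (face ε')^[i] h = (face ε)^[i] h := fun i hi =>
    iterate_face_regraft hyh h i fun j h0 hj => b1 j h0 (by omega)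
  have b3 : (face ε')^[q] h = h := by
    rw [iterate_face_regraft_last hyh h q (by omega) b1, ← hst, hper, Equiv.swap_apply_left]
  have hhI : Inner ε' h := by
    unfold Inner
    rw [hhs]; exact b3
  have inner_it : ∀ i, Inner ε' ((face ε')^[i] h) := by
    intro i
    induction i with
    | zero => exact hhI
    | succ i ih => rw [iterate_succ_apply']; exact hg'.inner_face ih
  refine ⟨⟨hg', ⟨hr.base, ?_, ?_, ?_, ?_, ?_⟩⟩, ?_⟩
  · exact fun v hv => conn_regraft (by rw [hyl]) (by rw [hhl]) (hr.conn v hv)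
  · exact a3
  · intro i h0 hi
    have hi' : i < n := by rwa [length_cons] at hi
    rw [a2 i hi']; exact (hav i h0 (by omega) (by omega)).1
  · rw [marks_iff]
    intro i hi
    have hi' : i < n := by rwa [length_cons] at hi
    rw [a2 i hi']
    have hmk := (marks_iff _ _).1 hm1 i (by simpa using hi)
    cases i with
    | zero =>
      refine ⟨hys, ?_⟩
      have : ε' y ≠ y := by rw [hε', regraft_left, hhl]; exact hhne
      simp [this]
    | succ i =>
      have h1 := hav (i + 1) (by omega) (by omega) (by omega)
      rw [hε', regraft_of_ne h1.1 h1.2]; exact hmk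
  · intro x hx
    rw [length_cons, ← hn']
    by_cases hxO : OnOrbit ε y (n + q) x
    · obtain ⟨i, hi, rfl⟩ := hxO
      rcases Nat.lt_or_ge i n with h' | h'
      · exact .inl ⟨i, h', a2 i h'⟩
      · right
        obtain ⟨j, rfl⟩ := Nat.exists_eq_add_of_le h'
        rw [hst, ← b2 j (by omega)]; exact inner_it j
    · right
      have hxI := (hin x hx).resolve_left hxO
      have horb := not_onOrbit_iterate hper hxO
      refine inner_regraft hyh hxI fun i => ⟨fun h' => horb i ?_, fun h' => horb i ?_⟩
      · rw [h']; exact ⟨0, by omega, rfl⟩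
      · rw [h']; exact ⟨n, by omega, hh.symm⟩
  · rintro ⟨i, hi, h'⟩
    rw [a2 i hi] at h'
    rcases Nat.eq_zero_or_pos i with rfl | h0
    · exact hhne h'.symm
    · exact (hav i h0 (by omega) (by omega)).2 h'

/-- The tilings in which the region on the other side of the edge at `y` is an inner region. -/
theorem ncard_cut_inner (S : Finset ℕ) (w : Weight m) (s : Slot m) (r : List (Mark m)) :
    {p ∈ labeled S (w + Finsupp.single s.flip.typeIdx 1) ((s, false) :: r) |
      ¬ OnOrbit p.1 p.2 (r.length + 1) (p.1 p.2)}.ncard =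
    (labeled S w ((s, true) :: r ++ stretch s.flip s.flip.period)).ncard := by
  refine Set.ncard_congr (fun p _ => (regraft p.1 p.2 (p.1 p.2), p.2)) ?_ ?_ ?_
  · rintro ⟨ε, y⟩ ⟨⟨h1, h2⟩, h3⟩
    exact ⟨num_cut_inner.1 h1, h2.cut_inner h3⟩
  · rintro ⟨ε, y⟩ ⟨ε', y'⟩ ⟨⟨h1, h2⟩, h3⟩ ⟨⟨h1', h2'⟩, h3'⟩ h
    simp only [Prod.mk.injEq] at h
    obtain ⟨h, rfl⟩ := h
    have key : ∀ ε : Perm (Corner m), Realizes S ε y ((s, false) :: r) →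
        ¬ OnOrbit ε y (r.length + 1) (ε y) →
        (face (regraft ε y (ε y)))^[r.length + 1] y = ε y := by
      intro ε h2 h3
      have hg := h2.toIsGluing
      have hn := h2.period
      rw [length_cons] at hn
      rw [iterate_face_regraft_last (.inl ⟨rfl, hg.invol y⟩) y _ (by omega), hn,
        Equiv.swap_apply_left]
      intro i h0 hi; exact ⟨h2.minimal i h0 (by simpa using hi), fun h' => h3 ⟨i, hi, h'⟩⟩
    have e : ε y = ε' y := by rw [← key ε h2 h3, ← key ε' h2' h3', h]
    congr 1
    rw [← regraft_regraft ε y (ε y), h, e, regraft_regraft]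
  · rintro ⟨ε, y⟩ ⟨h1, h2⟩
    have h3 := h2.glue_inner
    have e : regraft ε y ((face ε)^[r.length + 1] y) y = (face ε)^[r.length + 1] y := by
      rw [regraft_left]
      have hmk := ((marks_append _ _ _).1 h2.marks).2
      rw [length_cons] at hmk
      rcases stretch_period s.flip with ⟨hp, hs⟩ | ⟨hp, hs⟩ <;> rw [hs] at hmk <;>
        exact hmk.2.1.2 rfl
    refine ⟨(regraft ε y ((face ε)^[r.length + 1] y), y), ⟨⟨num_cut_inner.2 h1, h3.1⟩, ?_⟩, ?_⟩
    · change ¬ OnOrbit _ y _ (regraft ε y ((face ε)^[r.length + 1] y) y)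
      rw [e]; exact h3.2
    · simp only [e, regraft_regraft]

/-- If the region on the other side of the edge at `y` is an inner region of type `i`, then the
weight is at least `e_i`. -/
theorem single_le_of_cut_inner {w : Weight m}
    (hr : Realizes S ε y ((s, false) :: r)) (hn : Num S.card w ((s, false) :: r))
    (ho : ¬ OnOrbit ε y (r.length + 1) (ε y)) : Finsupp.single s.flip.typeIdx 1 ≤ w := by
  classical
  have hg := hr.toIsGluing
  rw [Finsupp.single_le_iff]
  have hys : y.2 = s := hr.marks.1
  have hne := hr.ne
  have hhs : (ε y).2 = s.flip := by rw [hg.flip y hne, hys]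
  have hhS : (ε y).1 ∈ S := hg.mem hr.base
  have h1 := hr.count_add (rep s.flip.typeIdx)
  have h2 := hn.1 s.flip.typeIdx
  have h3 : 0 < (S.filter fun v =>
      ¬ OnOrbit ε y ((s, false) :: r).length (v, rep s.flip.typeIdx)).card := by
    rw [Finset.card_pos]
    have hhI := (hr.inner _ hhS).resolve_left ho
    rcases Slot.rep_typeIdx_cases s.flip with h | h
    · refine ⟨(ε y).1, mem_filter.2 ⟨hhS, ?_⟩⟩
      rw [← h, ← hhs]; exact ho
    · refine ⟨(face ε (ε y)).1, mem_filter.2 ⟨hg.face_mem hhS, ?_⟩⟩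
      rw [← h, ← hhs, ← hg.inner_slot hhI]
      intro h'; exact ho (onOrbit_of_face hr.period h')
  omega

end CutInner

/-! ### Cutting an edge that separates the tiling -/

section Local

variable {ε ε' : Perm (Corner m)} {T : Finset ℕ} {y : Corner m}
  {ω : List (Mark m)}

theorem face_mem_of_closed (hcl : ∀ x : Corner m, x.1 ∈ T → (ε x).1 ∈ T) {x : Corner m}
    (hx : x.1 ∈ T) (n : ℕ) : ((face ε)^[n] x).1 ∈ T := by
  induction n with
  | zero => exact hx
  | succ n ih => rw [iterate_succ_apply', face_apply]; exact hcl _ ih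

theorem IsGluing.closed_sdiff {S : Finset ℕ} (hg : IsGluing S ε)
    (hcl : ∀ x : Corner m, x.1 ∈ T → (ε x).1 ∈ T) (x : Corner m) (hx : x.1 ∈ S \ T) :
    (ε x).1 ∈ S \ T := by
  obtain ⟨hx1, hx2⟩ := mem_sdiff.1 hx
  exact mem_sdiff.2 ⟨hg.mem hx1, fun h => hx2 (by simpa only [hg.invol] using hcl _ h)⟩

theorem iterate_face_congr (hcl : ∀ x : Corner m, x.1 ∈ T → (ε x).1 ∈ T)
    (he : ∀ x : Corner m, x.1 ∈ T → ε' x = ε x) {x : Corner m} (hx : x.1 ∈ T) (n : ℕ) :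
    (face ε')^[n] x = (face ε)^[n] x := by
  induction n with
  | zero => rfl
  | succ n ih =>
    rw [iterate_succ_apply', iterate_succ_apply', ih, face_apply, face_apply]
    exact he _ (face_mem_of_closed hcl hx n)

theorem conn_congr (hcl : ∀ x : Corner m, x.1 ∈ T → (ε x).1 ∈ T)
    (he : ∀ x : Corner m, x.1 ∈ T → ε' x = ε x) {a b : ℕ} (ha : a ∈ T)
    (h : ReflTransGen (Joined ε) a b) :
    b ∈ T ∧ ReflTransGen (Joined ε') a b := by
  induction h with
  | refl => exact ⟨ha, .refl⟩
  | @tail b c _ hbc ih =>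
    obtain ⟨s, s', hbc⟩ := hbc
    refine ⟨?_, ih.2.tail ⟨s, s', by rw [he _ ih.1, hbc]⟩⟩
    have := hcl (b, s) ih.1
    rwa [hbc] at this

theorem Traces.congr (h : Traces T ε y ω) (hcl : ∀ x : Corner m, x.1 ∈ T → (ε x).1 ∈ T)
    (he : ∀ x : Corner m, x.1 ∈ T → ε' x = ε x) : Traces T ε' y ω where
  base := h.base
  conn v hv := (conn_congr hcl he h.base (h.conn v hv)).2
  period := by rw [iterate_face_congr hcl he h.base, h.period]
  minimal i h0 hi := by rw [iterate_face_congr hcl he h.base]; exact h.minimal i h0 hi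
  marks := by
    rw [marks_iff]
    intro i hi
    rw [iterate_face_congr hcl he h.base, he _ (face_mem_of_closed hcl h.base i)]
    exact (marks_iff _ _).1 h.marks i hi
  inner x hx := by
    refine (h.inner x hx).imp ?_ ?_
    · rintro ⟨i, hi, h'⟩
      exact ⟨i, hi, by rw [iterate_face_congr hcl he h.base, h']⟩
    · intro h'
      unfold Inner at h' ⊢
      rw [iterate_face_congr hcl he hx, h']

/-- The part of a gluing at a union of components. -/
theorem exists_restrict {S : Finset ℕ} (hg : IsGluing S ε)
    (hcl : ∀ x : Corner m, x.1 ∈ T → (ε x).1 ∈ T) :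
    ∃ ε₁ : Perm (Corner m), IsGluing T ε₁ ∧ (∀ x : Corner m, x.1 ∈ T → ε₁ x = ε x) ∧
      ∀ x : Corner m, x.1 ∉ T → ε₁ x = x := by
  classical
  let f : Corner m → Corner m := fun x => if x.1 ∈ T then ε x else x
  have f1 : ∀ x : Corner m, x.1 ∈ T → f x = ε x := fun x hx => if_pos hx
  have f2 : ∀ x : Corner m, x.1 ∉ T → f x = x := fun x hx => if_neg hx
  have hf : Function.Involutive f := by
    intro x
    by_cases hx : x.1 ∈ T
    · rw [f1 x hx, f1 _ (hcl x hx), hg.invol]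
    · rw [f2 x hx, f2 x hx]
  refine ⟨hf.toPerm, ⟨hf, ?_, ?_⟩, f1, f2⟩
  · intro x hx
    by_cases hxT : x.1 ∈ T
    · change f x ≠ x at hx
      change (f x).2 = _
      rw [f1 x hxT] at hx ⊢; exact hg.flip x hx
    · exact absurd (f2 x hxT) hx
  · intro x hx
    by_contra hxT
    exact hx (f2 x hxT)

/-- The disjoint union of two gluings. -/
theorem isGluing_mul {S : Finset ℕ} {ε₁ ε₂ : Perm (Corner m)} (hT : T ⊆ S)
    (h1 : IsGluing T ε₁) (h2 : IsGluing (S \ T) ε₂) :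
    IsGluing S (ε₁ * ε₂) ∧ (∀ x : Corner m, x.1 ∈ T → (ε₁ * ε₂) x = ε₁ x) ∧
      ∀ x : Corner m, x.1 ∉ T → (ε₁ * ε₂) x = ε₂ x := by
  have e1 : ∀ x : Corner m, x.1 ∈ T → (ε₁ * ε₂) x = ε₁ x := by
    intro x hx
    rw [Perm.mul_apply]
    congr 1
    by_contra hne
    exact (mem_sdiff.1 (h2.supp x hne)).2 hx
  have e2 : ∀ x : Corner m, x.1 ∉ T → (ε₁ * ε₂) x = ε₂ x := by
    intro x hx
    rw [Perm.mul_apply]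
    by_contra hne
    have h3 := h1.supp _ hne
    by_cases h4 : ε₂ x = x
    · rw [h4] at h3; exact hx h3
    · exact (mem_sdiff.1 (h2.supp' h4)).2 h3
  refine ⟨⟨?_, ?_, ?_⟩, e1, e2⟩
  · intro x
    by_cases hx : x.1 ∈ T
    · rw [e1 x hx, e1 _ (h1.mem hx), h1.invol]
    · rw [e2 x hx, e2, h2.invol]
      by_cases h4 : ε₂ x = x
      · rw [h4]; exact hx
      · exact (mem_sdiff.1 (h2.supp' h4)).2
  · intro x hx
    by_cases hxT : x.1 ∈ T
    · rw [e1 x hxT] at hx ⊢; exact h1.flip x hx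
    · rw [e2 x hxT] at hx ⊢; exact h2.flip x hx
  · intro x hx
    by_cases hxT : x.1 ∈ T
    · exact hT hxT
    · rw [e2 x hxT] at hx; exact (mem_sdiff.1 (h2.supp x hx)).1

end Local

section CutSeparating

variable {ε : Perm (Corner m)} {S : Finset ℕ} {y : Corner m} {s : Slot m}
  {r : List (Mark m)}

/-- If the boundary meets both sides of an edge, then cutting this edge disconnects the tiling, by
Euler's inequality. -/
theorem Realizes.cut_separating {w : Weight m}
    (hr : Realizes S ε y ((s, false) :: r)) (hn : Num S.card w ((s, false) :: r))
    {j : ℕ} (hj : j < r.length) (hjh : (face ε)^[j + 1] y = ε y) :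
    ∃ T ⊆ S, (∀ x : Corner m, x.1 ∈ T → (regraft ε y (ε y) x).1 ∈ T) ∧
      Traces T (regraft ε y (ε y)) y ((s, true) :: r.take j) ∧
      Traces (S \ T) (regraft ε y (ε y)) (ε y) ((s.flip, true) :: r.drop (j + 1)) := by
  classical
  have hg := hr.toIsGluing
  obtain ⟨h, hh⟩ : ∃ h, h = ε y := ⟨_, rfl⟩
  rw [← hh] at hjh ⊢
  have hys : y.2 = s := hr.marks.1
  have hne := hr.ne
  have hhs : h.2 = s.flip := by rw [hh, hg.flip y hne, hys]
  have hhy : ε h = y := by rw [hh, hg.invol]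
  have hhne : h ≠ y := by rw [hh]; exact hne
  have hyh : Twins ε y h := .inl ⟨hh.symm, hhy⟩
  have hhS : h.1 ∈ S := by rw [hh]; exact hg.mem hr.base
  have hper := hr.period
  have hmin := hr.minimal
  have hin := hr.inner
  rw [length_cons] at hper hmin hin
  set n := r.length + 1 with hn'
  obtain ⟨k, hk⟩ : ∃ k, k = j + 1 := ⟨_, rfl⟩
  rw [← hk] at hjh ⊢
  have hav : ∀ i, 0 < i → i < n → i ≠ k → (face ε)^[i] y ≠ y ∧ (face ε)^[i] y ≠ h := by
    intro i h0 hi hik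
    refine ⟨hmin i h0 hi, fun h' => hik ?_⟩
    rw [← hjh] at h'; exact iterate_injOn hmin hi (by omega) h'
  have hst : ∀ i, (face ε)^[k + i] y = (face ε)^[i] h := fun i => by
    rw [Nat.add_comm, iterate_add_apply, hjh]
  set ε' := regraft ε y h with hε'
  have hg' : IsGluing S ε' := hg.cut hh.symm
  have hyl : ε' y = y := by rw [hε', regraft_left, hhy]
  have hhl : ε' h = h := by rw [hε', regraft_right, hh]
  have a2 : ∀ i < k, (face ε')^[i] y = (face ε)^[i] y := fun i hi =>
    iterate_face_regraft hyh y i fun l h0 hl => hav l h0 (by omega) (by omega)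
  have a3 : (face ε')^[k] y = y := by
    rw [iterate_face_regraft_last hyh y k (by omega)
      fun l h0 hl => hav l h0 (by omega) (by omega), hjh, Equiv.swap_apply_right]
  have b1 : ∀ i, 0 < i → i < n - k → (face ε)^[i] h ≠ y ∧ (face ε)^[i] h ≠ h := by
    intro i h0 hi
    rw [← hst]; exact hav _ (by omega) (by omega) (by omega)
  have b2 : ∀ i < n - k, (face ε')^[i] h = (face ε)^[i] h := fun i hi =>
    iterate_face_regraft hyh h i fun l h0 hl => b1 l h0 (by omega)
  have b3 : (face ε')^[n - k] h = h := by
    rw [iterate_face_regraft_last hyh h (n - k) (by omega) b1, ← hst,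
      show k + (n - k) = n by omega, hper, Equiv.swap_apply_left]
  have hinner : ∀ x : Corner m, x.1 ∈ S → ¬ OnOrbit ε y n x → Inner ε' x := by
    intro x hx hxO
    have hxI := (hin x hx).resolve_left hxO
    have horb := not_onOrbit_iterate hper hxO
    refine inner_regraft hyh hxI fun i => ⟨fun h' => horb i ?_, fun h' => horb i ?_⟩
    · rw [h']; exact ⟨0, by omega, rfl⟩
    · rw [h']; exact ⟨k, by omega, hjh⟩
  have hcomp : ∀ v, ReflTransGen (Joined ε) y.1 v →
      ReflTransGen (Joined ε') y.1 v ∨ ReflTransGen (Joined ε') h.1 v := by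
    intro v hv
    induction hv with
    | refl => exact .inl .refl
    | @tail a b _ hab ih =>
      obtain ⟨t, t', hab⟩ := hab
      by_cases h1 : (a, t) = y
      · rw [h1, ← hh] at hab
        right
        rw [hab]
      · by_cases h2 : (a, t) = h
        · rw [h2, hhy] at hab
          left
          rw [hab]
        · have : Joined ε' a b := ⟨t, t', by rw [hε', regraft_of_ne h1 h2, hab]⟩
          exact ih.imp (fun h => h.tail this) (fun h => h.tail this)
  have hsep : ¬ ReflTransGen (Joined ε') y.1 h.1 := by
    intro hc
    have hyh1 : ∀ i, (face ε')^[i] y ≠ h := by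
      intro i h'
      obtain ⟨l, hl, e⟩ := onOrbit_iterate (x := y) a3 ⟨0, by omega, rfl⟩ i
      rw [h', a2 l hl] at e
      rcases Nat.eq_zero_or_pos l with rfl | h0
      · exact hhne e.symm
      · exact (hav l h0 (by omega) (by omega)).2 e
    have hhy1 : ∀ i, (face ε')^[i] h ≠ y := by
      intro i h'
      obtain ⟨l, hl, e⟩ := onOrbit_iterate (x := h) b3 ⟨0, by omega, rfl⟩ i
      rw [h', b2 l hl, ← hst] at e
      exact hmin (k + l) (by omega) (by omega) e
    have key := hg'.euler (fun v hv => (hcomp v (hr.conn v hv)).elim id hc.trans) hr.base (ι := Bool) (fun b => if b then y else h)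
      (by intro b; cases b <;> simp [hr.base, hhS])
      (by intro b; cases b <;> simp [hyl, hhl])
      (by
        intro b b' i hi
        cases b <;> cases b'
        · rfl
        · exact absurd hi (hhy1 i)
        · exact absurd hi (hyh1 i)
        · rfl)
      (Realizes.innerReps ε S y n) (by
        intro x hx
        obtain ⟨h1, h2, h3⟩ := Realizes.mem_reps.1 hx
        exact ⟨h1, hinner x h1 h2, h3⟩)
    have hcard := hr.card_innerReps
    rw [length_cons, ← hn'] at hcard
    rw [hcard, hn.sum_sub, Fintype.card_bool] at key
    have hleaf : ((S ×ˢ (univ : Finset (Slot m))).filter fun x => ε x = x).card + 2 ≤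
        ((S ×ˢ (univ : Finset (Slot m))).filter fun x => ε' x = x).card := by
      have h1 : y ∉ (S ×ˢ (univ : Finset (Slot m))).filter fun x => ε x = x := by simp [hne]
      have h2 : h ∉ insert y ((S ×ˢ (univ : Finset (Slot m))).filter fun x => ε x = x) := by
        simp only [Finset.mem_insert, mem_filter, not_or, not_and]
        exact ⟨hhne, fun _ h' => hhne (by rw [← h', hhy])⟩
      have h3 := Finset.card_insert_of_notMem h2
      rw [Finset.card_insert_of_notMem h1] at h3
      have e : ∀ k : ℕ, k + 2 = k + 1 + 1 := fun _ => rfl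
      rw [e, ← h3]
      refine card_le_card ?_
      intro x hx
      simp only [Finset.mem_insert, mem_filter, mem_product, mem_univ, and_true] at hx ⊢
      rcases hx with rfl | rfl | ⟨hx1, hx2⟩
      · exact ⟨hhS, hhl⟩
      · exact ⟨hr.base, hyl⟩
      · refine ⟨hx1, ?_⟩
        rw [hε', regraft_of_ne, hx2]
        · rintro rfl; exact hne hx2
        · rintro rfl; exact hhne (by rw [← hx2, hhy])
    rw [hr.card_leaves] at hleaf
    have := hn.2
    omega
  set T := S.filter fun v => ReflTransGen (Joined ε') y.1 v with hT
  have hTmem : ∀ v, v ∈ T ↔ v ∈ S ∧ ReflTransGen (Joined ε') y.1 v := fun v => by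
    rw [hT, mem_filter]
  have hTh : ∀ v, ReflTransGen (Joined ε') h.1 v → v ∉ T := by
    intro v hv hvT; exact hsep (((hTmem v).1 hvT).2.trans (hg'.joined_trans_symm hv))
  have hl1 : ((s, true) :: r.take j).length = k := by rw [length_cons, List.length_take]; omega
  have hl2 : ((s.flip, true) :: r.drop k).length = n - k := by
    rw [length_cons, List.length_drop]; omega
  refine ⟨T, Finset.filter_subset _ _, ?_, ⟨?_, ?_, ?_, ?_, ?_, ?_⟩, ⟨?_, ?_, ?_, ?_, ?_, ?_⟩⟩
  · intro x hx
    obtain ⟨h1, h2⟩ := (hTmem _).1 hx; exact (hTmem _).2 ⟨hg'.mem h1, h2.tail ⟨x.2, _, rfl⟩⟩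
  · exact (hTmem _).2 ⟨hr.base, .refl⟩
  · intro v hv; exact ((hTmem _).1 hv).2
  · rw [hl1, a3]
  · intro i h0 hi
    rw [hl1] at hi
    rw [a2 i hi]; exact (hav i h0 (by omega) (by omega)).1
  · rw [marks_iff]
    intro i hi
    have hi' : i < k := by rwa [hl1] at hi
    rw [a2 i hi']
    cases i with
    | zero => exact ⟨hys, by simp [hyl]⟩
    | succ i =>
      have h1 := hav (i + 1) (by omega) (by omega) (by omega)
      rw [hε', regraft_of_ne h1.1 h1.2]
      have := (marks_iff _ _).1 hr.marks (i + 1) (by simp only [length_cons]; omega)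
      simpa using this
  · intro x hx
    obtain ⟨h1, h2⟩ := (hTmem _).1 hx
    rw [hl1]
    by_cases hxO : OnOrbit ε y n x
    · left
      obtain ⟨i, hi, rfl⟩ := hxO
      rcases Nat.lt_or_ge i k with h' | h'
      · exact ⟨i, h', a2 i h'⟩
      · exfalso
        obtain ⟨l, rfl⟩ := Nat.exists_eq_add_of_le h'
        rw [hst, ← b2 l (by omega)] at hx; exact hTh _ (IsGluing.conn_iterate h l) hx
    · exact .inr (hinner x h1 hxO)
  · exact mem_sdiff.2 ⟨hhS, hTh _ .refl⟩
  · intro v hv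
    obtain ⟨h1, h2⟩ := mem_sdiff.1 hv
    exact (hcomp v (hr.conn v h1)).resolve_left fun h' => h2 ((hTmem _).2 ⟨h1, h'⟩)
  · rw [hl2, b3]
  · intro i h0 hi
    rw [hl2] at hi
    rw [b2 i hi]; exact (b1 i h0 hi).2
  · rw [marks_iff]
    intro i hi
    have hi' : i < n - k := by rwa [hl2] at hi
    rw [b2 i hi']
    cases i with
    | zero => exact ⟨hhs, by simp [hhl]⟩
    | succ i =>
      have h1 := b1 (i + 1) (by omega) hi'
      rw [hε', regraft_of_ne h1.1 h1.2]
      have := (marks_iff _ _).1 hr.marks (k + (i + 1)) (by simp only [length_cons]; omega)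
      rw [hst] at this
      have e : k + (i + 1) = (k + i) + 1 := by omega
      simp only [e, List.getElem_cons_succ] at this; simpa using this
  · intro x hx
    obtain ⟨h1, h2⟩ := mem_sdiff.1 hx
    rw [hl2]
    by_cases hxO : OnOrbit ε y n x
    · left
      obtain ⟨i, hi, rfl⟩ := hxO
      rcases Nat.lt_or_ge i k with h' | h'
      · exfalso
        rw [← a2 i h'] at h1 h2; exact h2 ((hTmem _).2 ⟨h1, IsGluing.conn_iterate y i⟩)
      · obtain ⟨l, rfl⟩ := Nat.exists_eq_add_of_le h'
        exact ⟨l, by omega, by rw [hst]; exact b2 l (by omega)⟩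
    · exact .inr (hinner x h1 hxO)

/-- Two tilings can be glued along a pair of leaves. -/
theorem Realizes.glue_separating {T : Finset ℕ} {h : Corner m} {r' : List (Mark m)}
    (hg : IsGluing S ε) (hTS : T ⊆ S) (hcl : ∀ x : Corner m, x.1 ∈ T → (ε x).1 ∈ T)
    (h1 : Traces T ε y ((s, true) :: r)) (h2 : Traces (S \ T) ε h ((s.flip, true) :: r')) :
    Realizes S (regraft ε y h) y ((s, false) :: (r ++ (s.flip, false) :: r')) ∧
      (face (regraft ε y h))^[r.length + 1] y = h := by
  have hyl : ε y = y := h1.marks.2.1.2 rfl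
  have hhl : ε h = h := h2.marks.2.1.2 rfl
  have hys : y.2 = s := h1.marks.1
  have hhs : h.2 = s.flip := h2.marks.1
  have hyS : y.1 ∈ S := hTS h1.base
  have hhST := mem_sdiff.1 h2.base
  have hhne : h ≠ y := by rintro rfl; exact hhST.2 h1.base
  have hyh : Twins ε y h := .inr ⟨hyl, hhl⟩
  have hcl' := hg.closed_sdiff hcl
  have hT : ∀ (x : Corner m), x.1 ∈ T → ∀ i, (face ε)^[i] x ≠ h := by
    intro x hx i h'
    have := face_mem_of_closed hcl hx i
    rw [h'] at this; exact hhST.2 this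
  have hST : ∀ (x : Corner m), x.1 ∈ S \ T → ∀ i, (face ε)^[i] x ≠ y := by
    intro x hx i h'
    have := face_mem_of_closed hcl' hx i
    rw [h'] at this; exact (mem_sdiff.1 this).2 h1.base
  have p1 := h1.period
  have p2 := h2.period
  have q1 := h1.minimal
  have q2 := h2.minimal
  rw [length_cons] at p1 p2 q1 q2
  set k := r.length + 1 with hk
  set l := r'.length + 1 with hl
  set ε' := regraft ε y h with hε'
  have hg' : IsGluing S ε' := hg.glue hyl hhl hyS hhST.1 (by rw [hhs, hys])
  have a1 : ∀ i, 0 < i → i < k → (face ε)^[i] y ≠ y ∧ (face ε)^[i] y ≠ h := fun i h0 hi =>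
    ⟨q1 i h0 hi, hT y h1.base i⟩
  have b1 : ∀ i, 0 < i → i < l → (face ε)^[i] h ≠ y ∧ (face ε)^[i] h ≠ h := fun i h0 hi =>
    ⟨hST h h2.base i, q2 i h0 hi⟩
  have a2 : ∀ i < k, (face ε')^[i] y = (face ε)^[i] y := fun i hi =>
    iterate_face_regraft hyh y i fun j h0 hj => a1 j h0 (by omega)
  have a3 : (face ε')^[k] y = h := by
    rw [iterate_face_regraft_last hyh y k (by omega) a1, p1, Equiv.swap_apply_left]
  have b2 : ∀ i < l, (face ε')^[i] h = (face ε)^[i] h := fun i hi =>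
    iterate_face_regraft hyh h i fun j h0 hj => b1 j h0 (by omega)
  have b3 : (face ε')^[l] h = y := by
    rw [iterate_face_regraft_last hyh h l (by omega) b1, p2, Equiv.swap_apply_right]
  have hst : ∀ i, (face ε')^[k + i] y = (face ε')^[i] h := fun i => by
    rw [Nat.add_comm, iterate_add_apply, a3]
  have hlen : ((s, false) :: (r ++ (s.flip, false) :: r')).length = k + l := by
    simp only [length_cons, length_append]; omega
  refine ⟨⟨hg', ⟨hyS, ?_, ?_, ?_, ?_, ?_⟩⟩, a3⟩
  · have hlift : ∀ a b, ReflTransGen (Joined ε) a b → ReflTransGen (Joined ε') a b :=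
      fun a b => conn_regraft (by rw [hyl]) (by rw [hhl])
    intro v hv
    by_cases hvT : v ∈ T
    · exact hlift _ _ (h1.conn v hvT)
    · refine ReflTransGen.trans ?_ (hlift _ _ (h2.conn v (mem_sdiff.2 ⟨hv, hvT⟩)))
      rw [← a3]; exact IsGluing.conn_iterate y k
  · rw [hlen, hst, b3]
  · intro i h0 hi
    rw [hlen] at hi
    rcases Nat.lt_or_ge i k with h' | h'
    · rw [a2 i h']; exact (a1 i h0 h').1
    · obtain ⟨j, rfl⟩ := Nat.exists_eq_add_of_le h'
      rw [hst]
      rcases Nat.eq_zero_or_pos j with rfl | hj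
      · exact hhne
      · rw [b2 j (by omega)]; exact (b1 j hj (by omega)).1
  · rw [← cons_append, marks_append]
    constructor
    · rw [marks_iff]
      intro i hi
      have hi' : i < k := by rwa [length_cons] at hi
      rw [a2 i hi']
      cases i with
      | zero =>
        refine ⟨hys, ?_⟩
        have : ε' y ≠ y := by rw [hε', regraft_left, hhl]; exact hhne
        simp [this]
      | succ i =>
        have h3 := a1 (i + 1) (by omega) hi'
        rw [hε', regraft_of_ne h3.1 h3.2]; exact (marks_iff _ _).1 h1.marks (i + 1) hi
    · rw [length_cons, ← hk, a3, marks_iff]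
      intro i hi
      have hi' : i < l := by rwa [length_cons] at hi
      rw [b2 i hi']
      cases i with
      | zero =>
        refine ⟨hhs, ?_⟩
        have : ε' h ≠ h := by rw [hε', regraft_right, hyl]; exact hhne.symm
        simp [this]
      | succ i =>
        have h3 := b1 (i + 1) (by omega) hi'
        rw [hε', regraft_of_ne h3.1 h3.2]; exact (marks_iff _ _).1 h2.marks (i + 1) hi
  · intro x hx
    rw [hlen]
    by_cases hxT : x.1 ∈ T
    · by_cases hxO : OnOrbit ε y k x
      · obtain ⟨i, hi, rfl⟩ := hxO; exact .inl ⟨i, by omega, a2 i hi⟩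
      · right
        have hxI := (h1.inner x hxT).resolve_left hxO
        refine inner_regraft hyh hxI fun i => ⟨fun h' => ?_, hT x hxT i⟩
        exact not_onOrbit_iterate p1 hxO i ⟨0, by omega, h'.symm⟩
    · have hxST := mem_sdiff.2 ⟨hx, hxT⟩
      by_cases hxO : OnOrbit ε h l x
      · obtain ⟨i, hi, rfl⟩ := hxO; exact .inl ⟨k + i, by omega, by rw [hst]; exact b2 i hi⟩
      · right
        have hxI := (h2.inner x hxST).resolve_left hxO
        refine inner_regraft hyh hxI fun i => ⟨hST x hxST i, fun h' => ?_⟩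
        exact not_onOrbit_iterate p2 hxO i ⟨0, by omega, h'.symm⟩

theorem num_add {a b : ℕ} {u v : Weight m} {r r' : List (Mark m)}
    (h1 : Num a u ((s, true) :: r)) (h2 : Num b v ((s.flip, true) :: r')) :
    Num (a + b) (u + v) ((s, false) :: (r ++ (s.flip, false) :: r')) := by
  refine ⟨fun i => ?_, ?_⟩
  · have e1 := h1.1 i
    have e2 := h2.1 i
    simp only [map_cons, map_append, List.count_cons, List.count_append,
      Finsupp.add_apply] at e1 e2 ⊢
    omega
  · have e1 := h1.2
    have e2 := h2.2
    have e3 : ∑ i, (u + v : Weight m) i = ∑ i, u i + ∑ i, v i := by simp [sum_add_distrib]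
    rw [e3]
    simp only [List.countP_cons, countP_append, Nat.mul_add] at e1 e2 ⊢
    simp at e1 e2 ⊢; omega

theorem num_unique {d : ℕ} {u v : Weight m} {ω : List (Mark m)}
    (h1 : Num d u ω) (h2 : Num d v ω) : u = v := by
  ext i
  have := h1.1 i
  have := h2.1 i
  omega

/-- The pieces of a planar tiling are planar. -/
theorem exists_num {T : Finset ℕ} (hTS : T ⊆ S) {w : Weight m}
    {ε₁ ε₂ : Perm (Corner m)} {y h : Corner m} {r r' : List (Mark m)}
    (h1 : Realizes T ε₁ y ((s, true) :: r)) (h2 : Realizes (S \ T) ε₂ h ((s.flip, true) :: r'))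
    (hn : Num S.card w ((s, false) :: (r ++ (s.flip, false) :: r'))) :
    ∃ u v, u + v = w ∧ Num T.card u ((s, true) :: r) ∧
      Num (S \ T).card v ((s.flip, true) :: r') := by
  have hc : T.card + (S \ T).card = S.card := by
    rw [add_comm, Finset.card_sdiff_add_card_eq_card hTS]
  let u : Weight m := Finsupp.equivFunOnFinite.symm fun i =>
    T.card - (((s, true) :: r).map Prod.fst).count (rep i)
  let v : Weight m := Finsupp.equivFunOnFinite.symm fun i =>
    (S \ T).card - (((s.flip, true) :: r').map Prod.fst).count (rep i)
  have hu : ∀ i, u i + (((s, true) :: r).map Prod.fst).count (rep i) = T.card :=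
    fun i => Nat.sub_add_cancel (h1.count_le _)
  have hv : ∀ i, v i + (((s.flip, true) :: r').map Prod.fst).count (rep i) = (S \ T).card :=
    fun i => Nat.sub_add_cancel (h2.count_le _)
  have huv : u + v = w := by
    ext i
    have e1 := hu i
    have e2 := hv i
    have e3 := hn.1 i
    simp only [map_cons, map_append, List.count_cons, List.count_append,
      Finsupp.add_apply] at e1 e2 e3 ⊢
    omega
  have e1 := h1.euler_le (h1.marks.2.1.2 rfl)
  have e2 := h2.euler_le (h2.marks.2.1.2 rfl)
  have e3 := hn.2
  have s3 : ∑ i, w i = ∑ i, u i + ∑ i, v i := by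
    rw [← huv]
    simp [sum_add_distrib]
  change _ + 2 * ∑ i, u i ≤ _ at e1
  change _ + 2 * ∑ i, v i ≤ _ at e2
  rw [s3, ← hc] at e3
  refine ⟨u, v, huv, ⟨hu, ?_⟩, ⟨hv, ?_⟩⟩ <;>
  · simp only [List.countP_cons, countP_append, Nat.mul_add] at e1 e2 e3 ⊢
    simp at e1 e2 e3 ⊢; omega

end CutSeparating

open Classical in
/-- The tilings in which the boundary meets the edge at `y` a second time after `j + 1` steps. -/
theorem ncard_cut_separating (S : Finset ℕ) (w : Weight m) (s : Slot m)
    (r r' : List (Mark m)) :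
    {p ∈ labeled S w ((s, false) :: (r ++ (s.flip, false) :: r')) |
      (face p.1)^[r.length + 1] p.2 = p.1 p.2}.ncard =
    ∑ p ∈ antidiagonal w, ∑ T ∈ S.powerset, (labeled T p.1 ((s, true) :: r)).ncard *
        (labeled (S \ T) p.2 ((s.flip, true) :: r')).ncard := by
  let A : Weight m × Finset ℕ → Finset (Perm (Corner m) × (Corner m)) :=
    fun i => (finite_labeled i.2 i.1 ((s, true) :: r)).toFinset
  let B : Weight m × Finset ℕ → Finset (Perm (Corner m) × (Corner m)) :=
    fun i => (finite_labeled i.2 i.1 ((s.flip, true) :: r')).toFinset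
  have hfin : {p ∈ labeled S w ((s, false) :: (r ++ (s.flip, false) :: r')) |
      (face p.1)^[r.length + 1] p.2 = p.1 p.2}.Finite :=
    (finite_labeled _ _ _).subset fun _ h => h.1
  have hR : ∑ p ∈ antidiagonal w, ∑ T ∈ S.powerset, (labeled T p.1 ((s, true) :: r)).ncard *
        (labeled (S \ T) p.2 ((s.flip, true) :: r')).ncard =
      ((antidiagonal w ×ˢ S.powerset).sigma
        fun i => A (i.1.1, i.2) ×ˢ B (i.1.2, S \ i.2)).card := by
    rw [Finset.card_sigma, Finset.sum_product]
    refine sum_congr rfl fun p _ => sum_congr rfl fun T _ => ?_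
    rw [Finset.card_product, Set.ncard_eq_toFinset_card _ (finite_labeled _ _ _),
      Set.ncard_eq_toFinset_card _ (finite_labeled _ _ _)]
  rw [hR, Set.ncard_eq_toFinset_card _ hfin]
  symm
  refine Finset.card_bij (fun q _ => (regraft (q.2.1.1 * q.2.2.1) q.2.1.2 q.2.2.2, q.2.1.2))
    ?_ ?_ ?_
  · rintro ⟨⟨⟨u, v⟩, T⟩, ⟨⟨ε₁, y⟩, ⟨ε₂, h⟩⟩⟩ hq
    simp only [mem_sigma, mem_product, mem_powerset,
      mem_antidiagonal, A, B, Set.Finite.mem_toFinset] at hq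
    obtain ⟨⟨rfl, hTS⟩, ⟨n1, h1⟩, ⟨n2, h2⟩⟩ := hq
    simp only at h1 h2 n1 n2
    obtain ⟨g1, g2, g3⟩ := isGluing_mul hTS h1.toIsGluing h2.toIsGluing
    have hcl : ∀ x : Corner m, x.1 ∈ T → ((ε₁ * ε₂) x).1 ∈ T := fun x hx => by
      rw [g2 x hx]; exact h1.mem hx
    obtain ⟨k1, k2⟩ := Realizes.glue_separating g1 hTS hcl
      (h1.toTraces.congr (fun x hx => h1.mem hx) g2)
      (h2.toTraces.congr (fun x hx => h2.mem hx)
        (fun x hx => g3 x (mem_sdiff.1 hx).2))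
    have hc : T.card + (S \ T).card = S.card := by
      rw [add_comm, Finset.card_sdiff_add_card_eq_card hTS]
    simp only [Set.Finite.mem_toFinset]
    refine ⟨⟨?_, k1⟩, ?_⟩
    · have := num_add n1 n2
      rwa [hc] at this
    · change (face _)^[r.length + 1] y = _
      rw [k2]
      change h = regraft (ε₁ * ε₂) y h y
      rw [regraft_left, g3 h (mem_sdiff.1 h2.base).2]; exact (h2.marks.2.1.2 rfl).symm
  · rintro ⟨⟨⟨u, v⟩, T⟩, ⟨⟨ε₁, y⟩, ⟨ε₂, h⟩⟩⟩ hq ⟨⟨⟨u', v'⟩, T'⟩, ⟨⟨ε₁', y'⟩, ⟨ε₂', h'⟩⟩⟩ hq' heq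
    simp only [mem_sigma, mem_product, mem_powerset,
      mem_antidiagonal, A, B, Set.Finite.mem_toFinset] at hq hq'
    obtain ⟨⟨huv, hTS⟩, ⟨n1, h1⟩, ⟨n2, h2⟩⟩ := hq
    obtain ⟨⟨huv', hTS'⟩, ⟨n1', h1'⟩, ⟨n2', h2'⟩⟩ := hq'
    simp only [Prod.mk.injEq] at heq h1 h2 h1' h2' n1 n2 n1' n2' huv huv'
    obtain ⟨heq, rfl⟩ := heq
    obtain ⟨g1, g2, g3⟩ := isGluing_mul hTS h1.toIsGluing h2.toIsGluing
    obtain ⟨g1', g2', g3'⟩ := isGluing_mul hTS' h1'.toIsGluing h2'.toIsGluing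
    have l1 : (ε₁ * ε₂) h = h := by rw [g3 h (mem_sdiff.1 h2.base).2]; exact h2.marks.2.1.2 rfl
    have l1' : (ε₁' * ε₂') h' = h' := by
      rw [g3' h' (mem_sdiff.1 h2'.base).2]; exact h2'.marks.2.1.2 rfl
    have hhh : h = h' := by
      have := congrArg (fun e : Perm (Corner m) => e y) heq
      simp only [regraft_left] at this; rwa [l1, l1'] at this
    subst hhh
    have hε : ε₁ * ε₂ = ε₁' * ε₂' := by rw [← regraft_regraft (ε₁ * ε₂) y h, heq, regraft_regraft]
    have hT : ∀ (T : Finset ℕ) (ε₁ ε : Perm (Corner m)),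
        Realizes T ε₁ y ((s, true) :: r) → (∀ x : Corner m, x.1 ∈ T → ε x = ε₁ x) →
        ∀ v, v ∈ T ↔ ReflTransGen (Joined ε) y.1 v := by
      intro T ε₁ ε h1 g2 v
      constructor
      · exact fun hv => (conn_congr (fun x hx => h1.mem hx) g2 h1.base (h1.conn v hv)).2
      · exact fun hv => (conn_congr (ε' := ε) (fun x hx => by rw [g2 x hx]; exact h1.mem hx)
          (fun _ _ => rfl) h1.base hv).1
    have hTT : T = T' := by
      ext v
      rw [hT T ε₁ _ h1 g2, hT T' ε₁' _ h1' g2', hε]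
    subst hTT
    obtain rfl := num_unique n1 n1'
    obtain rfl := num_unique n2 n2'
    have e1 : ε₁ = ε₁' := by
      ext1 x
      by_cases hx : x.1 ∈ T
      · rw [← g2 x hx, ← g2' x hx, hε]
      · have e1 : ε₁ x = x := by_contra fun hne => hx (h1.supp x hne)
        have e2 : ε₁' x = x := by_contra fun hne => hx (h1'.supp x hne)
        rw [e1, e2]
    have e2 : ε₂ = ε₂' := by
      ext1 x
      by_cases hx : x.1 ∈ T
      · have e1 : ε₂ x = x := by_contra fun hne => (mem_sdiff.1 (h2.supp x hne)).2 hx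
        have e2 : ε₂' x = x := by_contra fun hne => (mem_sdiff.1 (h2'.supp x hne)).2 hx
        rw [e1, e2]
      · rw [← g3 x hx, ← g3' x hx, hε]
    rw [e1, e2]
  · rintro ⟨ε, y⟩ hp
    simp only [Set.Finite.mem_toFinset] at hp
    obtain ⟨⟨hn, hr⟩, hj⟩ := hp
    simp only at hn hr hj
    have hlen : r.length < (r ++ (s.flip, false) :: r').length := by simp
    obtain ⟨T, hTS, hcl, t1, t2⟩ := hr.cut_separating hn hlen hj
    have htake : (r ++ (s.flip, false) :: r').take r.length = r := List.take_left' rfl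
    have hdrop : (r ++ (s.flip, false) :: r').drop (r.length + 1) = r' := by
      rw [List.drop_append, List.drop_eq_nil_of_le (by omega)]; simp
    rw [htake] at t1
    rw [hdrop] at t2
    have hne := hr.ne
    have hg' : IsGluing S (regraft ε y (ε y)) := hr.toIsGluing.cut rfl
    have hcl' := hg'.closed_sdiff hcl
    obtain ⟨ε₁, g1, a1, b1⟩ := exists_restrict hg' hcl
    obtain ⟨ε₂, g2, a2, b2⟩ := exists_restrict hg' hcl'
    have r1 : Realizes T ε₁ y ((s, true) :: r) := ⟨g1, t1.congr hcl a1⟩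
    have r2 : Realizes (S \ T) ε₂ (ε y) ((s.flip, true) :: r') := ⟨g2, t2.congr hcl' a2⟩
    obtain ⟨u, v, huv, n1, n2⟩ := exists_num hTS r1 r2 hn
    obtain ⟨g3, a3, b3⟩ := isGluing_mul hTS g1 g2
    have hε : ε₁ * ε₂ = regraft ε y (ε y) := by
      ext1 x
      by_cases hx : x.1 ∈ T
      · rw [a3 x hx, a1 x hx]
      · rw [b3 x hx]
        by_cases hxS : x.1 ∈ S
        · exact a2 x (mem_sdiff.2 ⟨hxS, hx⟩)
        · rw [b2 x fun h' => hxS (mem_sdiff.1 h').1]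
          symm
          by_contra hne
          exact hxS (hg'.supp x hne)
    refine ⟨⟨((u, v), T), ((ε₁, y), (ε₂, ε y))⟩, ?_, ?_⟩
    · simp only [mem_sigma, mem_product, mem_powerset,
        mem_antidiagonal, A, B, Set.Finite.mem_toFinset]
      exact ⟨⟨huv, hTS⟩, ⟨n1, r1⟩, ⟨n2, r2⟩⟩
    · simp only [hε, regraft_regraft]

section Antidiagonal

variable {ι R : Type*} [DecidableEq ι] [AddCommMonoid R]

open Classical in
theorem sum_antidiagonal_ite_eq (w e u : ι →₀ ℕ) (h : w = u + e) (f : (ι →₀ ℕ) → R) :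
    (∑ p ∈ antidiagonal w, if p.2 = e then f p.1 else 0) = f u := by
  rw [Finset.sum_eq_single (u, e), if_pos rfl]
  · intro p hp hne
    refine if_neg fun h' => hne ?_
    have hp' := mem_antidiagonal.1 hp
    rw [h', h] at hp'; exact Prod.ext (add_right_cancel hp') h'
  · intro h'; exact absurd (mem_antidiagonal.2 h.symm) h'

open Classical in
theorem sum_antidiagonal_ite_of_not_le (w e : ι →₀ ℕ) (h : ¬ e ≤ w) (f : (ι →₀ ℕ) → R) :
    (∑ p ∈ antidiagonal w, if p.2 = e then f p.1 else 0) = 0 := by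
  refine sum_eq_zero fun p hp => if_neg fun h' => h ?_
  have hp' := mem_antidiagonal.1 hp
  rw [h'] at hp'
  exact hp' ▸ le_add_self

end Antidiagonal

open Classical in
/-- The cut equation for the numbers of tilings with numbered vertices. -/
theorem ncard_labeled_cut (S : Finset ℕ) (w : Weight m) (s : Slot m) (r : List (Mark m)) :
    (labeled S w ((s, false) :: r)).ncard =
    (∑ p ∈ antidiagonal w, if p.2 = Finsupp.single s.flip.typeIdx 1 then
        (labeled S p.1 ((s, true) :: r ++ stretch s.flip s.flip.period)).ncard else 0) +
    ∑ j ∈ range r.length, if r[j]? = some (s.flip, false) then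
      ∑ p ∈ antidiagonal w, ∑ T ∈ S.powerset, (labeled T p.1 ((s, true) :: r.take j)).ncard *
          (labeled (S \ T) p.2 ((s.flip, true) :: r.drop (j + 1))).ncard
      else 0 := by
  let F := (finite_labeled S w ((s, false) :: r)).toFinset
  have hF : ∀ p, p ∈ F ↔ p ∈ labeled S w ((s, false) :: r) := fun p => by simp [F]
  rw [Set.ncard_eq_toFinset_card _ (finite_labeled S w ((s, false) :: r)),
    ← Finset.card_filter_add_card_filter_not
      (p := fun p : Perm (Corner m) × (Corner m) => ¬ OnOrbit p.1 p.2 (r.length + 1) (p.1 p.2))]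
  congr 1
  · have e : ((F.filter fun p => ¬ OnOrbit p.1 p.2 (r.length + 1) (p.1 p.2)) :
        Set (Perm (Corner m) × (Corner m))) =
        {p ∈ labeled S w ((s, false) :: r) | ¬ OnOrbit p.1 p.2 (r.length + 1) (p.1 p.2)} := by
      ext p; simp [hF]
    change (F.filter fun p => ¬ OnOrbit p.1 p.2 (r.length + 1) (p.1 p.2)).card = _
    rw [← Set.ncard_coe_finset, e]
    by_cases hw : Finsupp.single s.flip.typeIdx 1 ≤ w
    · obtain ⟨u, hu⟩ := exists_add_of_le hw
      rw [sum_antidiagonal_ite_eq w _ u (by rw [hu, add_comm])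
        fun u => (labeled S u ((s, true) :: r ++ stretch s.flip s.flip.period)).ncard]
      rw [hu, add_comm, ncard_cut_inner]
    · rw [sum_antidiagonal_ite_of_not_le w _ hw
        fun u => (labeled S u ((s, true) :: r ++ stretch s.flip s.flip.period)).ncard,
        Set.ncard_eq_zero ((finite_labeled _ _ _).subset fun _ h => h.1)]
      rw [Set.eq_empty_iff_forall_notMem]
      rintro ⟨ε, y⟩ ⟨⟨h1, h2⟩, h3⟩
      exact hw (single_le_of_cut_inner h2 h1 h3)
  · simp only [not_not]
    have e : (F.filter fun p => OnOrbit p.1 p.2 (r.length + 1) (p.1 p.2)) =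
        (range r.length).biUnion fun j => F.filter fun p => (face p.1)^[j + 1] p.2 = p.1 p.2 := by
      ext ⟨ε, y⟩
      rw [Finset.mem_biUnion]
      constructor
      · intro hpi
        obtain ⟨hp, i, hi, h⟩ := mem_filter.1 hpi
        have hr := ((hF _).1 hp).2
        have hne := hr.ne
        cases i with
        | zero => exact absurd h.symm hne
        | succ i => exact ⟨i, mem_range.2 (by omega), mem_filter.2 ⟨hp, h⟩⟩
      · rintro ⟨j, hj, hpj⟩
        obtain ⟨hp, h⟩ := mem_filter.1 hpj
        exact mem_filter.2 ⟨hp, j + 1, Nat.succ_lt_succ (mem_range.1 hj), h⟩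
    change (F.filter fun p => OnOrbit p.1 p.2 (r.length + 1) (p.1 p.2)).card = _
    rw [e, Finset.card_biUnion]
    · refine sum_congr rfl fun j hj => ?_
      have hj' := mem_range.1 hj
      have e : ((F.filter fun p => (face p.1)^[j + 1] p.2 = p.1 p.2) :
          Set (Perm (Corner m) × (Corner m))) =
          {p ∈ labeled S w ((s, false) :: r) | (face p.1)^[j + 1] p.2 = p.1 p.2} := by
        ext p; exact mem_filter.trans (and_congr_left' (hF p))
      rw [← Set.ncard_coe_finset, e]
      split_ifs with hjr
      · have hsplit : r = r.take j ++ (s.flip, false) :: r.drop (j + 1) := by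
          conv_lhs => rw [← List.take_append_drop j r]
          rw [List.drop_eq_getElem_cons hj']
          rw [List.getElem?_eq_getElem hj'] at hjr
          rw [Option.some.inj hjr]
        have := ncard_cut_separating S w s (r.take j) (r.drop (j + 1))
        rwa [← hsplit, List.length_take, min_eq_left hj'.le] at this
      · rw [Set.ncard_eq_zero ((finite_labeled _ _ _).subset fun _ h => h.1),
          Set.eq_empty_iff_forall_notMem]
        rintro ⟨ε, y⟩ ⟨⟨h1, h2⟩, h3⟩
        apply hjr
        simp only at h1 h2 h3
        have hg := h2.toIsGluing
        have hys : y.2 = s := h2.marks.1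
        have hne := h2.ne
        have hm := (marks_iff _ _).1 h2.marks (j + 1) (by simpa using hj')
        rw [h3, hg.flip y hne, hys, hg.invol, List.getElem_cons_succ] at hm
        rw [List.getElem?_eq_getElem hj']
        congr 1
        refine Prod.ext hm.1.symm ?_
        have : ¬ y = ε y := fun h => hne h.symm
        simpa [this] using hm.2
    · intro i hi j hj hij
      rw [Function.onFun, disjoint_left]
      rintro ⟨ε, y⟩ h1 h2
      obtain ⟨hp, h1⟩ := mem_filter.1 h1
      obtain ⟨-, h2⟩ := mem_filter.1 h2
      have hr := ((hF _).1 hp).2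
      apply hij
      have := iterate_injOn hr.minimal (i := i + 1) (j := j + 1) (by simpa using hi)
        (by simpa using hj) (h1.trans h2.symm)
      omega

/-! ### Decorated graphs and tilings -/

theorem Slot.sector_cases (s : Slot m) : (s.sector = .U₁ ∧ (s.typeIdx : ℕ) = 1 ∧ s.across = s) ∨
    (s.sector = .Uₘ ∧ (s.typeIdx : ℕ) = m ∧ s.across = s) ∨
    (∃ h : 2 ≤ (s.typeIdx : ℕ) ∧ (s.typeIdx : ℕ) < m, s.across ≠ s ∧
      ((s.sector = .R _ h ∧ s.across.sector = .L _ h) ∨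
        (s.sector = .L _ h ∧ s.across.sector = .R _ h))) := by
  have h3 := hm.out
  rcases s with ⟨k, hk⟩ | ⟨k, hk⟩ <;> have hk' := mem_Ico.1 hk
  · by_cases h : k = 1
    · left
      subst h
      simp [sector, typeIdx, across, next, flip]
    · refine .inr (.inr ⟨by simp only [typeIdx]; omega, ?_, .inr ⟨?_, ?_⟩⟩)
      · simp [across, next, flip, h]
      · simp [sector, h, typeIdx]
      · have h1 : k - 1 ≠ m - 1 := by omega
        simp only [across, next, flip, sector, h, h1, dite_false, typeIdx]
        congr 1; omega
  · by_cases h : k = m - 1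
    · refine .inr (.inl ?_)
      subst h
      simp only [sector, typeIdx, across, next, flip, dite_true, true_and, and_true]; omega
    · refine .inr (.inr ⟨by simp only [typeIdx]; omega, ?_, .inl ⟨?_, ?_⟩⟩)
      · simp [across, next, flip, h]
      · simp [sector, h, typeIdx]
      · have h1 : k ≠ 0 := by omega
        simp [across, next, flip, sector, h, h1, typeIdx]

namespace DecoratedGraph

variable {n d : ℕ}

/-- The half-edges at the internal vertices, whose vertices become natural numbers. -/
def up (x : Fin d × Slot m) : Corner m := (x.1, x.2)

theorem up_injective : Injective (up (m := m) (d := d)) := by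
  rintro ⟨a, s⟩ ⟨b, t⟩ h
  simp only [up, Prod.mk.injEq] at h
  exact Prod.ext (Fin.ext h.1) h.2

theorem exists_up {x : Corner m} (h : x.1 ∈ range d) : ∃ z : Fin d × Slot m, up z = x :=
  ⟨(⟨x.1, mem_range.1 h⟩, x.2), rfl⟩

theorem up_mem (z : Fin d × Slot m) : (up z).1 ∈ range d := mem_range.2 z.1.2

variable (Γ : DecoratedGraph m n d)

/-- The half-edge at an internal vertex that is joined to the leaf `j`. -/
def leafEnd (j : Fin n) : Fin d × Slot m := (Γ.edge_inr j).choose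

theorem edge_leaf (j : Fin n) : Γ.edge (.inr j) = .inl (Γ.leafEnd j) := (Γ.edge_inr j).choose_spec

theorem edge_leafEnd (j : Fin n) : Γ.edge (.inl (Γ.leafEnd j)) = .inr j := by
  rw [← edge_leaf, Γ.edge_edge]

theorem leafEnd_injective : Injective Γ.leafEnd := by
  intro i j h
  have := Γ.edge_leafEnd i
  rw [h, edge_leafEnd] at this
  exact Sum.inr_injective this.symm

theorem eq_leafEnd {z : Fin d × Slot m} {j : Fin n} (h : Γ.edge (.inl z) = .inr j) :
    z = Γ.leafEnd j := by
  have := Γ.edge_edge (.inl z)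
  rw [h, edge_leaf] at this
  exact (Sum.inl_injective this).symm

/-- The involution `glue` on half-edges, before it is bundled. -/
def glueFun (x : Corner m) : Corner m :=
  if h : x.1 < d then (Γ.edge (.inl (⟨x.1, h⟩, x.2))).elim up (fun _ => x) else x

theorem glueFun_up (z : Fin d × Slot m) :
    Γ.glueFun (up z) = (Γ.edge (.inl z)).elim up (fun _ => up z) := by
  unfold glueFun
  rw [dif_pos (mem_range.1 (up_mem z))]
  rfl

theorem glueFun_glueFun (x : Corner m) : Γ.glueFun (Γ.glueFun x) = x := by
  by_cases h : x.1 < d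
  · obtain ⟨z, rfl⟩ := exists_up (d := d) (mem_range.2 h)
    rw [glueFun_up]
    rcases he : Γ.edge (.inl z) with z' | j
    · simp only [Sum.elim_inl]
      rw [glueFun_up, ← he, Γ.edge_edge]; rfl
    · simp only [Sum.elim_inr]
      rw [glueFun_up, he]; rfl
  · have : Γ.glueFun x = x := dif_neg h
    rw [this, this]

/-- The involution on the half-edges at internal vertices that exchanges the halves of each edge
between internal vertices and fixes the edges that lead to leaves. -/
def glue : Perm (Corner m) := Function.Involutive.toPerm Γ.glueFun Γ.glueFun_glueFun

theorem glue_up (z : Fin d × Slot m) :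
    Γ.glue (up z) = (Γ.edge (.inl z)).elim up (fun _ => up z) := Γ.glueFun_up z

theorem glue_of_inl {z z' : Fin d × Slot m} (h : Γ.edge (.inl z) = .inl z') :
    Γ.glue (up z) = up z' := by rw [glue_up, h]; rfl

theorem ne_of_inl {z z' : Fin d × Slot m} (h : Γ.edge (.inl z) = .inl z') : z' ≠ z := by
  rintro rfl
  exact flip_ne _ (Γ.edge_inl _ _ _ _ h).symm

theorem glue_leafEnd (j : Fin n) : Γ.glue (up (Γ.leafEnd j)) = up (Γ.leafEnd j) := by
  rw [glue_up, edge_leafEnd]; rfl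

theorem glue_eq_self_iff (z : Fin d × Slot m) : Γ.glue (up z) = up z ↔ ∃ j, z = Γ.leafEnd j := by
  constructor
  · intro h
    rcases he : Γ.edge (.inl z) with z' | j
    · rw [Γ.glue_of_inl he] at h; exact absurd (up_injective h) (Γ.ne_of_inl he)
    · exact ⟨j, Γ.eq_leafEnd he⟩
  · rintro ⟨j, rfl⟩
    exact Γ.glue_leafEnd j

theorem edge_of_glue_ne {z : Fin d × Slot m} (h : Γ.glue (up z) ≠ up z) :
    ∃ z', Γ.edge (.inl z) = .inl z' ∧ Γ.glue (up z) = up z' := by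
  rcases he : Γ.edge (.inl z) with z' | j
  · exact ⟨z', rfl, Γ.glue_of_inl he⟩
  · exact absurd ((Γ.glue_eq_self_iff z).2 ⟨j, Γ.eq_leafEnd he⟩) h

theorem glue_of_not_mem {x : Corner m} (h : x.1 ∉ range d) : Γ.glue x = x :=
  dif_neg fun h' => h (mem_range.2 h')

theorem isGluing_glue : IsGluing (range d) Γ.glue where
  invol := Γ.glueFun_glueFun
  flip := fun x hx => by
    have hm : x.1 ∈ range d := by_contra fun h => hx (Γ.glue_of_not_mem h)
    obtain ⟨z, rfl⟩ := exists_up hm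
    obtain ⟨z', h1, h2⟩ := Γ.edge_of_glue_ne hx
    rw [h2]; exact Γ.edge_inl _ _ _ _ h1
  supp := fun x hx => by_contra fun h => hx (Γ.glue_of_not_mem h)

/-- The half-edge at an internal vertex that a sector of a graph begins with, where a sector at a
leaf stands for the internal end of the edge at the leaf. -/
def land : HalfEdge m n d → Corner m := Sum.elim up fun j => up (Γ.leafEnd j)

theorem nextSector_inl (z : Fin d × Slot m) :
    Γ.nextSector (.inl z) = Γ.edge (.inl (z.1, z.2.next)) := rfl

theorem nextSector_inr (j : Fin n) :
    Γ.nextSector (.inr j) = .inl (Γ.leafEnd ((finRotate n).symm j)) := Γ.edge_leaf _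

theorem face_glue (z : Fin d × Slot m) : face Γ.glue (up z) = Γ.land (Γ.nextSector (.inl z)) := by
  rw [nextSector_inl]
  change Γ.glue (up (z.1, z.2.next)) = _
  rw [glue_up]
  rcases he : Γ.edge (.inl (z.1, z.2.next)) with z' | j
  · rfl
  · simp only [Sum.elim_inr, land]
    rw [Γ.eq_leafEnd he]

theorem glue_ne_of_nextSector {z z' : Fin d × Slot m} (h : Γ.nextSector (.inl z) = .inl z') :
    Γ.glue (up z') ≠ up z' := by
  intro h'
  obtain ⟨j, rfl⟩ := (Γ.glue_eq_self_iff z').1 h'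
  rw [nextSector_inl] at h
  have := Γ.edge_edge (.inl (z.1, z.2.next))
  rw [h, edge_leafEnd] at this
  exact Sum.inr_ne_inl this

theorem nextSector_of_ne {z : Fin d × Slot m}
    (h : Γ.glue (face Γ.glue (up z)) ≠ face Γ.glue (up z)) :
    ∃ z', Γ.nextSector (.inl z) = .inl z' ∧ face Γ.glue (up z) = up z' := by
  rw [face_glue] at h ⊢
  rcases he : Γ.nextSector (.inl z) with z' | j
  · exact ⟨z', rfl, rfl⟩
  · rw [he] at h; exact absurd (Γ.glue_leafEnd j) h

theorem nextSector_of_eq {z : Fin d × Slot m}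
    (h : Γ.glue (face Γ.glue (up z)) = face Γ.glue (up z)) :
    ∃ j, Γ.nextSector (.inl z) = .inr j ∧ face Γ.glue (up z) = up (Γ.leafEnd j) := by
  rcases he : Γ.nextSector (.inl z) with z' | j
  · rw [face_glue, he] at h; exact absurd h (Γ.glue_ne_of_nextSector he)
  · exact ⟨j, rfl, by rw [face_glue, he]; rfl⟩

theorem reads_cons_iff (z : Fin d × Slot m) (a : Arrow m) (w : List (Arrow m)) :
    Γ.Reads (.inl z) (a :: w) ↔ a = z.2.sector ∧ Γ.Reads (Γ.nextSector (.inl z)) w := by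
  obtain ⟨v, t⟩ := z
  constructor
  · intro h
    cases h with
    | sector _ _ _ h => exact ⟨rfl, h⟩
  · rintro ⟨rfl, h⟩
    exact .sector _ _ _ h

/-- A word is read off a region exactly if the sectors up to the next leaf are those of the
corresponding stretch. -/
theorem reads_letters_iff (z : Fin d × Slot m) (s : Slot m) (k : ℕ) :
    Γ.Reads (.inl z) (s.letters (k + 1)) ↔ z.2 = s ∧
      Marks Γ.glue (face Γ.glue (up z)) (run s.across k) ∧
      Γ.glue ((face Γ.glue)^[k + 1] (up z)) = (face Γ.glue)^[k + 1] (up z) := by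
  induction k generalizing z s with
  | zero =>
    simp only [Slot.letters, run, Marks, true_and, zero_add, iterate_one]
    rw [reads_cons_iff]
    refine and_congr ⟨fun h => (Slot.sector_injective h).symm, fun h => h ▸ rfl⟩ ?_
    rw [face_glue]
    rcases he : Γ.nextSector (.inl z) with z' | j
    · exact iff_of_false (by rintro ⟨⟩) (Γ.glue_ne_of_nextSector he)
    · exact iff_of_true (.leaf j) (Γ.glue_leafEnd j)
  | succ k ih =>
    rw [Slot.letters, reads_cons_iff]
    simp only [run, Marks, Bool.false_eq_true, iff_false]
    refine and_congr ⟨fun h => (Slot.sector_injective h).symm, fun h => h ▸ rfl⟩ ?_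
    rw [iterate_succ_apply]
    rcases he : Γ.nextSector (.inl z) with z' | j
    · have hf : face Γ.glue (up z) = up z' := by rw [face_glue, he]; rfl
      rw [ih, hf]
      have := Γ.glue_ne_of_nextSector he
      simp only [this, not_false_eq_true, true_and, and_assoc]; rfl
    · have hf : face Γ.glue (up z) = up (Γ.leafEnd j) := by rw [face_glue, he]; rfl
      rw [hf]
      exact iff_of_false (by rintro ⟨⟩) fun h => h.1.2.1 (Γ.glue_leafEnd j)

/-- The region of a sector. -/
def region (x : HalfEdge m n d) : Set (HalfEdge m n d) := {y | Γ.nextSector.SameCycle x y}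

theorem mem_region_self (x : HalfEdge m n d) : x ∈ Γ.region x := Perm.SameCycle.refl _ _

theorem nextSector_mem {x y : HalfEdge m n d} : Γ.nextSector y ∈ Γ.region x ↔ y ∈ Γ.region x :=
  Perm.sameCycle_apply_right

theorem region_eq_iff {x y : HalfEdge m n d} : Γ.region x = Γ.region y ↔ y ∈ Γ.region x := by
  constructor
  · intro h
    rw [h]; exact Γ.mem_region_self y
  · intro h
    ext z; exact ⟨fun h' => h.symm.trans h', fun h' => h.trans h'⟩

theorem region_subset {x : HalfEdge m n d} (Z : Set (HalfEdge m n d)) (hx : x ∈ Z)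
    (hZ : ∀ y ∈ Z, Γ.nextSector y ∈ Z) : Γ.region x ⊆ Z := by
  intro y hy
  obtain ⟨i, -, rfl⟩ := Perm.SameCycle.exists_pow_eq' hy
  clear hy
  induction i with
  | zero => exact hx
  | succ i ih => rw [pow_succ', Perm.mul_apply]; exact hZ _ ih

theorem iterate_mem_region (x : HalfEdge m n d) (i : ℕ) : Γ.nextSector^[i] x ∈ Γ.region x := by
  induction i with
  | zero => exact Γ.mem_region_self x
  | succ i ih => rw [iterate_succ_apply']; exact Γ.nextSector_mem.2 ih

theorem region_of_inner {z : Fin d × Slot m} (hI : Inner Γ.glue (up z)) :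
    ∃ z', Γ.region (.inl z) = {.inl z, .inl z'} ∧ z'.2 = z.2.across ∧
      (z.2.across = z.2 → z' = z) := by
  have hg := Γ.isGluing_glue
  obtain ⟨z', e1, f1⟩ := Γ.nextSector_of_ne (hg.inner_aux hI)
  have hI' := hg.inner_face hI
  have hs := hg.inner_slot hI
  have hff := hg.inner_face_face hI
  rw [f1] at hI' hs hff
  change z'.2 = z.2.across at hs
  obtain ⟨z'', e2, f2⟩ := Γ.nextSector_of_ne (hg.inner_aux hI')
  rw [hff] at f2
  obtain rfl := up_injective f2
  refine ⟨z', ?_, hs, ?_⟩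
  · apply Set.Subset.antisymm
    · apply Γ.region_subset
      · simp
      · rintro y (rfl | rfl)
        · rw [e1]; simp
        · rw [e2]; simp
    · rintro y (rfl | rfl)
      · exact Γ.mem_region_self _
      · rw [← e1]; exact Γ.nextSector_mem.2 (Γ.mem_region_self _)
  · intro h
    have hp : z.2.period = 1 := by
      rcases period_cases z.2 with h' | h'
      · exact h'.1
      · exact absurd h h'.2
    unfold Inner at hI
    change (face Γ.glue)^[z.2.period] _ = _ at hI
    rw [hp, iterate_one, f1] at hI; exact up_injective hI

/-- The region of a sector has one of the types if it is an inner region of the tiling. -/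
theorem isOfType_region_iff (z : Fin d × Slot m) (i : WeightIndex m) :
    IsOfType (Γ.region (.inl z)) i ↔ Inner Γ.glue (up z) ∧ z.2.typeIdx = i := by
  constructor
  · intro h
    have single : ∀ v s, Γ.region (.inl z) = {.inl (v, s)} → z = (v, s) ∧ Inner Γ.glue (up z) := by
      intro v s hF
      have h1 := Γ.mem_region_self (.inl z)
      have h2 := Γ.nextSector_mem.2 h1
      rw [hF] at h1 h2
      obtain rfl : z = (v, s) := Sum.inl_injective h1
      refine ⟨rfl, ?_⟩
      have h3 : face Γ.glue (up (v, s)) = up (v, s) := by rw [face_glue, h2]; rfl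
      exact Function.iterate_fixed h3 _
    rcases h with ⟨hi, v, s, hs, hF⟩ | ⟨hi, v, s, hs, hF⟩ | ⟨hi, v, s, v', s', hs, hs', hF⟩
    · obtain ⟨rfl, h⟩ := single v s hF
      refine ⟨h, Subtype.ext ?_⟩
      rcases s.sector_cases with h' | h' | ⟨h1, -, h' | h'⟩ <;> rw [hs] at h'
      · exact h'.2.1.trans hi.symm
      all_goals simp at h'
    · obtain ⟨rfl, h⟩ := single v s hF
      refine ⟨h, Subtype.ext ?_⟩
      rcases s.sector_cases with h' | h' | ⟨h1, -, h' | h'⟩ <;> rw [hs] at h'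
      · simp at h'
      · exact h'.2.1.trans hi.symm
      all_goals simp at h'
    · have hne : (Sum.inl (v, s) : HalfEdge m n d) ≠ .inl (v', s') := by
        intro h
        have := congrArg Prod.snd (Sum.inl_injective h)
        simp only at this
        rw [this, hs'] at hs
        simp at hs
      have bigon : ∀ a b : Fin d × Slot m, a ≠ b → z = a → Γ.region (.inl z) = {.inl a, .inl b} →
          Inner Γ.glue (up z) ∨ z.2.across = z.2 := by
        rintro a b hab rfl hF
        have hb : (Sum.inl b : HalfEdge m n d) ∈ Γ.region (.inl z) := by rw [hF]; simp
        have h1 := Γ.nextSector_mem.2 (Γ.mem_region_self (.inl z))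
        have h2 := Γ.nextSector_mem.2 hb
        rw [hF] at h1 h2
        have e1 : Γ.nextSector (.inl z) = .inl b := by
          rcases h1 with h1 | h1
          · exfalso
            have := Γ.region_subset {.inl z} rfl (by rintro y rfl; exact h1)
            exact hab (Sum.inl_injective (this hb)).symm
          · exact h1
        have e2 : Γ.nextSector (.inl b) = .inl z := by
          rcases h2 with h2 | h2
          · exact h2
          · rw [← e1] at h2
            have := Γ.nextSector.injective h2
            rw [e1] at this; exact absurd (Sum.inl_injective this).symm hab
        rcases period_cases z.2 with h | h
        · exact .inr h.2
        · left
          unfold Inner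
          change (face Γ.glue)^[z.2.period] _ = _
          rw [h.1]
          change face Γ.glue (face Γ.glue (up z)) = _
          rw [face_glue, e1]
          change face Γ.glue (up b) = _
          rw [face_glue, e2]; rfl
      have hz := Γ.mem_region_self (.inl z)
      rw [hF] at hz
      have hne' : (v, s) ≠ (v', s') := fun h => hne (congrArg _ h)
      rcases hz with hz | hz <;> have hz := Sum.inl_injective hz
      · have := bigon _ _ hne' hz hF
        have h5 : z.2.sector = s.sector := by rw [hz]
        rcases z.2.sector_cases with h' | h' | ⟨h1, h2, h' | h'⟩ <;> rw [h5, hs] at h'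
        · simp at h'
        · simp at h'
        · exact ⟨this.resolve_right h2, Subtype.ext (by simpa using h'.1.symm)⟩
        · simp at h'
      · have := bigon _ _ hne'.symm hz (by rw [hF, Set.pair_comm])
        have h5 : z.2.sector = s'.sector := by rw [hz]
        rcases z.2.sector_cases with h' | h' | ⟨h1, h2, h' | h'⟩ <;> rw [h5, hs'] at h'
        · simp at h'
        · simp at h'
        · simp at h'
        · exact ⟨this.resolve_right h2, Subtype.ext (by simpa using h'.1.symm)⟩
  · rintro ⟨hI, rfl⟩
    obtain ⟨z', hF, hs, hz⟩ := Γ.region_of_inner hI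
    have mono : z.2.across = z.2 → Γ.region (.inl z) = {.inl z} := by
      intro h
      rw [hF, hz h]; simp
    rcases z.2.sector_cases with h | h | ⟨h1, h2, h | h⟩
    · exact .inl ⟨h.2.1, z.1, z.2, h.1, mono h.2.2⟩
    · exact .inr (.inl ⟨h.2.1, z.1, z.2, h.1, mono h.2.2⟩)
    · refine .inr (.inr ⟨h1, z.1, z.2, z'.1, z'.2, h.1, ?_, hF⟩)
      rw [hs]; exact h.2
    · refine .inr (.inr ⟨h1, z'.1, z'.2, z.1, z.2, ?_, h.1, ?_⟩)
      · rw [hs]; exact h.2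
      · rw [hF, Set.pair_comm]

theorem eq_of_mem_region_of_inner {z z' : Fin d × Slot m} (hI : Inner Γ.glue (up z))
    (h : .inl z' ∈ Γ.region (.inl z)) (hs : z'.2 = z.2) : z' = z := by
  obtain ⟨z₁, hF, h1, h2⟩ := Γ.region_of_inner hI
  rw [hF] at h
  rcases h with h | h
  · exact Sum.inl_injective h
  · have e := Sum.inl_injective h
    rw [e] at hs ⊢; exact h2 (h1.symm.trans hs)

theorem inr_notMem_region_of_inner {z : Fin d × Slot m} (hI : Inner Γ.glue (up z)) (j : Fin n) :
    .inr j ∉ Γ.region (.inl z) := by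
  obtain ⟨z₁, hF, -, -⟩ := Γ.region_of_inner hI
  rw [hF]
  simp

/-- Every region of a type is the region of the distinguished sector of that type at one of the
vertices. -/
theorem exists_rep {x : HalfEdge m n d} {i : WeightIndex m} (h : IsOfType (Γ.region x) i) :
    ∃ v : Fin d, Inner Γ.glue (up (v, rep i)) ∧ Γ.region (.inl (v, rep i)) = Γ.region x := by
  rcases x with z | j
  · obtain ⟨hI, hi⟩ := (Γ.isOfType_region_iff z i).1 h
    rcases (Slot.typeIdx_eq_iff _ _).1 hi with hz | hz
    · refine ⟨z.1, ?_, ?_⟩ <;> rw [← hz]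
      exact hI
    · obtain ⟨z', hF, h1, -⟩ := Γ.region_of_inner hI
      have hz' : .inl z' ∈ Γ.region (.inl z) := by rw [hF]; simp
      have e := Γ.region_eq_iff.2 hz'
      have hs : z'.2 = rep i := by rw [h1, hz, across_across]
      have e' : z' = (z'.1, rep i) := Prod.ext rfl hs
      rw [e] at h
      refine ⟨z'.1, ?_, ?_⟩ <;> rw [← e']
      · exact ((Γ.isOfType_region_iff z' i).1 h).1
      · exact e.symm
  · exfalso
    have hj := Γ.mem_region_self (.inr j)
    rcases h with ⟨-, v, s, -, hF⟩ | ⟨-, v, s, -, hF⟩ | ⟨-, v, s, v', s', -, -, hF⟩ <;>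
      rw [hF] at hj <;> simp at hj

/-- The weight counts the vertices whose distinguished sector of the given type lies in an inner
region. -/
theorem weight_eq (i : WeightIndex m) :
    Γ.weight i = Nat.card {v : Fin d // Inner Γ.glue (up (v, rep i))} := by
  unfold weight
  rw [← Set.ncard_range_of_injective
    (f := fun v : {v : Fin d // Inner Γ.glue (up (v, rep i))} => Γ.region (.inl (v.1, rep i)))]
  · congr 1
    ext F
    constructor
    · rintro ⟨⟨x, rfl⟩, h⟩
      obtain ⟨v, hv, e⟩ := Γ.exists_rep h; exact ⟨⟨v, hv⟩, e⟩
    · rintro ⟨⟨v, hv⟩, rfl⟩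
      exact ⟨⟨_, rfl⟩, (Γ.isOfType_region_iff _ _).2 ⟨hv, typeIdx_rep i⟩⟩
  · rintro ⟨v, hv⟩ ⟨v', hv'⟩ h
    have := Γ.eq_of_mem_region_of_inner hv (Γ.region_eq_iff.1 h) rfl
    exact Subtype.ext (congrArg Prod.fst this).symm

/-- The regions are those at the leaves and those of the distinguished sectors. -/
def regionAt : Fin n ⊕ (Σ i : WeightIndex m, {v : Fin d // Inner Γ.glue (up (v, rep i))}) →
    Set (HalfEdge m n d) :=
  Sum.elim (fun j => Γ.region (.inr j)) fun t => Γ.region (.inl (t.2.1, rep t.1))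

theorem card_regionAt :
    Nat.card (Fin n ⊕ (Σ i : WeightIndex m, {v : Fin d // Inner Γ.glue (up (v, rep i))})) =
      n + ∑ i, Γ.weight i := by
  rw [Nat.card_sum, Nat.card_sigma, Nat.card_fin]
  simp only [weight_eq]

theorem range_regionAt
    (h : ∀ F ∈ Γ.regions, (∀ j : Fin n, Sum.inr j ∉ F) → ∃ i : WeightIndex m, IsOfType F i) :
    Set.range Γ.regionAt = Γ.regions := by
  ext F
  constructor
  · rintro ⟨j | t, rfl⟩
    · exact ⟨.inr j, rfl⟩
    · exact ⟨.inl (t.2.1, rep t.1), rfl⟩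
  · rintro ⟨x, rfl⟩
    by_cases hj : ∃ j : Fin n, Sum.inr j ∈ Γ.region x
    · obtain ⟨j, hj⟩ := hj; exact ⟨.inl j, (Γ.region_eq_iff.2 hj).symm⟩
    · push Not at hj
      obtain ⟨i, hi⟩ := h (Γ.region x) ⟨x, rfl⟩ hj
      obtain ⟨v, hv, e⟩ := Γ.exists_rep hi; exact ⟨.inr ⟨i, v, hv⟩, e⟩

theorem injective_regionAt (h : Injective fun j : Fin n => Γ.region (.inr j)) :
    Injective Γ.regionAt := by
  have mixed : ∀ (j : Fin n) (t : Σ i : WeightIndex m, {v : Fin d // Inner Γ.glue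
      (up (v, rep i))}), Γ.regionAt (.inl j) ≠ Γ.regionAt (.inr t) := by
    rintro j ⟨i, v, hv⟩ e
    exact Γ.inr_notMem_region_of_inner hv j (Γ.region_eq_iff.1 e.symm)
  rintro (j | ⟨i, v, hv⟩) (j' | ⟨i', v', hv'⟩) e
  · exact congrArg _ (h e)
  · exact absurd e (mixed _ _)
  · exact absurd e.symm (mixed _ _)
  · have h1 := (Γ.isOfType_region_iff (v, rep i) i).2 ⟨hv, typeIdx_rep i⟩
    have e' : Γ.region (.inl (v, rep i)) = Γ.region (.inl (v', rep i')) := e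
    rw [e'] at h1
    have h2 := ((Γ.isOfType_region_iff _ i).1 h1).2
    rw [typeIdx_rep] at h2
    subst h2
    have := Γ.eq_of_mem_region_of_inner hv (Γ.region_eq_iff.1 e') rfl
    obtain rfl : v' = v := congrArg Prod.fst this; rfl

theorem ncard_regions_eq
    (h : ∀ F ∈ Γ.regions, (∀ j : Fin n, Sum.inr j ∉ F) → ∃ i : WeightIndex m, IsOfType F i)
    (hinj : Injective fun j : Fin n => Γ.region (.inr j)) :
    Γ.regions.ncard = n + ∑ i, Γ.weight i := by
  rw [← Γ.range_regionAt h, ← card_regionAt,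
    Set.ncard_range_of_injective (Γ.injective_regionAt hinj)]

theorem injective_of_le_ncard_regions
    (h : ∀ F ∈ Γ.regions, (∀ j : Fin n, Sum.inr j ∉ F) → ∃ i : WeightIndex m, IsOfType F i)
    (hle : n + ∑ i, Γ.weight i ≤ Γ.regions.ncard) :
    Injective fun j : Fin n => Γ.region (.inr j) := by
  rw [← Γ.range_regionAt h, ← card_regionAt] at hle
  have := Set.rangeFactorization_surjective (f := Γ.regionAt) |>.bijective_of_nat_card_le hle
  have hi : Injective Γ.regionAt := Set.rangeFactorization_injective.1 this.1
  exact hi.comp Sum.inl_injective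

theorem edge_ne (x : HalfEdge m n d) : Γ.edge x ≠ x := by
  rcases x with z | j
  · intro h; exact Γ.ne_of_inl h rfl
  · rw [edge_leaf]; simp

theorem two_mul_ncard_edges : 2 * Γ.edges.ncard = 2 * (m - 1) * d + n := by
  classical
  have h1 : Fintype.card (HalfEdge m n d) = 2 * (m - 1) * d + n := by
    rw [Fintype.card_sum, Fintype.card_prod, Slot.card_eq, Fintype.card_fin, Fintype.card_fin,
      mul_comm]
  let f : HalfEdge m n d → Finset (HalfEdge m n d) := fun x => {x, Γ.edge x}
  have h2 : Γ.edges.ncard = (univ.image f).card := by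
    rw [← Set.ncard_coe_finset]
    refine Set.ncard_congr (fun e _ => e.toFinset) ?_ ?_ ?_ |>.trans rfl
    · rintro e ⟨x, rfl⟩
      simp only [Finset.coe_image, Finset.coe_univ, Set.image_univ, Set.mem_range]
      exact ⟨x, by ext y; simp [f]⟩
    · intro a b _ _ h; exact Set.toFinset_inj.1 h
    · intro b hb
      simp only [Finset.coe_image, Finset.coe_univ, Set.image_univ, Set.mem_range] at hb
      obtain ⟨x, rfl⟩ := hb; exact ⟨{x, Γ.edge x}, ⟨x, rfl⟩, by ext y; simp [f]⟩
  rw [h2, ← h1, ← Finset.card_univ, Finset.card_eq_sum_card_image f univ]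
  rw [Finset.sum_const_nat (m := 2), mul_comm]
  intro e he
  obtain ⟨x, -, rfl⟩ := mem_image.1 he
  rw [← Finset.card_pair (Γ.edge_ne x).symm]
  congr 1
  ext y
  simp only [mem_filter, mem_univ, true_and, Finset.mem_insert, mem_singleton]
  constructor
  · intro h
    have : y ∈ f x := by rw [← h]; simp [f]
    simpa [f] using this
  · rintro (rfl | rfl)
    · rfl
    · simp only [f, Γ.edge_edge]; exact Finset.pair_comm _ _

/-- Euler's formula in terms of the number of vertices, leaves and regions. -/
theorem planar_iff : ((d : ℤ) + 1) - Γ.edges.ncard + Γ.regions.ncard = 2 ↔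
      2 * Γ.regions.ncard = (2 * m - 4) * d + n + 2 := by
  have h := Γ.two_mul_ncard_edges
  have e := card_halfEdges (m := m) d
  rw [mul_comm d] at e; omega

theorem iterate_nextSector (z : Fin d × Slot m) (k : ℕ)
    (h : ∀ i < k, Γ.glue ((face Γ.glue)^[i + 1] (up z)) ≠ (face Γ.glue)^[i + 1] (up z)) :
    ∃ z', Γ.nextSector^[k] (.inl z) = .inl z' ∧ (face Γ.glue)^[k] (up z) = up z' := by
  induction k with
  | zero => exact ⟨z, rfl, rfl⟩
  | succ k ih =>
    obtain ⟨z', h1, h2⟩ := ih fun i hi => h i (by omega)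
    have h3 := h k (by omega)
    rw [iterate_succ_apply', h2] at h3
    obtain ⟨z'', h4, h5⟩ := Γ.nextSector_of_ne h3
    exact ⟨z'', by rw [iterate_succ_apply', h1, h4], by rw [iterate_succ_apply', h2, h5]⟩

theorem exists_leaf_of_iterate_nextSector (z : Fin d × Slot m) (k : ℕ) (j : Fin n)
    (h : Γ.nextSector^[k] (.inl z) = .inr j) :
    ∃ (i : ℕ) (j' : Fin n), (face Γ.glue)^[i] (up z) = up (Γ.leafEnd j') := by
  induction k generalizing z with
  | zero => simp at h
  | succ k ih =>
    rw [iterate_succ_apply] at h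
    rcases he : Γ.nextSector (.inl z) with z' | j'
    · rw [he] at h
      obtain ⟨i, j', hi⟩ := ih z' h
      refine ⟨i + 1, j', ?_⟩
      rw [iterate_succ_apply, face_glue, he]; exact hi
    · exact ⟨1, j', by rw [iterate_one, face_glue, he]; rfl⟩

theorem exists_inr_mem_region (z : Fin d × Slot m) (k : ℕ)
    (h : Γ.glue ((face Γ.glue)^[k + 1] (up z)) = (face Γ.glue)^[k + 1] (up z)) :
    ∃ j, .inr j ∈ Γ.region (.inl z) := by
  induction k generalizing z with
  | zero =>
    obtain ⟨j, hj, -⟩ := Γ.nextSector_of_eq h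
    exact ⟨j, hj ▸ Γ.nextSector_mem.2 (Γ.mem_region_self _)⟩
  | succ k ih =>
    rw [iterate_succ_apply] at h
    have hm := Γ.nextSector_mem.2 (Γ.mem_region_self (.inl z))
    rcases he : Γ.nextSector (.inl z) with z' | j'
    · rw [face_glue, he] at h
      obtain ⟨j, hj⟩ := ih z' h
      rw [he] at hm; exact ⟨j, by rw [Γ.region_eq_iff.2 hm]; exact hj⟩
    · exact ⟨j', he ▸ hm⟩

end DecoratedGraph

/-! ### The boundary word of a sequence of paths -/

/-- The boundary word of a sequence of arcs, each given by its first slot and its length. -/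
def boundary (L : List (Arc m)) : List (Mark m) := L.flatMap fun a => stretch a.1 a.2

/-- The position of the `j`-th leaf in the boundary word. -/
def pos (L : List (Arc m)) (j : ℕ) : ℕ := (boundary (L.take j)).length

theorem boundary_cons (a : Arc m) (L : List (Arc m)) :
    boundary (a :: L) = stretch a.1 a.2 ++ boundary L := rfl

theorem boundary_append (L L' : List (Arc m)) :
    boundary (L ++ L') = boundary L ++ boundary L' := List.flatMap_append

theorem boundary_singleton (a : Arc m) : boundary [a] = stretch a.1 a.2 := by simp [boundary]

theorem pos_zero (L : List (Arc m)) : pos L 0 = 0 := rfl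

theorem pos_succ (L : List (Arc m)) {j : ℕ} (h : j < L.length) :
    pos L (j + 1) = pos L j + L[j].2 := by
  unfold pos
  rw [List.take_add_one, List.getElem?_eq_getElem h, boundary_append, length_append]
  simp [boundary_singleton, length_stretch]

theorem pos_cons_succ (a : Arc m) (L : List (Arc m)) (j : ℕ) :
    pos (a :: L) (j + 1) = a.2 + pos L j := by
  simp [pos, boundary_cons, length_stretch]

theorem pos_length (L : List (Arc m)) : pos L L.length = (boundary L).length := by simp [pos]

theorem pos_of_length_eq {L : List (Arc m)} {n : ℕ} (h : L.length = n) :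
    pos L n = (boundary L).length := h ▸ pos_length L

theorem snd_of_mem_run {s : Slot m} {k : ℕ} {a : Mark m} (h : a ∈ run s k) :
    a.2 = false := by
  induction k generalizing s with
  | zero => simp [run] at h
  | succ k ih =>
    rcases mem_cons.1 h with rfl | h
    · rfl
    · exact ih h

/-- The leaves of the boundary word are at the beginnings of the stretches. -/
theorem exists_pos_of_leaf (L : List (Arc m)) {i : ℕ} {s : Slot m}
    (h : (boundary L)[i]? = some (s, true)) : ∃ j < L.length, i = pos L j := by
  induction L generalizing i with
  | nil => simp [boundary] at h
  | cons a L ih =>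
    rw [boundary_cons] at h
    rcases Nat.lt_or_ge i a.2 with hi | hi
    · refine ⟨0, by simp, ?_⟩
      rw [List.getElem?_append_left (by rwa [length_stretch])] at h
      obtain ⟨t, k⟩ := a
      rcases i with _ | i
      · rfl
      · cases k with
        | zero => simp at hi
        | succ k =>
          simp only [stretch, List.getElem?_cons_succ] at h
          have := snd_of_mem_run (List.mem_of_getElem? h)
          simp at this
    · rw [List.getElem?_append_right (by rwa [length_stretch]), length_stretch] at h
      obtain ⟨j, hj, e⟩ := ih h
      exact ⟨j + 1, by simpa using hj, by rw [pos_cons_succ]; omega⟩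

theorem countP_run (s : Slot m) (k : ℕ) : (run s k).countP (fun a => a.2) = 0 :=
  List.countP_eq_zero.2 fun a ha => by simp [snd_of_mem_run ha]

theorem countP_boundary (L : List (Arc m)) (hL : ∀ a ∈ L, 0 < a.2) :
    (boundary L).countP (fun a => a.2) = L.length := by
  induction L with
  | nil => rfl
  | cons a L ih =>
    obtain ⟨s, k⟩ := a
    obtain ⟨k, rfl⟩ := Nat.exists_eq_succ_of_ne_zero (hL (s, k) (by simp)).ne'
    rw [boundary_cons, countP_append, ih fun a ha => hL a (by simp [ha])]
    simp only [stretch, List.countP_cons, countP_run, length_cons]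
    simp [add_comm]

theorem marks_stretch_succ {ε : Perm (Corner m)} (x : Corner m) (s : Slot m) (k : ℕ) :
    Marks ε x (stretch s (k + 1)) ↔ x.2 = s ∧ ε x = x ∧ Marks ε (face ε x) (run s.across k) := by
  simp [stretch, Marks]

theorem Marks.arc {ε : Perm (Corner m)} {y : Corner m} {L : List (Arc m)}
    (h : Marks ε y (boundary L)) {j : ℕ} (hj : j < L.length) :
    Marks ε ((face ε)^[pos L j] y) (stretch L[j].1 L[j].2) := by
  have hs : L = L.take j ++ ([L[j]] ++ L.drop (j + 1)) := by
    conv_lhs => rw [← List.take_append_drop j L]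
    rw [List.drop_eq_getElem_cons (by omega)]; rfl
  rw [hs, boundary_append, boundary_append, marks_append, marks_append, boundary_singleton] at h
  exact h.2.1

theorem ne_of_marks_run {ε : Perm (Corner m)} {x : Corner m} {s : Slot m} {k : ℕ}
    (h : Marks ε x (run s k)) {i : ℕ} (hi : i < k) :
    ε ((face ε)^[i] x) ≠ (face ε)^[i] x := by
  have hi' : i < (run s k).length := by rwa [length_run]
  have := ((marks_iff _ _).1 h i hi').2
  rw [Ne, this, snd_of_mem_run (getElem_mem hi')]
  simp

theorem Realizes.not_onOrbit_iff {ε : Perm (Corner m)} {S : Finset ℕ} {y : Corner m}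
    {ω : List (Mark m)} (h : Realizes S ε y ω) (hy : ε y = y) {x : Corner m}
    (hx : x.1 ∈ S) : ¬ OnOrbit ε y ω.length x ↔ Inner ε x := by
  constructor
  · exact (h.inner x hx).resolve_left
  · rintro hI ⟨i, hi, rfl⟩
    have : ∀ k, Inner ε ((face ε)^[i + k] y) := by
      intro k
      induction k with
      | zero => exact hI
      | succ k ih => rw [← add_assoc, iterate_succ_apply']; exact h.inner_face ih
    have h1 := this (ω.length - i)
    rw [Nat.add_sub_cancel' hi.le, h.period] at h1; exact h.inner_not_leaf h1 hy

namespace DecoratedGraph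

variable {n d : ℕ} (Γ : DecoratedGraph m n d)

/-- The conditions on the graphs that contribute to an operation. -/
structure IsTiling (w : Weight m) (ps : List (QPath m)) : Prop extends Γ.IsCentered where
  weight_eq_apply : ∀ i, Γ.weight i = w i
  hasSequence : Γ.HasSequence ps

/-- The tiling given by a graph realizes the boundary word, with its leaves in their order. -/
structure Presents (w : Weight m) (L : List (Arc m)) : Prop where
  root : 0 < n
  num : Num d w (boundary L)
  realizes : Realizes (range d) Γ.glue (up (Γ.leafEnd ⟨0, root⟩)) (boundary L)
  leaf : ∀ j : Fin n, (face Γ.glue)^[pos L j] (up (Γ.leafEnd ⟨0, root⟩)) = up (Γ.leafEnd j)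

theorem finRotate_val (j : Fin n) : ((finRotate n j : Fin n) : ℕ) =
    (if (j : ℕ) + 1 = n then 0 else (j : ℕ) + 1 : ℕ) := by
  obtain ⟨j, hj⟩ := j
  obtain ⟨n, rfl⟩ := Nat.exists_eq_succ_of_ne_zero (show n ≠ 0 by omega)
  split_ifs with h
  · obtain rfl : j = n := by simpa using h
    rw [finRotate_last']
  · simp only [Nat.succ_eq_add_one] at h
    rw [finRotate_of_lt (by omega)]

open Classical in
theorem card_inner_eq (i : WeightIndex m) :
    ((range d).filter fun v => Inner Γ.glue (v, rep i)).card = Γ.weight i := by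
  rw [weight_eq, ← Nat.card_eq_finsetCard]
  refine Nat.card_congr
    { toFun := fun v => ⟨⟨v.1, mem_range.1 (mem_filter.1 v.2).1⟩, (mem_filter.1 v.2).2⟩
      invFun := fun v => ⟨v.1.1, mem_filter.2 ⟨mem_range.2 v.1.2, v.2⟩⟩
      left_inv := fun _ => rfl
      right_inv := fun _ => rfl }

variable {Γ} in
theorem hasSequence_iff {L : List (Arc m)} (hn : L.length = n) :
    Γ.HasSequence (L.map fun a => QPath.arc a.1 a.2) ↔
      ∀ (j : ℕ) (hj : j < n), Γ.Reads (.inl (Γ.leafEnd ⟨j, hj⟩))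
        (L[j].1.letters L[j].2) := by
  constructor
  · rintro ⟨h, hr⟩ j hj
    have := hr ⟨j, hj⟩
    rw [edge_leaf] at this
    simp only [List.get_eq_getElem, List.getElem_map] at this; exact this
  · intro h
    refine ⟨by simpa using hn, fun j => ?_⟩
    rw [edge_leaf]
    simp only [List.get_eq_getElem, List.getElem_map]; exact h j j.2

theorem reads_leafEnd_iff (j : Fin n) (s : Slot m) {k : ℕ} (hk : 0 < k) :
    Γ.Reads (.inl (Γ.leafEnd j)) (s.letters k) ↔ Marks Γ.glue (up (Γ.leafEnd j)) (stretch s k) ∧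
      Γ.glue ((face Γ.glue)^[k] (up (Γ.leafEnd j))) = (face Γ.glue)^[k] (up (Γ.leafEnd j)) := by
  obtain ⟨k, rfl⟩ := Nat.exists_eq_succ_of_ne_zero hk.ne'
  rw [Nat.succ_eq_add_one, reads_letters_iff, marks_stretch_succ]
  simp only [Γ.glue_leafEnd j, true_and, and_assoc]
  rfl

/-- The region at the boundary interval that starts at the leaf `j`, up to the next leaf. -/
theorem exists_leaf_of_reads (j : Fin n) (s : Slot m) {k : ℕ} (hk : 0 < k)
    (h : Γ.Reads (.inl (Γ.leafEnd j)) (s.letters k)) :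
    ∃ r, Γ.nextSector^[k] (.inl (Γ.leafEnd j)) = .inr r ∧
      (face Γ.glue)^[k] (up (Γ.leafEnd j)) = up (Γ.leafEnd r) ∧
      ∀ i < k, ∃ z, Γ.nextSector^[i] (.inl (Γ.leafEnd j)) = .inl z := by
  obtain ⟨k, rfl⟩ := Nat.exists_eq_succ_of_ne_zero hk.ne'
  rw [Nat.succ_eq_add_one, reads_letters_iff] at h
  obtain ⟨-, h1, h2⟩ := h
  have key : ∀ i ≤ k, ∃ z', Γ.nextSector^[i] (.inl (Γ.leafEnd j)) = .inl z' ∧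
      (face Γ.glue)^[i] (up (Γ.leafEnd j)) = up z' := by
    intro i hi
    apply Γ.iterate_nextSector
    intro i' hi'; exact ne_of_marks_run h1 (show i' < k by omega)
  obtain ⟨z, e1, e2⟩ := key k le_rfl
  rw [iterate_succ_apply', e2] at h2
  obtain ⟨r, e3, e4⟩ := Γ.nextSector_of_eq h2
  refine ⟨r, ?_, ?_, fun i hi => ?_⟩
  · rw [Nat.succ_eq_add_one, iterate_succ_apply', e1, e3]
  · rw [Nat.succ_eq_add_one, iterate_succ_apply', e2, e4]
  · obtain ⟨z', h', -⟩ := key i (by omega); exact ⟨z', h'⟩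

theorem joined_of_adj {v v' : Fin d} (h : Γ.Adj v v') : Joined Γ.glue v v' := by
  obtain ⟨s, s', h⟩ := h
  exact ⟨s, s', Γ.glue_of_inl h⟩

theorem card_leaves_glue [DecidablePred fun x : Corner m => Γ.glue x = x] :
    ((range d ×ˢ (univ : Finset (Slot m))).filter fun x => Γ.glue x = x).card
      = n := by
  classical
  have : ((range d ×ˢ (univ : Finset (Slot m))).filter fun x => Γ.glue x = x) =
      (univ : Finset (Fin n)).image fun j => up (Γ.leafEnd j) := by
    ext x
    simp only [mem_filter, mem_product, mem_univ, and_true, mem_image, true_and]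
    constructor
    · rintro ⟨h1, h2⟩
      obtain ⟨z, rfl⟩ := exists_up h1
      obtain ⟨j, rfl⟩ := (Γ.glue_eq_self_iff z).1 h2; exact ⟨j, rfl⟩
    · rintro ⟨j, rfl⟩
      exact ⟨up_mem _, Γ.glue_leafEnd j⟩
  rw [this, Finset.card_image_of_injective _ fun a b h => Γ.leafEnd_injective (up_injective h),
    Finset.card_univ, Fintype.card_fin]

variable {Γ}

theorem weight_add_count {y : Corner m} {ω : List (Mark m)} (h : Realizes (range d) Γ.glue y ω)
    (hy : Γ.glue y = y) (i : WeightIndex m) :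
    Γ.weight i + (ω.map Prod.fst).count (rep i) = d := by
  classical
  rw [← Γ.card_inner_eq i, ← Finset.filter_congr fun v hv => h.not_onOrbit_iff hy hv,
    add_comm, h.count_add, card_range]

theorem IsCentered.conn_glue (h : Γ.IsCentered) (u : Fin d) (v : ℕ) (hv : v ∈ range d) :
    ReflTransGen (Joined Γ.glue) u v :=
  ReflTransGen.lift (fun v : Fin d => (v : ℕ)) (fun _ _ hab => Γ.joined_of_adj hab) _ _
    (h.connected u ⟨v, mem_range.1 hv⟩)

/-- By Euler's inequality, Euler's formula implies that each region at the boundary of a centered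
tiling graph meets the boundary in one interval only. -/
theorem IsCentered.region_inr_injective (h : Γ.IsCentered) :
    Injective fun j : Fin n => Γ.region (.inr j) := by
  classical
  apply Γ.injective_of_le_ncard_regions h.inner_regions
  have hp := Γ.planar_iff.1 h.planar
  let y := Γ.leafEnd ⟨0, h.root⟩
  let T := Realizes.reps (range d) (Inner Γ.glue)
  have hT : T.card = ∑ i, Γ.weight i :=
    (Realizes.card_reps _ _).trans (sum_congr rfl fun i _ => Γ.card_inner_eq i)
  have hE := Γ.isGluing_glue.euler (v₀ := (up y).1) (ι := Unit) ?_ (up_mem y) (fun _ => up y)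
    (fun _ => up_mem y) (fun _ => Γ.glue_leafEnd _) (fun _ _ _ _ => rfl) T
    fun x hx => Realizes.mem_reps.1 hx
  · rw [hT, card_leaves_glue, Fintype.card_unit, card_range] at hE; omega
  · exact h.conn_glue y.1

/-- The boundary word of a centered tiling graph. -/
theorem IsTiling.presents {w : Weight m} {L : List (Arc m)}
    (hL : ∀ a ∈ L, 0 < a.2) (hn : L.length = n)
    (h : Γ.IsTiling w (L.map fun a => QPath.arc a.1 a.2)) : Γ.Presents w L := by
  have hseq := (hasSequence_iff hn).1 h.hasSequence
  have hinj := h.toIsCentered.region_inr_injective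
  have hpos : ∀ (j : ℕ) (hj : j < L.length), 0 < L[j].2 := fun j hj => hL _ (getElem_mem hj)
  set y : Corner m := up (Γ.leafEnd ⟨0, h.root⟩) with hy
  have hyl : Γ.glue y = y := Γ.glue_leafEnd _
  -- The leaf that is met after the leaf `j` lies in the same region as the leaf `j + 1`.
  have step : ∀ (j : Fin n), (face Γ.glue)^[(L[(j : ℕ)]).2] (up (Γ.leafEnd j)) =
      up (Γ.leafEnd (finRotate n j)) := by
    intro j
    obtain ⟨r, h1, h2, -⟩ := Γ.exists_leaf_of_reads j _ (hpos j (by omega)) (hseq j j.2)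
    rw [h2]
    congr 2
    apply hinj
    change Γ.region _ = Γ.region _
    symm
    rw [region_eq_iff, ← h1]
    have := Γ.iterate_mem_region (.inr (finRotate n j)) ((L[(j : ℕ)]).2 + 1)
    rwa [iterate_succ_apply, nextSector_inr, Equiv.symm_apply_apply] at this
  have main : ∀ k ≤ n, Marks Γ.glue y (boundary (L.take k)) ∧
      (face Γ.glue)^[pos L k] y = if hk : k < n then up (Γ.leafEnd ⟨k, hk⟩) else y := by
    intro k
    induction k with
    | zero =>
      intro _
      rw [dif_pos h.root]; exact ⟨trivial, rfl⟩
    | succ k ih =>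
      intro hk
      have hk' : k < n := hk
      obtain ⟨h1, h2⟩ := ih hk'.le
      rw [dif_pos hk'] at h2
      constructor
      · rw [List.take_add_one, List.getElem?_eq_getElem (by omega), boundary_append, marks_append]
        refine ⟨h1, ?_⟩
        rw [← pos, h2]
        change Marks _ _ (boundary [L[k]])
        rw [boundary_singleton]
        exact ((Γ.reads_leafEnd_iff _ _ (hpos k (by omega))).1 (hseq k hk')).1
      · rw [pos_succ L (by omega), add_comm, iterate_add_apply, h2, step ⟨k, hk'⟩]
        have hv := finRotate_val ⟨k, hk'⟩
        split_ifs at hv with hkn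
        · rw [dif_neg (by simp at hkn; omega), hy]
          congr 2; exact Fin.ext hv
        · simp only at hkn hv
          rw [dif_pos (by omega)]
          congr 2; exact Fin.ext hv
  have leaf : ∀ j : Fin n, (face Γ.glue)^[pos L j] y = up (Γ.leafEnd j) := by
    intro j
    have := (main j j.2.le).2
    rwa [dif_pos j.2] at this
  have marks : Marks Γ.glue y (boundary L) := by
    have := (main n le_rfl).1
    rwa [List.take_of_length_le hn.le] at this
  have hreal : Realizes (range d) Γ.glue y (boundary L) := by
    refine ⟨Γ.isGluing_glue, ⟨up_mem _, ?_, ?_, ?_, marks, ?_⟩⟩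
    · exact h.conn_glue _
    · have := (main n le_rfl).2
      rwa [dif_neg (lt_irrefl n), pos_of_length_eq hn] at this
    · intro i h0 hi h'
      have h1 := ((marks_iff _ _).1 marks i hi).2
      rw [h'] at h1
      have h2 := h1.1 hyl
      obtain ⟨j, hj, rfl⟩ := exists_pos_of_leaf L (i := i) (s := (boundary L)[i].1)
        (by rw [List.getElem?_eq_getElem hi, ← h2])
      rw [leaf ⟨j, by omega⟩, hy] at h'
      have := congrArg Fin.val (Γ.leafEnd_injective (up_injective h'))
      simp only at this
      subst this
      simp [pos_zero] at h0
    · intro x hx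
      obtain ⟨z, rfl⟩ := exists_up hx
      by_cases hz : ∃ j : Fin n, .inr j ∈ Γ.region (.inl z)
      · left
        obtain ⟨j, hj⟩ := hz
        obtain ⟨k, -, hk⟩ := Perm.SameCycle.exists_pow_eq' hj
        rw [← Perm.iterate_eq_pow] at hk
        obtain ⟨i, j', hi⟩ := Γ.exists_leaf_of_iterate_nextSector z k j hk
        have hper := (main n le_rfl).2
        rw [dif_neg (lt_irrefl n), pos_of_length_eq hn] at hper
        have h1 : OnOrbit Γ.glue y (boundary L).length ((face Γ.glue)^[i] (up z)) := by
          rw [hi, ← leaf j']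
          apply onOrbit_iterate hper
          refine ⟨0, ?_, rfl⟩
          rw [← pos_length]
          have h0 := h.root
          have := pos_succ L (j := L.length - 1) (by omega)
          rw [Nat.sub_add_cancel (by omega)] at this
          have := hpos (L.length - 1) (by omega)
          omega
        clear hi hk
        induction i with
        | zero => exact h1
        | succ i ih =>
          rw [iterate_succ_apply'] at h1; exact ih (onOrbit_of_face hper h1)
      · right
        push Not at hz
        obtain ⟨i, hi⟩ := h.inner_regions (Γ.region (.inl z)) ⟨_, rfl⟩ hz
        exact ((Γ.isOfType_region_iff z i).1 hi).1
  refine ⟨h.root, ⟨fun i => ?_, ?_⟩, hreal, leaf⟩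
  · rw [← h.weight_eq_apply]; exact weight_add_count hreal hyl i
  · rw [countP_boundary L hL, hn]
    have h1 := Γ.planar_iff.1 h.planar
    rw [Γ.ncard_regions_eq h.inner_regions hinj] at h1
    simp only [h.weight_eq_apply] at h1; omega

/-- A graph whose tiling realizes the boundary word is a centered tiling graph. -/
theorem Presents.isTiling {w : Weight m} {L : List (Arc m)}
    (hL : ∀ a ∈ L, 0 < a.2) (hn : L.length = n) (h : Γ.Presents w L) :
    Γ.IsTiling w (L.map fun a => QPath.arc a.1 a.2) := by
  have hr := h.realizes
  have hpos : ∀ (j : ℕ) (hj : j < L.length), 0 < L[j].2 := fun j hj => hL _ (getElem_mem hj)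
  set y : Corner m := up (Γ.leafEnd ⟨0, h.root⟩) with hy
  have hyl : Γ.glue y = y := Γ.glue_leafEnd _
  have hseq : ∀ (j : ℕ) (hj : j < n), Γ.Reads (.inl (Γ.leafEnd ⟨j, hj⟩))
      (L[j].1.letters L[j].2) := by
    intro j hj
    rw [Γ.reads_leafEnd_iff _ _ (hpos j (by omega)), ← h.leaf ⟨j, hj⟩, ← iterate_add_apply]
    constructor
    · exact hr.marks.arc (by omega)
    · rw [add_comm]
      have h1 := pos_succ L (j := j) (by omega)
      change Γ.glue ((face Γ.glue)^[pos L j + _] y) = (face Γ.glue)^[pos L j + _] y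
      rw [← h1]
      rcases Nat.lt_or_ge (j + 1) n with h' | h'
      · have := h.leaf ⟨j + 1, h'⟩
        simp only at this
        rw [this]; exact Γ.glue_leafEnd _
      · have : j + 1 = L.length := by omega
        rw [this, pos_length, hr.period]; exact hyl
  have inner_regions : ∀ F ∈ Γ.regions, (∀ j : Fin n, Sum.inr j ∉ F) →
      ∃ i : WeightIndex m, IsOfType F i := by
    rintro F ⟨x, rfl⟩ hF
    rcases x with z | j
    · refine ⟨z.2.typeIdx, (Γ.isOfType_region_iff z _).2 ⟨?_, rfl⟩⟩
      refine (hr.inner (up z) (up_mem z)).resolve_left ?_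
      rintro ⟨i, hi, hz⟩
      obtain ⟨j, hj⟩ := Γ.exists_inr_mem_region z ((boundary L).length - i - 1) (by
        rw [← hz, ← iterate_add_apply]
        have e : (boundary L).length - i - 1 + 1 + i = (boundary L).length := by omega
        rw [e, hr.period]
        exact hyl)
      exact hF j hj
    · exact absurd (Γ.mem_region_self (.inr j)) (hF j)
  have hinj : Injective fun j : Fin n => Γ.region (.inr j) := by
    intro a b hab
    have hb := Γ.region_eq_iff.1 hab
    set j := (finRotate n).symm a with hj
    have ha : a = finRotate n j := by rw [hj, Equiv.apply_symm_apply]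
    have hread := hseq j j.2
    obtain ⟨r, h1, h2, h3⟩ := Γ.exists_leaf_of_reads j _ (hpos j (by omega)) hread
    have hra : r = a := by
      rw [← h.leaf j, ← iterate_add_apply, add_comm, ← pos_succ L (by omega)] at h2
      apply Γ.leafEnd_injective
      apply up_injective
      rw [← h2, ← h.leaf a]
      have hv := finRotate_val j
      rw [← ha] at hv
      rw [hv]
      split_ifs with hjn
      · rw [hjn, pos_of_length_eq hn, pos_zero]; exact hr.period
      · rfl
    have hsub := Γ.region_subset (x := .inr a) ({.inr a} ∪
      {x | ∃ i < L[(j : ℕ)].2, x = Γ.nextSector^[i] (.inl (Γ.leafEnd j))}) (by simp) (by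
        rintro x (rfl | ⟨i, hi, rfl⟩)
        · right; exact ⟨0, hpos j (by omega), Γ.nextSector_inr a⟩
        · rw [← iterate_succ_apply' Γ.nextSector]
          rcases Nat.lt_or_ge (i + 1) L[(j : ℕ)].2 with h' | h'
          · exact .inr ⟨i + 1, h', rfl⟩
          · have e : i + 1 = L[(j : ℕ)].2 := by omega
            left
            rw [Nat.succ_eq_add_one, e, h1, hra]
            rfl)
    rcases hsub hb with h' | ⟨i, hi, h'⟩
    · exact (Sum.inr_injective h').symm
    · obtain ⟨z, hz⟩ := h3 i hi
      rw [hz] at h'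
      simp at h'
  have hweight : ∀ i, Γ.weight i = w i := fun i =>
    Nat.add_right_cancel ((weight_add_count hr hyl i).trans (h.num.1 i).symm)
  refine ⟨⟨h.root, ?_, ?_, ?_, inner_regions⟩, hweight, (hasSequence_iff hn).2 hseq⟩
  · intro v v'
    have key : ∀ u : ℕ, ReflTransGen (Joined Γ.glue) (v : ℕ) u →
        ∀ hu : u < d, ReflTransGen Γ.Adj v ⟨u, hu⟩ := by
      intro u huv
      induction huv with
      | refl => exact fun _ => .refl
      | @tail a b _ hab ih =>
        intro hb
        have ha : a < d := by
          obtain ⟨s, s', hab⟩ := hab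
          by_contra ha
          have := Γ.glue_of_not_mem (x := (a, s)) (by simpa using ha)
          rw [this] at hab
          obtain rfl : a = b := congrArg Prod.fst hab; exact ha hb
        by_cases hne : a = b
        · subst hne; exact ih ha
        · refine (ih ha).tail ?_
          obtain ⟨s, s', hab⟩ := hab
          have hab' : Γ.glue (up (⟨a, ha⟩, s)) = up (⟨b, hb⟩, s') := hab
          obtain ⟨z, e1, e2⟩ := Γ.edge_of_glue_ne (z := (⟨a, ha⟩, s)) (by
            rw [hab']
            intro h'
            exact hne (congrArg Prod.fst h').symm)
          rw [e2] at hab'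
          obtain rfl := up_injective hab'; exact ⟨s, s', e1⟩
    have h1 := hr.joined_trans_symm (hr.conn v (mem_range.2 v.2))
    exact key v' (h1.trans (hr.conn v' (mem_range.2 v'.2))) v'.2
  · rw [planar_iff, Γ.ncard_regions_eq inner_regions hinj]
    have h1 := h.num.2
    rw [countP_boundary L hL, hn] at h1
    simp only [hweight]; omega
  · intro v hv
    have hnum : Num (range d).card w (boundary L) := by
      rw [card_range]; exact h.num
    apply hr.acyclic hyl hnum v
    refine Relation.TransGen.lift (fun v : Fin d => (v : ℕ)) ?_ _ _ hv
    rintro a b ⟨hab, k, hk⟩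
    exact ⟨fun h' => hab (Fin.ext h'), k, Γ.glue_of_inl hk⟩

end DecoratedGraph

theorem pos_lt_pos {L : List (Arc m)} (hL : ∀ a ∈ L, 0 < a.2) {i j : ℕ} (hij : i < j)
    (hj : j ≤ L.length) : pos L i < pos L j := by
  induction j with
  | zero => omega
  | succ j ih =>
    have h1 := hL _ (getElem_mem (show j < L.length by omega))
    have h2 := pos_succ L (j := j) (by omega)
    rcases Nat.lt_or_ge i j with h | h
    · have := ih h (by omega)
      omega
    · obtain rfl : i = j := by omega
      omega

theorem Realizes.leaf_pos {ε : Perm (Corner m)} {S : Finset ℕ} {y : Corner m}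
    {L : List (Arc m)} (h : Realizes S ε y (boundary L)) (hL : ∀ a ∈ L, 0 < a.2) {j : ℕ}
    (hj : j < L.length) : ε ((face ε)^[pos L j] y) = (face ε)^[pos L j] y := by
  have h1 := h.marks.arc hj
  obtain ⟨k, hk⟩ := Nat.exists_eq_succ_of_ne_zero (hL _ (getElem_mem hj)).ne'
  rw [hk, Nat.succ_eq_add_one, marks_stretch_succ] at h1
  exact h1.2.1

namespace DecoratedGraph

variable {n d : ℕ}

theorem ext_edge {Γ Γ' : DecoratedGraph m n d} (h : ∀ x, Γ.edge x = Γ'.edge x) : Γ = Γ' := by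
  obtain ⟨e, h1, h2, h3⟩ := Γ
  obtain ⟨e', h1', h2', h3'⟩ := Γ'
  obtain rfl : e = e' := Equiv.ext h
  rfl

theorem ext_glue {Γ Γ' : DecoratedGraph m n d} (h : Γ.glue = Γ'.glue)
    (hl : ∀ j, Γ.leafEnd j = Γ'.leafEnd j) : Γ = Γ' := by
  apply ext_edge
  rintro (z | j)
  · by_cases hz : Γ.glue (up z) = up z
    · obtain ⟨j, rfl⟩ := (Γ.glue_eq_self_iff z).1 hz
      rw [edge_leafEnd, hl, edge_leafEnd]
    · obtain ⟨z₁, e1, e2⟩ := Γ.edge_of_glue_ne hz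
      rw [h] at hz e2
      obtain ⟨z₂, e3, e4⟩ := Γ'.edge_of_glue_ne hz
      rw [e1, e3, up_injective (e2.symm.trans e4)]
  · rw [edge_leaf, edge_leaf, hl]

/-- A tiling with numbered vertices comes from a graph. -/
theorem exists_graph {w : Weight m} {L : List (Arc m)} (hL : ∀ a ∈ L, 0 < a.2)
    (hn : L.length = n) (h0 : 0 < n) {ε : Perm (Corner m)} {y : Corner m}
    (hnum : Num d w (boundary L)) (h : Realizes (range d) ε y (boundary L)) :
    ∃ Γ : DecoratedGraph m n d, Γ.Presents w L ∧ Γ.glue = ε ∧ up (Γ.leafEnd ⟨0, h0⟩) = y := by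
  classical
  choose lf hlf using fun j : Fin n => exists_up (h.iterate_face_mem h.base (pos L j))
  choose eo heo using fun z : Fin d × Slot m =>
    exists_up (x := ε (up z)) (h.toIsGluing.mem (up_mem z))
  have lf_inj : Injective lf := by
    intro i j hij
    have e := congrArg up hij
    rw [hlf, hlf] at e
    have hb : ∀ i : Fin n, pos L i < (boundary L).length := fun i => by
      rw [← pos_length]; exact pos_lt_pos hL (by omega) le_rfl
    have e' := iterate_injOn h.minimal (hb i) (hb j) e
    rcases lt_trichotomy (i : ℕ) j with h' | h' | h'
    · have := pos_lt_pos hL h' (by omega)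
      omega
    · exact Fin.ext h'
    · have := pos_lt_pos hL h' (by omega)
      omega
  have leaf_iff : ∀ z, (∃ j, z = lf j) ↔ ε (up z) = up z := by
    intro z
    constructor
    · rintro ⟨j, rfl⟩
      rw [hlf]; exact h.leaf_pos hL (by omega)
    · intro hz
      obtain ⟨i, hi, e⟩ := h.onOrbit_of_leaf (up_mem z) hz
      have h1 := (h.leaf_iff hi).1 (by rw [e]; exact hz)
      obtain ⟨j, hj, rfl⟩ := exists_pos_of_leaf L (i := i) (s := (boundary L)[i].1)
        (by rw [List.getElem?_eq_getElem hi, ← h1])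
      exact ⟨⟨j, by omega⟩, up_injective (by rw [hlf, e])⟩
  let g : HalfEdge m n d → HalfEdge m n d := Sum.elim
    (fun z => if h : ∃ j, z = lf j then .inr h.choose else .inl (eo z)) fun j => .inl (lf j)
  have g_lf : ∀ j, g (.inl (lf j)) = .inr j := by
    intro j
    have hj : ∃ j', lf j = lf j' := ⟨j, rfl⟩
    change (if h : ∃ j', lf j = lf j' then _ else _) = _
    rw [dif_pos hj]; exact congrArg _ (lf_inj hj.choose_spec).symm
  have g_ne : ∀ z, (¬ ∃ j, z = lf j) → g (.inl z) = .inl (eo z) := fun z hz => dif_neg hz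
  have eo_ne : ∀ z, (¬ ∃ j, z = lf j) → ¬ ∃ j, eo z = lf j := by
    intro z hz
    rw [leaf_iff] at hz ⊢
    rw [heo, h.invol]; exact fun h' => hz h'.symm
  have hg : ∀ x, g (g x) = x := by
    rintro (z | j)
    · by_cases hz : ∃ j, z = lf j
      · obtain ⟨j, rfl⟩ := hz
        rw [g_lf]; rfl
      · rw [g_ne z hz, g_ne _ (eo_ne z hz)]
        congr 1
        apply up_injective
        rw [heo, heo, h.invol]
    · exact g_lf j
  let Γ : DecoratedGraph m n d :=
    { edge := Function.Involutive.toPerm g hg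
      edge_edge := hg
      edge_inl := by
        intro v s v' s' e
        have e : g (.inl (v, s)) = .inl (v', s') := e
        by_cases hz : ∃ j, (v, s) = lf j
        · obtain ⟨j, hj⟩ := hz
          rw [hj, g_lf] at e
          simp at e
        · rw [g_ne _ hz] at e
          have e' := heo (v, s)
          rw [Sum.inl_injective e] at e'
          rw [leaf_iff] at hz
          have := h.flip _ hz
          rwa [← e'] at this
      edge_inr := fun j => ⟨lf j, rfl⟩ }
  have hleaf : ∀ j, Γ.leafEnd j = lf j := fun j => by
    have := Γ.edge_leaf j
    exact (Sum.inl_injective this).symm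
  have hglue : Γ.glue = ε := by
    ext1 x
    by_cases hx : x.1 ∈ range d
    · obtain ⟨z, rfl⟩ := exists_up hx
      by_cases hz : ∃ j, z = lf j
      · rw [(leaf_iff z).1 hz]
        obtain ⟨j, rfl⟩ := hz
        rw [← hleaf, Γ.glue_leafEnd]
      · rw [Γ.glue_of_inl (g_ne z hz), heo]
    · rw [Γ.glue_of_not_mem hx]
      by_contra hne
      exact hx (h.supp x (Ne.symm hne))
  have hy : up (Γ.leafEnd ⟨0, h0⟩) = y := by
    rw [hleaf, hlf]; rfl
  refine ⟨Γ, ⟨h0, hnum, ?_, fun j => ?_⟩, hglue, hy⟩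
  · rw [hglue, hy]; exact h
  · rw [hglue, hy, hleaf, hlf]

theorem ncard_presents {w : Weight m} {L : List (Arc m)} (hL : ∀ a ∈ L, 0 < a.2)
    (hn : L.length = n) (h0 : 0 < n) :
    {Γ : DecoratedGraph m n d | Γ.Presents w L}.ncard =
      (labeled (range d) w (boundary L)).ncard := by
  refine Set.ncard_congr (fun Γ _ => (Γ.glue, up (Γ.leafEnd ⟨0, h0⟩))) ?_ ?_ ?_
  · intro Γ h
    refine ⟨?_, h.realizes⟩
    rw [card_range]; exact h.num
  · intro Γ Γ' h h' e
    simp only [Prod.mk.injEq] at e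
    obtain ⟨e1, e2⟩ := e
    refine ext_glue e1 fun j => up_injective ?_
    rw [← h.leaf, ← h'.leaf, e1, e2]
  · rintro ⟨ε, y⟩ ⟨h1, h2⟩
    rw [card_range] at h1
    obtain ⟨Γ, h3, rfl, rfl⟩ := exists_graph hL hn h0 h1 h2; exact ⟨Γ, h3, rfl⟩

theorem renumber_inl (e : Perm (Fin d)) (z : Fin d × Slot m) :
    renumber (n := n) e (.inl z) = .inl (e z.1, z.2) := rfl

theorem renumber_inr (e : Perm (Fin d)) (j : Fin n) : renumber (m := m) e (.inr j) = .inr j := rfl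

/-- The graph that is obtained by renumbering the vertices. -/
def act (e : Perm (Fin d)) (Γ : DecoratedGraph m n d) : DecoratedGraph m n d where
  edge := (renumber e).symm.trans (Γ.edge.trans (renumber e))
  edge_edge := fun x => by simp [Γ.edge_edge]
  edge_inl := by
    intro v s v' s' h
    have h1 : (renumber (m := m) (n := n) e).symm (.inl (v, s)) = .inl (e.symm v, s) := rfl
    simp only [Equiv.trans_apply, h1] at h
    rcases he : Γ.edge (.inl (e.symm v, s)) with ⟨v₁, s₁⟩ | j
    · rw [he, renumber_inl] at h
      have := Γ.edge_inl _ _ _ _ he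
      rw [← this]; exact (congrArg Prod.snd (Sum.inl_injective h)).symm
    · rw [he, renumber_inr] at h
      simp at h
  edge_inr := by
    intro j
    have h1 : (renumber (m := m) (d := d) e).symm (.inr j) = .inr j := rfl
    exact ⟨(e (Γ.leafEnd j).1, (Γ.leafEnd j).2), by
      simp only [Equiv.trans_apply, h1, edge_leaf, renumber_inl]⟩

theorem isomorphic_iff {Γ Γ' : DecoratedGraph m n d} : Isomorphic Γ Γ' ↔ ∃ e, Γ' = act e Γ := by
  constructor
  · rintro ⟨e, he⟩
    refine ⟨e, ext_edge fun x => ?_⟩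
    have := he ((renumber e).symm x)
    rwa [Equiv.apply_symm_apply] at this
  · rintro ⟨e, rfl⟩
    exact ⟨e, fun x => by simp [act]⟩

theorem leafEnd_act (e : Perm (Fin d)) (Γ : DecoratedGraph m n d) (j : Fin n) :
    (act e Γ).leafEnd j = (e (Γ.leafEnd j).1, (Γ.leafEnd j).2) := by
  have h := (act e Γ).edge_leaf j
  have h1 : (renumber (m := m) (d := d) e).symm (.inr j) = .inr j := rfl
  simp only [act, Equiv.trans_apply, h1, edge_leaf, renumber_inl] at h
  exact (Sum.inl_injective h).symm

/-- A renumbering of the internal vertices as a permutation of the natural numbers. -/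
def extend (e : Perm (Fin d)) : Perm ℕ := e.extendDomain Fin.equivSubtype

theorem extend_apply (e : Perm (Fin d)) (v : Fin d) : extend e v = e v :=
  Perm.extendDomain_apply_image e Fin.equivSubtype v

theorem map_extend (e : Perm (Fin d)) : (range d).map (extend e).toEmbedding = range d := by
  refine Finset.eq_of_subset_of_card_le ?_ (by rw [Finset.card_map])
  intro v hv
  obtain ⟨u, hu, rfl⟩ := mem_map.1 hv
  have := extend_apply e ⟨u, mem_range.1 hu⟩
  simp only [Equiv.coe_toEmbedding]
  simp only at this
  rw [this]
  exact mem_range.2 (e _).2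

theorem relabel_up (e : Perm (Fin d)) (z : Fin d × Slot m) :
    relabel (extend e) (up z) = up (e z.1, z.2) := by
  rw [relabel_apply]
  exact Prod.ext (extend_apply e z.1) rfl

theorem glue_act (e : Perm (Fin d)) (Γ : DecoratedGraph m n d) :
    (act e Γ).glue = (relabel (extend e)).symm.trans (Γ.glue.trans (relabel (extend e))) := by
  ext1 x
  obtain ⟨x, rfl⟩ := (relabel (extend e)).surjective x
  simp only [Equiv.trans_apply, Equiv.symm_apply_apply]
  by_cases hx : x.1 ∈ range d
  · obtain ⟨z, rfl⟩ := exists_up hx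
    rw [relabel_up]
    rcases he : Γ.edge (.inl z) with z' | j
    · rw [Γ.glue_of_inl he, relabel_up]
      apply glue_of_inl
      have h1 : (renumber (m := m) (n := n) e).symm (.inl (e z.1, z.2)) = .inl z := by
        rw [Equiv.symm_apply_eq]; rfl
      simp only [act, Equiv.trans_apply, h1, he, renumber_inl]
    · rw [Γ.eq_leafEnd he, Γ.glue_leafEnd, relabel_up, ← leafEnd_act, glue_leafEnd]
  · rw [Γ.glue_of_not_mem hx, glue_of_not_mem]
    intro h'
    rw [← map_extend e, relabel_apply] at h'
    simp only [mem_map, Equiv.coe_toEmbedding, EmbeddingLike.apply_eq_iff_eq, exists_eq_right] at h'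
    exact hx h'

theorem Presents.act {w : Weight m} {L : List (Arc m)}
    {Γ : DecoratedGraph m n d} (h : Γ.Presents w L) (e : Perm (Fin d)) :
    (act e Γ).Presents w L := by
  have h1 := h.realizes.relabel (extend e)
  rw [map_extend, ← glue_act, relabel_up, ← leafEnd_act] at h1
  refine ⟨h.root, h.num, h1, fun j => ?_⟩
  have key : ∀ (k : ℕ) (x : Corner m),
      (face (DecoratedGraph.act e Γ).glue)^[k] (relabel (extend e) x) =
      relabel (extend e) ((face Γ.glue)^[k] x) := by
    intro k
    induction k with
    | zero => exact fun _ => rfl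
    | succ k ih =>
      intro x
      rw [iterate_succ_apply', ih, iterate_succ_apply', face_apply, face_apply, glue_act]
      set x' := (face Γ.glue)^[k] x
      change relabel (extend e) (Γ.glue ((relabel (extend e)).symm
        (relabel (extend e) (x'.1, x'.2.next)))) = _
      rw [Equiv.symm_apply_apply]
  rw [leafEnd_act, leafEnd_act, ← relabel_up, ← relabel_up, key, h.leaf]

/-- A connected rooted graph has no automorphisms. -/
theorem act_injective {Γ : DecoratedGraph m n d} (hc : Γ.IsCentered) {e e' : Perm (Fin d)}
    (h : act e Γ = act e' Γ) : e = e' := by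
  have hedge : ∀ x,
      (renumber e).symm (renumber e' (Γ.edge x)) = Γ.edge ((renumber e).symm (renumber e' x)) := by
    intro x
    rw [Equiv.symm_apply_eq]
    have := congrArg (fun G : DecoratedGraph m n d => G.edge (renumber e' x)) h
    simp only [act, Equiv.trans_apply, Equiv.symm_apply_apply] at this; exact this.symm
  have hren : ∀ z : Fin d × Slot m, (renumber (n := n) e).symm (renumber e' (.inl z)) =
      .inl (e.symm (e' z.1), z.2) := fun z => rfl
  have root : e.symm (e' (Γ.leafEnd ⟨0, hc.root⟩).1) = (Γ.leafEnd ⟨0, hc.root⟩).1 := by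
    have := hedge (.inr ⟨0, hc.root⟩)
    have h2 : (renumber (m := m) e).symm (renumber e' (.inr ⟨0, hc.root⟩)) =
      .inr ⟨0, hc.root⟩ := rfl
    rw [h2, edge_leaf, hren] at this; exact congrArg Prod.fst (Sum.inl_injective this)
  have all : ∀ v, e.symm (e' v) = v := by
    intro v
    have hv := hc.connected (Γ.leafEnd ⟨0, hc.root⟩).1 v
    induction hv with
    | refl => exact root
    | @tail a b _ hab ih =>
      obtain ⟨s, s', hab⟩ := hab
      have := hedge (.inl (a, s))
      rw [hab, hren, hren] at this
      simp only [ih, hab] at this; exact congrArg Prod.fst (Sum.inl_injective this)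
  ext1 v
  rw [← all v, Equiv.apply_symm_apply, all v]

theorem mk_mem_iff {w : Weight m} {L : List (Arc m)} {Γ : DecoratedGraph m n d} :
    (Quotient.mk (setoid m n d) Γ) ∈ Quotient.mk (setoid m n d) '' {Γ | Γ.Presents w L} ↔
      Γ.Presents w L := by
  constructor
  · rintro ⟨Γ', h, e⟩
    obtain ⟨π, rfl⟩ := isomorphic_iff.1 (Quotient.exact e); exact Presents.act h π
  · exact fun h => ⟨Γ, h, rfl⟩

/-- Each isomorphism class of graphs with `d` vertices can be numbered in `d!` ways. -/
theorem ncard_presents_eq {w : Weight m} {L : List (Arc m)}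
    (hL : ∀ a ∈ L, 0 < a.2) (hn : L.length = n) :
    {Γ : DecoratedGraph m n d | Γ.Presents w L}.ncard =
      d.factorial * (Quotient.mk (setoid m n d) '' {Γ | Γ.Presents w L}).ncard := by
  have e1 : d.factorial = Nat.card (Perm (Fin d)) := by
    rw [Nat.card_eq_fintype_card, Fintype.card_perm, Fintype.card_fin]
  rw [e1, ← Nat.card_coe_set_eq, ← Nat.card_coe_set_eq, ← Nat.card_prod]
  symm
  have hout : ∀ C : ↥(Quotient.mk (setoid m n d) '' {Γ | Γ.Presents w L}),
      (C.1.out).Presents w L := by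
    intro C
    rw [← mk_mem_iff, Quotient.out_eq]; exact C.2
  refine Nat.card_eq_of_bijective
    (fun p => (⟨act p.1 p.2.1.out, Presents.act (hout p.2) p.1⟩ :
      {Γ : DecoratedGraph m n d | Γ.Presents w L})) ⟨?_, ?_⟩
  · rintro ⟨e, C⟩ ⟨e', C'⟩ h
    have h := congrArg Subtype.val h
    simp only at h
    have hC : C = C' := by
      apply Subtype.ext
      rw [← Quotient.out_eq C.1, ← Quotient.out_eq C'.1]
      apply Quotient.sound
      have h1 : C.1.out ≈ act e C.1.out := isomorphic_iff.2 ⟨e, rfl⟩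
      have h2 : C'.1.out ≈ act e' C'.1.out := isomorphic_iff.2 ⟨e', rfl⟩
      rw [h] at h1; exact Setoid.trans h1 (Setoid.symm h2)
    subst hC
    have hc := ((hout C).isTiling hL hn).toIsCentered
    rw [act_injective hc h]
  · rintro ⟨Γ, h⟩
    have h1 : (Quotient.mk (setoid m n d) Γ).out ≈ Γ := Quotient.mk_out Γ
    obtain ⟨e, he⟩ := isomorphic_iff.1 h1
    exact ⟨(e, ⟨Quotient.mk _ Γ, Γ, h, rfl⟩), Subtype.ext he.symm⟩

theorem rootLabel_iff {w : Weight m} {a : Arc m} {L : List (Arc m)}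
    (ha : 0 < a.2) {Γ : DecoratedGraph m n d} (h : Γ.Presents w (a :: L)) (k : Vertex m) :
    Γ.RootLabel k ↔ k = a.1.label := by
  have hs : (Γ.leafEnd ⟨0, h.root⟩).2 = a.1 := by
    have := h.realizes.marks
    obtain ⟨s, l⟩ := a
    obtain ⟨l, rfl⟩ := Nat.exists_eq_succ_of_ne_zero ha.ne'; exact this.1
  constructor
  · rintro ⟨h0, v, s, e, rfl⟩
    rw [edge_leaf] at e
    rw [← hs, Sum.inl_injective e]
  · rintro rfl
    exact ⟨h.root, _, _, Γ.edge_leaf _, congrArg Slot.label hs⟩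

/-- The number of isomorphism classes of tiling graphs in terms of tilings with numbered
vertices. -/
theorem factorial_mul_ncard_classes {a : Arc m} {L : List (Arc m)}
    (hL : ∀ b ∈ a :: L, 0 < b.2) (w : Weight m) (d : ℕ) :
    d.factorial * (classes w ((a :: L).map fun b => QPath.arc b.1 b.2) d a.1.label).ncard =
      (labeled (range d) w (boundary (a :: L))).ncard := by
  have hn : (a :: L).length = ((a :: L).map fun b => QPath.arc b.1 b.2).length := by simp
  rw [← ncard_presents hL hn (by simp), ncard_presents_eq hL hn]
  congr 2
  ext C
  constructor
  · rintro ⟨Γ, rfl, h1, h2, h3, h4⟩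
    exact ⟨Γ, IsTiling.presents hL hn ⟨h1, h3, h4⟩, rfl⟩
  · rintro ⟨Γ, h, rfl⟩
    have h' := Presents.isTiling hL hn h
    exact ⟨Γ, rfl, h'.toIsCentered, (rootLabel_iff (hL a (by simp)) h _).2 rfl,
      h'.weight_eq_apply, h'.hasSequence⟩

theorem classes_eq_empty {a : Arc m} {L : List (Arc m)}
    (hL : ∀ b ∈ a :: L, 0 < b.2) (w : Weight m) (d : ℕ) (k : Vertex m)
    (hk : k ≠ a.1.label) :
    classes w ((a :: L).map fun b => QPath.arc b.1 b.2) d k = ∅ := by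
  rw [Set.eq_empty_iff_forall_notMem]
  rintro C ⟨Γ, rfl, h1, h2, h3, h4⟩
  have hn : (a :: L).length = ((a :: L).map fun b => QPath.arc b.1 b.2).length := by simp
  exact hk ((rootLabel_iff (hL a (by simp)) (IsTiling.presents hL hn ⟨h1, h3, h4⟩) k).1 h2)

end DecoratedGraph

/-! ### Sums over decompositions of lists -/

section Gaps

variable {α M : Type*} [AddCommMonoid M]

/-- The sum over all decompositions of a list into two parts. -/
def gaps : (List α → List α → M) → List α → M
  | f, [] => f [] []
  | f, a :: L => f [] (a :: L) + gaps (fun X Y => f (a :: X) Y) L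

theorem gaps_congr {f g : List α → List α → M} {L : List α}
    (h : ∀ X Y, L = X ++ Y → f X Y = g X Y) : gaps f L = gaps g L := by
  induction L generalizing f g with
  | nil => exact h [] [] rfl
  | cons a L ih => rw [gaps, gaps, h [] (a :: L) rfl, ih fun X Y e => h (a :: X) Y (by rw [e]; rfl)]

theorem gaps_add (f g : List α → List α → M) (L : List α) :
    gaps (fun X Y => f X Y + g X Y) L = gaps f L + gaps g L := by
  induction L generalizing f g with
  | nil => rfl
  | cons a L ih => rw [gaps, gaps, gaps, ih, add_add_add_comm]

theorem gaps_zero (L : List α) : gaps (fun _ _ => (0 : M)) L = 0 := by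
  induction L with
  | nil => rfl
  | cons a L ih => rw [gaps, ih, add_zero]

theorem map_gaps {N F : Type*} [AddCommMonoid N] [FunLike F M N] [AddMonoidHomClass F M N] (φ : F)
    (f : List α → List α → M) (L : List α) : φ (gaps f L) = gaps (fun X Y => φ (f X Y)) L := by
  induction L generalizing f with
  | nil => rfl
  | cons a L ih => rw [gaps, gaps, map_add, ih]

theorem gaps_snoc (f : List α → List α → M) (L : List α) (b : α) :
    gaps f (L ++ [b]) = gaps (fun X Y => f X (Y ++ [b])) L + f (L ++ [b]) [] := by
  induction L generalizing f with
  | nil => rfl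
  | cons a L ih =>
    rw [cons_append, gaps, ih, gaps, ← add_assoc]; rfl

theorem gaps_gaps (f : List α → List α → List α → M) (L : List α) :
    gaps (fun X W => gaps (fun Y Z => f X Y Z) W) L =
      gaps (fun P Z => gaps (fun X Y => f X Y Z) P) L := by
  induction L generalizing f with
  | nil => rfl
  | cons a L ih =>
    change f [] [] (a :: L) + gaps (fun Y Z => f [] (a :: Y) Z) L +
        gaps (fun X W => gaps (fun Y Z => f (a :: X) Y Z) W) L =
      f [] [] (a :: L) + gaps (fun P Z => f [] (a :: P) Z + gaps (fun X Y => f (a :: X) Y Z) P) L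
    rw [ih, gaps_add, add_assoc]

theorem gaps_eq_sum (f : List α → List α → M) (L : List α) :
    gaps f L = ∑ i ∈ range (L.length + 1), f (L.take i) (L.drop i) := by
  induction L generalizing f with
  | nil => simp [gaps]
  | cons a L ih =>
    rw [gaps, ih, length_cons, Finset.sum_range_succ' _ (L.length + 1), add_comm]; rfl

/-- The sum over all decompositions of a list into three parts. -/
theorem gaps_gaps_eq_sum (f : List α → List α → List α → M) (L : List α) :
    gaps (fun X W => gaps (fun Y Z => f X Y Z) W) L =
      ∑ i ∈ range (L.length + 1), ∑ j ∈ Finset.Icc i L.length,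
        f (L.take i) ((L.take j).drop i) (L.drop j) := by
  rw [gaps_eq_sum]
  refine sum_congr rfl fun i hi => ?_
  have hi' := mem_range.1 hi
  rw [gaps_eq_sum, List.length_drop]
  refine Finset.sum_bij (fun k _ => i + k) ?_ ?_ ?_ ?_
  · intro k hk
    have := mem_range.1 hk
    exact mem_Icc.2 ⟨by omega, by omega⟩
  · intro a _ b _ h; omega
  · intro j hj
    have := mem_Icc.1 hj
    exact ⟨j - i, mem_range.2 (by omega), by omega⟩
  · intro k _
    rw [List.drop_take, List.drop_drop, Nat.add_sub_cancel_left]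

end Gaps

section Splits

variable {M : Type*} [AddCommMonoid M]

theorem sum_Ioo_add {p q : ℕ} (hp : 0 < p) (hq : 0 < q) (f : ℕ → M) : ∑ l ∈ Ioo 0 (p + q), f l =
      ∑ l ∈ Ioo 0 p, f l + f p + ∑ k ∈ Ioo 0 q, f (p + k) := by
  have e : ∀ n, Ioo 0 n = Finset.Ico 1 n := fun _ => rfl
  rw [e, e, e, ← Finset.sum_Ico_consecutive f hp (Nat.le_add_right p q),
    Finset.sum_eq_sum_Ico_succ_bot (Nat.lt_add_of_pos_right hq), ← add_assoc, Finset.sum_Ico_add f 1 q p,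
    add_comm 1, add_comm q]

/-- The sum over all factorizations of an arc into two arcs of positive length. -/
def parts (a : Arc m) (g : Arc m → Arc m → M) : M :=
  ∑ k ∈ Ioo 0 a.2, g (a.1, k) (across^[k] a.1, a.2 - k)

theorem parts_congr {a : Arc m} {g h : Arc m → Arc m → M}
    (H : ∀ x y : Arc m, x.1 = a.1 → y.1 = across^[x.2] a.1 → 0 < x.2 → 0 < y.2 →
      x.2 + y.2 = a.2 → g x y = h x y) : parts a g = parts a h := by
  refine sum_congr rfl fun k hk => ?_
  have := mem_Ioo.1 hk
  exact H _ _ rfl rfl (by simp; omega) (by simp; omega) (by simp; omega)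

theorem parts_zero (a : Arc m) : parts a (fun _ _ => (0 : M)) = 0 := Finset.sum_const_zero

theorem parts_ite (p : Prop) [Decidable p] (a : Arc m) (g : Arc m → Arc m → M) :
    parts a (fun x y => if p then g x y else 0) = if p then parts a g else 0 := by
  split_ifs
  · rfl
  · exact parts_zero a

theorem parts_eq_zero {a : Arc m} {g : Arc m → Arc m → M}
    (H : ∀ x y : Arc m, x.1 = a.1 → y.1 = across^[x.2] a.1 → 0 < x.2 → 0 < y.2 →
      x.2 + y.2 = a.2 → g x y = 0) : parts a g = 0 :=
  (parts_congr H).trans (parts_zero a)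

theorem parts_add (a : Arc m) (g h : Arc m → Arc m → M) :
    parts a (fun x y => g x y + h x y) = parts a g + parts a h := sum_add_distrib

theorem parts_sum {ι : Type*} (s : Finset ι) (a : Arc m) (g : ι → Arc m → Arc m → M) :
    parts a (fun x y => ∑ i ∈ s, g i x y) = ∑ i ∈ s, parts a (g i) := Finset.sum_comm

theorem map_parts {N F : Type*} [AddCommMonoid N] [FunLike F M N] [AddMonoidHomClass F M N] (φ : F)
    (a : Arc m) (g : Arc m → Arc m → M) :
    φ (parts a g) = parts a fun x y => φ (g x y) := map_sum _ _ _

/-- Both sides are the sum over all factorizations into three arcs. -/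
theorem parts_parts (a : Arc m) (g : Arc m → Arc m → Arc m → M) :
    parts a (fun x y => parts y fun y' y'' => g x y' y'') =
      parts a (fun x y => parts x fun x' x'' => g x' x'' y) := by
  unfold parts
  rw [Finset.sum_sigma', Finset.sum_sigma']
  refine Finset.sum_bij' (fun p _ => ⟨p.1 + p.2, p.1⟩) (fun p _ => ⟨p.2, p.1 - p.2⟩) ?_ ?_ ?_ ?_ ?_
  · rintro ⟨k, l⟩ h
    simp only [mem_sigma, mem_Ioo] at h ⊢; omega
  · rintro ⟨k, l⟩ h
    simp only [mem_sigma, mem_Ioo] at h ⊢; omega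
  · rintro ⟨k, l⟩ h
    simp only [mem_sigma, mem_Ioo, Sigma.mk.injEq, heq_eq_eq, true_and] at h ⊢; omega
  · rintro ⟨k, l⟩ h
    simp only [mem_sigma, mem_Ioo, Sigma.mk.injEq, heq_eq_eq, and_true] at h ⊢; omega
  · rintro ⟨k, l⟩ h
    simp only [mem_sigma, mem_Ioo] at h ⊢
    rw [Nat.add_sub_cancel_left, ← iterate_add_apply, add_comm l k, Nat.sub_sub]

/-- The factorizations of a product of two arcs. -/
theorem parts_mul (s : Slot m) {a b : ℕ} (ha : 0 < a) (hb : 0 < b) (g : Arc m → Arc m → M) :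
    parts (s, a + b) g = parts (s, a) (fun x y => g x (y.1, y.2 + b)) + g (s, a) (across^[a] s, b) +
      parts (across^[a] s, b) (fun x y => g (s, a + x.2) y) := by
  unfold parts
  rw [sum_Ioo_add ha hb]
  congr 1
  · congr 1
    · refine sum_congr rfl fun k hk => ?_
      have := mem_Ioo.1 hk
      simp only
      congr 2; omega
    · simp
  · refine sum_congr rfl fun k hk => ?_
    rw [← iterate_add_apply, add_comm k a, Nat.add_sub_add_left]

/-- The sum over all entries of a list and all factorizations of that entry. -/
def splits : (List (Arc m) → Arc m → Arc m → List (Arc m) → M) → List (Arc m) → M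
  | _, [] => 0
  | f, a :: L => parts a (fun x y => f [] x y L) + splits (fun X x y Z => f (a :: X) x y Z) L

theorem splits_congr {f g : List (Arc m) → Arc m → Arc m → List (Arc m) → M}
    {L : List (Arc m)} (h : ∀ X x y Z, 0 < x.2 → 0 < y.2 → y.1 = across^[x.2] x.1 →
      (∀ a ∈ X, a ∈ L) → (∀ a ∈ Z, a ∈ L) → f X x y Z = g X x y Z) : splits f L = splits g L := by
  induction L generalizing f g with
  | nil => rfl
  | cons a L ih =>
    rw [splits, splits]
    congr 1
    · exact parts_congr fun x y h1 h2 h3 h4 h5 => h _ _ _ _ h3 h4 (by rw [h2, h1]) (by simp)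
        (fun b hb => mem_cons_of_mem _ hb)
    · refine ih fun X x y Z h1 h2 h3 h4 h5 => h _ _ _ _ h1 h2 h3 ?_
        (fun b hb => mem_cons_of_mem _ (h5 b hb))
      intro b hb
      rcases mem_cons.1 hb with rfl | hb
      · exact List.mem_cons_self
      · exact mem_cons_of_mem _ (h4 b hb)

theorem splits_add (f g : List (Arc m) → Arc m → Arc m → List (Arc m) → M) (L : List (Arc m)) :
    splits (fun X x y Z => f X x y Z + g X x y Z) L = splits f L + splits g L := by
  induction L generalizing f g with
  | nil => simp [splits]
  | cons a L ih => rw [splits, splits, splits, ih, parts_add, add_add_add_comm]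

theorem splits_zero (L : List (Arc m)) : splits (fun _ _ _ _ => (0 : M)) L = 0 := by
  induction L with
  | nil => rfl
  | cons a L ih => rw [splits, ih, add_zero, parts_zero]

theorem splits_sum {ι : Type*} (s : Finset ι)
    (f : ι → List (Arc m) → Arc m → Arc m → List (Arc m) → M)
    (L : List (Arc m)) :
    splits (fun X x y Z => ∑ i ∈ s, f i X x y Z) L = ∑ i ∈ s, splits (f i) L := by
  classical
  induction s using Finset.induction_on with
  | empty => simp [splits_zero]
  | insert a s ha ih => simp only [Finset.sum_insert ha, splits_add, ih]

theorem splits_parts (b : Arc m) (f : Arc m → Arc m → List (Arc m) → Arc m → Arc m →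
      List (Arc m) → M) (L : List (Arc m)) :
    splits (fun X x y Z => parts b fun u v => f u v X x y Z) L =
      parts b fun u v => splits (f u v) L := splits_sum _ _ L

theorem map_splits {N F : Type*} [AddCommMonoid N] [FunLike F M N] [AddMonoidHomClass F M N]
    (φ : F) (f : List (Arc m) → Arc m → Arc m → List (Arc m) → M)
    (L : List (Arc m)) :
    φ (splits f L) = splits (fun X x y Z => φ (f X x y Z)) L := by
  induction L generalizing f with
  | nil => exact map_zero φ
  | cons a L ih => rw [splits, splits, map_add, ih, map_parts]

theorem splits_append (f : List (Arc m) → Arc m → Arc m → List (Arc m) → M) (L L' : List (Arc m)) :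
    splits f (L ++ L') = splits (fun X x y Z => f X x y (Z ++ L')) L +
      splits (fun X x y Z => f (L ++ X) x y Z) L' := by
  induction L generalizing f with
  | nil => simp [splits]
  | cons a L ih => rw [cons_append, splits, ih, splits, add_assoc]; rfl

theorem splits_singleton (f : List (Arc m) → Arc m → Arc m → List (Arc m) → M) (a : Arc m) :
    splits f [a] = parts a fun x y => f [] x y [] := by simp [splits]

/-- The factorizations of an entry of a list, sorted by the part of the list before that entry. -/
theorem gaps_head (f : List (Arc m) → Arc m → Arc m → List (Arc m) → M)
    (h : List (Arc m) → List (Arc m) → M) (hn : ∀ X, h X [] = 0)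
    (hc : ∀ X a Y, h X (a :: Y) = parts a fun x y => f X x y Y) (L : List (Arc m)) :
    gaps h L = splits f L := by
  induction L generalizing f h with
  | nil => exact hn []
  | cons a L ih =>
    rw [gaps, splits, hc]
    congr 1
    exact ih (fun X => f (a :: X)) (fun X => h (a :: X)) (fun X => hn _) fun X b Y => hc _ b Y

theorem gaps_last (f : List (Arc m) → Arc m → Arc m → List (Arc m) → M)
    (h : List (Arc m) → List (Arc m) → M) (hn : ∀ Z, h [] Z = 0)
    (hc : ∀ X a Z, h (X ++ [a]) Z = parts a fun x y => f X x y Z) (L : List (Arc m)) :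
    gaps h L = splits f L := by
  induction L generalizing f h with
  | nil => exact hn []
  | cons a L ih =>
    rw [gaps, splits, hn, zero_add]
    have key : gaps (fun X Y => h (a :: X) Y) L = (parts a fun x y => f [] x y L) +
          gaps (fun X Y => if X = [] then 0 else h (a :: X) Y) L := by
      cases L with
      | nil =>
        have := hc [] a []
        simp only [nil_append] at this
        simp [gaps, this]
      | cons b L =>
        have := hc [] a (b :: L)
        simp only [nil_append] at this
        rw [gaps, gaps, this]; simp
    rw [key]
    congr 1
    refine ih _ _ (by simp) fun X b Z => ?_
    rw [if_neg (by simp)]; exact hc (a :: X) b Z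

end Splits

/-! ### The cancellations behind the structure relation -/

section Module

variable {R M : Type*} [CommRing R] [AddCommGroup M] [Module R M]

theorem smul_parts (r : R) (a : Arc m) (g : Arc m → Arc m → M) :
    r • parts a g = parts a fun x y => r • g x y := Finset.smul_sum

theorem parts_smul (v : M) (a : Arc m) (g : Arc m → Arc m → R) :
    parts a g • v = parts a fun x y => g x y • v := sum_smul

theorem splits_smul (v : M) (L : List (Arc m))
    (f : List (Arc m) → Arc m → Arc m → List (Arc m) → R) :
    splits f L • v = splits (fun X x y Z => f X x y Z • v) L :=
  map_splits ((LinearMap.toSpanSingleton R M v) : R →+ M) f L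

end Module

/-- The properties of the numbers `C L` of tilings with boundary sequence `L` on which the
structure relation depends; `U s` keeps track of the weight.  Cutting the edge that separates the
factors of a product of arcs yields `cut`. -/
structure IsTilingCount {R : Type*} [CommRing R] (U : Slot m → R)
    (C : List (Arc m) → R) : Prop where
  across : ∀ s, U s.across = U s
  rotate : ∀ a L, C (a :: L) = C (L ++ [a])
  turn : ∀ a b L, C (a :: b :: L) ≠ 0 → b.1 = (Slot.across^[a.2] a.1).flip
  singleton : ∀ a, C [a] = 0
  cut : ∀ p q L, 0 < p.2 → 0 < q.2 →
    (if q.1 = Slot.across^[p.2] p.1 then C ((p.1, p.2 + q.2) :: L) else 0) =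
      ∑ s, U s * C ((s, s.period) :: q :: L ++ [p]) +
        splits (fun X x y Z => C (q :: X ++ [x]) * C (y :: Z ++ [p])) L

section Defect

variable {R M : Type*} [CommRing R] [AddCommGroup M] [Module R M]

/-- The value of `f` at the sequence in which the last entry of `X` and the first entry of `Z` are
replaced by their product. -/
def merge (f : List (Arc m) → M) (X Z : List (Arc m)) : M :=
  match X.getLast?, Z with
  | some p, q :: Z' =>
    if q.1 = across^[p.2] p.1 then f (X.dropLast ++ (p.1, p.2 + q.2) :: Z') else 0
  | _, _ => 0

theorem merge_snoc_cons (f : List (Arc m) → M) (X Z : List (Arc m)) (p q : Arc m) :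
    merge f (X ++ [p]) (q :: Z) =
      if q.1 = across^[p.2] p.1 then f (X ++ (p.1, p.2 + q.2) :: Z) else 0 := by
  simp [merge]

theorem merge_nil_left (f : List (Arc m) → M) (Z : List (Arc m)) :
    merge f [] Z = 0 := by simp [merge]

theorem merge_nil_right (f : List (Arc m) → M) (X : List (Arc m)) : merge f X [] = 0 := by
  unfold merge
  cases X.getLast? <;> rfl

theorem merge_add (f g : List (Arc m) → M) (X Z : List (Arc m)) :
    merge (fun L => f L + g L) X Z = merge f X Z + merge g X Z := by
  rcases eq_nil_or_concat X with rfl | ⟨X, p, rfl⟩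
  · simp [merge_nil_left]
  · rw [concat_eq_append]
    cases Z with
    | nil => simp [merge_nil_right]
    | cons q Z =>
      rw [merge_snoc_cons, merge_snoc_cons, merge_snoc_cons]
      split_ifs <;> simp

variable (U : Slot m → R) (C : List (Arc m) → R)

/-- The sum of those terms of the structure relation for `f` on the sequence `X ++ Z` that are
supported at the gap between `X` and `Z`: the inner operation inserts the boundary of a monogon or
bigon, multiplies the entries next to the gap, or is an extended term whose inputs begin or end
there. -/
def defect (f : List (Arc m) → M) (X Z : List (Arc m)) : M :=
  ∑ s, U s • f (X ++ (s, s.period) :: Z) + merge f X Z +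
    splits (fun X₁ x y X₂ => C (y :: X₂) • f (X₁ ++ x :: Z)) X +
    splits (fun Y₁ x y Y₂ => C (Y₁ ++ [x]) • f (X ++ y :: Y₂)) Z

theorem defect_add (f g : List (Arc m) → M) (X Z : List (Arc m)) :
    defect U C (fun L => f L + g L) X Z = defect U C f X Z + defect U C g X Z := by
  unfold defect
  simp only [smul_add, sum_add_distrib, merge_add, splits_add]
  abel

end Defect

namespace IsTilingCount

variable {R : Type*} [CommRing R] {U : Slot m → R} {C : List (Arc m) → R}
  (h : IsTilingCount U C)
include h

theorem append_comm (X Y : List (Arc m)) : C (X ++ Y) = C (Y ++ X) := by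
  induction X generalizing Y with
  | nil => simp
  | cons a X ih =>
    rw [cons_append, h.rotate, append_assoc, ih]; simp

theorem turn_append (X Y : List (Arc m)) (a b : Arc m) (hC : C (X ++ a :: b :: Y) ≠ 0) :
    b.1 = (Slot.across^[a.2] a.1).flip := by
  rw [h.append_comm] at hC
  exact h.turn a b _ hC

theorem turn_last (X : List (Arc m)) (a b : Arc m) (hC : C (a :: X ++ [b]) ≠ 0) :
    a.1 = (Slot.across^[b.2] b.1).flip := by
  rw [h.append_comm] at hC
  exact h.turn b a _ hC

/-- The cut equation, for a product at any place of a sequence. -/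
theorem defect_eq_zero [CharP R 2] (X Z : List (Arc m)) (p q : Arc m) (hp : 0 < p.2)
    (hq : 0 < q.2) : defect U C C (X ++ [p]) (q :: Z) = 0 := by
  have hcut := h.cut p q (Z ++ X) hp hq
  rw [splits_append] at hcut
  unfold defect
  rw [merge_snoc_cons, splits_append, splits_singleton, splits]
  have e1 : ∀ X₁ Z₁ : List (Arc m), C (X₁ ++ [p] ++ q :: Z₁) = C (q :: (Z₁ ++ X₁) ++ [p]) := by
    intro X₁ Z₁
    rw [h.append_comm]; simp
  have e2 : (if q.1 = Slot.across^[p.2] p.1 then C (X ++ (p.1, p.2 + q.2) :: Z) else 0) =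
      if q.1 = Slot.across^[p.2] p.1 then C ((p.1, p.2 + q.2) :: (Z ++ X)) else 0 := by
    rw [h.append_comm]; rfl
  have e3 : ∀ s : Slot m, C (X ++ [p] ++ (s, s.period) :: q :: Z) =
      C ((s, s.period) :: q :: (Z ++ X) ++ [p]) := by
    intro s
    rw [h.append_comm]; simp
  have e4 : (parts p fun x y => C (y :: []) • C (X ++ [] ++ x :: q :: Z)) = 0 :=
    parts_eq_zero fun x y _ _ _ _ _ => by rw [h.singleton, zero_smul]
  have e5 : (parts q fun x y => C ([] ++ [x]) • C (X ++ [p] ++ y :: Z)) = 0 :=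
    parts_eq_zero fun x y _ _ _ _ _ => by rw [nil_append, h.singleton, zero_smul]
  rw [e4, e5, e2, hcut]
  simp only [e3, smul_eq_mul, add_zero, zero_add]
  have e6 : splits (fun X₁ x y X₂ => C (y :: (X₂ ++ [p])) * C (X₁ ++ x :: q :: Z)) X =
      splits (fun X₁ x y Z₁ => C (q :: (Z ++ X₁) ++ [x]) * C (y :: Z₁ ++ [p])) X := by
    congr 1
    funext X₁ x y X₂
    have : C (X₁ ++ x :: q :: Z) = C (q :: (Z ++ X₁) ++ [x]) := by
      have : X₁ ++ x :: q :: Z = (X₁ ++ [x]) ++ (q :: Z) := by simp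
      rw [this, h.append_comm]; simp
    rw [this, mul_comm]; rfl
  have e7 : splits (fun Y₁ x y Y₂ => C (q :: Y₁ ++ [x]) * C (X ++ [p] ++ y :: Y₂)) Z =
      splits (fun X₁ x y Z₁ => C (q :: X₁ ++ [x]) * C (y :: (Z₁ ++ X) ++ [p])) Z := by
    congr 1
    funext Y₁ x y Y₂
    have : C (X ++ [p] ++ y :: Y₂) = C (y :: (Y₂ ++ X) ++ [p]) := by
      rw [h.append_comm]; simp
    rw [this]
  rw [e6, e7]
  ring_nf
  rw [CharTwo.two_eq_zero]
  ring

/-- The cut equation, with the factors of the product at the ends of the sequence. -/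
theorem defect_cons_snoc (L : List (Arc m)) (p q : Arc m) (hp : 0 < p.2)
    (hq : 0 < q.2) : defect U C C (q :: (L ++ [p])) [] =
      if q.1 = Slot.across^[p.2] p.1 then C ((p.1, p.2 + q.2) :: L) else 0 := by
  rw [h.cut p q L hp hq]
  unfold defect
  rw [merge_nil_right, splits, splits, splits_append, splits_singleton]
  have e3 : ∀ s : Slot m, C (q :: (L ++ [p]) ++ [(s, s.period)]) =
      C ((s, s.period) :: q :: L ++ [p]) := by
    intro s
    rw [h.append_comm]; rfl
  have e4 : (parts p fun x y => C (y :: []) • C (q :: (L ++ []) ++ x :: [])) = 0 :=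
    parts_eq_zero fun x y _ _ _ _ _ => by rw [h.singleton, zero_smul]
  have e5 : (parts q fun x y => C (y :: (L ++ [p])) • C ([] ++ x :: [])) = 0 :=
    parts_eq_zero fun x y _ _ _ _ _ => by rw [nil_append, h.singleton, smul_zero]
  rw [e4, e5]
  simp only [e3, smul_eq_mul, add_zero, zero_add]
  congr 2
  funext X x y Z
  rw [mul_comm]
  rfl

theorem defect_nil_left (L : List (Arc m)) : defect U C C [] L = defect U C C L [] := by
  unfold defect
  rw [merge_nil_left, merge_nil_right, splits, splits, add_zero, add_zero, add_zero, add_zero]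
  congr 1
  · refine sum_congr rfl fun s _ => ?_
    change U s • C ((s, s.period) :: L) = _
    rw [h.rotate]
  · congr 1
    funext X x y Z
    simp only [smul_eq_mul, nil_append]
    rw [mul_comm]

end IsTilingCount

section Vec

variable {R : Type*} [CommRing R]

variable (R) in
/-- The basis element given by an arc. -/
def vec (a : Arc m) : BorderedAlgebra R m := basis (QPath.arc a.1 a.2)

theorem vec_mul_vec (a b : Arc m) (ha : 0 < a.2) (hb : 0 < b.2) :
    vec R a * vec R b = if b.1 = across^[a.2] a.1 then vec R (a.1, a.2 + b.2) else 0 := by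
  classical
  unfold vec
  rw [basis_mul_basis, QPath.comp_arc _ _ ha hb]
  split_ifs <;> rfl

theorem arc_zero (s : Slot m) : QPath.arc s 0 = QPath.const s.label := rfl

theorem vec_mul_vec_zero (a : Arc m) (s : Slot m) : vec R a * vec R (s, 0) =
      if s.label = (across^[a.2] a.1).label then vec R a else 0 := by
  classical
  unfold vec
  rw [basis_mul_basis, arc_zero, QPath.comp_const, QPath.finish_arc]
  split_ifs <;> rfl

theorem vec_zero_mul_vec (a : Arc m) (s : Slot m) :
    vec R (s, 0) * vec R a = if s.label = a.1.label then vec R a else 0 := by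
  classical
  unfold vec
  rw [basis_mul_basis, arc_zero, QPath.const_comp, QPath.start_arc]
  split_ifs <;> rfl

theorem vec_zero_congr {s t : Slot m} (h : s.label = t.label) : vec R (s, 0) = vec R (t, 0) := by
  unfold vec
  rw [arc_zero, arc_zero, h]

theorem mul_parts (v : BorderedAlgebra R m) (a : Arc m) (g : Arc m → Arc m → BorderedAlgebra R m) :
    v * parts a g = parts a fun x y => v * g x y := mul_sum _ _ _

theorem parts_mul_right (v : BorderedAlgebra R m) (a : Arc m)
    (g : Arc m → Arc m → BorderedAlgebra R m) :
    parts a g * v = parts a fun x y => g x y * v := Finset.sum_mul _ _ _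

theorem smul_mul_assoc' (r : R) (a b : BorderedAlgebra R m) : (r • a) * b = r • (a * b) :=
  BorderedAlgebra.smul_mul r a b

theorem mul_smul_comm' (r : R) (a b : BorderedAlgebra R m) : a * (r • b) = r • (a * b) :=
  BorderedAlgebra.mul_smul' r a b

theorem add_self_eq_zero [CharP R 2] (v : BorderedAlgebra R m) : v + v = 0 := by
  rw [← two_smul R v, CharTwo.two_eq_zero, zero_smul]

variable (C : List (Arc m) → R)

/-- The centered term. -/
def centerTerm : List (Arc m) → BorderedAlgebra R m
  | [] => 0
  | a :: L => C (a :: L) • vec R (a.1, 0)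

/-- The left-extended terms. -/
def leftTerm : List (Arc m) → BorderedAlgebra R m
  | [] => 0
  | a :: L => parts a fun x y => C (y :: L) • vec R x

/-- The right-extended terms. -/
def rightTerm (L : List (Arc m)) : BorderedAlgebra R m :=
  match L.getLast? with
  | none => 0
  | some a => parts a fun x y => C (L.dropLast ++ [x]) • vec R y

theorem rightTerm_nil : rightTerm C [] = 0 := rfl

theorem rightTerm_snoc (L : List (Arc m)) (a : Arc m) :
    rightTerm C (L ++ [a]) = parts a fun x y => C (L ++ [x]) • vec R y := by
  simp [rightTerm]

end Vec

/-- Monogons and bigons can be read from either corner. -/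
theorem sum_parts_period {R M : Type*} [CommRing R] [AddCommGroup M] [Module R M] {U : Slot m → R}
    (hU : ∀ s, U s.across = U s) (g : Arc m → Arc m → M) :
    ∑ s, U s • parts (s, s.period) g = ∑ s, U s • parts (s, s.period) fun x y => g y x := by
  refine Fintype.sum_equiv (Function.Involutive.toPerm (across (m := m))
    across_across) _ _ fun s => ?_
  change U s • _ = U s.across • parts (s.across, s.across.period) _
  rw [hU, period_across]
  congr 1
  refine sum_congr rfl fun k hk => ?_
  have hk' := mem_Ioo.1 hk
  simp only at hk'
  rcases period_cases s with h | h
  · omega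
  · obtain rfl : k = 1 := by omega
    simp only [iterate_one, across_across, h.1]

section Ends

variable {R : Type*} [CommRing R] (U : Slot m → R) (C : List (Arc m) → R)

theorem defect_leftTerm (a : Arc m) (X Z : List (Arc m)) : defect U C (leftTerm C) (a :: X) Z =
      (parts a fun x y => defect U C C (y :: X) Z • vec R x) +
        (merge (leftTerm C) (a :: X) Z - parts a fun x y => merge C (y :: X) Z • vec R x) := by
  have e1 : (∑ s, U s • leftTerm C (a :: X ++ (s, s.period) :: Z)) =
      parts a fun x y => (∑ s, U s • C (y :: X ++ (s, s.period) :: Z)) • vec R x := by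
    simp only [sum_smul, parts_sum, smul_assoc]
    refine sum_congr rfl fun s _ => ?_
    rw [cons_append, leftTerm, smul_parts]; rfl
  have e2 : splits (fun X₁ x y X₂ => C (y :: X₂) • leftTerm C (X₁ ++ x :: Z)) (a :: X) =
      parts a fun x y =>
        splits (fun X₁ x y X₂ => C (y :: X₂) • C (X₁ ++ x :: Z)) (y :: X) • vec R x := by
    simp only [splits, add_smul, parts_add]
    congr 1
    · simp only [nil_append, leftTerm, smul_parts, parts_smul]
      rw [parts_parts]
      simp only [smul_assoc]
    · simp only [splits_smul, ← splits_parts]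
      refine splits_congr fun X₁ x y X₂ _ _ _ _ _ => ?_
      rw [cons_append, leftTerm, smul_parts]
      simp only [smul_assoc, cons_append]
  have e3 : splits (fun Y₁ x y Y₂ => C (Y₁ ++ [x]) • leftTerm C (a :: X ++ y :: Y₂)) Z =
      parts a fun u v =>
        splits (fun Y₁ x y Y₂ => C (Y₁ ++ [x]) • C (v :: X ++ y :: Y₂)) Z • vec R u := by
    simp only [splits_smul, ← splits_parts]
    refine splits_congr fun X₁ x y X₂ _ _ _ _ _ => ?_
    rw [cons_append, leftTerm, smul_parts]
    simp only [smul_assoc, cons_append]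
  unfold defect
  rw [e1, e2, e3]
  simp only [add_smul, parts_add]
  abel

theorem defect_rightTerm (b : Arc m) (X Z : List (Arc m)) : defect U C (rightTerm C) X (Z ++ [b]) =
      (parts b fun x y => defect U C C X (Z ++ [x]) • vec R y) + (merge (rightTerm C) X (Z ++ [b]) -
          parts b fun x y => merge C X (Z ++ [x]) • vec R y) := by
  have e1 : (∑ s, U s • rightTerm C (X ++ (s, s.period) :: (Z ++ [b]))) =
      parts b fun x y => (∑ s, U s • C (X ++ (s, s.period) :: (Z ++ [x]))) • vec R y := by
    simp only [sum_smul, parts_sum, smul_assoc]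
    refine sum_congr rfl fun s _ => ?_
    rw [← cons_append, ← append_assoc, rightTerm_snoc, smul_parts]
    simp only [append_assoc, cons_append]
  have e2 : splits (fun Y₁ x y Y₂ => C (Y₁ ++ [x]) • rightTerm C (X ++ y :: Y₂)) (Z ++ [b]) =
      parts b fun u v =>
        splits (fun Y₁ x y Y₂ => C (Y₁ ++ [x]) • C (X ++ y :: Y₂)) (Z ++ [u]) • vec R v := by
    simp only [splits_append, splits_singleton, add_smul, parts_add]
    congr 1
    · simp only [splits_smul, ← splits_parts]
      refine splits_congr fun X₁ x y X₂ _ _ _ _ _ => ?_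
      rw [← cons_append, ← append_assoc, rightTerm_snoc, smul_parts]
      simp only [smul_assoc, append_assoc, cons_append]
    · simp only [rightTerm_snoc, smul_parts, parts_smul]
      rw [parts_parts]
      simp only [smul_assoc, List.append_nil]
  have e3 : splits (fun X₁ x y X₂ => C (y :: X₂) • rightTerm C (X₁ ++ x :: (Z ++ [b]))) X =
      parts b fun u v =>
        splits (fun X₁ x y X₂ => C (y :: X₂) • C (X₁ ++ x :: (Z ++ [u]))) X • vec R v := by
    simp only [splits_smul, ← splits_parts]
    refine splits_congr fun X₁ x y X₂ _ _ _ _ _ => ?_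
    rw [← cons_append, ← append_assoc, rightTerm_snoc, smul_parts]
    simp only [smul_assoc, append_assoc, cons_append]
  unfold defect
  rw [e1, e2, e3]
  simp only [add_smul, parts_add]
  abel

theorem merge_leftTerm (a p : Arc m) (X Z : List (Arc m)) : merge (leftTerm C) (a :: (X ++ [p])) Z =
      parts a fun x y => merge C (y :: (X ++ [p])) Z • vec R x := by
  cases Z with
  | nil => simp only [merge_nil_right, zero_smul, parts_zero]
  | cons q Z =>
    simp only [← cons_append, merge_snoc_cons]
    split_ifs
    · rfl
    · simp only [zero_smul, parts_zero]

theorem merge_rightTerm (b q : Arc m) (X Z : List (Arc m)) :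
    merge (rightTerm C) X (q :: (Z ++ [b])) =
      parts b fun x y => merge C X (q :: (Z ++ [x])) • vec R y := by
  rcases eq_nil_or_concat X with rfl | ⟨X, p, rfl⟩
  · simp only [merge_nil_left, zero_smul, parts_zero]
  · simp only [concat_eq_append, merge_snoc_cons]
    split_ifs
    · rw [← cons_append, ← append_assoc, rightTerm_snoc]
      simp only [append_assoc, cons_append]
    · simp only [zero_smul, parts_zero]

/-- At the first gap, the factorizations of the product of the first two entries include some in
which the first entry is not divided. -/
theorem merge_leftTerm_singleton (a q : Arc m) (Z : List (Arc m)) (ha : 0 < a.2) (hq : 0 < q.2) :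
    merge (leftTerm C) [a] (q :: Z) = (parts a fun x y => merge C [y] (q :: Z) • vec R x) +
        ((if q.1 = across^[a.2] a.1 then C (q :: Z) • vec R a else 0) +
          vec R a * leftTerm C (q :: Z)) := by
  have h1 := merge_snoc_cons (leftTerm C) [] Z a q
  have h2 : ∀ y, merge C [y] (q :: Z) = _ := fun y => merge_snoc_cons C [] Z y q
  simp only [nil_append] at h1 h2
  rw [h1]
  simp only [h2]
  have h3 : (parts a fun x y => (if q.1 = across^[y.2] y.1 then C ((y.1, y.2 + q.2) :: Z)
      else 0) • vec R x) = parts a fun x y => (if q.1 = across^[a.2] a.1 then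
        C ((y.1, y.2 + q.2) :: Z) else 0) • vec R x := by
    refine parts_congr fun x y _ hy _ _ hxy => ?_
    rw [hy, ← iterate_add_apply, add_comm, hxy]
  have h4 : vec R a * leftTerm C (q :: Z) = parts q fun x y =>
      if q.1 = across^[a.2] a.1 then C (y :: Z) • vec R (a.1, a.2 + x.2) else 0 := by
    rw [leftTerm, mul_parts]
    refine parts_congr fun x y hx _ hx0 _ _ => ?_
    rw [mul_smul_comm', vec_mul_vec _ _ ha hx0, hx]
    split_ifs <;> simp
  rw [h3, h4]
  split_ifs with h
  · rw [leftTerm, parts_mul _ ha hq, ← h, add_assoc]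
  · simp only [zero_smul, parts_zero, add_zero]

theorem merge_rightTerm_singleton (b p : Arc m) (X : List (Arc m)) (hp : 0 < p.2) (hb : 0 < b.2) :
    merge (rightTerm C) (X ++ [p]) [b] = (parts b fun x y => merge C (X ++ [p]) [x] • vec R y) +
        ((if b.1 = across^[p.2] p.1 then C (X ++ [p]) • vec R b else 0) +
          rightTerm C (X ++ [p]) * vec R b) := by
  rw [merge_snoc_cons]
  simp only [merge_snoc_cons]
  have h3 : (parts b fun x y => (if x.1 = across^[p.2] p.1 then C (X ++ [(p.1, p.2 + x.2)])
      else 0) • vec R y) = parts b fun x y => (if b.1 = across^[p.2] p.1 then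
        C (X ++ [(p.1, p.2 + x.2)]) else 0) • vec R y := by
    refine parts_congr fun x y hx _ _ _ hxy => ?_
    rw [hx]
  have h4 : rightTerm C (X ++ [p]) * vec R b = parts p fun x y =>
      if b.1 = across^[p.2] p.1 then C (X ++ [x]) • vec R (y.1, y.2 + b.2) else 0 := by
    rw [rightTerm_snoc, parts_mul_right]
    refine parts_congr fun x y _ hy _ hy0 hxy => ?_
    rw [smul_mul_assoc', vec_mul_vec _ _ hy0 hb, hy, ← iterate_add_apply, add_comm y.2, hxy]
    split_ifs <;> simp
  rw [h3, h4]
  split_ifs with h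
  · rw [rightTerm_snoc, parts_mul _ hp hb, ← h]
    have : ∀ u v w : BorderedAlgebra R m, u + v + w = w + (v + u) := fun u v w => by abel
    rw [this]
  · simp only [zero_smul, parts_zero, add_zero]

/-- The terms of the structure relation at the two ends of the sequence, in which an inner
operation cuts a piece off both ends of one of the entries, agree. -/
theorem defect_ends (hU : ∀ s, U s.across = U s) (hC : ∀ a L, C (a :: L) = C (L ++ [a]))
    (L : List (Arc m)) :
    defect U C (leftTerm C) [] L = defect U C (rightTerm C) L [] := by
  unfold defect
  rw [merge_nil_left, merge_nil_right, splits, splits]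
  simp only [add_zero, nil_append]
  congr 1
  · simp only [rightTerm_snoc, leftTerm]
    rw [sum_parts_period hU]
    exact sum_congr rfl fun s _ => congrArg _ (parts_congr fun x y _ _ _ _ _ => by rw [hC])
  · have e1 : splits (fun Y₁ x y Y₂ => C (Y₁ ++ [x]) • leftTerm C (y :: Y₂)) L =
        splits (fun Y₁ x y Y₂ => parts y fun y' y'' =>
          (C (Y₁ ++ [x]) * C (y'' :: Y₂)) • vec R y') L := by
      congr 1
      funext Y₁ x y Y₂
      simp only [leftTerm, smul_parts, mul_smul]
    have e2 : splits (fun X₁ x y X₂ => C (y :: X₂) • rightTerm C (X₁ ++ [x])) L =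
        splits (fun Y₁ x y Y₂ => parts x fun x' x'' =>
          (C (Y₁ ++ [x']) * C (y :: Y₂)) • vec R x'') L := by
      congr 1
      funext Y₁ x y Y₂
      simp only [rightTerm_snoc, smul_parts]
      refine parts_congr fun u v _ _ _ _ _ => ?_
      rw [mul_comm, mul_smul]
    rw [e1, e2]
    clear e1 e2
    have key : ∀ (f : List (Arc m) → Arc m → Arc m → Arc m →
        List (Arc m) → BorderedAlgebra R m) (L : List (Arc m)),
        splits (fun Y₁ x y Y₂ => parts y fun y' y'' => f Y₁ x y' y'' Y₂) L =
        splits (fun Y₁ x y Y₂ => parts x fun x' x'' => f Y₁ x' x'' y Y₂) L := by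
      intro f L
      induction L generalizing f with
      | nil => rfl
      | cons a L ih => rw [splits, splits, ih fun Y => f (a :: Y), parts_parts]
    exact key (fun Y₁ x y z Y₂ => (C (Y₁ ++ [x]) * C (z :: Y₂)) • vec R y) L

end Ends

/-! ### The structure relation on sequences of pure elements -/

section Sums

variable {α M : Type*} [AddCommMonoid M]

theorem gaps_eq_of_middle (f : List α → List α → M) (L : List α) (hL : L ≠ [])
    (h : ∀ X Z, X ≠ [] → Z ≠ [] → L = X ++ Z → f X Z = 0) : gaps f L = f [] L + f L [] := by
  cases L with
  | nil => exact absurd rfl hL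
  | cons a L =>
    rw [gaps]
    congr 1
    rcases eq_nil_or_concat L with rfl | ⟨L, b, rfl⟩
    · rfl
    · rw [concat_eq_append] at h ⊢
      rw [gaps_snoc]
      have : gaps (fun X Y => f (a :: X) (Y ++ [b])) L = gaps (fun _ _ => 0) L :=
        gaps_congr fun X Y e => h _ _ (by simp) (by simp) (by simp [e])
      rw [this, gaps_zero, zero_add]

theorem sum_Ioo_reflect (n : ℕ) (f : ℕ → M) : ∑ l ∈ Ioo 0 n, f l = ∑ l ∈ Ioo 0 n, f (n - l) := by
  refine Finset.sum_nbij' (fun k => n - k) (fun k => n - k) ?_ ?_ ?_ ?_ ?_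
  all_goals intro k hk; have hk' := mem_Ioo.1 hk
  · exact mem_Ioo.2 (by omega)
  · exact mem_Ioo.2 (by omega)
  · omega
  · omega
  · congr 1; omega

end Sums

namespace IsTilingCount

variable {R : Type*} [CommRing R] {U : Slot m → R} {C : List (Arc m) → R}
  (h : IsTilingCount U C)
include h

theorem defect_eq_zero' [CharP R 2] {X Z : List (Arc m)} (hX : X ≠ []) (hZ : Z ≠ [])
    (hpX : ∀ a ∈ X, 0 < a.2) (hpZ : ∀ a ∈ Z, 0 < a.2) : defect U C C X Z = 0 := by
  rcases eq_nil_or_concat X with rfl | ⟨X, p, rfl⟩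
  · exact absurd rfl hX
  rw [concat_eq_append] at hpX ⊢
  cases Z with
  | nil => exact absurd rfl hZ
  | cons q Z => exact h.defect_eq_zero X Z p q (hpX _ (by simp)) (hpZ _ (by simp))

theorem defect_centerTerm_cons (a : Arc m) (X Z : List (Arc m)) :
    defect U C (centerTerm C) (a :: X) Z = defect U C C (a :: X) Z • vec R (a.1, 0) := by
  unfold defect
  simp only [add_smul, sum_smul, splits_smul, smul_assoc]
  congr 1
  · congr 1
    · congr 1
      rcases eq_nil_or_concat X with rfl | ⟨X, p, rfl⟩
      · cases Z with
        | nil => simp only [merge_nil_right, zero_smul]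
        | cons q Z =>
          have h1 := merge_snoc_cons (centerTerm C) [] Z a q
          have h2 := merge_snoc_cons C [] Z a q
          simp only [nil_append] at h1 h2
          rw [h1, h2]
          split_ifs
          · rfl
          · rw [zero_smul]
      · rw [concat_eq_append]
        cases Z with
        | nil => simp only [merge_nil_right, zero_smul]
        | cons q Z =>
          rw [← cons_append, merge_snoc_cons, merge_snoc_cons]
          split_ifs
          · rfl
          · rw [zero_smul]

theorem defect_centerTerm_nil (a : Arc m) (L : List (Arc m)) :
    defect U C (centerTerm C) [] (a :: L) = defect U C C [] (a :: L) • vec R (a.1, 0) := by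
  unfold defect
  rw [merge_nil_left, merge_nil_left, splits, splits]
  simp only [add_smul, sum_smul, splits_smul, smul_assoc, nil_append, add_zero]
  congr 1
  · refine sum_congr rfl fun s _ => ?_
    rw [centerTerm]
    by_cases hC : C ((s, s.period) :: a :: L) = 0
    · rw [hC, zero_smul, zero_smul]
    · have := h.turn _ _ _ hC
      simp only [across_iterate_period] at this
      rw [vec_zero_congr (s := s) (t := a.1) (by rw [this, label_flip])]
  · rw [splits, splits]
    congr 1
    · refine parts_congr fun x y _ _ _ _ _ => ?_
      rw [nil_append, h.singleton, zero_smul, zero_smul]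
    · refine splits_congr fun X x y Z _ _ hxy _ _ => ?_
      by_cases hC : C (a :: X ++ [x]) = 0
      · rw [hC, zero_smul, zero_smul]
      · rw [centerTerm]
        have := h.turn_last _ _ _ hC
        rw [← hxy] at this
        rw [vec_zero_congr (s := y.1) (t := a.1) (by rw [this, label_flip])]

theorem gaps_defect_centerTerm [CharP R 2] (L : List (Arc m)) (hL : ∀ a ∈ L, 0 < a.2) :
    gaps (defect U C (centerTerm C)) L = 0 := by
  cases L with
  | nil =>
    have : ∀ s : Slot m, centerTerm C [(s, s.period)] = 0 := fun s => by
      rw [centerTerm, h.singleton, zero_smul]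
    simp [gaps, defect, merge_nil_left, splits, this]
  | cons a L =>
    have e : gaps (defect U C (centerTerm C)) (a :: L) =
        gaps (fun X Z => defect U C C X Z • vec R (a.1, 0)) (a :: L) := by
      refine gaps_congr fun X Y e => ?_
      cases X with
      | nil =>
        rw [nil_append] at e
        rw [← e, h.defect_centerTerm_nil]
      | cons b X =>
        obtain rfl : a = b := by simpa using congrArg List.head? e
        rw [h.defect_centerTerm_cons]
    rw [e, gaps_eq_of_middle _ _ (by simp), h.defect_nil_left, add_self_eq_zero]
    intro X Z hX hZ e
    rw [h.defect_eq_zero' hX hZ, zero_smul]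
    · exact fun b hb => hL _ (by rw [e]; exact mem_append_left _ hb)
    · exact fun b hb => hL _ (by rw [e]; exact mem_append_right _ hb)

theorem gaps_defect_leftTerm_singleton (a : Arc m) :
    gaps (defect U C (leftTerm C)) [a] = defect U C (leftTerm C) [] [a] +
      parts a fun x y => defect U C C [y] [] • vec R x := by
  rw [gaps, gaps, defect_leftTerm, merge_nil_right]
  simp only [merge_nil_right, zero_smul, parts_zero, sub_zero, add_zero]

theorem gaps_defect_rightTerm_singleton (a : Arc m) :
    gaps (defect U C (rightTerm C)) [a] = (parts a fun x y => defect U C C [] [x] • vec R y) +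
      defect U C (rightTerm C) [a] [] := by
  have := defect_rightTerm U C a [] []
  rw [nil_append] at this
  rw [gaps, gaps, this, merge_nil_left]
  simp only [merge_nil_left, zero_smul, parts_zero, sub_zero, add_zero, nil_append]

theorem gaps_defect_leftTerm [CharP R 2] (a q : Arc m) (L : List (Arc m))
    (hL : ∀ b ∈ a :: q :: L, 0 < b.2) :
    gaps (defect U C (leftTerm C)) (a :: q :: L) = defect U C (leftTerm C) [] (a :: q :: L) +
      (((if q.1 = Slot.across^[a.2] a.1 then C (q :: L) • vec R a else 0) +
        vec R a * leftTerm C (q :: L)) +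
      parts a fun x y => defect U C C (y :: q :: L) [] • vec R x) := by
  rw [gaps]
  congr 1
  rw [gaps_eq_of_middle _ _ (by simp)]
  · rw [defect_leftTerm, merge_leftTerm_singleton _ _ _ _ (hL _ (by simp)) (hL _ (by simp)),
      defect_leftTerm, merge_nil_right]
    simp only [merge_nil_right, zero_smul, parts_zero, sub_zero, add_zero]
    have e : (parts a fun x y => defect U C C [y] (q :: L) • vec R x) = 0 := by
      refine parts_eq_zero fun x y _ _ _ hy _ => ?_
      rw [h.defect_eq_zero' (by simp) (by simp) _ fun b hb => hL b (mem_cons_of_mem _ hb),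
        zero_smul]
      simpa using hy
    rw [e, zero_add, add_sub_cancel_left]
  · intro X Z hX hZ e
    rw [defect_leftTerm]
    have e1 : (parts a fun x y => defect U C C (y :: X) Z • vec R x) = 0 := by
      refine parts_eq_zero fun x y _ _ _ hy _ => ?_
      rw [h.defect_eq_zero' (by simp) hZ, zero_smul]
      · intro b hb
        rcases mem_cons.1 hb with rfl | hb
        · exact hy
        · exact hL b (by rw [e]; exact mem_cons_of_mem _ (mem_append_left _ hb))
      · exact fun b hb => hL b (by
          rw [e]; exact mem_cons_of_mem _ (mem_append_right _ hb))
    rcases eq_nil_or_concat X with rfl | ⟨X, p, rfl⟩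
    · exact absurd rfl hX
    · rw [concat_eq_append] at e1 ⊢
      rw [e1, merge_leftTerm, sub_self, add_zero]

theorem gaps_defect_rightTerm [CharP R 2] (b p : Arc m) (L : List (Arc m))
    (hL : ∀ a ∈ L ++ [p] ++ [b], 0 < a.2) :
    gaps (defect U C (rightTerm C)) (L ++ [p] ++ [b]) =
      ((parts b fun x y => defect U C C [] (L ++ [p] ++ [x]) • vec R y) +
      ((if b.1 = Slot.across^[p.2] p.1 then C (L ++ [p]) • vec R b else 0) +
        rightTerm C (L ++ [p]) * vec R b)) + defect U C (rightTerm C) (L ++ [p] ++ [b]) [] := by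
  rw [gaps_snoc]
  congr 1
  have h0 : ∀ X, defect U C (rightTerm C) X [b] = _ := fun X => defect_rightTerm U C b X []
  rw [gaps_eq_of_middle _ _ (by simp)]
  · rw [defect_rightTerm, nil_append, h0]
    simp only [nil_append]
    rw [merge_rightTerm_singleton _ _ _ _ (hL _ (by simp)) (hL _ (by simp)), merge_nil_left]
    simp only [merge_nil_left, zero_smul, parts_zero, sub_zero, add_zero]
    have e : (parts b fun x y => defect U C C (L ++ [p]) [x] • vec R y) = 0 := by
      refine parts_eq_zero fun x y _ _ hx _ _ => ?_
      rw [h.defect_eq_zero' (by simp) (by simp) fun b hb => hL b (mem_append_left _ hb), zero_smul]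
      simpa using hx
    rw [e, zero_add, add_sub_cancel_left]
  · intro X Z hX hZ e
    rw [defect_rightTerm]
    have e1 : (parts b fun x y => defect U C C X (Z ++ [x]) • vec R y) = 0 := by
      refine parts_eq_zero fun x y _ _ hx _ _ => ?_
      rw [h.defect_eq_zero' hX (by simp), zero_smul]
      · exact fun b hb => hL b (by
          rw [e]; exact mem_append_left _ (mem_append_left _ hb))
      · intro b hb
        rcases mem_append.1 hb with hb | hb
        · exact hL b (by rw [e]; exact mem_append_left _ (mem_append_right _ hb))
        · obtain rfl := List.mem_singleton.1 hb; exact hx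
    cases Z with
    | nil => exact absurd rfl hZ
    | cons q Z =>
      simp only [cons_append] at e1 ⊢
      rw [e1, merge_rightTerm, sub_self, add_zero]

end IsTilingCount

/-- The operations given by graphs, on pure elements. -/
def graphTerm {R : Type*} [CommRing R] (C : List (Arc m) → R)
    (L : List (Arc m)) : BorderedAlgebra R m :=
  centerTerm C L + leftTerm C L + rightTerm C L

theorem gaps_defect_graphTerm {R : Type*} [CommRing R] (U : Slot m → R)
    (C : List (Arc m) → R) (L : List (Arc m)) :
    gaps (defect U C (graphTerm C)) L = gaps (defect U C (centerTerm C)) L +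
      gaps (defect U C (leftTerm C)) L + gaps (defect U C (rightTerm C)) L := by
  rw [← gaps_add, ← gaps_add]
  refine gaps_congr fun X Y _ => ?_
  rw [← defect_add, ← defect_add]
  rfl

theorem across_iterate_eq_iff {s t : Slot m} {a b c d : ℕ} (h : (a + b) % 2 = (c + d) % 2) :
    across^[a] s = across^[b] t ↔ across^[c] s = across^[d] t := by
  have e : ∀ n : ℕ, across^[n] t = across^[n % 2] t := fun n => by
    conv_lhs => rw [← Nat.mod_add_div n 2, iterate_add_apply, Function.iterate_mul]
    congr 1; exact Function.iterate_fixed (Slot.across_iterate_self t 1) _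
  have key : ∀ a b : ℕ, across^[a] s = across^[b] t ↔ s = across^[(a + b) % 2] t := fun a b => by
      rw [← e, iterate_add_apply, ← Slot.across_iterate_inj (n := a), Slot.across_iterate_self]
  rw [key, key, h]

theorem ite_flip_add_ite_label {R : Type*} [CommRing R] [CharP R 2]
    (s t : Slot m) (c : R) (v : BorderedAlgebra R m) :
    (if t.flip = s then c • v else 0) + c • (if t.label = s.label then v else 0) =
      if s = t then c • v else 0 := by
  by_cases hl : t.label = s.label
  · rw [if_pos hl]
    rcases Slot.eq_or_eq_flip_of_label_eq hl with rfl | rfl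
    · rw [if_neg (flip_ne _), if_pos rfl, zero_add]
    · rw [Slot.flip_flip, if_pos rfl, if_neg fun e => flip_ne _ e.symm]
      exact add_self_eq_zero _
  · rw [if_neg hl, smul_zero, add_zero, if_neg, if_neg]
    · rintro rfl
      exact hl rfl
    · rintro rfl
      exact hl (label_flip _).symm

namespace IsTilingCount

variable {R : Type*} [CommRing R] {U : Slot m → R} {C : List (Arc m) → R}
  (h : IsTilingCount U C)
include h

theorem defect_pair (y : Arc m) : defect U C C [y] [] = ∑ s, U s * C [(s, s.period), y] := by
  unfold defect
  rw [merge_nil_right, splits_singleton, splits, add_zero, add_zero, parts_eq_zero, add_zero]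
  · refine sum_congr rfl fun s _ => ?_
    rw [h.append_comm]; rfl
  · intro x z _ _ _ _ _
    rw [h.singleton, zero_smul]

theorem iterate_of_defect_pair_ne (s : Slot m) (j : ℕ) (hD : defect U C C [(s, j)] [] ≠ 0) :
    Slot.across^[j] s = s := by
  rw [h.defect_pair] at hD
  obtain ⟨e, -, he⟩ := Finset.exists_ne_zero_of_sum_ne_zero hD
  have hC : C [(e, e.period), (s, j)] ≠ 0 := right_ne_zero_of_mul he
  have h1 := h.turn _ _ _ hC
  rw [h.rotate] at hC
  have h2 := h.turn _ _ _ hC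
  simp only [across_iterate_period] at h1 h2
  rw [h2, Slot.flip_flip] at h1
  exact h1.symm

/-- A tiling with two boundary arcs, one of which is closed off by a monogon or a bigon, may be cut
at either end of the first letter of the other arc. -/
theorem defect_pair_across (s : Slot m) {j : ℕ} (hj : 0 < j) :
    defect U C C [(s.across, j)] [] = defect U C C [(s, j)] [] := by
  by_cases hs : Slot.across^[j] s = s
  · rcases Nat.lt_or_ge 1 j with hj1 | hj1
    · have c : ∀ (x y e : Arc m), 0 < x.2 → 0 < y.2 → y.1 = Slot.across^[x.2] x.1 →
          C [(x.1, x.2 + y.2), e] = ∑ t, U t * C [(t, t.period), y, e, x] +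
            parts e fun u v => C [y, u] * C [v, x] := fun x y e hx hy hxy => by
        have := h.cut x y [e] hx hy
        rwa [if_pos hxy, splits_singleton] at this
      have c1 : ∀ e : Arc m, C [(s, j), e] =
          ∑ t, U t * C [(t, t.period), (s.across, j - 1), e, (s, 1)] +
            parts e fun u v => C [(s.across, j - 1), u] * C [v, (s, 1)] := fun e => by
        rw [← c (s, 1) (s.across, j - 1) e one_pos (by simp; omega) rfl]
        congr 3
        simp only; omega
      have c2 : ∀ e : Arc m, C [(s.across, j), e] =
          ∑ t, U t * C [(t, t.period), (s, 1), e, (s.across, j - 1)] +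
            parts e fun u v => C [(s, 1), u] * C [v, (s.across, j - 1)] := fun e => by
        rw [← c (s.across, j - 1) (s, 1) e (by simp; omega) one_pos]
        · congr 3
          simp only; omega
        · change s = Slot.across^[j - 1] s.across
          rw [← iterate_succ_apply, Nat.succ_eq_add_one, Nat.sub_add_cancel hj, hs]
      have d : ∀ t : Slot m, defect U C C [(t, j)] [] =
          ∑ e, U e * C [(t, j), (e, e.period)] := fun t => by
        rw [h.defect_pair]; exact sum_congr rfl fun e _ => by rw [h.rotate]; rfl
      rw [d, d]
      simp only [c1, c2, mul_add, sum_add_distrib, mul_sum]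
      congr 1
      · rw [Finset.sum_comm]
        refine sum_congr rfl fun e' _ => sum_congr rfl fun e _ => ?_
        have : C [(e', e'.period), (s, 1), (e, e.period), (s.across, j - 1)] =
            C [(e, e.period), (s.across, j - 1), (e', e'.period), (s, 1)] :=
          h.append_comm [_, _] [_, _]
        rw [this]; ring
      · have := sum_parts_period h.across fun x y => C [(s.across, j - 1), x] * C [y, (s, 1)]
        simp only [smul_eq_mul] at this
        rw [this]
        refine sum_congr rfl fun e _ => ?_
        congr 1
        refine parts_congr fun x y _ _ _ _ _ => ?_
        rw [h.rotate (s, 1), h.rotate y, mul_comm]; rfl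
    · obtain rfl : j = 1 := by omega
      rw [iterate_one] at hs
      rw [hs]
  · rw [not_imp_comm.1 (h.iterate_of_defect_pair_ne s j) hs, not_imp_comm.1
      (h.iterate_of_defect_pair_ne s.across j)]
    rw [← iterate_succ_apply, iterate_succ_apply']
    intro h'; exact hs (by rw [← across_across (Slot.across^[j] s), h', across_across])

theorem defect_pair_iterate (s : Slot m) (k : ℕ) {j : ℕ} (hj : 0 < j) :
    defect U C C [(Slot.across^[k] s, j)] [] = defect U C C [(s, j)] [] := by
  rcases Slot.across_iterate_cases s k with e | e <;> rw [e]
  exact h.defect_pair_across s hj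

/-- The structure relation with one input. -/
theorem gaps_defect_graphTerm_singleton [CharP R 2] (a : Arc m) (ha : 0 < a.2) :
    gaps (defect U C (graphTerm C)) [a] = 0 := by
  rw [gaps_defect_graphTerm, h.gaps_defect_centerTerm _ (by simpa using ha),
    h.gaps_defect_leftTerm_singleton, h.gaps_defect_rightTerm_singleton,
    defect_ends U C h.across h.rotate, zero_add]
  have e : (parts a fun x y => defect U C C [] [x] • vec R y) =
      parts a fun x y => defect U C C [y] [] • vec R x := by
    unfold parts
    rw [sum_Ioo_reflect]
    refine sum_congr rfl fun k hk => ?_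
    have hk' := mem_Ioo.1 hk
    change defect U C C [] [(a.1, a.2 - k)] • vec R (Slot.across^[a.2 - k] a.1, a.2 - (a.2 - k)) =
      defect U C C [(Slot.across^[k] a.1, a.2 - k)] [] • vec R (a.1, k)
    rw [h.defect_nil_left, h.defect_pair_iterate a.1 k (by omega), Nat.sub_sub_self hk'.2.le]
    by_cases hD : defect U C C [(a.1, a.2 - k)] [] = 0
    · rw [hD, zero_smul, zero_smul]
    · rw [h.iterate_of_defect_pair_ne _ _ hD]
  rw [e]
  have : ∀ u v : BorderedAlgebra R m, u + v + (v + u) = (u + u) + (v + v) := fun u v => by abel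
  rw [this, add_self_eq_zero, add_self_eq_zero, add_zero]

/-- The structure relation with at least two inputs. -/
theorem gaps_defect_graphTerm_add [CharP R 2] (a b : Arc m) (l : List (Arc m))
    (hL : ∀ c ∈ a :: (l ++ [b]), 0 < c.2) :
    gaps (defect U C (graphTerm C)) (a :: (l ++ [b])) + vec R a * graphTerm C (l ++ [b]) +
      graphTerm C (a :: l) * vec R b = 0 := by
  have ha : 0 < a.2 := hL a (by simp)
  have hb : 0 < b.2 := hL b (by simp)
  obtain ⟨q, l', hq⟩ : ∃ q l', l ++ [b] = q :: l' := by
    cases l with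
    | nil => exact ⟨b, [], rfl⟩
    | cons q l => exact ⟨q, l ++ [b], rfl⟩
  obtain ⟨p, l'', hp⟩ : ∃ p l'', a :: l = l'' ++ [p] := by
    rcases eq_nil_or_concat l with rfl | ⟨l, p, rfl⟩
    · exact ⟨a, [], rfl⟩
    · exact ⟨p, a :: l, by simp⟩
  have hleft := h.gaps_defect_leftTerm a q l' (by rw [← hq]; exact hL)
  have hright := h.gaps_defect_rightTerm b p l'' (by rw [← hp]; exact hL)
  rw [← hq] at hleft
  rw [← hp, cons_append] at hright
  rw [gaps_defect_graphTerm, h.gaps_defect_centerTerm _ hL, hleft, hright,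
    defect_ends U C h.across h.rotate]
  -- the contribution `f j` of the factorizations in which the output has length `j`
  set f : ℕ → BorderedAlgebra R m := fun j =>
    if Slot.across^[a.2] a.1 = Slot.across^[a.2 + b.2 - j] b.1 then
      C ((b.1, a.2 + b.2 - j) :: l) • vec R (a.1, j) else 0 with hf
  have T1 : (parts a fun x y => defect U C C (y :: (l ++ [b])) [] • vec R x) =
      ∑ j ∈ Ioo 0 a.2, f j := by
    refine sum_congr rfl fun j hj => ?_
    have hj' := mem_Ioo.1 hj
    change defect U C C ((Slot.across^[j] a.1, a.2 - j) :: (l ++ [b])) [] • vec R (a.1, j) = _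
    rw [h.defect_cons_snoc _ _ _ hb (by simp; omega), ite_smul, zero_smul]
    simp only [hf, show b.2 + (a.2 - j) = a.2 + b.2 - j by omega]
    exact if_congr (across_iterate_eq_iff (by omega)) rfl rfl
  have T3 : vec R a * rightTerm C (l ++ [b]) = ∑ j ∈ Ioo 0 b.2, f (a.2 + j) := by
    rw [sum_Ioo_reflect, rightTerm_snoc, mul_parts]
    refine sum_congr rfl fun j hj => ?_
    have hj' := mem_Ioo.1 hj
    change vec R a * (C (l ++ [(b.1, j)]) • vec R (Slot.across^[j] b.1, b.2 - j)) = _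
    rw [mul_smul_comm', vec_mul_vec _ _ ha (by simp; omega), smul_ite, smul_zero, h.append_comm]
    simp only [hf, show a.2 + b.2 - (a.2 + (b.2 - j)) = j by omega]
    exact if_congr ⟨Eq.symm, Eq.symm⟩ rfl rfl
  have T5 : (if q.1 = Slot.across^[a.2] a.1 then C (l ++ [b]) • vec R a else 0) +
      vec R a * centerTerm C (l ++ [b]) = f a.2 := by
    rw [hq, centerTerm, ← hq, mul_smul_comm', vec_mul_vec_zero]
    simp only [hf, Nat.add_sub_cancel_left]
    have hrot : C (l ++ [b]) = C (b :: l) := (h.rotate b l).symm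
    change _ = if Slot.across^[a.2] a.1 = Slot.across^[b.2] b.1 then C (b :: l) • vec R a else 0
    by_cases hC : C (l ++ [b]) = 0
    · rw [← hrot, hC]; simp
    · have ht : q.1 = (Slot.across^[b.2] b.1).flip := by
        cases l with
        | nil => exact absurd (h.singleton b) hC
        | cons q' l =>
          obtain ⟨rfl, -⟩ := cons_eq_cons.1 hq; exact h.turn_last _ _ _ hC
      rw [← hrot, ht, label_flip]; exact ite_flip_add_ite_label _ _ _ _
  have T2 : (parts b fun x y => defect U C C [] (a :: l ++ [x]) • vec R y) =
      ∑ j ∈ Ioo 0 b.2, f j := by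
    rw [sum_Ioo_reflect]
    refine sum_congr rfl fun j hj => ?_
    have hj' := mem_Ioo.1 hj
    change defect U C C [] (a :: (l ++ [(b.1, j)])) • vec R (Slot.across^[j] b.1, b.2 - j) = _
    rw [h.defect_nil_left, h.defect_cons_snoc _ _ _ (by simp; omega) ha, ite_smul, zero_smul]
    simp only [hf, show a.2 + b.2 - (b.2 - j) = j + a.2 by omega]
    have e : a.1 = Slot.across^[j] b.1 ↔ Slot.across^[a.2] a.1 = Slot.across^[j + a.2] b.1 :=
      across_iterate_eq_iff (a := 0) (by omega)
    by_cases hc : a.1 = Slot.across^[j] b.1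
    · rw [if_pos hc, if_pos (e.1 hc), hc]
    · rw [if_neg hc, if_neg fun h' => hc (e.2 h')]
  have T4 : leftTerm C (a :: l) * vec R b = ∑ j ∈ Ioo 0 a.2, f (b.2 + j) := by
    rw [leftTerm, parts_mul_right]
    refine sum_congr rfl fun j hj => ?_
    have hj' := mem_Ioo.1 hj
    change (C ((Slot.across^[j] a.1, a.2 - j) :: l) • vec R (a.1, j)) * vec R b = _
    rw [smul_mul_assoc', vec_mul_vec _ _ (by simp; omega) hb, smul_ite, smul_zero]
    simp only [hf, show a.2 + b.2 - (b.2 + j) = a.2 - j by omega]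
    have e : Slot.across^[j] a.1 = b.1 ↔ Slot.across^[a.2] a.1 = Slot.across^[a.2 - j] b.1 :=
      across_iterate_eq_iff (b := 0) (by omega)
    by_cases hc : Slot.across^[j] a.1 = b.1
    · rw [if_pos hc.symm, if_pos (e.1 hc), hc, add_comm j]
    · rw [if_neg fun h' => hc h'.symm, if_neg fun h' => hc (e.2 h')]
  have T6 : (if b.1 = Slot.across^[p.2] p.1 then C (a :: l) • vec R b else 0) +
      centerTerm C (a :: l) * vec R b = f b.2 := by
    rw [centerTerm, smul_mul_assoc', vec_zero_mul_vec]
    simp only [hf, Nat.add_sub_cancel]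
    by_cases hC : C (a :: l) = 0
    · have e : Slot.across^[a.2] a.1 = Slot.across^[a.2] b.1 ↔ a.1 = b.1 :=
        across_iterate_eq_iff (c := 0) (d := 0) (by omega)
      by_cases hc : a.1 = b.1
      · have : C ((b.1, a.2) :: l) = 0 := by rw [← hc]; exact hC
        rw [hC, this]; simp
      · rw [if_neg fun h' => hc (e.1 h'), hC]; simp
    · have ht : a.1 = (Slot.across^[p.2] p.1).flip := by
        rcases eq_nil_or_concat l with rfl | ⟨l, p', rfl⟩
        · exact absurd (h.singleton a) hC
        · rw [concat_eq_append, ← cons_append] at hp hC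
          obtain ⟨-, e⟩ := List.append_inj' hp rfl
          obtain rfl : p' = p := by simpa using e
          exact h.turn_last _ _ _ hC
      have e1 : b.1 = Slot.across^[p.2] p.1 ↔ a.1.flip = b.1 := by
        rw [ht, Slot.flip_flip]; exact ⟨Eq.symm, Eq.symm⟩
      have e : Slot.across^[a.2] a.1 = Slot.across^[a.2] b.1 ↔ b.1 = a.1 := by
        rw [across_iterate_eq_iff (c := 0) (d := 0) (by omega)]; exact ⟨Eq.symm, Eq.symm⟩
      have key := ite_flip_add_ite_label b.1 a.1 (C (a :: l)) (vec R b)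
      rw [if_congr e1 rfl rfl, key, if_congr e rfl rfl]
      by_cases hc : b.1 = a.1
      · rw [if_pos hc, if_pos hc, hc]
        congr 2; exact Prod.ext hc rfl
      · rw [if_neg hc, if_neg hc]
  have key := sum_Ioo_add ha hb f
  have key' := sum_Ioo_add hb ha f
  rw [add_comm b.2 a.2, key, ← T1, ← T3, ← T5, ← T2, ← T4, ← T6] at key'
  unfold graphTerm
  simp only [mul_add, add_mul]
  have comb : ∀ t₁ t₂ t₃ t₄ c₅ d₅ c₆ d₆ x y z : BorderedAlgebra R m,
      t₁ + (c₅ + d₅) + t₃ = t₂ + (c₆ + d₆) + t₄ →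
      0 + (z + (c₅ + x + t₁)) + (t₂ + (c₆ + y) + z) + (d₅ + x + t₃) + (d₆ + t₄ + y) = 0 := by
    intro t₁ t₂ t₃ t₄ c₅ d₅ c₆ d₆ x y z e
    have : 0 + (z + (c₅ + x + t₁)) + (t₂ + (c₆ + y) + z) + (d₅ + x + t₃) + (d₆ + t₄ + y) =
        (z + z) + (x + x) + (y + y) + ((t₁ + (c₅ + d₅) + t₃) + (t₂ + (c₆ + d₆) + t₄)) := by abel
    rw [this, e]
    simp only [add_self_eq_zero, add_zero]
  exact comb _ _ _ _ _ _ _ _ _ _ _ (by rw [← key'])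

end IsTilingCount

/-! ### The structure relation on sequences of paths -/

section Plug

variable {R : Type*} [CommRing R]

/-- The value, extended linearly, of `f` at a sequence with an arbitrary element of the algebra
between the paths `X` and the paths `Z`. -/
def plug (f : List (QPath m) → BorderedAlgebra R m) (X Z : List (QPath m)) :
    BorderedAlgebra R m →ₗ[R] BorderedAlgebra R m :=
  (Finsupp.linearCombination R fun p => f (X ++ p :: Z) : (QPath m →₀ R) →ₗ[R] BorderedAlgebra R m)

theorem plug_basis (f : List (QPath m) → BorderedAlgebra R m) (X Z : List (QPath m))
    (p : QPath m) : plug f X Z (basis p) = f (X ++ p :: Z) := by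
  unfold plug basis single
  exact (Finsupp.linearCombination_single R _ _).trans (one_smul _ _)

theorem linearMap_ext {M : Type*} [AddCommGroup M] [Module R M]
    {f g : BorderedAlgebra R m →ₗ[R] M} (h : ∀ p, f (basis p) = g (basis p)) : f = g := by
  have : (show (QPath m →₀ R) →ₗ[R] M from f) = g :=
    Finsupp.lhom_ext' fun p => LinearMap.ext_ring (h p)
  exact this

instance : IsScalarTower R (BorderedAlgebra R m) (BorderedAlgebra R m) :=
  ⟨fun r a b => BorderedAlgebra.smul_mul r a b⟩

instance : SMulCommClass R (BorderedAlgebra R m) (BorderedAlgebra R m) :=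
  ⟨fun r a b => (BorderedAlgebra.mul_smul' r a b).symm⟩

theorem plug_add (f g : List (QPath m) → BorderedAlgebra R m) (X Z : List (QPath m))
    (v : BorderedAlgebra R m) : plug (fun L => f L + g L) X Z v = plug f X Z v + plug g X Z v := by
  have : plug (fun L => f L + g L) X Z = plug f X Z + plug g X Z :=
    linearMap_ext fun p => by rw [LinearMap.add_apply, plug_basis, plug_basis, plug_basis]
  rw [this, LinearMap.add_apply]

theorem plug_eq_zero (f : List (QPath m) → BorderedAlgebra R m) (X Z : List (QPath m))
    (h : ∀ p, f (X ++ p :: Z) = 0) (v : BorderedAlgebra R m) : plug f X Z v = 0 := by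
  have : plug f X Z = 0 := linearMap_ext fun p => by rw [plug_basis, h, LinearMap.zero_apply]
  rw [this, LinearMap.zero_apply]

/-- The multiplication, as a function on sequences of paths. -/
def productTerm (R : Type*) [CommRing R] : List (QPath m) → BorderedAlgebra R m
  | [p, q] => basis p * basis q
  | _ => 0

theorem productTerm_eq_zero {ps : List (QPath m)} (h : ps.length ≠ 2) : productTerm R ps = 0 := by
  rcases ps with _ | ⟨p, _ | ⟨q, _ | ⟨r, ps⟩⟩⟩
  · rfl
  · rfl
  · exact absurd rfl h
  · rfl

theorem plug_productTerm_left (p : QPath m) (v : BorderedAlgebra R m) :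
    plug (productTerm R) [p] [] v = basis p * v := by
  have : plug (productTerm R) [p] [] = LinearMap.mulLeft R (basis p) :=
    linearMap_ext fun q => by rw [plug_basis]; rfl
  rw [this]
  rfl

theorem plug_productTerm_right (p : QPath m) (v : BorderedAlgebra R m) :
    plug (productTerm R) [] [p] v = v * basis p := by
  have : plug (productTerm R) [] [p] = LinearMap.mulRight R (basis p) :=
    linearMap_ext fun q => by rw [plug_basis]; rfl
  rw [this]
  rfl

theorem plug_productTerm_eq_zero (X Z : List (QPath m)) (h : X.length + Z.length ≠ 1)
    (v : BorderedAlgebra R m) : plug (productTerm R) X Z v = 0 :=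
  plug_eq_zero _ _ _ (fun p => productTerm_eq_zero (by simp; omega)) v

theorem gaps_eq_last {α M : Type*} [AddCommMonoid M] (f : List α → List α → M) (L : List α)
    (h : ∀ X Y, Y ≠ [] → L = X ++ Y → f X Y = 0) : gaps f L = f L [] := by
  induction L generalizing f with
  | nil => rfl
  | cons a L ih =>
    rw [gaps, h [] _ (by simp) rfl, zero_add]
    exact ih _ fun X Y hY e => h _ _ hY (by rw [e]; rfl)

theorem gaps_eq_zero {α M : Type*} [AddCommMonoid M] (f : List α → List α → M) (L : List α)
    (h : ∀ X Y, L = X ++ Y → f X Y = 0) : gaps f L = 0 :=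
  (gaps_congr h).trans (gaps_zero L)

theorem gaps_map {α β M : Type*} [AddCommMonoid M] (g : α → β) (f : List β → List β → M)
    (L : List α) : gaps f (L.map g) = gaps (fun X Y => f (X.map g) (Y.map g)) L := by
  induction L generalizing f with
  | nil => rfl
  | cons a L ih =>
    rw [map_cons, gaps, ih, gaps]; rfl

theorem gaps_append_cons {α M : Type*} [AddCommMonoid M] (f : List α → List α → M) (A B : List α)
    (a : α) : gaps f (A ++ a :: B) =
      gaps (fun X Y => f X (Y ++ a :: B)) A + gaps (fun X Y => f (A ++ a :: X) Y) B := by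
  induction A generalizing f with
  | nil => rfl
  | cons c A ih =>
    rw [cons_append, gaps, ih, gaps, add_assoc]; rfl

/-- The terms of the structure relation in which the outer operation is the multiplication. -/
theorem gaps_plug_productTerm (O : List (QPath m) → BorderedAlgebra R m) (a b : QPath m)
    (l l' : List (QPath m)) (e : a :: l = l' ++ [b]) :
    gaps (fun X W => gaps (fun Y Z => plug (productTerm R) X Z (O Y)) W) (a :: l) =
      basis a * O l + O l' * basis b := by
  rw [gaps, add_comm]
  congr 1
  · cases l with
    | nil => rw [gaps, gaps, plug_productTerm_left]
    | cons c l =>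
      rw [gaps, gaps_eq_last, plug_productTerm_left]
      · rw [gaps_eq_zero, add_zero]
        intro X Y _
        exact gaps_eq_zero _ _ fun _ _ _ => plug_productTerm_eq_zero _ _ (by simp; omega) _
      · intro X Y hY _
        have := length_pos_iff_ne_nil.2 hY
        exact plug_productTerm_eq_zero _ _ (by simp; omega) _
  · rw [e, gaps_snoc, plug_productTerm_eq_zero [] [] (by simp), add_zero, gaps_eq_last,
      nil_append, plug_productTerm_right]
    intro X Y hY _
    have := length_pos_iff_ne_nil.2 hY
    exact plug_productTerm_eq_zero _ _ (by simp; omega) _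

variable (U : Slot m → R)

/-- The operation without inputs: the sum of the boundaries of all monogons and bigons. -/
def curvature : List (QPath m) → BorderedAlgebra R m
  | [] => ∑ s, U s • vec R (s, s.period)
  | _ => 0

theorem curvature_cons (p : QPath m) (ps : List (QPath m)) : curvature U (p :: ps) = 0 := rfl

theorem exists_vec (p : QPath m) : ∃ a : Arc m, vec R a = basis p := by
  by_cases h : p.IsPure
  · exact ⟨(p.slot, p.length), by rw [vec, ← p.eq_arc h]⟩
  · obtain ⟨x, rfl⟩ := p.not_isPure_iff.1 h; exact ⟨(.out x, 0), rfl⟩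

theorem curvature_comm (hU : ∀ s, U s.across = U s) (p : QPath m) :
    curvature U [] * basis p = basis p * curvature U [] := by
  have hper : ∀ s : Slot m, 0 < s.period := Slot.period_pos
  obtain ⟨⟨t, n⟩, h⟩ := exists_vec (R := R) p
  rw [← h, curvature, Finset.sum_mul, mul_sum]
  simp only [smul_mul_assoc', mul_smul_comm']
  rcases Nat.eq_zero_or_pos n with rfl | hn
  · refine sum_congr rfl fun s _ => ?_
    rw [vec_mul_vec_zero, vec_zero_mul_vec]
    simp only [across_iterate_period]
  · have e1 : ∀ s : Slot m, vec R (s, s.period) * vec R (t, n) =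
        if t = s then vec R (t, t.period + n) else 0 := fun s => by
      rw [vec_mul_vec _ _ (hper s) hn]
      simp only [across_iterate_period]
      by_cases hs : t = s
      · rw [if_pos hs, if_pos hs, hs]
      · rw [if_neg hs, if_neg hs]
    have e2 : ∀ s : Slot m, vec R (t, n) * vec R (s, s.period) =
        if across^[n] t = s then vec R (t, n + (across^[n] t).period) else 0 := fun s => by
      rw [vec_mul_vec _ _ hn (hper s)]
      by_cases hs : s = across^[n] t
      · rw [if_pos hs, if_pos hs.symm, ← hs]
      · rw [if_neg hs, if_neg fun e => hs e.symm]
    simp only [e1, e2, smul_ite, smul_zero, Finset.sum_ite_eq, mem_univ, if_true]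
    rcases Slot.across_iterate_cases t n with e | e <;> rw [e]
    · rw [add_comm]
    · rw [hU, period_across, add_comm]

end Plug

section GraphOp

variable {R : Type*} [CommRing R] (U : Slot m → R) (C : List (Arc m) → R)

open Classical in
/-- The operations given by graphs, on paths. -/
def graphOp (ps : List (QPath m)) : BorderedAlgebra R m :=
  if ∀ p ∈ ps, p.IsPure then graphTerm C (ps.map fun p => (p.slot, p.length)) else 0

/-- All the operations, on paths. -/
def totalOp (ps : List (QPath m)) : BorderedAlgebra R m :=
  productTerm R ps + curvature U ps + graphOp C ps

theorem graphOp_nil : graphOp C [] = 0 := by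
  simp [graphOp, graphTerm, centerTerm, leftTerm, rightTerm]

theorem graphOp_eq_zero {ps : List (QPath m)} {p : QPath m} (hp : p ∈ ps) (h : ¬ p.IsPure) :
    graphOp C ps = 0 := if_neg fun H => h (H p hp)

/-- The paths given by a sequence of arcs. -/
def arcs (L : List (Arc m)) : List (QPath m) := L.map fun a => QPath.arc a.1 a.2

theorem exists_arcs {ps : List (QPath m)} (h : ∀ p ∈ ps, p.IsPure) :
    ∃ L : List (Arc m), (∀ a ∈ L, 0 < a.2) ∧ ps = arcs L := by
  refine ⟨ps.map fun p => (p.slot, p.length), ?_, ?_⟩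
  · simp only [List.mem_map, forall_exists_index, and_imp]
    rintro _ p hp rfl
    exact QPath.length_pos (h p hp)
  · rw [arcs, List.map_map]
    refine (List.map_id _).symm.trans (List.map_congr_left fun p hp => ?_)
    exact p.eq_arc (h p hp)

theorem graphOp_arcs {L : List (Arc m)} (h : ∀ a ∈ L, 0 < a.2) :
    graphOp C (arcs L) = graphTerm C L := by
  have : (arcs L).map (fun p => (p.slot, p.length)) = L := by
    rw [arcs, List.map_map]
    refine (List.map_congr_left fun a ha => ?_).trans (List.map_id _)
    change ((QPath.arc a.1 a.2).slot, (QPath.arc a.1 a.2).length) = a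
    rw [QPath.slot_arc _ (h a ha), QPath.length_arc]
  rw [graphOp, if_pos, this]
  intro p hp
  obtain ⟨a, ha, rfl⟩ := List.mem_map.1 hp
  exact QPath.isPure_arc (h a ha)

theorem productTerm_cancel [CharP R 2] (a b : QPath m) (l l' : List (QPath m))
    (e : a :: l = l' ++ [b]) :
    basis a * productTerm R l + productTerm R l' * basis b = 0 := by
  have hlen := congrArg List.length e
  simp only [length_cons, length_append, List.length_nil] at hlen
  by_cases hl : l.length = 2
  · obtain ⟨c, d, rfl⟩ := List.length_eq_two.1 hl
    obtain ⟨c', d', rfl⟩ := List.length_eq_two.1 (show l'.length = 2 by omega)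
    simp only [cons_append, nil_append, cons_eq_cons, and_true] at e
    obtain ⟨rfl, rfl, rfl⟩ := e
    simp only [productTerm]
    rw [mul_assoc, add_self_eq_zero]
  · rw [productTerm_eq_zero hl, productTerm_eq_zero (by omega), mul_zero, zero_mul, add_zero]

theorem curvature_cancel [CharP R 2] (hU : ∀ s, U s.across = U s) (a b : QPath m)
    (l l' : List (QPath m)) (e : a :: l = l' ++ [b]) :
    basis a * curvature U l + curvature U l' * basis b = 0 := by
  cases l with
  | nil =>
    cases l' with
    | nil =>
      obtain rfl : a = b := by simpa using e
      rw [curvature_comm U hU, add_self_eq_zero]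
    | cons c l' => simp at e
  | cons c l =>
    cases l' with
    | nil => simp at e
    | cons d l' => rw [curvature_cons, curvature_cons, mul_zero, zero_mul, add_zero]

theorem totalOp_cancel [CharP R 2] (hU : ∀ s, U s.across = U s) (a b : QPath m)
    (l l' : List (QPath m)) (e : a :: l = l' ++ [b]) :
    basis a * totalOp U C l + totalOp U C l' * basis b =
      basis a * graphOp C l + graphOp C l' * basis b := by
  have h1 := productTerm_cancel (R := R) a b l l' e
  have h2 := curvature_cancel U hU a b l l' e
  unfold totalOp
  simp only [mul_add, add_mul]
  have : ∀ u v w x y z : BorderedAlgebra R m, u + x = 0 → v + y = 0 →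
      u + v + w + (x + y + z) = w + z := by
    intro u v w x y z h h'
    have : u + v + w + (x + y + z) = (u + x) + (v + y) + (w + z) := by abel
    rw [this, h, h', zero_add, zero_add]
  exact this _ _ _ _ _ _ h1 h2

theorem gaps_plug_totalOp [CharP R 2] (hU : ∀ s, U s.across = U s) (a b : QPath m)
    (l l' : List (QPath m)) (e : a :: l = l' ++ [b]) :
    gaps (fun X W => gaps (fun Y Z => plug (totalOp U C) X Z (totalOp U C Y)) W) (a :: l) =
      gaps (fun X W => gaps (fun Y Z => plug (graphOp C) X Z (totalOp U C Y)) W) (a :: l) +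
        (basis a * graphOp C l + graphOp C l' * basis b) := by
  rw [← totalOp_cancel U C hU a b l l' e, ← gaps_plug_productTerm _ a b l l' e, ← gaps_add]
  refine gaps_congr fun X W _ => ?_
  rw [← gaps_add]
  refine gaps_congr fun Y Z _ => ?_
  have h0 : plug (curvature U) X Z (totalOp U C Y) = 0 :=
    plug_eq_zero _ _ _ (fun p => by cases X <;> rfl) _
  have : totalOp U C = fun ps => (productTerm R ps + curvature U ps) + graphOp C ps := rfl
  conv_lhs => rw [this]
  rw [plug_add, plug_add]
  change _ + plug (curvature U) X Z (totalOp U C Y) + _ = _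
  rw [h0, add_zero, add_comm]
  rfl

end GraphOp

section Pairs

variable {α M : Type*} [AddCommMonoid M]

theorem gaps_eq_first (f : List α → List α → M) (L : List α)
    (h : ∀ X Y, X ≠ [] → L = X ++ Y → f X Y = 0) : gaps f L = f [] L := by
  cases L with
  | nil => rfl
  | cons a L =>
    rw [gaps, gaps_eq_zero, add_zero]; exact fun X Y e => h _ _ (by simp) (by rw [e]; rfl)

theorem gaps_eq_first_add (f : List α → List α → M) (L : List α) :
    gaps f L = f [] L + gaps (fun X Y => if X = [] then 0 else f X Y) L := by
  cases L with
  | nil => simp [gaps]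
  | cons a L => simp [gaps]

/-- The sum over all pairs of adjacent entries of a list. -/
def pairTerm (J : List α → α → α → List α → M) (X Z : List α) : M :=
  match X.getLast?, Z with
  | some p, q :: Z' => J X.dropLast p q Z'
  | _, _ => 0

theorem pairTerm_nil_left (J : List α → α → α → List α → M) (Z : List α) :
    pairTerm J [] Z = 0 := by simp [pairTerm]

theorem pairTerm_nil_right (J : List α → α → α → List α → M) (X : List α) :
    pairTerm J X [] = 0 := by
  unfold pairTerm
  cases X.getLast? <;> rfl

theorem pairTerm_snoc_cons (J : List α → α → α → List α → M) (X Z : List α) (p q : α) :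
    pairTerm J (X ++ [p]) (q :: Z) = J X p q Z := by
  simp [pairTerm]

theorem gaps_pairs (J : List α → α → α → List α → M) (k : List α → List α → M)
    (h0 : ∀ X, k X [] = 0) (h1 : ∀ X p, k X [p] = 0)
    (h2 : ∀ X p q W, k X (p :: q :: W) = J X p q W) (L : List α) :
    gaps k L = gaps (pairTerm J) L := by
  induction L generalizing J k with
  | nil => simp [gaps, h0, pairTerm_nil_left]
  | cons a L ih =>
    rw [gaps, gaps, pairTerm_nil_left, zero_add, gaps_eq_first_add fun X Y => pairTerm J (a :: X) Y,
      ih (fun X => J (a :: X)) (fun X => k (a :: X)) (fun X => h0 _) (fun X => h1 _)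
        (fun X => h2 _)]
    congr 1
    · cases L with
      | nil => rw [h1, pairTerm_nil_right]
      | cons b L =>
        rw [h2]; exact (pairTerm_snoc_cons J [] L a b).symm
    · refine gaps_congr fun X Y _ => ?_
      rcases eq_nil_or_concat X with rfl | ⟨X, p, rfl⟩
      · rw [if_pos rfl, pairTerm_nil_left]
      · rw [concat_eq_append, if_neg (by simp)]
        cases Y with
        | nil => rw [pairTerm_nil_right, pairTerm_nil_right]
        | cons q Y => rw [pairTerm_snoc_cons, ← cons_append, pairTerm_snoc_cons]

end Pairs

section Pure

variable {R : Type*} [CommRing R] (U : Slot m → R) (C : List (Arc m) → R)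

theorem arcs_append (X Y : List (Arc m)) : arcs (X ++ Y) = arcs X ++ arcs Y := map_append

theorem plug_graphOp_vec {X Z : List (Arc m)} {y : Arc m} (hX : ∀ a ∈ X, 0 < a.2)
    (hZ : ∀ a ∈ Z, 0 < a.2) (hy : 0 < y.2) :
    plug (graphOp C) (arcs X) (arcs Z) (vec R y) = graphTerm C (X ++ y :: Z) := by
  rw [vec, plug_basis, ← graphOp_arcs]
  · rw [arcs_append]; rfl
  · intro a ha
    rcases mem_append.1 ha with ha | ha
    · exact hX a ha
    · rcases mem_cons.1 ha with rfl | ha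
      · exact hy
      · exact hZ a ha

theorem plug_graphOp_const (X Z : List (QPath m)) (s : Slot m) :
    plug (graphOp C) X Z (vec R (s, 0)) = 0 := by
  rw [vec, plug_basis]
  refine graphOp_eq_zero C (p := QPath.const s.label) (by simp [arc_zero]) ?_
  exact (QPath.not_isPure_iff _).2 ⟨_, rfl⟩

theorem gaps_plug_curvature {L : List (Arc m)} (hL : ∀ a ∈ L, 0 < a.2) :
    gaps (fun X W => gaps (fun Y Z =>
      plug (graphOp C) (arcs X) (arcs Z) (curvature U (arcs Y))) W) L =
    gaps (fun X Z => ∑ s, U s • graphTerm C (X ++ (s, s.period) :: Z)) L := by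
  refine gaps_congr fun X W e => ?_
  rw [gaps_eq_first]
  · change plug (graphOp C) (arcs X) (arcs W) (∑ s, U s • vec R (s, s.period)) = _
    rw [map_sum]
    refine sum_congr rfl fun s _ => ?_
    rw [map_smul, plug_graphOp_vec C _ _ s.period_pos]
    · exact fun a ha => hL a (by rw [e]; exact mem_append_left _ ha)
    · exact fun a ha => hL a (by rw [e]; exact mem_append_right _ ha)
  · intro Y Z hY _
    cases Y with
    | nil => exact absurd rfl hY
    | cons a Y => exact map_zero _

theorem gaps_plug_productTerm_inner {L : List (Arc m)} (hL : ∀ a ∈ L, 0 < a.2) :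
    gaps (fun X W => gaps (fun Y Z =>
      plug (graphOp C) (arcs X) (arcs Z) (productTerm R (arcs Y))) W) L =
    gaps (fun X Z => merge (graphTerm C) X Z) L := by
  rw [gaps_pairs fun X p q W => plug (graphOp C) (arcs X) (arcs W) (vec R p * vec R q)]
  · refine gaps_congr fun X Z e => ?_
    rcases eq_nil_or_concat X with rfl | ⟨X, p, rfl⟩
    · rw [pairTerm_nil_left, merge_nil_left]
    · rw [concat_eq_append] at e ⊢
      cases Z with
      | nil => rw [pairTerm_nil_right, merge_nil_right]
      | cons q Z =>
        have hp : 0 < p.2 := hL p (by rw [e]; simp)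
        have hq : 0 < q.2 := hL q (by rw [e]; simp)
        rw [pairTerm_snoc_cons, merge_snoc_cons, vec_mul_vec _ _ hp hq]
        split_ifs
        · refine plug_graphOp_vec C ?_ ?_ (by simp; omega)
          · exact fun a ha => hL a (by rw [e]; simp [ha])
          · exact fun a ha => hL a (by rw [e]; simp [ha])
        · exact map_zero _
  · intro X; exact map_zero _
  · intro X p
    rw [gaps, gaps]
    change plug _ _ _ 0 + plug _ _ _ 0 = _
    simp only [map_zero, add_zero]
  · intro X p q W
    rw [gaps, gaps, gaps_eq_first]
    · change plug _ _ _ 0 + (plug _ _ _ 0 + plug _ _ _ (vec R p * vec R q)) = _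
      simp only [map_zero, zero_add]
    · intro Y Z hY _
      have := length_pos_iff_ne_nil.2 hY
      rw [productTerm_eq_zero (by simp [arcs]; omega), map_zero]

theorem gaps_plug_centerTerm (L : List (Arc m)) : gaps (fun X W => gaps (fun Y Z =>
      plug (graphOp C) (arcs X) (arcs Z) (centerTerm C Y)) W) L = 0 := by
  refine gaps_eq_zero _ _ fun X W _ => gaps_eq_zero _ _ fun Y Z _ => ?_
  cases Y with
  | nil => exact map_zero _
  | cons a Y => rw [centerTerm, map_smul, plug_graphOp_const, smul_zero]

theorem gaps_plug_leftTerm {L : List (Arc m)} (hL : ∀ a ∈ L, 0 < a.2) :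
    gaps (fun X W => gaps (fun Y Z => plug (graphOp C) (arcs X) (arcs Z) (leftTerm C Y)) W) L =
    gaps (fun X Z => splits (fun X₁ x y X₂ => C (y :: X₂) • graphTerm C (X₁ ++ x :: Z)) X) L := by
  rw [gaps_gaps fun X Y Z => plug (graphOp C) (arcs X) (arcs Z) (leftTerm C Y)]
  refine gaps_congr fun P Z e => ?_
  rw [gaps_head fun X₁ x y X₂ => C (y :: X₂) • plug (graphOp C) (arcs X₁) (arcs Z) (vec R x)]
  · refine splits_congr fun X₁ x y X₂ hx hy _ h₁ h₂ => ?_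
    rw [plug_graphOp_vec C _ _ hx]
    · exact fun a ha => hL a (by rw [e]; exact mem_append_left _ (h₁ a ha))
    · exact fun a ha => hL a (by rw [e]; exact mem_append_right _ ha)
  · exact fun X => map_zero _
  · intro X a Y
    rw [leftTerm, map_parts]
    simp only [map_smul]

theorem gaps_plug_rightTerm {L : List (Arc m)} (hL : ∀ a ∈ L, 0 < a.2) :
    gaps (fun X W => gaps (fun Y Z => plug (graphOp C) (arcs X) (arcs Z) (rightTerm C Y)) W) L =
    gaps (fun X Z => splits (fun Y₁ x y Y₂ => C (Y₁ ++ [x]) • graphTerm C (X ++ y :: Y₂)) Z) L := by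
  refine gaps_congr fun X W e => ?_
  rw [gaps_last fun Y₁ x y Y₂ => C (Y₁ ++ [x]) • plug (graphOp C) (arcs X) (arcs Y₂) (vec R y)]
  · refine splits_congr fun X₁ x y X₂ hx hy _ h₁ h₂ => ?_
    rw [plug_graphOp_vec C _ _ hy]
    · exact fun a ha => hL a (by rw [e]; exact mem_append_left _ ha)
    · exact fun a ha => hL a (by rw [e]; exact mem_append_right _ (h₂ a ha))
  · exact fun X => map_zero _
  · intro X a Y
    rw [rightTerm_snoc, map_parts]
    simp only [map_smul]

theorem gaps_plug_graphOp_arcs {L : List (Arc m)} (hL : ∀ a ∈ L, 0 < a.2) :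
    gaps (fun X W => gaps (fun Y Z => plug (graphOp C) X Z (totalOp U C Y)) W) (arcs L) =
      gaps (defect U C (graphTerm C)) L := by
  have e : gaps (fun X W => gaps (fun Y Z => plug (graphOp C) X Z (totalOp U C Y)) W) (arcs L) =
      gaps (fun X W => gaps (fun Y Z =>
        plug (graphOp C) (arcs X) (arcs Z) (productTerm R (arcs Y)) +
        plug (graphOp C) (arcs X) (arcs Z) (curvature U (arcs Y)) +
        (plug (graphOp C) (arcs X) (arcs Z) (centerTerm C Y) +
        plug (graphOp C) (arcs X) (arcs Z) (leftTerm C Y) +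
        plug (graphOp C) (arcs X) (arcs Z) (rightTerm C Y))) W) L := by
    rw [arcs, gaps_map]
    refine gaps_congr fun X W e => ?_
    rw [gaps_map]
    refine gaps_congr fun Y Z e' => ?_
    have : graphOp C (arcs Y) = centerTerm C Y + leftTerm C Y + rightTerm C Y :=
      graphOp_arcs C fun a ha => hL a (by rw [e, e']; simp [ha])
    rw [← map_add, ← map_add, ← map_add, ← map_add, ← this]; rfl
  rw [e]
  simp only [gaps_add]
  rw [gaps_plug_curvature U C hL, gaps_plug_productTerm_inner C hL, gaps_plug_centerTerm,
    gaps_plug_leftTerm C hL, gaps_plug_rightTerm C hL, ← gaps_add, zero_add, ← gaps_add,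
    ← gaps_add]
  refine gaps_congr fun X Z _ => ?_
  unfold defect
  abel

end Pure

namespace IsTilingCount

variable {R : Type*} [CommRing R] {U : Slot m → R} {C : List (Arc m) → R}
  (h : IsTilingCount U C)
include h

/-- Adjacent inputs of a graph are composable. -/
theorem graphTerm_eq_zero (X Z : List (Arc m)) (p q : Arc m)
    (hpq : (Slot.across^[p.2] p.1).label ≠ q.1.label) : graphTerm C (X ++ p :: q :: Z) = 0 := by
  have key : ∀ (X Z : List (Arc m)) (p q : Arc m),
      (Slot.across^[p.2] p.1).label ≠ q.1.label → C (X ++ p :: q :: Z) = 0 := by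
    intro X Z p q hpq
    by_contra hC
    exact hpq (by rw [h.turn_append X Z p q hC, label_flip])
  have e1 : centerTerm C (X ++ p :: q :: Z) = 0 := by
    have := key X Z p q hpq
    cases X with
    | nil =>
      change C ([] ++ p :: q :: Z) • _ = (0 : BorderedAlgebra R m)
      rw [this, zero_smul]
    | cons a X =>
      change C (a :: X ++ p :: q :: Z) • _ = (0 : BorderedAlgebra R m)
      rw [this, zero_smul]
  have e2 : leftTerm C (X ++ p :: q :: Z) = 0 := by
    cases X with
    | nil =>
      rw [nil_append, leftTerm]
      refine parts_eq_zero fun x y _ hy _ _ hxy => ?_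
      have := key [] Z y q (by rw [hy, ← iterate_add_apply, add_comm, hxy]; exact hpq)
      rw [nil_append] at this
      rw [this, zero_smul]
    | cons a X =>
      rw [cons_append, leftTerm]
      refine parts_eq_zero fun x y _ _ _ _ _ => ?_
      change C ((y :: X) ++ p :: q :: Z) • _ = (0 : BorderedAlgebra R m)
      rw [key _ _ _ _ hpq, zero_smul]
  have e3 : rightTerm C (X ++ p :: q :: Z) = 0 := by
    rcases eq_nil_or_concat Z with rfl | ⟨Z, b, rfl⟩
    · have e : X ++ [p, q] = (X ++ [p]) ++ [q] := by simp
      rw [e, rightTerm_snoc]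
      refine parts_eq_zero fun x y hx _ _ _ _ => ?_
      rw [append_assoc]
      change C (X ++ p :: x :: []) • _ = (0 : BorderedAlgebra R m)
      rw [key _ _ _ _ (by rw [hx]; exact hpq), zero_smul]
    · have e : ∀ b, X ++ p :: q :: (Z ++ [b]) = (X ++ p :: q :: Z) ++ [b] := by simp
      rw [concat_eq_append, e, rightTerm_snoc]
      refine parts_eq_zero fun x y hx _ _ _ _ => ?_
      rw [← e, key _ _ _ _ hpq, zero_smul]
  rw [graphTerm, e1, e2, e3, add_zero, add_zero]

theorem const_mul_graphTerm (x : Vertex m) (a : Arc m) (L : List (Arc m)) :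
    basis (QPath.const x) * graphTerm C (a :: L) =
      if x = a.1.label then graphTerm C (a :: L) else 0 := by
  have hx : (basis (QPath.const x) : BorderedAlgebra R m) = vec R (.out x, 0) := rfl
  have hv : ∀ b : Arc m, vec R (.out x, 0) * vec R b =
      if x = b.1.label then vec R b else 0 := fun b => vec_zero_mul_vec b (.out x)
  have e1 : vec R (.out x, 0) * centerTerm C (a :: L) =
      if x = a.1.label then centerTerm C (a :: L) else 0 := by
    rw [centerTerm, mul_smul_comm', hv, smul_ite, smul_zero]
  have e2 : vec R (.out x, 0) * leftTerm C (a :: L) =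
      if x = a.1.label then leftTerm C (a :: L) else 0 := by
    rw [leftTerm, mul_parts, ← parts_ite]
    exact parts_congr fun u v hu _ _ _ _ => by rw [mul_smul_comm', hv, smul_ite, smul_zero, hu]
  have e3 : vec R (.out x, 0) * rightTerm C (a :: L) =
      if x = a.1.label then rightTerm C (a :: L) else 0 := by
    obtain ⟨l, b, hl⟩ : ∃ l b, a :: L = l ++ [b] :=
      ⟨_, _, (List.dropLast_append_getLast (List.cons_ne_nil a L)).symm⟩
    rw [hl, rightTerm_snoc, mul_parts, ← parts_ite]
    refine parts_congr fun u v hu hv' _ _ _ => ?_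
    rw [mul_smul_comm', hv, smul_ite, smul_zero]
    by_cases hC : C (l ++ [u]) = 0
    · simp [hC]
    · have : v.1.label = a.1.label := by
        cases l with
        | nil => exact absurd (h.singleton u) hC
        | cons c l =>
          obtain ⟨rfl, -⟩ := cons_eq_cons.1 hl
          rw [h.turn_last _ _ _ hC, hv', ← hu, label_flip]
      rw [this]
  rw [hx, graphTerm, mul_add, mul_add, e1, e2, e3]
  split_ifs <;> simp

theorem graphTerm_mul_const (x : Vertex m) (b : Arc m) (L : List (Arc m)) :
    graphTerm C (L ++ [b]) * basis (QPath.const x) =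
      if x = (Slot.across^[b.2] b.1).label then graphTerm C (L ++ [b]) else 0 := by
  have hx : (basis (QPath.const x) : BorderedAlgebra R m) = vec R (.out x, 0) := rfl
  have hv : ∀ b : Arc m, vec R b * vec R (.out x, 0) =
      if x = (Slot.across^[b.2] b.1).label then vec R b else 0 :=
    fun b => vec_mul_vec_zero b (.out x)
  obtain ⟨a, l, hl⟩ : ∃ a l, L ++ [b] = a :: l := by
    cases L with
    | nil => exact ⟨b, [], rfl⟩
    | cons a L => exact ⟨a, L ++ [b], rfl⟩
  have e1 : centerTerm C (L ++ [b]) * vec R (.out x, 0) =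
      if x = (Slot.across^[b.2] b.1).label then centerTerm C (L ++ [b]) else 0 := by
    rw [hl, centerTerm, smul_mul_assoc', hv, smul_ite, smul_zero]
    by_cases hC : C (a :: l) = 0
    · simp [hC]
    · have : (Slot.across^[b.2] b.1).label = a.1.label := by
        rw [← hl] at hC
        cases L with
        | nil => exact absurd (h.singleton b) hC
        | cons c L =>
          obtain ⟨rfl, -⟩ := cons_eq_cons.1 hl
          rw [h.turn_last _ _ _ hC, label_flip]
      rw [this]; rfl
  have e2 : leftTerm C (L ++ [b]) * vec R (.out x, 0) =
      if x = (Slot.across^[b.2] b.1).label then leftTerm C (L ++ [b]) else 0 := by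
    rw [hl, leftTerm, parts_mul_right, ← parts_ite]
    refine parts_congr fun u v hu hv' _ _ _ => ?_
    rw [smul_mul_assoc', hv, smul_ite, smul_zero]
    by_cases hC : C (v :: l) = 0
    · simp [hC]
    · have : (Slot.across^[b.2] b.1).label = (Slot.across^[u.2] u.1).label := by
        cases L with
        | nil =>
          obtain ⟨rfl, rfl⟩ := cons_eq_cons.1 hl; exact absurd (h.singleton v) hC
        | cons c L =>
          obtain ⟨rfl, rfl⟩ := cons_eq_cons.1 hl
          have := h.turn_last (v :: L).tail v b hC
          rw [hu, ← hv', this, label_flip]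
      rw [this]
  have e3 : rightTerm C (L ++ [b]) * vec R (.out x, 0) =
      if x = (Slot.across^[b.2] b.1).label then rightTerm C (L ++ [b]) else 0 := by
    rw [rightTerm_snoc, parts_mul_right, ← parts_ite]
    exact parts_congr fun u v _ hv' _ _ huv => by
      rw [smul_mul_assoc', hv, smul_ite, smul_zero, hv', ← iterate_add_apply, add_comm, huv]
  rw [hx, graphTerm, add_mul, add_mul, e1, e2, e3]
  split_ifs <;> simp

/-- Adjacent inputs that are not composable give zero. -/
theorem graphOp_eq_zero_of_finish_ne (X Z : List (QPath m)) (p q : QPath m)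
    (hpq : p.finish ≠ q.start) : graphOp C (X ++ p :: q :: Z) = 0 := by
  by_cases hp : ∀ r ∈ X ++ p :: q :: Z, r.IsPure
  · rw [graphOp, if_pos hp, map_append, map_cons, map_cons]
    apply h.graphTerm_eq_zero
    intro e
    apply hpq
    rw [p.eq_arc (hp p (by simp)), q.eq_arc (hp q (by simp)), QPath.finish_arc, e, QPath.start_arc]
  · exact if_neg hp

theorem const_mul_graphOp (x : Vertex m) (p : QPath m) (ps : List (QPath m)) :
    basis (QPath.const x) * graphOp C (p :: ps) =
      if x = p.start then graphOp C (p :: ps) else 0 := by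
  by_cases hp : ∀ r ∈ p :: ps, r.IsPure
  · rw [graphOp, if_pos hp, map_cons, h.const_mul_graphTerm]
    have : p.slot.label = p.start := by conv_rhs => rw [p.eq_arc (hp p (by simp)), QPath.start_arc]
    rw [this]
  · rw [graphOp, if_neg hp, mul_zero, ite_self]

theorem graphOp_mul_const (x : Vertex m) (p : QPath m) (ps : List (QPath m)) :
    graphOp C (ps ++ [p]) * basis (QPath.const x) =
      if x = p.finish then graphOp C (ps ++ [p]) else 0 := by
  by_cases hp : ∀ r ∈ ps ++ [p], r.IsPure
  · rw [graphOp, if_pos hp, map_append, List.map_singleton, h.graphTerm_mul_const]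
    have : (Slot.across^[p.length] p.slot).label = p.finish := by
      conv_rhs => rw [p.eq_arc (hp p (by simp)), QPath.finish_arc]
    rw [this]
  · rw [graphOp, if_neg hp, zero_mul, ite_self]

/-- In the presence of a constant input, only products involving it can be inner operations. -/
theorem gaps_plug_graphOp_const (x : Vertex m) (A B : List (QPath m)) :
    gaps (fun X W => gaps (fun Y Z => plug (graphOp C) X Z (totalOp U C Y)) W)
        (A ++ QPath.const x :: B) =
      gaps (pairTerm fun X p q Z => plug (graphOp C) X Z (basis p * basis q))
        (A ++ QPath.const x :: B) := by
  have hx : ¬ (QPath.const x).IsPure := (QPath.not_isPure_iff _).2 ⟨x, rfl⟩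
  have e : gaps (fun X W => gaps (fun Y Z => plug (graphOp C) X Z (totalOp U C Y)) W)
        (A ++ QPath.const x :: B) =
      gaps (fun X W => gaps (fun Y Z => plug (graphOp C) X Z (productTerm R Y)) W)
        (A ++ QPath.const x :: B) := by
    refine gaps_congr fun X W e => gaps_congr fun Y Z e' => ?_
    have hmem : QPath.const x ∈ X ++ (Y ++ Z) := by rw [← e', ← e]; simp
    by_cases hY : QPath.const x ∈ Y
    · obtain ⟨p, Y, rfl⟩ := List.exists_cons_of_ne_nil (List.ne_nil_of_mem hY)
      rw [totalOp, curvature_cons, graphOp_eq_zero C hY hx, add_zero, add_zero]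
    · have : ∀ v, plug (graphOp C) X Z v = 0 := plug_eq_zero _ _ _ fun p => by
        refine graphOp_eq_zero C (p := QPath.const x) ?_ hx
        simp only [mem_append, mem_cons] at hmem ⊢; tauto
      rw [this, this]
  rw [e]
  refine gaps_pairs _ _ (fun X => map_zero _) (fun X p => ?_) (fun X p q W => ?_) _
  · rw [gaps, gaps]
    change plug _ _ _ 0 + plug _ _ _ 0 = _
    simp only [map_zero, add_zero]
  · rw [gaps, gaps, gaps_eq_first]
    · change plug _ _ _ 0 + (plug _ _ _ 0 + plug _ _ _ (basis p * basis q)) = _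
      simp only [map_zero, zero_add]
    · intro Y Z hY _
      have := length_pos_iff_ne_nil.2 hY
      rw [productTerm_eq_zero (by simp; omega), map_zero]

theorem gaps_pairTerm_const (x : Vertex m) (A B : List (QPath m)) :
    gaps (pairTerm fun X p q Z => plug (graphOp C) X Z (basis p * basis q))
        (A ++ QPath.const x :: B) =
      (match A.getLast? with
        | some p => if x = p.finish then graphOp C (A ++ B) else 0
        | none => 0) +
      (match B with
        | q :: _ => if x = q.start then graphOp C (A ++ B) else 0
        | [] => 0) := by
  classical
  have hx : ¬ (QPath.const x).IsPure := (QPath.not_isPure_iff _).2 ⟨x, rfl⟩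
  have hJ : ∀ X p q Z, (QPath.const x ∈ X ∨ QPath.const x ∈ Z) →
      plug (graphOp C) X Z (basis p * basis q) = 0 := fun X p q Z hc =>
    plug_eq_zero _ _ _ (fun r => graphOp_eq_zero C (p := QPath.const x)
      (by simp only [mem_append, mem_cons]; tauto) hx) _
  have hl : ∀ X Z p, plug (graphOp C) X Z (basis p * basis (QPath.const x)) =
      if x = p.finish then graphOp C (X ++ p :: Z) else 0 := fun X Z p => by
    rw [basis_mul_basis, QPath.comp_const]
    split_ifs
    · exact plug_basis _ _ _ _
    · exact map_zero _
  have hr : ∀ X Z p, plug (graphOp C) X Z (basis (QPath.const x) * basis p) =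
      if x = p.start then graphOp C (X ++ p :: Z) else 0 := fun X Z p => by
    rw [basis_mul_basis, QPath.const_comp]
    split_ifs
    · exact plug_basis _ _ _ _
    · exact map_zero _
  rw [gaps_append_cons]
  congr 1
  · rcases eq_nil_or_concat A with rfl | ⟨A, p, rfl⟩
    · rw [gaps, pairTerm_nil_left]; rfl
    · rw [concat_eq_append, List.getLast?_concat, gaps_snoc, nil_append,
        pairTerm_snoc_cons, hl, gaps_eq_zero, zero_add]
      · simp
      · intro X Y _
        rcases eq_nil_or_concat X with rfl | ⟨X, r, rfl⟩
        · exact pairTerm_nil_left _ _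
        · rw [concat_eq_append]
          cases Y with
          | nil =>
            simp only [nil_append, cons_append, pairTerm_snoc_cons]
            exact hJ _ _ _ _ (.inr (by simp))
          | cons q Y =>
            simp only [append_assoc, cons_append, pairTerm_snoc_cons]
            exact hJ _ _ _ _ (.inr (by simp))
  · cases B with
    | nil => rw [gaps, pairTerm_nil_right]
    | cons q B =>
      rw [gaps, pairTerm_snoc_cons, hr, gaps_eq_zero, add_zero]
      intro X Y _
      rcases eq_nil_or_concat X with rfl | ⟨X, r, rfl⟩
      · have e : A ++ [QPath.const x, q] = (A ++ [QPath.const x]) ++ [q] := by simp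
        cases Y with
        | nil => exact pairTerm_nil_right _ _
        | cons s Y =>
          rw [e, pairTerm_snoc_cons]; exact hJ _ _ _ _ (.inl (by simp))
      · have e : A ++ QPath.const x :: q :: (X ++ [r]) =
          (A ++ QPath.const x :: q :: X) ++ [r] := by simp
        rw [concat_eq_append, e]
        cases Y with
        | nil => exact pairTerm_nil_right _ _
        | cons s Y =>
          rw [pairTerm_snoc_cons]; exact hJ _ _ _ _ (.inl (by simp))

theorem relation_of_const [CharP R 2] (x : Vertex m) (A B : List (QPath m)) :
    gaps (fun X W => gaps (fun Y Z => plug (totalOp U C) X Z (totalOp U C Y)) W)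
        (A ++ QPath.const x :: B) = 0 := by
  have hx : ¬ (QPath.const x).IsPure := (QPath.not_isPure_iff _).2 ⟨x, rfl⟩
  cases A with
  | nil =>
    rcases eq_nil_or_concat B with rfl | ⟨B, b, rfl⟩
    · have := gaps_plug_totalOp U C h.across (QPath.const x) (QPath.const x) [] [] rfl
      rw [nil_append, this, graphOp_nil, mul_zero, zero_mul, add_zero, add_zero]
      have := h.gaps_plug_graphOp_const x [] []
      rw [nil_append] at this
      rw [this]
      have := h.gaps_pairTerm_const x [] []
      rw [nil_append] at this
      rw [this]; simp
    · rw [concat_eq_append]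
      have := gaps_plug_totalOp U C h.across (QPath.const x) b (B ++ [b]) (QPath.const x :: B) rfl
      rw [nil_append, this, graphOp_eq_zero C (List.mem_cons_self) hx, zero_mul, add_zero]
      have := h.gaps_plug_graphOp_const x [] (B ++ [b])
      rw [nil_append] at this
      rw [this]
      have := h.gaps_pairTerm_const x [] (B ++ [b])
      rw [nil_append] at this
      rw [this]
      obtain ⟨q, l, hl⟩ : ∃ q l, B ++ [b] = q :: l := by
        cases B with
        | nil => exact ⟨b, [], rfl⟩
        | cons q B => exact ⟨q, B ++ [b], rfl⟩
      rw [hl, h.const_mul_graphOp]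
      simp only [List.getLast?_nil, nil_append, zero_add]; exact add_self_eq_zero _
  | cons a A =>
    rcases eq_nil_or_concat B with rfl | ⟨B, b, rfl⟩
    · have := gaps_plug_totalOp U C h.across a (QPath.const x) (A ++ [QPath.const x]) (a :: A) rfl
      rw [cons_append, this, graphOp_eq_zero C (p := QPath.const x) (by simp) hx, mul_zero,
        zero_add, ← cons_append, h.gaps_plug_graphOp_const, h.gaps_pairTerm_const]
      obtain ⟨l, q, hl⟩ : ∃ l q, a :: A = l ++ [q] :=
        ⟨_, _, (List.dropLast_append_getLast (List.cons_ne_nil a A)).symm⟩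
      rw [hl, h.graphOp_mul_const]
      simp only [List.getLast?_concat, List.append_nil, add_zero]; exact add_self_eq_zero _
    · rw [concat_eq_append]
      have := gaps_plug_totalOp U C h.across a b (A ++ QPath.const x :: (B ++ [b]))
        (a :: A ++ QPath.const x :: B) (by simp)
      rw [cons_append, this, graphOp_eq_zero C (p := QPath.const x) (by simp) hx, mul_zero,
        graphOp_eq_zero C (p := QPath.const x) (by simp) hx, zero_mul, add_zero, add_zero,
        ← cons_append, h.gaps_plug_graphOp_const, h.gaps_pairTerm_const]
      obtain ⟨l, p, hl⟩ : ∃ l q, a :: A = l ++ [q] :=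
        ⟨_, _, (List.dropLast_append_getLast (List.cons_ne_nil a A)).symm⟩
      obtain ⟨q, l', hl'⟩ : ∃ q l, B ++ [b] = q :: l := by
        cases B with
        | nil => exact ⟨b, [], rfl⟩
        | cons q B => exact ⟨q, B ++ [b], rfl⟩
      rw [hl, hl', List.getLast?_concat]
      simp only
      by_cases hpq : p.finish = q.start
      · rw [hpq, add_self_eq_zero]
      · rw [append_assoc, List.singleton_append, h.graphOp_eq_zero_of_finish_ne _ _ _ _ hpq,
          ite_self, ite_self, add_zero]

/-- The structure relation, for sequences of paths. -/
theorem relation [CharP R 2] (ps : List (QPath m)) :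
    gaps (fun X W => gaps (fun Y Z => plug (totalOp U C) X Z (totalOp U C Y)) W) ps = 0 := by
  by_cases hp : ∀ p ∈ ps, p.IsPure
  · obtain ⟨L, hL, rfl⟩ := exists_arcs hp
    rcases L with _ | ⟨a, L⟩
    · change plug _ _ _ (totalOp U C []) = 0
      have e : totalOp U C [] = ∑ s, U s • vec R (s, s.period) := by
        rw [totalOp, graphOp_nil, add_zero]; exact zero_add _
      rw [e, map_sum]
      refine sum_eq_zero fun s _ => ?_
      have e2 : graphOp C [QPath.arc s s.period] = graphTerm C [(s, s.period)] :=
        graphOp_arcs C (L := [(s, s.period)]) (by simpa using s.period_pos)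
      have e3 : ∀ (y : Arc m) (v : BorderedAlgebra R m), C [y] • v = 0 := fun y v => by
        rw [h.singleton, zero_smul]
      rw [map_smul, vec, plug_basis, totalOp, nil_append, productTerm_eq_zero (by simp),
        curvature_cons, e2, graphTerm, centerTerm, leftTerm]
      have e4 := rightTerm_snoc C [] (s, s.period)
      rw [nil_append] at e4
      rw [e4]
      simp only [nil_append, e3, parts_zero, add_zero, smul_zero]
    · rcases eq_nil_or_concat L with rfl | ⟨L, b, rfl⟩
      · have := gaps_plug_totalOp U C h.across (QPath.arc a.1 a.2) (QPath.arc a.1 a.2) [] [] rfl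
        change gaps _ [QPath.arc a.1 a.2] = 0
        rw [this, graphOp_nil, mul_zero, zero_mul, add_zero, add_zero]
        have := gaps_plug_graphOp_arcs U C hL
        exact this.trans (h.gaps_defect_graphTerm_singleton a (hL a (by simp)))
      · rw [concat_eq_append] at hL hp ⊢
        have e : arcs (a :: (L ++ [b])) = arcs (a :: L) ++ [QPath.arc b.1 b.2] := by
          rw [← cons_append, arcs_append]; rfl
        have := gaps_plug_totalOp U C h.across (QPath.arc a.1 a.2) (QPath.arc b.1 b.2)
          (arcs (L ++ [b])) (arcs (a :: L)) e
        have e' : arcs (a :: (L ++ [b])) = QPath.arc a.1 a.2 :: arcs (L ++ [b]) := rfl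
        rw [← e'] at this
        rw [this, gaps_plug_graphOp_arcs U C hL,
          graphOp_arcs C (fun c hc => hL c (mem_cons_of_mem _ hc)),
          graphOp_arcs C (fun c hc => hL c (by
            rw [← cons_append]; exact mem_append_left _ hc)), ← add_assoc]
        exact h.gaps_defect_graphTerm_add a b L hL
  · push Not at hp
    obtain ⟨p, hp, hp'⟩ := hp
    obtain ⟨x, rfl⟩ := (QPath.not_isPure_iff p).1 hp'
    obtain ⟨A, B, rfl⟩ := List.append_of_mem hp; exact h.relation_of_const x A B

end IsTilingCount

/-! ### The numbers of tilings -/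

section Words

theorem run_add (s : Slot m) (a b : ℕ) : run s (a + b) = run s a ++ run (across^[a] s) b := by
  induction a generalizing s with
  | zero => simp [run]
  | succ a ih => rw [Nat.succ_add, run, run, ih, cons_append, iterate_succ_apply]

theorem stretch_add (s : Slot m) {a : ℕ} (ha : 0 < a) (b : ℕ) :
    stretch s (a + b) = stretch s a ++ run (across^[a] s) b := by
  obtain ⟨a, rfl⟩ := Nat.exists_eq_succ_of_ne_zero ha.ne'
  rw [Nat.succ_add, stretch, stretch, run_add, cons_append, Nat.succ_eq_add_one, iterate_succ_apply]

theorem run_of_pos (s : Slot m) {n : ℕ} (hn : 0 < n) :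
    run s n = (s, false) :: run s.across (n - 1) := by
  obtain ⟨n, rfl⟩ := Nat.exists_eq_succ_of_ne_zero hn.ne'
  rfl

theorem stretch_of_pos (s : Slot m) {n : ℕ} (hn : 0 < n) :
    stretch s n = (s, true) :: run s.across (n - 1) := by
  obtain ⟨n, rfl⟩ := Nat.exists_eq_succ_of_ne_zero hn.ne'
  rfl

theorem fst_of_mem_run {s : Slot m} {n : ℕ} {z : Mark m} (h : z ∈ run s n) :
    z.1 = s ∨ z.1 = s.across := by
  induction n generalizing s with
  | zero => simp [run] at h
  | succ n ih =>
    rcases mem_cons.1 h with rfl | h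
    · exact .inl rfl
    · rcases ih h with e | e
      · exact .inr e
      · exact .inl (by rw [e, across_across])

theorem across_ne_flip (s : Slot m) : s.across ≠ s.flip := by
  intro e
  apply Slot.next_ne s
  rw [Slot.next_eq, e, Slot.flip_flip]

theorem turn_of_marks {S : Finset ℕ} {ε : Perm (Corner m)} (hg : IsGluing S ε) {t : Slot m}
    {ω : List (Mark m)} (n : ℕ) (x : Corner m)
    (h : Marks ε (face ε x) (run x.2.across n ++ (t, true) :: ω)) :
    t = (across^[n + 1] x.2).flip := by
  induction n generalizing x with
  | zero =>
    obtain ⟨h1, h2, -⟩ := h; exact h1.symm.trans (hg.face_slot_leaf (h2.2 rfl))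
  | succ n ih =>
    obtain ⟨h1, -, h2⟩ := h
    rw [ih (face ε x) (by rw [h1]; exact h2), h1]; rfl

end Words

section Number

/-- The number of tilings with boundary sequence `L`, with weight `w` and with `d` vertices, up to
renumbering of the vertices. -/
def tilingNumber (d : ℕ) (w : Weight m) (L : List (Arc m)) : ℕ := open Classical in
  if ∀ a ∈ L, 0 < a.2 then (labeled (range d) w (boundary L)).ncard / d.factorial else 0

theorem factorial_mul_tilingNumber {d : ℕ} {w : Weight m} {a : Arc m}
    {L : List (Arc m)} (hL : ∀ b ∈ a :: L, 0 < b.2) :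
    d.factorial * tilingNumber d w (a :: L) = (labeled (range d) w (boundary (a :: L))).ncard := by
  rw [tilingNumber, if_pos hL, ← DecoratedGraph.factorial_mul_ncard_classes hL,
    Nat.mul_div_cancel_left _ d.factorial_pos]

theorem tilingNumber_eq_ncard {d : ℕ} {w : Weight m} {a : Arc m}
    {L : List (Arc m)} (hL : ∀ b ∈ a :: L, 0 < b.2) :
    tilingNumber d w (a :: L) = (DecoratedGraph.classes w (arcs (a :: L)) d a.1.label).ncard := by
  rw [tilingNumber, if_pos hL, ← DecoratedGraph.factorial_mul_ncard_classes hL,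
    Nat.mul_div_cancel_left _ d.factorial_pos]
  rfl

theorem exists_of_tilingNumber_ne {d : ℕ} {w : Weight m} {L : List (Arc m)}
    (h : tilingNumber d w L ≠ 0) :
    (∀ a ∈ L, 0 < a.2) ∧ Num d w (boundary L) ∧ ∃ ε y, Realizes (range d) ε y (boundary L) := by
  unfold tilingNumber at h
  split_ifs at h with hL
  · have h0 : (labeled (range d) w (boundary L)).ncard ≠ 0 := fun e => h (by rw [e]; simp)
    obtain ⟨⟨ε, y⟩, h1, h2⟩ := Set.nonempty_of_ncard_ne_zero h0
    rw [card_range] at h1; exact ⟨hL, h1, ε, y, h2⟩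
  · exact absurd rfl h

theorem tilingNumber_append_comm (d : ℕ) (w : Weight m) (X Y : List (Arc m)) :
    tilingNumber d w (X ++ Y) = tilingNumber d w (Y ++ X) := by
  unfold tilingNumber
  rw [boundary_append, ncard_labeled_rotate, ← boundary_append]
  refine if_congr ?_ rfl rfl
  simp only [mem_append]
  exact ⟨fun h a ha => h a ha.symm, fun h a ha => h a ha.symm⟩

theorem tilingNumber_turn {d : ℕ} {w : Weight m} (X Y : List (Arc m))
    (a b : Arc m) (h : tilingNumber d w (X ++ a :: b :: Y) ≠ 0) :
    b.1 = (across^[a.2] a.1).flip := by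
  rw [tilingNumber_append_comm] at h
  obtain ⟨h1, -, ε, y, h2⟩ := exists_of_tilingNumber_ne h
  have ha : 0 < a.2 := h1 a (by simp)
  have hb : 0 < b.2 := h1 b (by simp)
  have hmarks := h2.marks
  rw [cons_append, cons_append, boundary_cons, boundary_cons, stretch_of_pos _ ha,
    stretch_of_pos _ hb] at hmarks
  obtain ⟨e1, -, e2⟩ := hmarks
  have := turn_of_marks h2.toIsGluing (t := b.1) (a.2 - 1) y (by rw [e1]; exact e2)
  rwa [e1, Nat.sub_add_cancel ha] at this

theorem tilingNumber_turn_last {d : ℕ} {w : Weight m} (X : List (Arc m))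
    (a b : Arc m) (h : tilingNumber d w (a :: X ++ [b]) ≠ 0) :
    a.1 = (across^[b.2] b.1).flip := by
  rw [tilingNumber_append_comm] at h
  exact tilingNumber_turn [] _ _ _ h

theorem tilingNumber_singleton (d : ℕ) (w : Weight m) (a : Arc m) : tilingNumber d w [a] = 0 := by
  by_contra h
  obtain ⟨h1, h2, -⟩ := exists_of_tilingNumber_ne h
  have h3 := h2.2
  rw [countP_boundary _ h1, List.length_singleton] at h3
  obtain ⟨k, hk⟩ : ∃ k, 2 * m - 4 = 2 * k := ⟨m - 2, by omega⟩
  rw [hk, mul_assoc] at h3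
  omega

/-- Euler's formula. -/
theorem mul_add_two_of_tilingNumber_ne {d : ℕ} {w : Weight m} {L : List (Arc m)}
    (h : tilingNumber d w L ≠ 0) : (2 * m - 4) * d + 2 = L.length + 2 * ∑ i, w i := by
  obtain ⟨h1, h2, -⟩ := exists_of_tilingNumber_ne h
  rw [← countP_boundary _ h1]
  exact h2.2

end Number

section Cut

variable {M : Type*} [AddCommMonoid M]

theorem gaps_append {α : Type*} (f : List α → List α → M) (A B : List α)
    (h0 : ∀ X, f X [] = 0) : gaps f (A ++ B) =
      gaps (fun X Y => if Y = [] then 0 else f X (Y ++ B)) A + gaps (fun X Y => f (A ++ X) Y) B := by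
  induction A generalizing f with
  | nil => simp [gaps]
  | cons a A ih =>
    rw [cons_append, gaps, ih _ fun X => h0 _, gaps, if_neg (by simp), add_assoc]; rfl

/-- The positions in a boundary word that are not preceded by a leaf are the factorizations of the
arcs of the boundary. -/
theorem gaps_boundary (f : List (Mark m) → List (Mark m) → M)
    (h0 : ∀ X, f X [] = 0) (h1 : ∀ X s Y, f X ((s, true) :: Y) = 0) (L : List (Arc m)) :
    gaps f (boundary L) =
      splits (fun X x y Z => f (boundary X ++ stretch x.1 x.2) (run y.1 y.2 ++ boundary Z)) L := by
  induction L generalizing f with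
  | nil => exact h0 []
  | cons a L ih =>
    rw [boundary_cons, gaps_append f _ _ h0, splits, ih _ (fun X => h0 _) (fun X => h1 _)]
    congr 1
    · obtain ⟨s, n⟩ := a
      rw [gaps_eq_sum, length_stretch, Finset.sum_range_succ, if_pos (by
        rw [List.drop_eq_nil_iff, length_stretch]), add_zero]
      unfold parts
      simp only
      rcases Nat.eq_zero_or_pos n with rfl | hn
      · rfl
      · have hsplit : range n = insert 0 (Ioo 0 n) := by
          ext k
          simp only [mem_range, Finset.mem_insert, mem_Ioo]; omega
        rw [hsplit, Finset.sum_insert (by simp), stretch_of_pos _ hn, List.drop_zero,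
          if_neg (by simp), cons_append, h1, zero_add, ← stretch_of_pos _ hn]
        refine sum_congr rfl fun k hk => ?_
        have hk' := mem_Ioo.1 hk
        have e : stretch s n = stretch s k ++ run (across^[k] s) (n - k) := by
          rw [← stretch_add s hk'.1, Nat.add_sub_cancel' hk'.2.le]
        rw [e, List.take_left' (length_stretch _ _), List.drop_left' (length_stretch _ _),
          if_neg (fun h => by
            have := congrArg List.length h
            rw [length_run, List.length_nil] at this
            omega)]
        rfl
    · refine splits_congr fun X x y Z _ _ _ _ _ => ?_
      rw [boundary_cons, append_assoc]

theorem sum_powerset_eq {d : ℕ} (f g : ℕ → ℕ) : ∑ T ∈ (range d).powerset,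
        (T.card.factorial * f T.card) * ((range d \ T).card.factorial * g (range d \ T).card) =
      d.factorial * ∑ e ∈ antidiagonal d, f e.1 * g e.2 := by
  have h1 : ∀ T ∈ (range d).powerset,
      (T.card.factorial * f T.card) * ((range d \ T).card.factorial * g (range d \ T).card) =
        (fun k => (k.factorial * f k) * ((d - k).factorial * g (d - k))) T.card := by
    intro T hT
    rw [Finset.card_sdiff_of_subset (mem_powerset.1 hT), card_range]
  rw [sum_congr rfl h1, Finset.sum_powerset_apply_card fun k =>
      (k.factorial * f k) * ((d - k).factorial * g (d - k)), card_range,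
    Finset.Nat.sum_antidiagonal_eq_sum_range_succ fun i j => f i * g j, mul_sum]
  refine sum_congr rfl fun k hk => ?_
  have hk' := mem_range.1 hk
  rw [smul_eq_mul, ← Nat.choose_mul_factorial_mul_factorial (show k ≤ d by omega)]
  ring

theorem tilingNumber_cut {d : ℕ} {w : Weight m} (p q : Arc m)
    (L : List (Arc m)) (hL : ∀ a ∈ L, 0 < a.2) (hp : 0 < p.2) (hq : 0 < q.2)
    (hpq : q.1 = across^[p.2] p.1) :
    tilingNumber d w ((p.1, p.2 + q.2) :: L) = ∑ v ∈ antidiagonal w,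
        (if v.2 = Finsupp.single q.1.flip.typeIdx 1 then
          tilingNumber d v.1 ((q.1.flip, q.1.flip.period) :: q :: L ++ [p]) else 0) +
      splits (fun X x y Z => ∑ v ∈ antidiagonal w, ∑ e ∈ antidiagonal d,
          tilingNumber e.1 v.1 (q :: X ++ [x]) * tilingNumber e.2 v.2 (y :: Z ++ [p])) L := by
  obtain ⟨s, a⟩ := p
  obtain ⟨t, b⟩ := q
  simp only at hp hq hpq ⊢
  apply Nat.eq_of_mul_eq_mul_left d.factorial_pos
  rw [factorial_mul_tilingNumber (by
    intro c hc
    rcases mem_cons.1 hc with rfl | hc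
    · exact Nat.add_pos_left hp _
    · exact hL c hc)]
  rw [boundary_cons, stretch_add s hp, ← hpq, append_assoc, ncard_labeled_rotate,
    run_of_pos t hq, cons_append, cons_append, ncard_labeled_cut]
  set r := run t.across (b - 1) ++ boundary L ++ stretch s a with hr
  rw [mul_add]
  congr 1
  · rw [mul_sum]
    refine sum_congr rfl fun v _ => ?_
    have hcons : (t.flip, t.flip.period) :: (t, b) :: L ++ [(s, a)] =
        (t.flip, t.flip.period) :: ((t, b) :: (L ++ [(s, a)])) := rfl
    rw [mul_ite, mul_zero, hcons, factorial_mul_tilingNumber]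
    · refine if_congr Iff.rfl ?_ rfl
      rw [boundary_cons, boundary_cons, boundary_append, boundary_singleton,
        stretch_of_pos t hq, ncard_labeled_rotate]
      simp only [hr, cons_append, append_assoc]
    · intro c hc
      simp only [mem_cons, mem_append, List.not_mem_nil, or_false] at hc
      rcases hc with rfl | rfl | hc | rfl
      · exact Slot.period_pos _
      · exact hq
      · exact hL c hc
      · exact hp
  · set F : List (Mark m) → List (Mark m) → ℕ := fun A B =>
      ∑ v ∈ antidiagonal w, ∑ T ∈ (range d).powerset, (labeled T v.1 ((t, true) :: A)).ncard *
          (labeled (range d \ T) v.2 ((t.flip, true) :: B)).ncard with hF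
    set f : List (Mark m) → List (Mark m) → ℕ := fun A Y =>
      if Y.head? = some (t.flip, false) then F A Y.tail else 0 with hf
    have e1 : (∑ j ∈ range r.length, if r[j]? = some (t.flip, false) then
        F (r.take j) (r.drop (j + 1)) else 0) = gaps f r := by
      rw [gaps_eq_sum, Finset.sum_range_succ]
      simp only [hf, List.head?_drop, List.tail_drop]; simp
    have h0 : ∀ X, f X [] = 0 := fun X => by simp [hf]
    have hz : ∀ (A ω : List (Mark m)) (B : List (Mark m)),
        (∀ z ∈ ω, z ≠ (t.flip, false)) →
        gaps (fun X Y => if Y = [] then 0 else f (A ++ X) (Y ++ B)) ω = 0 := by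
      intro A ω B hω
      refine gaps_eq_zero _ _ fun X Y e => ?_
      cases Y with
      | nil => simp
      | cons z Y =>
        rw [if_neg (by simp)]
        refine if_neg fun h => hω z (by rw [e]; simp) ?_
        simpa using h
    have hne : ∀ z : Mark m, z.1 = t ∨ z.1 = t.across → z ≠ (t.flip, false) := by
      rintro z hz rfl
      rcases hz with hz | hz
      · exact flip_ne _ hz
      · exact across_ne_flip _ hz.symm
    rw [e1, hr, append_assoc, gaps_append f _ _ h0, gaps_append _ _ _ fun X => h0 _]
    have z1 := hz [] (run t.across (b - 1)) (boundary L ++ stretch s a) fun z hz' => hne z <| by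
      rcases fst_of_mem_run hz' with e | e
      · exact .inr e
      · exact .inl (by rw [e, across_across])
    have z2 := hz (run t.across (b - 1) ++ boundary L) (stretch s a) [] fun z hz' => by
      rw [stretch_of_pos s hp] at hz'
      rcases mem_cons.1 hz' with rfl | hz'
      · simp
      · apply hne
        have h2 : z.1 = s ∨ z.1 = s.across := by
          rcases fst_of_mem_run hz' with e | e
          · exact .inr e
          · exact .inl (by rw [e, across_across])
        rcases Slot.across_iterate_cases s a with e | e
        · rw [hpq, e]; exact h2
        · rw [hpq, e, across_across]; exact h2.symm
    have z2' : gaps (fun X Y => f (run t.across (b - 1) ++ (boundary L ++ X)) Y) (stretch s a) =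
        0 := by
      rw [← z2]
      refine gaps_congr fun X Y _ => ?_
      split_ifs with hY
      · rw [hY, h0]
      · rw [append_assoc, List.append_nil]
    simp only [nil_append] at z1
    rw [z1, z2', zero_add, add_zero]
    rw [gaps_boundary (fun X Y => if Y = [] then 0 else
      f (run t.across (b - 1) ++ X) (Y ++ stretch s a)) (fun X => by simp)
      (fun X u Y => by simp [hf]), ← smul_eq_mul,
      show d.factorial • splits _ L = DistribSMul.toAddMonoidHom ℕ d.factorial (splits _ L) from rfl,
      map_splits]
    refine splits_congr fun X x y Z hx hy hxy hX hZ => ?_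
    simp only [DistribSMul.toAddMonoidHom_apply, smul_eq_mul]
    rw [run_of_pos y.1 hy, if_neg (by simp)]
    simp only [hf, cons_append, List.head?_cons, List.tail_cons, Option.some.injEq,
      Prod.mk.injEq, and_true]
    have hpos1 : ∀ c ∈ (t, b) :: (X ++ [x]), 0 < c.2 := by
      intro c hc
      simp only [mem_cons, mem_append, List.not_mem_nil, or_false] at hc
      rcases hc with rfl | hc | rfl
      · exact hq
      · exact hL c (hX c hc)
      · exact hx
    have hpos2 : ∀ c ∈ y :: (Z ++ [(s, a)]), 0 < c.2 := by
      intro c hc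
      simp only [mem_cons, mem_append, List.not_mem_nil, or_false] at hc
      rcases hc with rfl | hc | rfl
      · exact hy
      · exact hL c (hZ c hc)
      · exact hp
    rw [mul_sum]
    split_ifs with hty
    · refine sum_congr rfl fun v _ => ?_
      rw [← sum_powerset_eq (fun k => tilingNumber k v.1 ((t, b) :: (X ++ [x])))
        fun k => tilingNumber k v.2 (y :: (Z ++ [(s, a)]))]
      refine sum_congr rfl fun T _ => ?_
      rw [factorial_mul_tilingNumber hpos1, factorial_mul_tilingNumber hpos2,
        ncard_labeled_eq_of_card_eq (card_range T.card).symm,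
        ncard_labeled_eq_of_card_eq (card_range (range d \ T).card).symm]
      congr 3
      · rw [boundary_cons, boundary_append, boundary_singleton, stretch_of_pos t hq, cons_append]
      · rw [boundary_cons, boundary_append, boundary_singleton, stretch_of_pos y.1 hy, hty]
        simp
    · symm
      refine sum_eq_zero fun v _ => ?_
      rw [sum_eq_zero, mul_zero]
      intro e _
      by_contra h
      have h1 := tilingNumber_turn_last X (t, b) x (left_ne_zero_of_mul h)
      rw [← hxy] at h1
      simp only at h1; exact hty (by rw [h1, Slot.flip_flip])

end Cut

/-! ### Generating series -/

section Series

/-- Power series in variables that keep track of the weight, with coefficients in `(ℤ/2)[t]`. -/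
abbrev WeightSeries (m : ℕ) : Type := MvPowerSeries (WeightIndex m) (ZMod 2)[X]

/-- The generating series of the numbers of tilings with a given boundary sequence. -/
def tilingSeries (L : List (Arc m)) : WeightSeries m := fun w =>
  -- by Euler's formula, all further coefficients vanish
  ∑ d ∈ range (L.length + 2 * ∑ i, w i + 1), Polynomial.monomial d (tilingNumber d w L : ZMod 2)

theorem lt_of_tilingNumber_ne {d : ℕ} {w : Weight m} {L : List (Arc m)}
    (h : tilingNumber d w L ≠ 0) : d < L.length + 2 * ∑ i, w i + 1 := by
  have h3 := hm.out
  have h1 := mul_add_two_of_tilingNumber_ne h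
  have h2 : 1 * d ≤ (2 * m - 4) * d := Nat.mul_le_mul_right d (by omega)
  omega

theorem coeff_tilingSeries (w : Weight m) (d : ℕ) (L : List (Arc m)) :
    (MvPowerSeries.coeff w (tilingSeries L)).coeff d = (tilingNumber d w L : ZMod 2) := by
  change Polynomial.coeff (∑ d ∈ range (L.length + 2 * ∑ i, w i + 1),
    Polynomial.monomial d (tilingNumber d w L : ZMod 2)) d = _
  rw [Polynomial.finsetSum_coeff]
  simp only [Polynomial.coeff_monomial, Finset.sum_ite_eq', mem_range]
  split_ifs with h
  · rfl
  · by_contra hne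
    exact h (lt_of_tilingNumber_ne fun e => hne (by rw [e]; simp))

theorem series_ext {f g : WeightSeries m}
    (h : ∀ w d, (MvPowerSeries.coeff w f).coeff d = (MvPowerSeries.coeff w g).coeff d) : f = g :=
  MvPowerSeries.ext fun w => Polynomial.ext fun d => h w d

theorem exists_of_tilingSeries_ne {L : List (Arc m)} (h : tilingSeries L ≠ 0) :
    ∃ d w, tilingNumber d w L ≠ 0 := by
  by_contra! h'
  refine h (series_ext fun w d => ?_)
  rw [coeff_tilingSeries, h']
  simp

theorem tilingSeries_eq_zero_of_mem {L : List (Arc m)} {a : Arc m} (ha : a ∈ L)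
    (h : ¬ 0 < a.2) : tilingSeries L = 0 := by
  by_contra hne
  obtain ⟨d, w, hd⟩ := exists_of_tilingSeries_ne hne
  exact h ((exists_of_tilingNumber_ne hd).1 a ha)

theorem coeff_mul_tilingSeries (w : Weight m) (d : ℕ) (L L' : List (Arc m)) :
    (MvPowerSeries.coeff w (tilingSeries L * tilingSeries L')).coeff d = ((∑ v ∈ antidiagonal w,
        ∑ e ∈ antidiagonal d, tilingNumber e.1 v.1 L * tilingNumber e.2 v.2 L' : ℕ) : ZMod 2) := by
  classical
  rw [MvPowerSeries.coeff_mul, Polynomial.finsetSum_coeff]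
  simp only [Polynomial.coeff_mul, coeff_tilingSeries]
  push_cast
  rfl

theorem coeff_X_mul_tilingSeries (w : Weight m) (d : ℕ) (i : WeightIndex m) (L : List (Arc m)) :
    (MvPowerSeries.coeff w (MvPowerSeries.X i * tilingSeries L)).coeff d = ((∑ v ∈ antidiagonal w,
        if v.2 = Finsupp.single i 1 then tilingNumber d v.1 L else 0 : ℕ) : ZMod 2) := by
  classical
  rw [mul_comm, MvPowerSeries.coeff_mul, Polynomial.finsetSum_coeff]
  push_cast
  refine sum_congr rfl fun v _ => ?_
  rw [MvPowerSeries.coeff_X, mul_ite, mul_one, mul_zero]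
  split_ifs
  · exact coeff_tilingSeries _ _ _
  · exact Polynomial.coeff_zero _

theorem isTilingCount_tilingSeries :
    IsTilingCount (fun s : Slot m => (MvPowerSeries.X s.typeIdx : WeightSeries m))
      tilingSeries where
  across s := by rw [Slot.typeIdx_across]
  rotate a L := series_ext fun w d => by
    rw [coeff_tilingSeries, coeff_tilingSeries, ← tilingNumber_append_comm d w [a] L]; rfl
  turn a b L h := by
    obtain ⟨d, w, hd⟩ := exists_of_tilingSeries_ne h; exact tilingNumber_turn [] L a b hd
  singleton a := by
    by_contra h
    obtain ⟨d, w, hd⟩ := exists_of_tilingSeries_ne h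
    exact hd (tilingNumber_singleton d w a)
  cut p q L hp hq := by
    have turn : ∀ s : Slot m, tilingSeries ((s, s.period) :: q :: L ++ [p]) ≠ 0 →
        q.1 = s.flip ∧ q.1 = across^[p.2] p.1 := by
      intro s hs
      obtain ⟨d, w, hd⟩ := exists_of_tilingSeries_ne hs
      have h1 := tilingNumber_turn [] (L ++ [p]) (s, s.period) q hd
      have h2 := tilingNumber_turn_last (q :: L) (s, s.period) p hd
      simp only [across_iterate_period] at h1 h2; exact ⟨h1, by rw [h1, h2, Slot.flip_flip]⟩
    by_cases hpq : q.1 = across^[p.2] p.1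
    · rw [if_pos hpq]
      by_cases hL : ∀ a ∈ L, 0 < a.2
      · rw [Finset.sum_eq_single q.1.flip]
        · refine series_ext fun w d => ?_
          rw [map_add, Polynomial.coeff_add, coeff_tilingSeries,
            tilingNumber_cut p q L hL hp hq hpq, Nat.cast_add, coeff_X_mul_tilingSeries]
          congr 1
          rw [← Polynomial.lcoeff_apply, map_splits (MvPowerSeries.coeff w), map_splits]
          have := map_splits (Nat.castAddMonoidHom (ZMod 2)) (fun X x y Z =>
            ∑ v ∈ antidiagonal w, ∑ e ∈ antidiagonal d,
                tilingNumber e.1 v.1 (q :: X ++ [x]) * tilingNumber e.2 v.2 (y :: Z ++ [p])) L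
          refine this.trans (splits_congr fun X x y Z _ _ _ _ _ => ?_)
          rw [Polynomial.lcoeff_apply, coeff_mul_tilingSeries]; rfl
        · intro s _ hs
          by_contra h
          exact hs (by rw [(turn s (right_ne_zero_of_mul h)).1, Slot.flip_flip])
        · simp
      · push Not at hL
        obtain ⟨a, ha, ha0⟩ := hL
        have h0 : ¬ 0 < a.2 := by omega
        rw [tilingSeries_eq_zero_of_mem (a := a) (by simp [ha]) h0, sum_eq_zero, zero_add]
        · symm
          obtain ⟨A, B, rfl⟩ := List.append_of_mem ha
          rw [splits_append, splits]
          have e1 : splits (fun X x y Z => tilingSeries (q :: X ++ [x]) *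
              tilingSeries (y :: (Z ++ a :: B) ++ [p])) A = 0 := by
            rw [← splits_zero A]
            refine splits_congr fun X x y Z _ _ _ _ _ => ?_
            rw [tilingSeries_eq_zero_of_mem (a := a) (L := y :: (Z ++ a :: B) ++ [p])
              (by simp) h0, mul_zero]
          have e2 : (parts a fun x y => tilingSeries (q :: (A ++ []) ++ [x]) *
              tilingSeries (y :: B ++ [p])) = 0 :=
            parts_eq_zero fun x y _ _ _ _ hxy => by omega
          have e3 : splits (fun X x y Z => tilingSeries (q :: (A ++ a :: X) ++ [x]) *
              tilingSeries (y :: Z ++ [p])) B = 0 := by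
            rw [← splits_zero B]
            refine splits_congr fun X x y Z _ _ _ _ _ => ?_
            rw [tilingSeries_eq_zero_of_mem (a := a) (L := q :: (A ++ a :: X) ++ [x])
              (by simp) h0, zero_mul]
          rw [e1, e2, e3, add_zero, add_zero]
        · intro s _
          rw [tilingSeries_eq_zero_of_mem (a := a) (by simp [ha]) h0, mul_zero]
    · rw [if_neg hpq, sum_eq_zero, zero_add]
      · symm
        rw [← splits_zero L]
        refine splits_congr fun X x y Z _ _ hxy _ _ => ?_
        by_contra h
        obtain ⟨d, w, hd⟩ := exists_of_tilingSeries_ne (left_ne_zero_of_mul h)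
        obtain ⟨d', w', hd'⟩ := exists_of_tilingSeries_ne (right_ne_zero_of_mul h)
        have h1 := tilingNumber_turn_last X q x hd
        have h2 := tilingNumber_turn_last Z y p hd'
        rw [← hxy, h2, Slot.flip_flip] at h1; exact hpq h1
      · intro s _
        by_contra h
        exact hpq (turn s (right_ne_zero_of_mul h)).2

instance : CharP (WeightSeries m) 2 :=
  charP_of_injective_ringHom (f := (MvPowerSeries.C : (ZMod 2)[X] →+* WeightSeries m))
    MvPowerSeries.C_injective 2

end Series

/-! ### Passage from generating series to the operations -/

section Coefficient

/-- The coefficient of a given weight. -/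
def weightPart (w : Weight m) : BorderedAlgebra (WeightSeries m) m →+ TAlgebra m :=
  Finsupp.mapRange.addMonoidHom (MvPowerSeries.coeff w).toAddMonoidHom

theorem single_eq {R : Type*} [CommRing R] (p : QPath m) (r : R) : single p r = r • basis p := by
  unfold single basis single
  exact (Finsupp.smul_single_one p r).symm

theorem algebra_induction {R : Type*} [CommRing R] {P : BorderedAlgebra R m → Prop} (v)
    (h0 : P 0) (hadd : ∀ u v, P u → P v → P (u + v)) (hb : ∀ (r : R) p, P (r • basis p)) : P v :=
  Finsupp.induction_linear v h0 hadd fun p r => by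
    have := hb r p
    rwa [← single_eq] at this

theorem weightPart_smul_basis (w : Weight m) (r : WeightSeries m) (p : QPath m) :
    weightPart w (r • basis p) = MvPowerSeries.coeff w r • basis p := by
  rw [← single_eq, ← single_eq]
  exact Finsupp.mapRange_single (hf := map_zero _)

theorem weightPart_smul (w : Weight m) (r : WeightSeries m)
    (v : BorderedAlgebra (WeightSeries m) m) : weightPart w (r • v) = ∑ u ∈ antidiagonal w,
        MvPowerSeries.coeff u.1 r • weightPart u.2 v := by
  classical
  induction v using algebra_induction with
  | h0 => simp
  | hadd u v hu hv =>
    rw [smul_add, map_add, hu, hv, ← sum_add_distrib]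
    exact sum_congr rfl fun u _ => by rw [map_add, smul_add]
  | hb r' p =>
    rw [smul_smul, weightPart_smul_basis, MvPowerSeries.coeff_mul, sum_smul]
    refine sum_congr rfl fun u _ => ?_
    rw [weightPart_smul_basis, smul_smul]

theorem weightPart_basis (w : Weight m) (p : QPath m) :
    weightPart w (basis p) = if w = 0 then basis p else 0 := by
  classical
  rw [← one_smul (WeightSeries m) (basis p), weightPart_smul_basis, MvPowerSeries.coeff_one]
  split_ifs <;> simp

theorem weightPart_basis_mul (w : Weight m) (p : QPath m) (v : BorderedAlgebra (WeightSeries m) m) :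
    weightPart w (basis p * v) = basis p * weightPart w v := by
  induction v using algebra_induction with
  | h0 => simp
  | hadd u v hu hv => rw [mul_add, map_add, hu, hv, map_add, mul_add]
  | hb r q =>
    rw [mul_smul_comm', weightPart_smul_basis, mul_smul_comm', basis_mul_basis, basis_mul_basis]
    cases p.comp q with
    | none =>
      change weightPart w (r • 0) = _ • 0
      rw [smul_zero, smul_zero, map_zero]
    | some s => exact weightPart_smul_basis w r s

theorem weightPart_basis_mul_basis (w : Weight m) (p q : QPath m) :
    weightPart w (basis p * basis q) = if w = 0 then basis p * basis q else 0 := by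
  rw [weightPart_basis_mul, weightPart_basis, mul_ite, mul_zero]

theorem weightPart_mul_basis (w : Weight m) (p : QPath m) (v : BorderedAlgebra (WeightSeries m) m) :
    weightPart w (v * basis p) = weightPart w v * basis p := by
  induction v using algebra_induction with
  | h0 => simp
  | hadd u v hu hv => rw [add_mul, map_add, hu, hv, map_add, add_mul]
  | hb r q =>
    rw [smul_mul_assoc', weightPart_smul_basis, smul_mul_assoc', basis_mul_basis, basis_mul_basis]
    cases q.comp p with
    | none =>
      change weightPart w (r • 0) = _ • 0
      rw [smul_zero, smul_zero, map_zero]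
    | some s => exact weightPart_smul_basis w r s

theorem weightPart_plug (w : Weight m)
    (f : List (QPath m) → BorderedAlgebra (WeightSeries m) m) (X Z : List (QPath m))
    (v : BorderedAlgebra (WeightSeries m) m) : weightPart w (plug f X Z v) = ∑ u ∈ antidiagonal w,
        plug (fun ps => weightPart u.1 (f ps)) X Z (weightPart u.2 v) := by
  induction v using algebra_induction with
  | h0 => simp
  | hadd u v hu hv =>
    rw [map_add, map_add, hu, hv, ← sum_add_distrib]
    exact sum_congr rfl fun u _ => by rw [map_add, map_add]
  | hb r p =>
    rw [map_smul, plug_basis, weightPart_smul]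
    refine Finset.sum_equiv (Equiv.prodComm _ _) (fun u => ?_) fun u _ => ?_
    · simp [add_comm]
    rw [weightPart_smul_basis, map_smul, plug_basis]; rfl

end Coefficient

section Curvature

theorem ofArrow_eq (a : Arrow m) : QPath.ofArrow a = QPath.arc (Slot.ofArrow a) 1 := by
  ext1
  · change a.src = (Slot.ofArrow a).label
    rw [← Slot.src_sector, Slot.sector_ofArrow]
  · change [a] = [(Slot.ofArrow a).sector]
    rw [Slot.sector_ofArrow]

theorem basis_ofArrow {R : Type*} [CommRing R] (a : Arrow m) :
    (basis (QPath.ofArrow a) : BorderedAlgebra R m) = vec R (Slot.ofArrow a, 1) := by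
  rw [ofArrow_eq]
  rfl

theorem sum_typeIdx {M : Type*} [AddCommMonoid M] (i : WeightIndex m) (F : Slot m → M) :
    (∑ s : Slot m, if s.typeIdx = i then F s else 0) = if (rep i).across = rep i then F (rep i)
      else F (rep i) + F (rep i).across := by
  classical
  rw [← Finset.sum_filter]
  have : univ.filter (fun s : Slot m => s.typeIdx = i) = {rep i, (rep i).across} := by
    ext s
    simp [Slot.typeIdx_eq_iff]
  rw [this]
  split_ifs with h
  · rw [h]; simp
  · rw [Finset.sum_pair (Ne.symm h)]

theorem U_eq_sum {R : Type*} [CommRing R] (i : WeightIndex m) :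
    (BorderedAlgebra.U i : BorderedAlgebra R m) =
      ∑ s : Slot m, if s.typeIdx = i then vec R (s, s.period) else 0 := by
  have h3 := hm.out
  have hi := mem_Icc.1 i.2
  rw [sum_typeIdx]
  unfold BorderedAlgebra.U
  split_ifs with h1 h2 h2 h4 h4
  · exfalso
    revert h2
    unfold rep across Slot.next
    rw [dif_neg (by omega)]
    simp only
    rw [dif_neg (by omega)]
    simp [Slot.flip]
  · have e1 : rep i = Slot.ofArrow (.R i h1) := by
      unfold rep Slot.ofArrow
      rw [dif_neg (by omega)]
    have e2 : (rep i).across = Slot.ofArrow (.L i h1) := by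
      rw [e1]
      unfold Slot.ofArrow across Slot.next
      simp only
      rw [dif_neg (by omega)]
      simp only [Slot.flip]
      congr 2; omega
    have hper : (rep i).period = 2 := by
      rcases (rep i).period_cases with h | h
      · exact absurd h.2 h2
      · exact h.1
    rw [period_across, hper, basis_ofArrow, basis_ofArrow, ← e1, ← e2,
      vec_mul_vec _ _ one_pos one_pos, vec_mul_vec _ _ one_pos one_pos]
    simp only [iterate_one, across_across, if_true]
  · have hper : (rep i).period = 1 := if_pos h4
    rw [hper, basis_ofArrow]
    congr 2
    unfold rep
    rw [dif_pos h2]; rfl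
  · exfalso
    apply h4
    unfold rep
    rw [dif_pos h2]
    unfold across Slot.next
    simp [Slot.flip, Vertex.first]
  · have hper : (rep i).period = 1 := if_pos h4
    rw [hper, basis_ofArrow]
    congr 2
    unfold rep
    rw [dif_neg h2]
    change Slot.inc (Vertex.last m) = Slot.inc _
    congr 2; exact Subtype.ext (show m - 1 = (i : ℕ) - 1 by omega)
  · exfalso
    apply h4
    unfold rep
    rw [dif_neg h2]
    unfold across Slot.next
    simp only
    rw [dif_pos (by omega)]; rfl

theorem weightPart_curvature (w : Weight m) :
    weightPart w (curvature (fun s : Slot m => (MvPowerSeries.X s.typeIdx : WeightSeries m)) []) =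
      ∑ i : WeightIndex m, if w = Finsupp.single i 1 then BorderedAlgebra.U i else 0 := by
  classical
  rw [curvature, map_sum]
  have e : ∀ i : WeightIndex m, (if w = Finsupp.single i 1 then
      (BorderedAlgebra.U i : TAlgebra m) else 0) = ∑ s : Slot m, if s.typeIdx = i then
        (if w = Finsupp.single i 1 then vec (ZMod 2)[X] (s, s.period) else 0) else 0 := by
    intro i
    split_ifs
    · exact U_eq_sum i
    · simp
  simp only [e]
  rw [Finset.sum_comm]
  refine sum_congr rfl fun s _ => ?_
  rw [Finset.sum_ite_eq, if_pos (mem_univ _), vec, weightPart_smul_basis, MvPowerSeries.coeff_X]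
  split_ifs
  · exact one_smul _ _
  · exact zero_smul _ _

end Curvature

section Graphs

theorem centered_arcs {a : Arc m} {L : List (Arc m)} (hL : ∀ b ∈ a :: L, 0 < b.2)
    (w : Weight m) : centered w (arcs (a :: L)) =
      MvPowerSeries.coeff w (tilingSeries (a :: L)) • vec (ZMod 2)[X] (a.1, 0) := by
  classical
  have e : ∀ d : ℕ, (∑ k : Vertex m, (DecoratedGraph.classes w (arcs (a :: L)) d k).ncard •
      (single (QPath.const k) (Polynomial.X ^ d) : TAlgebra m)) =
      (Polynomial.monomial d (tilingNumber d w (a :: L) : ZMod 2)) • vec (ZMod 2)[X] (a.1, 0) := by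
    intro d
    rw [Finset.sum_eq_single a.1.label]
    · rw [← tilingNumber_eq_ncard hL, single_eq, ← Nat.cast_smul_eq_nsmul (ZMod 2)[X], smul_smul,
        ← Polynomial.C_mul_X_pow_eq_monomial, Polynomial.C_eq_natCast]
      rfl
    · intro k _ hk
      have : DecoratedGraph.classes w (arcs (a :: L)) d k = ∅ :=
        DecoratedGraph.classes_eq_empty hL w d k hk
      rw [this, Set.ncard_empty, zero_smul]
    · simp
  unfold centered
  simp only [e]
  rw [finsum_eq_sum_of_support_subset (s := range ((a :: L).length + 2 * ∑ i, w i + 1)), ← sum_smul]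
  · rfl
  · intro d hd
    rw [Function.mem_support] at hd
    rw [Finset.coe_range, Set.mem_Iio]
    refine lt_of_tilingNumber_ne fun h => hd ?_
    rw [h, Nat.cast_zero, map_zero, zero_smul]

theorem weightPart_graphOp (w : Weight m) {ps : List (QPath m)} (hps : ps ≠ []) :
    weightPart w (graphOp tilingSeries ps) = graphOperation w ps := by
  classical
  by_cases hp : ∀ p ∈ ps, p.IsPure
  · obtain ⟨L, hL, rfl⟩ := exists_arcs hp
    rw [graphOp_arcs _ hL, graphOperation, if_pos hp, graphTerm, map_add, map_add]
    cases L with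
    | nil => exact absurd rfl hps
    | cons a L =>
    congr 1
    · congr 1
      · rw [centered_arcs hL, centerTerm]; exact weightPart_smul_basis _ _ _
      · change _ = ∑ k ∈ Ioo 0 (QPath.arc a.1 a.2).length, basis ((QPath.arc a.1 a.2).take k) *
          centered w ((QPath.arc a.1 a.2).drop k :: arcs L)
        rw [leftTerm, parts, map_sum, QPath.length_arc]
        refine sum_congr rfl fun k hk => ?_
        have hk' := mem_Ioo.1 hk
        have e : QPath.arc (across^[k] a.1) (a.2 - k) :: arcs L =
          arcs ((across^[k] a.1, a.2 - k) :: L) := rfl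
        rw [QPath.take_arc _ hk'.2.le, QPath.drop_arc _ hk'.2.le, e, centered_arcs, mul_smul_comm',
          vec, weightPart_smul_basis]
        · congr 1
          have := vec_mul_vec_zero (R := (ZMod 2)[X]) (a.1, k) (across^[k] a.1)
          rw [if_pos rfl] at this; exact this.symm
        · intro b hb
          rcases mem_cons.1 hb with rfl | hb
          · exact Nat.sub_pos_of_lt hk'.2
          · exact hL b (mem_cons_of_mem _ hb)
    · obtain ⟨l, b, hl⟩ : ∃ l b, a :: L = l ++ [b] :=
        ⟨_, _, (List.dropLast_append_getLast (List.cons_ne_nil a L)).symm⟩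
      rw [hl] at hL ⊢
      have hb := hL b (by simp)
      rw [rightTerm_snoc, arcs_append, rightExtended]
      change _ = (match (arcs l ++ [QPath.arc b.1 b.2]).getLast? with
        | none => (0 : TAlgebra m)
        | some p => ∑ k ∈ Ioo 0 p.length,
            centered w ((arcs l ++ [QPath.arc b.1 b.2]).dropLast ++ [p.take k]) * basis (p.drop k))
      rw [List.getLast?_concat, List.dropLast_concat]
      simp only
      rw [parts, map_sum, QPath.length_arc]
      refine sum_congr rfl fun k hk => ?_
      have hk' := mem_Ioo.1 hk
      have e : arcs l ++ [QPath.arc b.1 k] = arcs (l ++ [(b.1, k)]) := by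
        rw [arcs_append]; rfl
      rw [QPath.take_arc _ hk'.2.le, QPath.drop_arc _ hk'.2.le, e, vec, weightPart_smul_basis]
      have hL' : ∀ c ∈ l ++ [(b.1, k)], 0 < c.2 := by
        intro c hc
        rcases mem_append.1 hc with hc | hc
        · exact hL c (mem_append_left _ hc)
        · obtain rfl := List.mem_singleton.1 hc; exact hk'.1
      cases l with
      | nil =>
        rw [nil_append] at hL' ⊢
        rw [centered_arcs hL', isTilingCount_tilingSeries.singleton, map_zero, zero_smul,
          zero_smul, zero_mul]
      | cons c l =>
        rw [cons_append] at hL' ⊢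
        rw [centered_arcs hL', smul_mul_assoc']
        by_cases hC : tilingSeries (c :: (l ++ [(b.1, k)])) = 0
        · rw [hC, map_zero, zero_smul, zero_smul]
        · have ht := isTilingCount_tilingSeries.turn_last l c (b.1, k) hC
          have := vec_zero_mul_vec (R := (ZMod 2)[X]) (across^[k] b.1, b.2 - k) c.1
          rw [if_pos (by rw [ht, label_flip])] at this
          congr 1; exact this.symm
  · rw [graphOp, if_neg hp, graphOperation, if_neg hp, map_zero]

/-- The operations of the theorem are the coefficients of the generating series. -/
theorem weightPart_totalOp (w : Weight m) (ps : List (QPath m)) :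
    weightPart w (totalOp (fun s : Slot m => (MvPowerSeries.X s.typeIdx : WeightSeries m))
      tilingSeries ps) = pathOperation w ps := by
  classical
  rw [totalOp, map_add, map_add]
  rcases ps with _ | ⟨p, _ | ⟨q, _ | ⟨r, ps⟩⟩⟩
  · rw [graphOp_nil, weightPart_curvature, map_zero, add_zero]
    change weightPart w 0 + _ = _
    rw [map_zero, zero_add]; rfl
  · rw [weightPart_graphOp w (by simp)]
    change weightPart w 0 + weightPart w 0 + _ = _
    rw [map_zero, zero_add, zero_add]; rfl
  · rw [weightPart_graphOp w (by simp)]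
    change weightPart w (basis p * basis q) + weightPart w 0 + _ =
      if w = 0 then basis p * basis q else graphOperation w [p, q]
    rw [weightPart_basis_mul_basis, map_zero, add_zero]
    split_ifs with hw
    · subst hw
      have key : ∀ a b : Arc m, MvPowerSeries.coeff 0 (tilingSeries [a, b]) = 0 := by
        intro a b
        ext d
        rw [coeff_tilingSeries]
        have : tilingNumber d 0 [a, b] = 0 := by
          by_contra h
          have h1 := mul_add_two_of_tilingNumber_ne h
          have h3 := hm.out
          simp only [length_cons, List.length_nil, Finsupp.coe_zero, Pi.zero_apply,
            Finset.sum_const_zero, mul_zero, add_zero] at h1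
          have hd : d = 0 := by
            by_contra hd
            have : 0 < (2 * m - 4) * d := Nat.mul_pos (by omega) (Nat.pos_of_ne_zero hd)
            omega
          subst hd
          obtain ⟨-, -, ε, y, hr⟩ := exists_of_tilingNumber_ne h; simpa using hr.base
        rw [this]; simp
      have : graphOperation 0 [p, q] = 0 := by
        rw [← weightPart_graphOp 0 (by simp)]
        by_cases hp : ∀ r ∈ [p, q], r.IsPure
        · rw [graphOp, if_pos hp]
          simp only [map_cons, List.map_nil]
          have e1 : ∀ (a b : Arc m) (c : Arc m),
              weightPart 0 (tilingSeries [a, b] • vec (WeightSeries m) c) = 0 := by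
            intro a b c
            rw [vec, weightPart_smul_basis, key, zero_smul]
          have e2 := rightTerm_snoc (R := WeightSeries m) tilingSeries [(p.slot, p.length)]
            (q.slot, q.length)
          simp only [cons_append, nil_append] at e2
          rw [graphTerm, centerTerm, leftTerm, e2, map_add, map_add, map_parts, map_parts]
          simp only [e1, parts_zero, add_zero]
        · rw [graphOp, if_neg hp, map_zero]
      rw [this, add_zero]
    · exact zero_add _
  · rw [weightPart_graphOp w (by simp)]
    change weightPart w 0 + weightPart w 0 + _ = _
    rw [map_zero, zero_add, zero_add]; rfl

/-- The structure relation for the operations on paths. -/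
theorem pathOperation_relation (w : Weight m) (ps : List (QPath m)) :
    gaps (fun X W => gaps (fun Y Z => ∑ u ∈ antidiagonal w,
      plug (pathOperation u.1) X Z (pathOperation u.2 Y)) W) ps = 0 := by
  have h := congrArg (weightPart w) (isTilingCount_tilingSeries.relation ps)
  rw [map_zero, map_gaps] at h
  rw [← h]
  refine gaps_congr fun X W _ => ?_
  rw [map_gaps]
  refine gaps_congr fun Y Z _ => ?_
  rw [weightPart_plug]
  simp only [weightPart_totalOp]

end Graphs

/-! ### The axioms of a weighted A-infinity algebra -/

section Linear

theorem isLinearMap_gaps {R A α M : Type*} [CommRing R] [AddCommGroup A] [Module R A]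
    [AddCommGroup M] [Module R M] (f : A → List α → List α → M) (L : List α)
    (h : ∀ X Y, L = X ++ Y → IsLinearMap R fun x => f x X Y) :
    IsLinearMap R fun x => gaps (f x) L := by
  induction L generalizing f with
  | nil => exact h [] [] rfl
  | cons a L ih =>
    have h1 := h [] (a :: L) rfl
    have h2 := ih (fun x X => f x (a :: X)) fun X Y e => h (a :: X) Y (by rw [e]; rfl)
    exact ⟨fun x y => by rw [gaps, h1.map_add, h2.map_add, add_add_add_comm]; rfl,
      fun c x => by rw [gaps, h1.map_smul, h2.map_smul, ← smul_add]; rfl⟩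

theorem isLinearMap_sum {R A M ι : Type*} [CommRing R] [AddCommGroup A] [Module R A]
    [AddCommGroup M] [Module R M] (s : Finset ι) (f : ι → A → M)
    (h : ∀ i ∈ s, IsLinearMap R (f i)) : IsLinearMap R fun x => ∑ i ∈ s, f i x :=
  ⟨fun x y => by
    rw [← sum_add_distrib]
    exact sum_congr rfl fun i hi => (h i hi).map_add x y, fun c x => by
    rw [Finset.smul_sum]
    exact sum_congr rfl fun i hi => (h i hi).map_smul c x⟩

theorem isLinearMap_add {R A M : Type*} [CommRing R] [AddCommGroup A] [Module R A]
    [AddCommGroup M] [Module R M] {f g : A → M} (hf : IsLinearMap R f) (hg : IsLinearMap R g) :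
    IsLinearMap R fun x => f x + g x :=
  ⟨fun x y => by rw [hf.map_add, hg.map_add, add_add_add_comm],
    fun c x => by rw [hf.map_smul, hg.map_smul, smul_add]⟩

/-- A function on sequences that is linear in each entry. -/
def IsMultilinear (F : List (TAlgebra m) → TAlgebra m) : Prop :=
  ∀ l₁ l₂, IsLinearMap (ZMod 2)[X] fun x => F (l₁ ++ x :: l₂)

/-- A multilinear function is determined by its values at sequences of paths. -/
theorem IsMultilinear.eq_zero {F : List (TAlgebra m) → TAlgebra m} (hF : IsMultilinear F)
    (h : ∀ ps : List (QPath m), F (ps.map basis) = 0) (l : List (TAlgebra m)) : F l = 0 := by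
  have key : ∀ (l : List (TAlgebra m)) (ps : List (QPath m)), F (ps.map basis ++ l) = 0 := by
    intro l
    induction l with
    | nil => exact fun ps => by rw [List.append_nil, h]
    | cons a l ih =>
      intro ps
      have : (hF (ps.map basis) l).mk' _ = 0 := linearMap_ext fun p => by
        have := ih (ps ++ [p])
        rwa [map_append, append_assoc] at this
      exact congrArg (fun φ => φ a) this
  exact key l []

theorem multilinearExtension_basis_cons (f : List (QPath m) → TAlgebra m) (p : QPath m)
    (l : List (TAlgebra m)) : multilinearExtension f (basis p :: l) =
      multilinearExtension (fun ps => f (p :: ps)) l := by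
  change (Finsupp.single p (1 : (ZMod 2)[X])).sum (fun p r =>
    r • multilinearExtension (fun ps => f (p :: ps)) l) = _
  rw [Finsupp.sum_single_index (h := fun p r => r • multilinearExtension (fun ps => f (p :: ps)) l)
    (zero_smul _ _), one_smul]

theorem multilinearExtension_basis (f : List (QPath m) → TAlgebra m) (ps : List (QPath m)) :
    multilinearExtension f (ps.map basis) = f ps := by
  induction ps generalizing f with
  | nil => rfl
  | cons p ps ih => rw [map_cons, multilinearExtension_basis_cons, ih]

theorem isMultilinear_multilinearExtension (f : List (QPath m) → TAlgebra m) :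
    IsMultilinear (multilinearExtension f) := by
  intro l₁ l₂
  induction l₁ generalizing f with
  | nil =>
    exact (Finsupp.linearCombination (ZMod 2)[X] fun p =>
      multilinearExtension (fun ps => f (p :: ps)) l₂ :
        (QPath m →₀ (ZMod 2)[X]) →ₗ[(ZMod 2)[X]] TAlgebra m).isLinear
  | cons a l₁ ih =>
    refine isLinearMap_sum a.coeffs.support _ fun p _ => ?_
    have := ih fun ps => f (p :: ps)
    exact ⟨fun x y => (congrArg (a.coeffs p • ·) (this.map_add x y)).trans (smul_add _ _ _),
      fun c x => (congrArg (a.coeffs p • ·) (this.map_smul c x)).trans (smul_comm _ _ _)⟩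

theorem isMultilinear_operation (w : Weight m) : IsMultilinear (operation w) :=
  isMultilinear_multilinearExtension _

theorem operation_basis (w : Weight m) (ps : List (QPath m)) :
    operation w (ps.map basis) = pathOperation w ps := multilinearExtension_basis _ ps

theorem operation_eq_plug (w : Weight m) (X Z : List (QPath m)) (v : TAlgebra m) :
    operation w (X.map basis ++ v :: Z.map basis) = plug (pathOperation w) X Z v := by
  have : (isMultilinear_operation w (X.map basis) (Z.map basis)).mk' _ =
      plug (pathOperation w) X Z := linearMap_ext fun p => by
    rw [plug_basis, ← operation_basis, map_append, map_cons]; rfl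
  exact congrArg (fun φ => φ v) this

theorem operation_relation (w : Weight m) (l : List (TAlgebra m)) :
    gaps (fun X W => gaps (fun Y Z => ∑ u ∈ antidiagonal w,
      operation u.1 (X ++ operation u.2 Y :: Z)) W) l = 0 := by
  refine IsMultilinear.eq_zero (F := fun l => gaps (fun X W => gaps (fun Y Z =>
    ∑ u ∈ antidiagonal w, operation u.1 (X ++ operation u.2 Y :: Z)) W) l) ?_ ?_ l
  · intro l₁ l₂
    simp only [gaps_append_cons]
    refine isLinearMap_add (isLinearMap_gaps _ _ fun X W _ => isLinearMap_add
      (isLinearMap_gaps _ _ fun Y Z _ => isLinearMap_sum _ _ fun u _ => ?_)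
      (isLinearMap_gaps _ _ fun Y Z _ => isLinearMap_sum _ _ fun u _ => ?_))
      (isLinearMap_gaps _ _ fun X W _ => isLinearMap_gaps _ _ fun Y Z _ =>
        isLinearMap_sum _ _ fun u _ => ?_)
    · have := isMultilinear_operation u.1 (X ++ operation u.2 Y :: Z) l₂
      simp only [append_assoc, cons_append] at this; exact this
    · have h1 := isMultilinear_operation u.1 X Z
      have h2 := isMultilinear_operation u.2 W Y
      exact ⟨fun x y => by rw [h2.map_add, h1.map_add], fun c x => by rw [h2.map_smul, h1.map_smul]⟩
    · have := isMultilinear_operation u.1 l₁ (X ++ operation u.2 Y :: Z)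
      simp only [append_assoc, cons_append]; exact this
  · intro ps
    rw [gaps_map, ← pathOperation_relation w ps]
    refine gaps_congr fun X W _ => ?_
    rw [gaps_map]
    refine gaps_congr fun Y Z _ => sum_congr rfl fun u _ => ?_
    rw [operation_eq_plug, operation_basis]

end Linear

section Bimodule

theorem groundHom_apply (κ : IdempotentRing m) : groundHom m κ =
    ∑ x : Vertex m, (Polynomial.C (κ x) : (ZMod 2)[X]) • (basis (QPath.const x) : TAlgebra m) := rfl

/-- Left multiplication by an idempotent, as a linear map over `(ℤ/2)[t]`. -/
def leftAction (κ : IdempotentRing m) : TAlgebra m →ₗ[(ZMod 2)[X]] TAlgebra m :=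
  LinearMap.mulLeft _ (groundHom m κ)

/-- Right multiplication by an idempotent, as a linear map over `(ℤ/2)[t]`. -/
def rightAction (κ : IdempotentRing m) : TAlgebra m →ₗ[(ZMod 2)[X]] TAlgebra m :=
  LinearMap.mulRight _ (groundHom m κ)

theorem leftAction_apply (κ : IdempotentRing m) (a : TAlgebra m) : leftAction κ a = κ • a := rfl

theorem rightAction_apply (κ : IdempotentRing m) (a : TAlgebra m) :
    rightAction κ a = MulOpposite.op κ • a := rfl

theorem leftAction_of_const_mul (κ : IdempotentRing m) (v : TAlgebra m) (y : Vertex m)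
    (h : ∀ x, basis (QPath.const x) * v = if x = y then v else 0) :
    leftAction κ v = (Polynomial.C (κ y) : (ZMod 2)[X]) • v := by
  change groundHom m κ * v = _
  rw [groundHom_apply, Finset.sum_mul]
  simp only [smul_mul_assoc', h, smul_ite, smul_zero, Finset.sum_ite_eq', mem_univ, if_true]

theorem rightAction_of_mul_const (κ : IdempotentRing m) (v : TAlgebra m) (y : Vertex m)
    (h : ∀ x, v * basis (QPath.const x) = if x = y then v else 0) :
    rightAction κ v = (Polynomial.C (κ y) : (ZMod 2)[X]) • v := by
  change v * groundHom m κ = _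
  rw [groundHom_apply, mul_sum]
  simp only [mul_smul_comm', h, smul_ite, smul_zero, Finset.sum_ite_eq', mem_univ, if_true]

theorem const_mul_basis {R : Type*} [CommRing R] (x : Vertex m) (p : QPath m) :
    (basis (QPath.const x) * basis p : BorderedAlgebra R m) = if x = p.start then basis p else 0 := by
  rw [basis_mul_basis, QPath.const_comp]
  split_ifs <;> rfl

theorem basis_mul_const {R : Type*} [CommRing R] (x : Vertex m) (p : QPath m) :
    (basis p * basis (QPath.const x) : BorderedAlgebra R m) =
      if x = p.finish then basis p else 0 := by
  rw [basis_mul_basis, QPath.comp_const]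
  split_ifs <;> rfl

theorem leftAction_basis (κ : IdempotentRing m) (p : QPath m) :
    leftAction κ (basis p) = (Polynomial.C (κ p.start) : (ZMod 2)[X]) • basis p :=
  leftAction_of_const_mul κ _ _ fun x => const_mul_basis x p

theorem rightAction_basis (κ : IdempotentRing m) (p : QPath m) :
    rightAction κ (basis p) = (Polynomial.C (κ p.finish) : (ZMod 2)[X]) • basis p :=
  rightAction_of_mul_const κ _ _ fun x => basis_mul_const x p

theorem const_mul_pathOperation (w : Weight m) (x : Vertex m) (p : QPath m)
    (ps : List (QPath m)) : basis (QPath.const x) * pathOperation w (p :: ps) =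
      if x = p.start then pathOperation w (p :: ps) else 0 := by
  have h := isTilingCount_tilingSeries.const_mul_graphOp x p ps
  have h' : basis (QPath.const x) * productTerm (WeightSeries m) (p :: ps) =
      if x = p.start then productTerm (WeightSeries m) (p :: ps) else 0 := by
    rcases ps with _ | ⟨q, _ | ⟨r, ps⟩⟩
    · exact (mul_zero _).trans (ite_self _).symm
    · change _ * (basis p * basis q) = if _ then basis p * basis q else 0
      rw [← mul_assoc, const_mul_basis, ite_mul, zero_mul]
    · exact (mul_zero _).trans (ite_self _).symm
  rw [← weightPart_totalOp, ← weightPart_basis_mul, totalOp, curvature_cons, add_zero, mul_add, h,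
    h']
  split_ifs
  · rfl
  · rw [add_zero, map_zero]

theorem pathOperation_mul_const (w : Weight m) (x : Vertex m) (p : QPath m)
    (ps : List (QPath m)) : pathOperation w (ps ++ [p]) * basis (QPath.const x) =
      if x = p.finish then pathOperation w (ps ++ [p]) else 0 := by
  have h := isTilingCount_tilingSeries.graphOp_mul_const x p ps
  have h' : productTerm (WeightSeries m) (ps ++ [p]) * basis (QPath.const x) =
      if x = p.finish then productTerm (WeightSeries m) (ps ++ [p]) else 0 := by
    by_cases hps : ps.length = 1
    · obtain ⟨q, rfl⟩ := List.length_eq_one_iff.1 hps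
      change (basis q * basis p) * _ = if _ then basis q * basis p else 0
      rw [mul_assoc, basis_mul_const, mul_ite, mul_zero]
    · rw [productTerm_eq_zero (by simpa using hps), zero_mul, ite_self]
  have h'' : curvature (fun s : Slot m => (MvPowerSeries.X s.typeIdx : WeightSeries m))
      (ps ++ [p]) = 0 := by cases ps <;> rfl
  rw [← weightPart_totalOp, ← weightPart_mul_basis, totalOp, h'', add_zero, add_mul, h, h']
  split_ifs
  · rfl
  · rw [add_zero, map_zero]

theorem pathOperation_eq_zero_of_finish_ne (w : Weight m) (X Z : List (QPath m))
    (p q : QPath m) (hpq : p.finish ≠ q.start) : pathOperation w (X ++ p :: q :: Z) = 0 := by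
  have h := isTilingCount_tilingSeries.graphOp_eq_zero_of_finish_ne X Z p q hpq
  have h' : productTerm (WeightSeries m) (X ++ p :: q :: Z) = 0 := by
    by_cases hl : (X ++ p :: q :: Z).length = 2
    · simp only [length_append, length_cons] at hl
      obtain rfl := List.length_eq_zero_iff.1 (show X.length = 0 by omega)
      obtain rfl := List.length_eq_zero_iff.1 (show Z.length = 0 by omega)
      change basis p * basis q = 0
      rw [basis_mul_basis]
      unfold QPath.comp
      rw [dif_neg fun h => hpq h.1]; rfl
    · exact productTerm_eq_zero hl
  have h'' : curvature (fun s : Slot m => (MvPowerSeries.X s.typeIdx : WeightSeries m))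
      (X ++ p :: q :: Z) = 0 := by cases X <;> rfl
  rw [← weightPart_totalOp, totalOp, h, h', h'', add_zero, add_zero, map_zero]

theorem map_multilinearExtension (φ : TAlgebra m →ₗ[(ZMod 2)[X]] TAlgebra m)
    (f : List (QPath m) → TAlgebra m) (l : List (TAlgebra m)) :
    φ (multilinearExtension f l) = multilinearExtension (fun ps => φ (f ps)) l := by
  induction l generalizing f with
  | nil => rfl
  | cons a l ih =>
    rw [multilinearExtension, multilinearExtension, map_finsuppSum]
    exact Finsupp.sum_congr fun p _ => by rw [map_smul, ih]

theorem isLinearMap_ext {f g : TAlgebra m → TAlgebra m} (hf : IsLinearMap (ZMod 2)[X] f)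
    (hg : IsLinearMap (ZMod 2)[X] g) (h : ∀ p, f (basis p) = g (basis p)) (x : TAlgebra m) :
    f x = g x :=
  congrArg (fun φ => φ x) (linearMap_ext h : hf.mk' f = hg.mk' g)

theorem isLinearMap_comp {f g : TAlgebra m → TAlgebra m} (hf : IsLinearMap (ZMod 2)[X] f)
    (hg : IsLinearMap (ZMod 2)[X] g) : IsLinearMap (ZMod 2)[X] fun x => f (g x) :=
  ⟨fun x y => by rw [hg.map_add, hf.map_add], fun c x => by rw [hg.map_smul, hf.map_smul]⟩

theorem isLinearMap_multilinearExtension_cons (f : List (QPath m) → TAlgebra m)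
    (l : List (TAlgebra m)) : IsLinearMap (ZMod 2)[X] fun x => multilinearExtension f (x :: l) :=
  isMultilinear_multilinearExtension f [] l

section Endomorphism

variable {φ ψ : TAlgebra m →ₗ[(ZMod 2)[X]] TAlgebra m} {c d : QPath m → (ZMod 2)[X]}
  (hφ : ∀ p, φ (basis p) = c p • basis p) (hψ : ∀ p, ψ (basis p) = d p • basis p)

include hφ

theorem multilinearExtension_apply_basis_cons (f : List (QPath m) → TAlgebra m) (p : QPath m)
    (l : List (TAlgebra m)) : multilinearExtension f (φ (basis p) :: l) =
      multilinearExtension (fun ps => c p • f (p :: ps)) l := by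
  rw [hφ, (isLinearMap_multilinearExtension_cons f l).map_smul, multilinearExtension_basis_cons]
  exact map_multilinearExtension (LinearMap.lsmul _ _ (c p)) _ l

theorem multilinearExtension_apply_left {f : List (QPath m) → TAlgebra m}
    (h : ∀ p ps, c p • f (p :: ps) = φ (f (p :: ps))) (l : List (TAlgebra m)) (x : TAlgebra m) :
    multilinearExtension f (φ x :: l) = φ (multilinearExtension f (x :: l)) := by
  have h1 := isLinearMap_multilinearExtension_cons f l
  refine isLinearMap_ext (isLinearMap_comp h1 φ.isLinear) (isLinearMap_comp φ.isLinear h1)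
    (fun p => ?_) x
  rw [multilinearExtension_apply_basis_cons hφ, multilinearExtension_basis_cons,
    map_multilinearExtension]
  simp only [h]

theorem multilinearExtension_apply_right {f : List (QPath m) → TAlgebra m}
    (h : ∀ ps p, c p • f (ps ++ [p]) = φ (f (ps ++ [p]))) (l : List (TAlgebra m))
    (x : TAlgebra m) :
    multilinearExtension f (l ++ [φ x]) = φ (multilinearExtension f (l ++ [x])) := by
  induction l generalizing f with
  | nil =>
    have h1 := isLinearMap_multilinearExtension_cons f []
    rw [nil_append, nil_append]
    refine isLinearMap_ext (f := fun x => multilinearExtension f [φ x])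
      (g := fun x => φ (multilinearExtension f [x])) (isLinearMap_comp h1 φ.isLinear)
      (isLinearMap_comp φ.isLinear h1) (fun p => ?_) x
    rw [multilinearExtension_apply_basis_cons hφ, multilinearExtension_basis_cons]
    exact h [] p
  | cons a l ih =>
    rw [cons_append, cons_append, multilinearExtension, multilinearExtension, map_finsuppSum]
    exact Finsupp.sum_congr fun p _ => by
      rw [ih (f := fun ps => f (p :: ps)) fun ps q => h (p :: ps) q, map_smul]

include hψ

theorem multilinearExtension_balanced {f : List (QPath m) → TAlgebra m}
    (h : ∀ X p q Z, c p • f (X ++ p :: q :: Z) = d q • f (X ++ p :: q :: Z))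
    (l₁ l₂ : List (TAlgebra m)) (x y : TAlgebra m) :
    multilinearExtension f (l₁ ++ φ x :: y :: l₂) =
      multilinearExtension f (l₁ ++ x :: ψ y :: l₂) := by
  induction l₁ generalizing f with
  | nil =>
    rw [nil_append, nil_append]
    refine isLinearMap_ext (f := fun x => multilinearExtension f (φ x :: y :: l₂))
      (g := fun x => multilinearExtension f (x :: ψ y :: l₂)) (isLinearMap_comp
      (isLinearMap_multilinearExtension_cons f (y :: l₂)) φ.isLinear)
      (isLinearMap_multilinearExtension_cons f (ψ y :: l₂)) (fun p => ?_) x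
    rw [multilinearExtension_apply_basis_cons hφ, multilinearExtension_basis_cons]
    refine isLinearMap_ext (g := fun y => multilinearExtension (fun ps => f (p :: ps)) (ψ y :: l₂))
      (isLinearMap_multilinearExtension_cons _ l₂) (isLinearMap_comp
      (isLinearMap_multilinearExtension_cons _ l₂) ψ.isLinear) (fun q => ?_) y
    rw [multilinearExtension_apply_basis_cons hψ, multilinearExtension_basis_cons]
    exact congrArg (multilinearExtension · l₂) (funext fun ps => h [] p q ps)
  | cons a l ih =>
    rw [cons_append, cons_append, multilinearExtension, multilinearExtension]
    exact Finsupp.sum_congr fun p _ => by rw [ih (f := fun ps => f (p :: ps)) fun X => h (p :: X)]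

end Endomorphism

theorem operation_smul_left (w : Weight m) (l : List (TAlgebra m))
    (κ : IdempotentRing m) (x : TAlgebra m) :
    operation w ((κ • x) :: l) = κ • operation w (x :: l) := by
  rw [← leftAction_apply, ← leftAction_apply]
  exact multilinearExtension_apply_left (φ := leftAction κ) (leftAction_basis κ) (fun p ps =>
    (leftAction_of_const_mul κ _ _ fun x => const_mul_pathOperation w x p ps).symm) l x

theorem operation_op_smul_right (w : Weight m) (l : List (TAlgebra m))
    (κ : IdempotentRing m) (x : TAlgebra m) :
    operation w (l ++ [MulOpposite.op κ • x]) = MulOpposite.op κ • operation w (l ++ [x]) := by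
  rw [← rightAction_apply, ← rightAction_apply]
  exact multilinearExtension_apply_right (φ := rightAction κ) (rightAction_basis κ) (fun ps p =>
    (rightAction_of_mul_const κ _ _ fun x => pathOperation_mul_const w x p ps).symm) l x

theorem operation_balanced (w : Weight m) (l₁ l₂ : List (TAlgebra m))
    (κ : IdempotentRing m) (x y : TAlgebra m) :
    operation w (l₁ ++ (MulOpposite.op κ • x) :: y :: l₂) =
      operation w (l₁ ++ x :: (κ • y) :: l₂) := by
  rw [← rightAction_apply, ← leftAction_apply]
  refine multilinearExtension_balanced (φ := rightAction κ) (ψ := leftAction κ) (rightAction_basis κ)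
    (leftAction_basis κ) (fun X p q Z => ?_) l₁ l₂ x y
  by_cases hpq : p.finish = q.start
  · rw [hpq]
  · rw [pathOperation_eq_zero_of_finish_ne w X Z p q hpq, smul_zero, smul_zero]

theorem smul_operation_nil (w : Weight m) (κ : IdempotentRing m) :
    κ • operation w [] = MulOpposite.op κ • operation w [] := by
  have e : operation w [] = weightPart w
      (curvature (fun s : Slot m => (MvPowerSeries.X s.typeIdx : WeightSeries m)) []) :=
    (weightPart_curvature w).symm
  change groundHom m κ * _ = _ * groundHom m κ
  rw [groundHom_apply, Finset.sum_mul, mul_sum]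
  refine sum_congr rfl fun x _ => ?_
  rw [smul_mul_assoc', mul_smul_comm', e, ← weightPart_basis_mul, ← weightPart_mul_basis,
    curvature_comm _ fun s => by rw [Slot.typeIdx_across]]

end Bimodule

/-! ### The grading and the unit -/

section Grading

theorem coeffs_smul (r : (ZMod 2)[X]) (v : TAlgebra m) (p : QPath m) :
    (r • v).coeffs p = r * v.coeffs p := rfl

theorem coeffs_add (u v : TAlgebra m) (p : QPath m) :
    (u + v).coeffs p = u.coeffs p + v.coeffs p := rfl

open Classical in
theorem coeffs_basis (p q : QPath m) : (basis p : TAlgebra m).coeffs q = if p = q then 1 else 0 :=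
  Finsupp.single_apply

theorem smul_mem_grading {g h : ℤ} {r : (ZMod 2)[X]}
    (hr : ∀ k, r.coeff k ≠ 0 → (k : ℤ) * (2 * m - 4) = h) {v : TAlgebra m} (hv : v ∈ grading m g) :
    r • v ∈ grading m (h + g) := by
  intro p k hk
  rw [coeffs_smul, Polynomial.coeff_mul] at hk
  obtain ⟨x, hx, hne⟩ := Finset.exists_ne_zero_of_sum_ne_zero hk
  have e := mem_antidiagonal.1 hx
  have h1 := hr x.1 (left_ne_zero_of_mul hne)
  have h2 := hv p x.2 (right_ne_zero_of_mul hne)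
  rw [← e, Nat.cast_add, add_mul, h1, h2]

theorem basis_mem_grading (p : QPath m) : basis p ∈ grading m 0 := by
  intro q k hk
  rw [coeffs_basis] at hk
  split_ifs at hk
  · rw [Polynomial.coeff_one] at hk
    split_ifs at hk with h
    · rw [h, Nat.cast_zero, zero_mul]
    · exact absurd rfl hk
  · exact absurd (Polynomial.coeff_zero k) hk

theorem basis_mul_basis_mem_grading (p q : QPath m) : basis p * basis q ∈ grading m 0 := by
  rw [basis_mul_basis]
  cases p.comp q with
  | none => exact zero_mem _
  | some s => exact basis_mem_grading s

theorem map_mem_grading {φ : TAlgebra m →ₗ[(ZMod 2)[X]] TAlgebra m} {e : QPath m → ZMod 2}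
    (hφ : ∀ p, φ (basis p) = Polynomial.C (e p) • basis p) {g : ℤ} {v : TAlgebra m}
    (hv : v ∈ grading m g) : φ v ∈ grading m g := by
  have key : ∀ p, (φ v).coeffs p = Polynomial.C (e p) * v.coeffs p := by
    intro p
    classical
    clear hv
    induction v using algebra_induction with
    | h0 => rw [map_zero]; exact (mul_zero _).symm
    | hadd u v hu hv => rw [map_add, coeffs_add, coeffs_add, hu, hv, mul_add]
    | hb r q =>
      rw [map_smul, hφ, coeffs_smul, coeffs_smul, coeffs_smul, coeffs_basis]
      split_ifs with h
      · rw [h, mul_left_comm]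
      · simp
  intro p k hk
  rw [key, Polynomial.coeff_C_mul] at hk
  exact hv p k (right_ne_zero_of_mul hk)

theorem isInternal_grading : DirectSum.IsInternal (grading m) := by
  have h3 := hm.out
  constructor
  · rw [injective_iff_map_eq_zero]
    intro x hx
    -- the coefficient of `p t^k` sees the component of degree `k (2m - 4)` only
    have key : ∀ (p : QPath m) (k : ℕ),
        ((DirectSum.coeAddMonoidHom (grading m) x).coeffs p).coeff k =
          (((x ((k : ℤ) * (2 * m - 4))) : TAlgebra m).coeffs p).coeff k := by
      intro p k
      clear hx
      induction x using DirectSum.induction_on with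
      | zero => rw [map_zero]; rfl
      | of g y =>
        rw [DirectSum.coeAddMonoidHom_of]
        by_cases hg : g = (k : ℤ) * (2 * m - 4)
        · subst hg
          rw [DirectSum.of_eq_same]
        · rw [DirectSum.of_eq_of_ne _ _ _ (Ne.symm hg)]
          refine (not_ne_iff.1 fun h => hg (y.2 p k h).symm).trans (Polynomial.coeff_zero k).symm
      | add x y hx hy =>
        rw [map_add, DirectSum.add_apply, AddSubgroup.coe_add, coeffs_add, coeffs_add,
          Polynomial.coeff_add, Polynomial.coeff_add, hx, hy]
    refine DFinsupp.ext fun g => Subtype.ext (Finsupp.ext fun p => Polynomial.ext fun k => ?_)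
    by_contra hne
    change (((x g : TAlgebra m)).coeffs p).coeff k ≠ (0 : (ZMod 2)[X]).coeff k at hne
    rw [Polynomial.coeff_zero] at hne
    have hg := (x g).2 p k hne
    subst hg
    rw [← key, hx] at hne; exact hne (Polynomial.coeff_zero k)
  · have : ∀ v, v ∈ (DirectSum.coeAddMonoidHom (grading m)).range := fun v => by
      induction v using algebra_induction with
      | h0 => exact zero_mem _
      | hadd u v hu hv => exact add_mem hu hv
      | hb r p =>
        induction r using Polynomial.induction_on' with
        | add r s hr hs =>
          rw [add_smul]; exact add_mem hr hs
        | monomial k c =>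
          have h : (Polynomial.monomial k c : (ZMod 2)[X]) • (basis p : TAlgebra m) ∈
              grading m ((k : ℤ) * (2 * m - 4) + 0) := by
            refine smul_mem_grading (fun j hj => ?_) (basis_mem_grading p)
            rw [Polynomial.coeff_monomial] at hj
            split_ifs at hj with e
            · rw [e]
            · exact absurd rfl hj
          exact ⟨DirectSum.of (fun g => grading m g) _ ⟨_, h⟩, DirectSum.coeAddMonoidHom_of _ _ _⟩
    exact this

theorem weightPart_tilingSeries_smul_mem {w : Weight m} {L : List (Arc m)}
    (p : QPath m) : weightPart w (tilingSeries L • basis p) ∈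
      grading m ((L.length : ℤ) - 2 + 2 * ∑ i, (w i : ℤ)) := by
  have h3 := hm.out
  rw [weightPart_smul_basis, ← add_zero ((L.length : ℤ) - 2 + 2 * ∑ i, (w i : ℤ))]
  refine smul_mem_grading (fun d hd => ?_) (basis_mem_grading p)
  rw [coeff_tilingSeries] at hd
  have h := mul_add_two_of_tilingNumber_ne (d := d) (w := w) (L := L) fun e => hd (by simp [e])
  have h' := congrArg (Nat.cast : ℕ → ℤ) h
  push_cast [Nat.cast_sub (show 4 ≤ 2 * m by omega)] at h'
  linarith

theorem weightPart_graphTerm_mem (w : Weight m) (L : List (Arc m)) :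
    weightPart w (graphTerm tilingSeries L) ∈
      grading m ((L.length : ℤ) - 2 + 2 * ∑ i, (w i : ℤ)) := by
  rw [graphTerm, map_add, map_add]
  refine add_mem (add_mem ?_ ?_) ?_
  · cases L with
    | nil => rw [centerTerm, map_zero]; exact zero_mem _
    | cons a L => exact weightPart_tilingSeries_smul_mem _
  · cases L with
    | nil => rw [leftTerm, map_zero]; exact zero_mem _
    | cons a L =>
      rw [leftTerm, parts, map_sum]
      exact sum_mem fun k _ => weightPart_tilingSeries_smul_mem
        (L := (across^[k] a.1, a.2 - k) :: L) _
  · rcases eq_nil_or_concat L with rfl | ⟨l, a, rfl⟩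
    · rw [rightTerm_nil, map_zero]; exact zero_mem _
    · rw [concat_eq_append, rightTerm_snoc, parts, map_sum]
      refine sum_mem fun k _ => ?_
      have := weightPart_tilingSeries_smul_mem (w := w) (L := l ++ [(a.1, k)])
      rw [length_append, List.length_singleton] at this ⊢; exact this _

theorem pathOperation_mem_grading (w : Weight m) (ps : List (QPath m)) :
    pathOperation w ps ∈ grading m ((ps.length : ℤ) - 2 + 2 * ∑ i, (w i : ℤ)) := by
  classical
  rw [← weightPart_totalOp, totalOp, map_add, map_add]
  refine add_mem (add_mem ?_ ?_) ?_
  · by_cases hl : ps.length = 2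
    · obtain ⟨p, q, rfl⟩ := List.length_eq_two.1 hl
      change weightPart w (basis p * basis q) ∈ _
      rw [weightPart_basis_mul_basis]
      split_ifs with hw
      · subst hw; simpa using basis_mul_basis_mem_grading p q
      · exact zero_mem _
    · rw [productTerm_eq_zero hl, map_zero]; exact zero_mem _
  · cases ps with
    | cons p ps => rw [curvature_cons, map_zero]; exact zero_mem _
    | nil =>
      rw [curvature, map_sum]
      refine sum_mem fun s _ => ?_
      rw [vec, weightPart_smul_basis, MvPowerSeries.coeff_X]
      split_ifs with hw
      · subst hw
        rw [one_smul]; simpa [Finsupp.single_apply] using basis_mem_grading _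
      · rw [zero_smul]; exact zero_mem _
  · rw [graphOp]
    split_ifs
    · simpa using weightPart_graphTerm_mem w (ps.map fun p => (p.slot, p.length))
    · rw [map_zero]; exact zero_mem _

theorem multilinearExtension_mem_grading {f : List (QPath m) → TAlgebra m} {D : ℤ}
    {l : List (TAlgebra m)} {g : List ℤ} (h : List.Forall₂ (fun x k => x ∈ grading m k) l g)
    (hf : ∀ ps : List (QPath m), ps.length = l.length → f ps ∈ grading m D) :
    multilinearExtension f l ∈ grading m (g.sum + D) := by
  induction h generalizing f with
  | nil =>
    rw [List.sum_nil, zero_add]; exact hf [] rfl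
  | @cons a k l g ha h ih =>
    rw [List.sum_cons, add_assoc]
    exact sum_mem fun p _ => smul_mem_grading (fun j hj => ha p j hj)
      (ih fun ps hps => hf (p :: ps) (by simp [hps]))

theorem operation_mem_grading (w : Weight m) (l : List (TAlgebra m)) (g : List ℤ)
    (h : List.Forall₂ (fun x k => x ∈ grading m k) l g) :
    operation w l ∈ grading m (g.sum + (l.length : ℤ) - 2 + 2 * ∑ i, (w i : ℤ)) := by
  rw [show g.sum + (l.length : ℤ) - 2 + 2 * ∑ i, (w i : ℤ) =
    g.sum + ((l.length : ℤ) - 2 + 2 * ∑ i, (w i : ℤ)) by ring]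
  exact multilinearExtension_mem_grading h fun ps hps => hps ▸ pathOperation_mem_grading w ps

end Grading

section Unit

theorem operation_zero_pair (a b : TAlgebra m) : operation 0 [a, b] = a * b := by
  have h1 := fun b : TAlgebra m => isLinearMap_multilinearExtension_cons (pathOperation 0) [b]
  refine isLinearMap_ext (f := fun a => operation 0 [a, b]) (g := fun a => a * b) (h1 b)
    (LinearMap.mulRight (ZMod 2)[X] b).isLinear (fun p => ?_) a
  have h2 := isMultilinear_operation (m := m) 0 [basis p] []
  refine isLinearMap_ext (f := fun b => operation 0 [basis p, b]) (g := fun b => basis p * b) h2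
    (LinearMap.mulLeft (ZMod 2)[X] (basis p)).isLinear (fun q => ?_) b
  refine (operation_basis 0 [p, q]).trans ?_
  rw [pathOperation]
  exact if_pos rfl

theorem multilinearExtension_eq_zero {f : List (QPath m) → TAlgebra m} {l : List (TAlgebra m)}
    (h : ∀ ps : List (QPath m), ps.length = l.length → f ps = 0) :
    multilinearExtension f l = 0 := by
  induction l generalizing f with
  | nil => exact h [] rfl
  | cons a l ih =>
    refine sum_eq_zero fun p _ => ?_
    beta_reduce
    rw [ih fun ps hps => h (p :: ps) (by simp [hps]), smul_zero]

theorem multilinearExtension_one {f : List (QPath m) → TAlgebra m} {l : List (TAlgebra m)}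
    (h1 : 1 ∈ l) (h : ∀ ps : List (QPath m), ps.length = l.length →
      (∃ x, QPath.const x ∈ ps) → f ps = 0) : multilinearExtension f l = 0 := by
  induction l generalizing f with
  | nil => exact absurd h1 List.not_mem_nil
  | cons a l ih =>
    by_cases hl : 1 ∈ l
    · refine sum_eq_zero fun p _ => ?_
      beta_reduce
      rw [ih (f := fun ps => f (p :: ps)) hl fun ps hps ⟨x, hx⟩ =>
        h (p :: ps) (by simp [hps]) ⟨x, mem_cons_of_mem _ hx⟩, smul_zero]
    · obtain rfl : 1 = a := (mem_cons.1 h1).resolve_right hl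
      have e := map_sum ((isLinearMap_multilinearExtension_cons f l).mk' _)
        (fun x : Vertex m => basis (QPath.const x)) univ
      refine e.trans (sum_eq_zero fun x _ => ?_)
      exact (multilinearExtension_basis_cons f _ l).trans (multilinearExtension_eq_zero
        fun ps hps => h _ (by simp [hps]) ⟨x, List.mem_cons_self⟩)

theorem operation_eq_zero_of_one_mem (w : Weight m) (l : List (TAlgebra m)) (h1 : 1 ∈ l)
    (hl : (l.length, w) ≠ (2, 0)) : operation w l = 0 := by
  refine multilinearExtension_one h1 fun ps hps ⟨x, hx⟩ => ?_
  have h0 : graphOperation w ps = 0 := if_neg fun h => h _ hx rfl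
  rcases ps with _ | ⟨p, _ | ⟨q, _ | ⟨r, ps⟩⟩⟩
  · exact absurd hx List.not_mem_nil
  · exact h0
  · exact (if_neg fun hw => hl (by rw [← hps, hw]; rfl)).trans h0
  · exact h0

theorem isAInfinityUnit_one : IsAInfinityUnit (operation (m := m)) (1 : TAlgebra m) where
  mul_unit a := by rw [operation_zero_pair, mul_one]
  unit_mul a := by rw [operation_zero_pair, one_mul]
  eq_zero := operation_eq_zero_of_one_mem

theorem isWeightedAInfinityAlgebra_operation :
    IsWeightedAInfinityAlgebra (IdempotentRing m) (grading m) (operation (m := m)) where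
  char_two := by
    have : Nonempty (Vertex m) := ⟨Vertex.first m⟩
    infer_instance
  graded := isInternal_grading
  smul_mem g κ x hx := map_mem_grading (φ := leftAction κ) (leftAction_basis κ) hx
  op_smul_mem g κ x hx := map_mem_grading (φ := rightAction κ) (rightAction_basis κ) hx
  map_add w l₁ l₂ := (isMultilinear_operation w l₁ l₂).map_add
  map_smul_left := operation_smul_left
  map_smul_right := operation_op_smul_right
  balanced := operation_balanced
  smul_nil := smul_operation_nil
  degree := operation_mem_grading
  zero_nil := by
    change ∑ i : WeightIndex m, (if 0 = Finsupp.single i 1 then (U i : TAlgebra m) else 0) = 0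
    refine sum_eq_zero fun i _ => if_neg fun h => ?_
    have := DFunLike.congr_fun h i
    simp at this
  relation w l := by rw [← operation_relation w l, gaps_gaps_eq_sum]

end Unit

end PlanarTiling

end

theorem mainTheorem1 (m : ℕ) [Fact (3 ≤ m)] :
    IsWeightedAInfinityAlgebra (PlanarTiling.IdempotentRing m) (PlanarTiling.grading m)
      (PlanarTiling.operation (m := m)) ∧
    IsAInfinityUnit (PlanarTiling.operation (m := m)) (1 : PlanarTiling.TAlgebra m) :=
  ⟨PlanarTiling.isWeightedAInfinityAlgebra_operation, PlanarTiling.isAInfinityUnit_one⟩
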